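/- Let $G\rightrightarrows M$ be a Lie groupoid with source $s$ and target $t$ (a product $gh$ is defined when $s(g)=t(h)$), let $G^{(q)}$ be the manifold of composable $q$-tuples ($G^{(0)}=M$, $G^{(1)}=G$), which form the simplicial manifold $N_\bullet G$, and let $\Pi_1(X)\rightrightarrows X$ denote the fundamental groupoid of a manifold $X$, with the smooth structure for which the end point map $\Pi_1(X)\to X\times X$ is étale. A path class goes from its source to its target, and composites are written from right to left. The structure maps of $G$ induce maps between $\Pi_1(G)$ and $\Pi_1(M)$, e.g. $s_*,t_*:\Pi_1(G)\to\Pi_1(M)$. The double nerve $N=N_{\bullet,\bullet}\Pi_1(G)$ of $\Pi_1(G)\rightrightarrows\Pi_1(M)$ over $G\rightrightarrows M$ is the bisimplicial space with $N_{p,q}=N_p\Pi_1(G^{(q)})$; in particular the column $N_{1,\bullet}$ is $\Pi_1(N_\bullet G)$. Let $\overline W N$ be its bar construction: $\overline W_rN$ consists of the $(x_0,\dots,x_r)$ with $x_p\in N_{p,r-p}$ such that the $0$-th vertical face of $x_p$ is the $(p+1)$-st horizontal face of $x_{p+1}$. Thus $\overline W_0N=M$ and $\overline W_1N=G\times_{s,t}\Pi_1(M)$.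 For a simplicial space $X$, let $\mathfrak G(X)\rightrightarrows X_0$ be the groupoid of formal products $y_1^{\pm1}\cdots y_k^{\pm1}$ of composable elements of $X_1$ (an element $y$ goes from $f_0y$ to $f_1y$) modulo the relations generated by $f_1z\sim f_2z\cdot f_0z$ for $z\in X_2$, by $y y^{-1}\sim\delta_0f_1y$ and $y^{-1}y\sim\delta_0f_0y$ for $y\in X_1$, where $\delta_0x$ is the identity of $x\in X_0$; it carries the quotient topology. The Haefliger fundamental groupoid of $G$ is the groupoid over $M$ of $G$-paths $g_n\rho_ng_{n-1}\cdots\rho_1g_0$ ($g_i\in G$, and $\rho_i$ a path in $M$ from $t(g_{i-1})$ to $s(g_i)$) modulo the equivalence relation generated by (i) replacing $g_i\rho_ig_{i-1}$ by $g_ig_{i-1}$ if $\rho_i$ is constant, (ii) replacing $\rho_{i+1}g_i\rho_i$ by the concatenated path if $g_i$ is a unit, and (iii) deformations (continuous families of $G$-paths of constant order with fixed end points), with the quotient of the compact-open topology. A simplicial manifold has surjective submersions as face maps and embeddings as degeneracy maps; a bisimplicial manifold is a bisimplicial space of manifolds all of whose rows and columns are simplicial manifolds. Consider the following properties of the horn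 maps $\lambda_{q,k}:X_q\to\Lambda_{q,k}X$ ($0\le k\le q$) of a simplicial manifold $X$, whose horn spaces are assumed to be smooth as submanifolds of the products. A local Lie $n$-groupoid has submersions as horn maps for $q\ge1$ and injective étale maps for $q>n$. A Lie $n$-groupoid has surjective submersions for $q\ge1$ and diffeomorphisms for $q>n$. An étale local Lie $n$-groupoid has submersions for $q\ge1$ and étale maps, not necessarily injective, for $q>n$. Then: 1. $N$ is a bisimplicial manifold (for the smooth structures induced from that of $G$). Every column $N_{p,\bullet}$ is an étale local Lie $1$-groupoid, and $\overline W N$ is an étale local Lie $2$-groupoid. If $\Pi_1(N_\bullet G)$ is a local Lie $1$-groupoid, then $\overline W N$ is a local Lie $2$-groupoid; if in addition the source map of $G$ is a (Serre) fibration, then every column $N_{p,\bullet}$ is a Lie $1$-groupoid and $\overline W N$ is a Lie $2$-groupoid. 2. For every Lie groupoid $G$, $\mathfrak G(\overline W N)$ and the Haefliger fundamental groupoid of $G$ are topological groupoids, and there is an isomorphism of topological groupoids between them that is the identification $\overline W_0N=M$ on objects and sends the generator $(g,[\rho])\in G\times_{s,t}\Pi_1(M)$ to the class of the $G$-path $g\rho$.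 3. If the source map of $G$ is a (Serre) fibration, then the double source map of $\Pi_1(G)$ is onto, i.e. for $g\in G$ and $\eta\in\Pi_1(M)$ starting at $s(g)$ there is $\alpha\in\Pi_1(G)$ starting at $g$ with $s_*\alpha=\eta$. Let $\sim$ be the equivalence relation on $G\times_{s,t}\Pi_1(M)$ generated by $$(\theta\cdot\alpha(1),\,s_*\alpha\cdot\eta)\sim(\theta\cdot\alpha'(1),\,s_*\alpha'\cdot\eta)$$ for $\alpha,\alpha'\in\Pi_1(G)$ with $t_*\alpha=t_*\alpha'$ and $\alpha(0)=\alpha'(0)$, whenever both sides are defined. Then the quotient space $(G\times_{s,t}\Pi_1(M))/\!\sim$ is a groupoid over $M$ with source $s(\eta)$, target $t(\theta)$ (for $[\theta,\eta]$), units $[1_x,1_x]$ and multiplication $[\theta,t_*\alpha]\cdot[\alpha(0),\eta]=[\theta\cdot\alpha(1),s_*\alpha\cdot\eta]$ for $\alpha\in\Pi_1(G)$, and $[\theta,[\rho]]\mapsto[\theta\rho]$ is an isomorphism of topological groupoids over $M$ onto the Haefliger fundamental groupoid of $G$. -/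

import Mathlib

open scoped Manifold ContDiff Topology unitInterval

universe u v w

namespace DoubleGpd

noncomputable section

/-! ### Groupoids presented by a space of arrows and a space of objects -/

/-- A groupoid with arrows `A` and objects `O`. The product `mul a b` is defined
when `src a = tgt b` (first `b`, then `a`). -/
structure InternalGroupoid (A : Type u) (O : Type v) where
  src : A → O
  tgt : A → O
  one : O → A
  inv : A → A
  mul : (a b : A) → src a = tgt b → A
  src_one : ∀ x, src (one x) = x
  tgt_one : ∀ x, tgt (one x) = x
  src_inv : ∀ a, src (inv a) = tgt a
  tgt_inv : ∀ a, tgt (inv a) = src a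
  src_mul : ∀ a b h, src (mul a b h) = src b
  tgt_mul : ∀ a b h, tgt (mul a b h) = tgt a
  mul_assoc : ∀ a b c (h₁ : src a = tgt b) (h₂ : src b = tgt c)
    (h₃ : src (mul a b h₁) = tgt c) (h₄ : src a = tgt (mul b c h₂)),
    mul (mul a b h₁) c h₃ = mul a (mul b c h₂) h₄
  one_mul : ∀ a h, mul (one (tgt a)) a h = a
  mul_one : ∀ a h, mul a (one (src a)) h = a
  inv_mul : ∀ a h, mul (inv a) a h = one (src a)
  mul_inv : ∀ a h, mul a (inv a) h = one (tgt a)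

namespace InternalGroupoid

variable {A : Type u} {O : Type v}

/-- All structure maps are continuous, i.e. the groupoid is a topological groupoid. -/
structure IsTopological [TopologicalSpace A] [TopologicalSpace O]
    (Γ : InternalGroupoid A O) : Prop where
  continuous_src : Continuous Γ.src
  continuous_tgt : Continuous Γ.tgt
  continuous_one : Continuous Γ.one
  continuous_inv : Continuous Γ.inv
  continuous_mul : Continuous
    (fun p : {p : A × A // Γ.src p.1 = Γ.tgt p.2} => Γ.mul p.1.1 p.1.2 p.2)

end InternalGroupoid

/-- An isomorphism of groupoids that is a homeomorphism on arrows and on objects.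
(Compatibility with units and inverses is automatic.) -/
structure TopGroupoidIso {A : Type u} {O : Type v} {B : Type w} {P : Type*}
    [TopologicalSpace A] [TopologicalSpace O] [TopologicalSpace B] [TopologicalSpace P]
    (Γ : InternalGroupoid A O) (Δ : InternalGroupoid B P) where
  arr : A ≃ₜ B
  obj : O ≃ₜ P
  src_arr : ∀ a, Δ.src (arr a) = obj (Γ.src a)
  tgt_arr : ∀ a, Δ.tgt (arr a) = obj (Γ.tgt a)
  mul_arr : ∀ a b (h : Γ.src a = Γ.tgt b) (h' : Δ.src (arr a) = Δ.tgt (arr b)),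
    arr (Γ.mul a b h) = Δ.mul (arr a) (arr b) h'

/-! ### The fundamental groupoid of a space, with its topology -/

/-- A homotopy class (with fixed end points) of paths in `X`, from `src` to `tgt`. -/
structure PathClass (X : Type u) [TopologicalSpace X] where
  src : X
  tgt : X
  cls : Path.Homotopic.Quotient src tgt

namespace PathClass

variable {X : Type u} [TopologicalSpace X] {Y : Type v} [TopologicalSpace Y]
  {Z : Type w} [TopologicalSpace Z]

/-- The class of a path `I → X`. -/
def mk' (p : C(I, X)) : PathClass X :=
  ⟨p 0, p 1, Path.Homotopic.Quotient.mk ⟨p, rfl, rfl⟩⟩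

/-- The quotient of the compact-open topology on the space of paths. -/
instance : TopologicalSpace (PathClass X) := TopologicalSpace.coinduced mk' inferInstance

/-- The map of path classes induced by a continuous map. -/
def map (f : C(X, Y)) (γ : PathClass X) : PathClass Y :=
  ⟨f γ.src, f γ.tgt, γ.cls.map f⟩

theorem mk'_surjective : Function.Surjective (mk' : C(I, X) → PathClass X) := by
  rintro ⟨x, y, γ⟩
  induction γ using Path.Homotopic.Quotient.ind with
  | mk p =>
    refine ⟨p.toContinuousMap, ?_⟩
    have h0 : p 0 = x := p.source
    have h1 : p 1 = y := p.target
    obtain ⟨p, rfl, rfl⟩ := p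
    rfl

theorem map_mk' (f : C(X, Y)) (p : C(I, X)) : map f (mk' p) = mk' (f.comp p) := rfl

theorem continuous_mk' : Continuous (mk' : C(I, X) → PathClass X) := continuous_coinduced_rng

theorem continuous_map (f : C(X, Y)) : Continuous (map f) :=
  continuous_coinduced_dom.2 <| by
    have : map f ∘ mk' = mk' ∘ (fun p : C(I, X) => f.comp p) := rfl
    rw [this]
    exact continuous_mk'.comp (ContinuousMap.continuous_postcomp f)

theorem map_map (g : C(Y, Z)) (f : C(X, Y)) (γ : PathClass X) :
    map g (map f γ) = map (g.comp f) γ := by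
  obtain ⟨p, rfl⟩ := mk'_surjective γ
  rfl

theorem map_id (γ : PathClass X) : map (ContinuousMap.id X) γ = γ := by
  obtain ⟨p, rfl⟩ := mk'_surjective γ
  rfl

/-- `mul a b` is "first `b`, then `a`". -/
def mul (a b : PathClass X) (h : a.src = b.tgt) : PathClass X :=
  ⟨b.src, a.tgt, b.cls.trans (a.cls.cast h.symm rfl)⟩

theorem map_mul (f : C(X, Y)) (a b : PathClass X) (h : a.src = b.tgt)
    (h' : (map f a).src = (map f b).tgt) :
    map f (mul a b h) = mul (map f a) (map f b) h' := by
  obtain ⟨x, y, α⟩ := a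
  obtain ⟨z, x', β⟩ := b
  obtain rfl : x = x' := h
  induction α using Path.Homotopic.Quotient.ind with
  | mk α =>
    induction β using Path.Homotopic.Quotient.ind with
    | mk β =>
      change PathClass.mk _ _ _ = PathClass.mk _ _ _
      congr 1
      exact congrArg Path.Homotopic.Quotient.mk (β.map_trans α f.continuous)

end PathClass

/-- The fundamental groupoid `Π₁(X) ⇉ X`. -/
def Pi1 (X : Type u) [TopologicalSpace X] : InternalGroupoid (PathClass X) X where
  src := PathClass.src
  tgt := PathClass.tgt
  one x := ⟨x, x, Path.Homotopic.Quotient.refl x⟩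
  inv a := ⟨a.tgt, a.src, a.cls.symm⟩
  mul := PathClass.mul
  src_one _ := rfl
  tgt_one _ := rfl
  src_inv _ := rfl
  tgt_inv _ := rfl
  src_mul _ _ _ := rfl
  tgt_mul _ _ _ := rfl
  mul_assoc := by
    rintro ⟨x, y, α⟩ ⟨z, x', β⟩ ⟨t, z', γ⟩ h₁ h₂ h₃ h₄
    obtain rfl : x = x' := h₁
    obtain rfl : z = z' := h₂
    simp [PathClass.mul]
  one_mul := by
    rintro ⟨x, y, α⟩ h
    simp [PathClass.mul]
  mul_one := by
    rintro ⟨x, y, α⟩ h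
    simp [PathClass.mul]
  inv_mul := by
    rintro ⟨x, y, α⟩ h
    simp [PathClass.mul]
  mul_inv := by
    rintro ⟨x, y, α⟩ h
    simp [PathClass.mul]

/-! ### Nerves -/

/-- An `n`-simplex of the nerve of a groupoid: a diagram of shape `[n]`, i.e. vertices
`obj 0, …, obj n` and a compatible system of arrows `arr i j : obj j → obj i`.
It corresponds to the composable tuple `(arr 0 1, arr 1 2, …, arr (n-1) n)`, in which the
source of each entry is the target of the next one. -/
@[ext]
structure Nerve {A : Type u} {O : Type v} (Γ : InternalGroupoid A O) (n : ℕ) where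
  obj : Fin (n + 1) → O
  arr : Fin (n + 1) → Fin (n + 1) → A
  src_arr : ∀ i j, Γ.src (arr i j) = obj j
  tgt_arr : ∀ i j, Γ.tgt (arr i j) = obj i
  arr_self : ∀ i, arr i i = Γ.one (obj i)
  mul_arr : ∀ i j k, Γ.mul (arr i j) (arr j k) ((src_arr i j).trans (tgt_arr j k).symm) = arr i k

namespace Nerve

variable {A : Type u} {O : Type v} {Γ : InternalGroupoid A O}

instance [TopologicalSpace A] [TopologicalSpace O] (n : ℕ) : TopologicalSpace (Nerve Γ n) :=
  TopologicalSpace.induced (fun x => (x.obj, x.arr)) inferInstance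

/-- Restriction of a simplex along a map of vertices. -/
def reindex {m n : ℕ} (φ : Fin (m + 1) → Fin (n + 1)) (x : Nerve Γ n) : Nerve Γ m where
  obj i := x.obj (φ i)
  arr i j := x.arr (φ i) (φ j)
  src_arr _ _ := x.src_arr _ _
  tgt_arr _ _ := x.tgt_arr _ _
  arr_self _ := x.arr_self _
  mul_arr _ _ _ := x.mul_arr _ _ _

theorem continuous_obj [TopologicalSpace A] [TopologicalSpace O] (n : ℕ) :
    Continuous (Nerve.obj : Nerve Γ n → _) :=
  continuous_fst.comp
    (continuous_induced_dom (f := fun x : Nerve Γ n => (x.obj, x.arr)))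

theorem continuous_arr [TopologicalSpace A] [TopologicalSpace O] (n : ℕ) :
    Continuous (Nerve.arr : Nerve Γ n → _) :=
  continuous_snd.comp
    (continuous_induced_dom (f := fun x : Nerve Γ n => (x.obj, x.arr)))

theorem continuous_reindex [TopologicalSpace A] [TopologicalSpace O] {m n : ℕ}
    (φ : Fin (m + 1) → Fin (n + 1)) :
    Continuous (reindex φ : Nerve Γ n → Nerve Γ m) := by
  refine continuous_induced_rng.2 (Continuous.prodMk ?_ ?_)
  · exact continuous_pi fun i => (continuous_apply (φ i)).comp (continuous_obj n)
  · exact continuous_pi fun i => continuous_pi fun j =>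
      (continuous_apply (φ j)).comp ((continuous_apply (φ i)).comp (continuous_arr n))

theorem reindex_reindex {l m n : ℕ} (ψ : Fin (l + 1) → Fin (m + 1))
    (φ : Fin (m + 1) → Fin (n + 1)) (x : Nerve Γ n) :
    reindex ψ (reindex φ x) = reindex (φ ∘ ψ) x := rfl

theorem reindex_id {n : ℕ} (x : Nerve Γ n) : reindex id x = x := rfl

/-- The map of nerves of fundamental groupoids induced by a continuous map. -/
def mapPi1 {X : Type u} [TopologicalSpace X] {Y : Type v} [TopologicalSpace Y] (f : C(X, Y))
    {n : ℕ} (x : Nerve (Pi1 X) n) : Nerve (Pi1 Y) n where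
  obj i := f (x.obj i)
  arr i j := PathClass.map f (x.arr i j)
  src_arr i j := congrArg f (x.src_arr i j)
  tgt_arr i j := congrArg f (x.tgt_arr i j)
  arr_self i := by rw [x.arr_self i]; rfl
  mul_arr i j k := by
    rw [← x.mul_arr i j k]
    exact (PathClass.map_mul f _ _ ((x.src_arr i j).trans (x.tgt_arr j k).symm)
      (congrArg f ((x.src_arr i j).trans (x.tgt_arr j k).symm))).symm

theorem continuous_mapPi1 {X : Type u} [TopologicalSpace X] {Y : Type v} [TopologicalSpace Y]
    (f : C(X, Y)) (n : ℕ) : Continuous (mapPi1 f : Nerve (Pi1 X) n → Nerve (Pi1 Y) n) := by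
  refine continuous_induced_rng.2 (Continuous.prodMk ?_ ?_)
  · exact continuous_pi fun i =>
      f.continuous.comp ((continuous_apply i).comp (continuous_obj n))
  · exact continuous_pi fun i => continuous_pi fun j => (PathClass.continuous_map f).comp
      ((continuous_apply j).comp ((continuous_apply i).comp (continuous_arr n)))

theorem mapPi1_mapPi1 {X : Type u} [TopologicalSpace X] {Y : Type v} [TopologicalSpace Y]
    {Z : Type w} [TopologicalSpace Z] (g : C(Y, Z)) (f : C(X, Y)) {n : ℕ}
    (x : Nerve (Pi1 X) n) : mapPi1 g (mapPi1 f x) = mapPi1 (g.comp f) x := by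
  refine Nerve.ext rfl ?_
  funext i j
  exact PathClass.map_map g f _

theorem mapPi1_id {X : Type u} [TopologicalSpace X] {n : ℕ} (x : Nerve (Pi1 X) n) :
    mapPi1 (ContinuousMap.id X) x = x := by
  refine Nerve.ext rfl ?_
  funext i j
  exact PathClass.map_id _

end Nerve

/-! ### Simplicial and bisimplicial spaces -/

/-- The simplicial identities for face maps `d n i : X (n+1) → X n` (`i ≤ n + 1`) and
degeneracy maps `s n i : X n → X (n+1)` (`i ≤ n`). -/
structure SimplicialLaws (X : ℕ → Type u)
    (d : (n i : ℕ) → i ≤ n + 1 → X (n + 1) → X n)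
    (s : (n i : ℕ) → i ≤ n → X n → X (n + 1)) : Prop where
  d_d : ∀ n i j (hij : i < j) (hj : j ≤ n + 2) x,
    d n i (by omega) (d (n + 1) j hj x) = d n (j - 1) (by omega) (d (n + 1) i (by omega) x)
  s_s : ∀ n i j (hij : i ≤ j) (hj : j ≤ n) x,
    s (n + 1) i (by omega) (s n j hj x) = s (n + 1) (j + 1) (by omega) (s n i (by omega) x)
  d_s_lt : ∀ n i j (hij : i < j) (hj : j ≤ n + 1) x,
    d (n + 1) i (by omega) (s (n + 1) j hj x) = s n (j - 1) (by omega) (d n i (by omega) x)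
  d_s_self : ∀ n i (hi : i ≤ n) x, d n i (by omega) (s n i hi x) = x
  d_s_succ : ∀ n i (hi : i ≤ n) x, d n (i + 1) (by omega) (s n i hi x) = x
  d_s_gt : ∀ n i j (hij : j + 1 < i) (hi : i ≤ n + 2) x,
    d (n + 1) i hi (s (n + 1) j (by omega) x) = s n j (by omega) (d n (i - 1) (by omega) x)

/-- A simplicial space. -/
structure SimplicialSpace where
  obj : ℕ → Type u
  [top : ∀ n, TopologicalSpace (obj n)]
  face : (n i : ℕ) → i ≤ n + 1 → obj (n + 1) → obj n
  degen : (n i : ℕ) → i ≤ n → obj n → obj (n + 1)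
  continuous_face : ∀ n i hi, Continuous (face n i hi)
  continuous_degen : ∀ n i hi, Continuous (degen n i hi)
  laws : SimplicialLaws obj face degen

instance (X : SimplicialSpace.{u}) (n : ℕ) : TopologicalSpace (X.obj n) := X.top n

/-- A bisimplicial space, with horizontal maps changing the first index and vertical maps
changing the second one. -/
structure BisimplicialSpace where
  obj : ℕ → ℕ → Type u
  [top : ∀ p q, TopologicalSpace (obj p q)]
  hface : (p q i : ℕ) → i ≤ p + 1 → obj (p + 1) q → obj p q
  hdegen : (p q i : ℕ) → i ≤ p → obj p q → obj (p + 1) q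
  vface : (p q i : ℕ) → i ≤ q + 1 → obj p (q + 1) → obj p q
  vdegen : (p q i : ℕ) → i ≤ q → obj p q → obj p (q + 1)
  continuous_hface : ∀ p q i hi, Continuous (hface p q i hi)
  continuous_hdegen : ∀ p q i hi, Continuous (hdegen p q i hi)
  continuous_vface : ∀ p q i hi, Continuous (vface p q i hi)
  continuous_vdegen : ∀ p q i hi, Continuous (vdegen p q i hi)
  hlaws : ∀ q, SimplicialLaws (fun p => obj p q) (fun p => hface p q) (fun p => hdegen p q)
  vlaws : ∀ p, SimplicialLaws (fun q => obj p q) (fun q => vface p q) (fun q => vdegen p q)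
  vface_hface : ∀ p q i j hi hj x,
    vface p q j hj (hface p (q + 1) i hi x) = hface p q i hi (vface (p + 1) q j hj x)
  vdegen_hdegen : ∀ p q i j hi hj x,
    vdegen (p + 1) q j hj (hdegen p q i hi x) = hdegen p (q + 1) i hi (vdegen p q j hj x)
  vface_hdegen : ∀ p q i j hi hj x,
    vface (p + 1) q j hj (hdegen p (q + 1) i hi x) = hdegen p q i hi (vface p q j hj x)
  vdegen_hface : ∀ p q i j hi hj x,
    vdegen p q j hj (hface p q i hi x) = hface p (q + 1) i hi (vdegen (p + 1) q j hj x)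

instance (X : BisimplicialSpace.{u}) (p q : ℕ) : TopologicalSpace (X.obj p q) := X.top p q

namespace BisimplicialSpace

/-- The simplicial space `X_{•,q}`. -/
def horizontal (X : BisimplicialSpace.{u}) (q : ℕ) : SimplicialSpace.{u} where
  obj p := X.obj p q
  face p := X.hface p q
  degen p := X.hdegen p q
  continuous_face p := X.continuous_hface p q
  continuous_degen p := X.continuous_hdegen p q
  laws := X.hlaws q

/-- The simplicial space `X_{p,•}`. -/
def vertical (X : BisimplicialSpace.{u}) (p : ℕ) : SimplicialSpace.{u} where
  obj q := X.obj p q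
  face q := X.vface p q
  degen q := X.vdegen p q
  continuous_face q := X.continuous_vface p q
  continuous_degen q := X.continuous_vdegen p q
  laws := X.vlaws p

end BisimplicialSpace

/-- The increasing injection that misses the vertex `i`. -/
def skip (n i : ℕ) (k : Fin (n + 1)) : Fin (n + 2) :=
  ⟨if k.1 < i then k.1 else k.1 + 1, by split_ifs <;> omega⟩

/-- The weakly increasing surjection that takes the value `i` twice. -/
def rep (n i : ℕ) (hi : i ≤ n) (k : Fin (n + 2)) : Fin (n + 1) :=
  ⟨if k.1 ≤ i then k.1 else k.1 - 1, by split_ifs <;> omega⟩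

theorem Nerve.laws {A : Type u} {O : Type v} (Γ : InternalGroupoid A O) :
    SimplicialLaws (fun n => Nerve Γ n) (fun n i _ => Nerve.reindex (skip n i))
      (fun n i hi => Nerve.reindex (rep n i hi)) where
  d_d n i j hij hj x := by
    simp only [Nerve.reindex_reindex]
    congr 1; funext k; apply Fin.ext; simp only [Function.comp, skip]; split_ifs <;> omega
  s_s n i j hij hj x := by
    simp only [Nerve.reindex_reindex]
    congr 1; funext k; apply Fin.ext; simp only [Function.comp, rep]; split_ifs <;> omega
  d_s_lt n i j hij hj x := by
    simp only [Nerve.reindex_reindex]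
    congr 1; funext k; apply Fin.ext; simp only [Function.comp, skip, rep]; split_ifs <;> omega
  d_s_self n i hi x := by
    simp only [Nerve.reindex_reindex]
    conv_rhs => rw [← Nerve.reindex_id x]
    congr 1; funext k; apply Fin.ext; simp only [Function.comp, skip, rep, id]
    split_ifs <;> omega
  d_s_succ n i hi x := by
    simp only [Nerve.reindex_reindex]
    conv_rhs => rw [← Nerve.reindex_id x]
    congr 1; funext k; apply Fin.ext; simp only [Function.comp, skip, rep, id]
    split_ifs <;> omega
  d_s_gt n i j hij hi x := by
    simp only [Nerve.reindex_reindex]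
    congr 1; funext k; apply Fin.ext; simp only [Function.comp, skip, rep]; split_ifs <;> omega

/-- The nerve of a groupoid, as a simplicial space. The `i`-th face omits the `i`-th vertex. -/
def nerve {A : Type u} {O : Type v} [TopologicalSpace A] [TopologicalSpace O]
    (Γ : InternalGroupoid A O) : SimplicialSpace.{max u v} where
  obj n := Nerve Γ n
  face n i _ := Nerve.reindex (skip n i)
  degen n i hi := Nerve.reindex (rep n i hi)
  continuous_face _ _ _ := Nerve.continuous_reindex _
  continuous_degen _ _ _ := Nerve.continuous_reindex _
  laws := Nerve.laws Γ

/-- The face and degeneracy maps of a simplicial space as bundled continuous maps. -/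
def SimplicialSpace.faceC (X : SimplicialSpace.{u}) (n i : ℕ) (hi : i ≤ n + 1) :
    C(X.obj (n + 1), X.obj n) := ⟨X.face n i hi, X.continuous_face n i hi⟩

def SimplicialSpace.degenC (X : SimplicialSpace.{u}) (n i : ℕ) (hi : i ≤ n) :
    C(X.obj n, X.obj (n + 1)) := ⟨X.degen n i hi, X.continuous_degen n i hi⟩

/-- The bisimplicial space with `(p,q)`-simplices `N_p Π₁(X_q)`, the composable `p`-tuples of
path classes in `X_q`. -/
def pi1Nerve (X : SimplicialSpace.{u}) : BisimplicialSpace.{u} where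
  obj p q := Nerve (Pi1 (X.obj q)) p
  hface p _ i _ := Nerve.reindex (skip p i)
  hdegen p _ i hi := Nerve.reindex (rep p i hi)
  vface _ q i hi := Nerve.mapPi1 (X.faceC q i hi)
  vdegen _ q i hi := Nerve.mapPi1 (X.degenC q i hi)
  continuous_hface _ _ _ _ := Nerve.continuous_reindex _
  continuous_hdegen _ _ _ _ := Nerve.continuous_reindex _
  continuous_vface _ _ _ _ := Nerve.continuous_mapPi1 _ _
  continuous_vdegen _ _ _ _ := Nerve.continuous_mapPi1 _ _
  hlaws q := Nerve.laws _
  vlaws p :=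
    { d_d := fun n i j hij hj x => by
        simp only [Nerve.mapPi1_mapPi1]
        congr 1; ext y; exact X.laws.d_d n i j hij hj y
      s_s := fun n i j hij hj x => by
        simp only [Nerve.mapPi1_mapPi1]
        congr 1; ext y; exact X.laws.s_s n i j hij hj y
      d_s_lt := fun n i j hij hj x => by
        simp only [Nerve.mapPi1_mapPi1]
        congr 1; ext y; exact X.laws.d_s_lt n i j hij hj y
      d_s_self := fun n i hi x => by
        simp only [Nerve.mapPi1_mapPi1]
        conv_rhs => rw [← Nerve.mapPi1_id x]
        congr 1; ext y; exact X.laws.d_s_self n i hi y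
      d_s_succ := fun n i hi x => by
        simp only [Nerve.mapPi1_mapPi1]
        conv_rhs => rw [← Nerve.mapPi1_id x]
        congr 1; ext y; exact X.laws.d_s_succ n i hi y
      d_s_gt := fun n i j hij hi x => by
        simp only [Nerve.mapPi1_mapPi1]
        congr 1; ext y; exact X.laws.d_s_gt n i j hij hi y }
  vface_hface _ _ _ _ _ _ _ := rfl
  vdegen_hdegen _ _ _ _ _ _ _ := rfl
  vface_hdegen _ _ _ _ _ _ _ := rfl
  vdegen_hface _ _ _ _ _ _ _ := rfl

/-! ### The bar construction -/

/-- The pairs `(p, q)` with `p + q = r`. -/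
abbrev AntiDiag (r : ℕ) := {pq : ℕ × ℕ // pq.1 + pq.2 = r}

/-- The condition `v_0 (x_p) = h_{p+1} (x_{p+1})` defining the bar construction, for
`x_p ∈ X_{p,q}`, `p + q = r`. -/
def BarCompat (X : BisimplicialSpace.{u}) (r : ℕ)
    (x : (a : AntiDiag r) → X.obj a.1.1 a.1.2) : Prop :=
  ∀ p q (h : p + (q + 1) = r) (h' : p + 1 + q = r),
    X.vface p q 0 (Nat.zero_le _) (x ⟨(p, q + 1), h⟩) =
      X.hface p q (p + 1) le_rfl (x ⟨(p + 1, q), h'⟩)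

/-- The `r`-simplices `(x_0, …, x_r)` of the bar construction. -/
def Bar (X : BisimplicialSpace.{u}) (r : ℕ) : Type u :=
  {x : (a : AntiDiag r) → X.obj a.1.1 a.1.2 // BarCompat X r x}

instance (X : BisimplicialSpace.{u}) (r : ℕ) : TopologicalSpace (Bar X r) :=
  inferInstanceAs (TopologicalSpace {x : (a : AntiDiag r) → X.obj a.1.1 a.1.2 // BarCompat X r x})

namespace Bar

variable {X : BisimplicialSpace.{u}}

/-- The component `x_p ∈ X_{p,q}`. -/
def at' {r : ℕ} (x : Bar X r) (p q : ℕ) (h : p + q = r) : X.obj p q := x.1 ⟨(p, q), h⟩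

theorem ext' {r : ℕ} {x y : Bar X r} (h : ∀ p q hpq, x.at' p q hpq = y.at' p q hpq) : x = y :=
  Subtype.ext (funext fun a => h a.1.1 a.1.2 a.2)

theorem compat {r : ℕ} (x : Bar X r) (p q : ℕ) (h : p + (q + 1) = r) (h' : p + 1 + q = r) :
    X.vface p q 0 (Nat.zero_le _) (x.at' p (q + 1) h) =
      X.hface p q (p + 1) le_rfl (x.at' (p + 1) q h') := x.2 p q h h'

/-- The components `v_i(x_0), v_{i-1}(x_1), …, v_1(x_{i-1}), h_i(x_{i+1}), …, h_i(x_{r+1})`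
of the `i`-th face of `(x_0, …, x_{r+1})`. -/
def faceComp {r : ℕ} (i : ℕ) (hi : i ≤ r + 1) (x : Bar X (r + 1)) (p q : ℕ) (h : p + q = r) :
    X.obj p q :=
  if hp : p < i then X.vface p q (i - p) (by omega) (x.at' p (q + 1) (by omega))
  else X.hface p q i (by omega) (x.at' (p + 1) q (by omega))

/-- The components `μ_i(x_0), μ_{i-1}(x_1), …, μ_0(x_i), η_i(x_i), …, η_i(x_r)` of the `i`-th
degeneracy of `(x_0, …, x_r)`. -/
def degenComp {r : ℕ} (i : ℕ) (hi : i ≤ r) (x : Bar X r) :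
    (p q : ℕ) → p + q = r + 1 → X.obj p q
  | 0, 0, h => absurd h (by omega)
  | 0, q + 1, h => X.vdegen 0 q i (by omega) (x.at' 0 q (by omega))
  | p + 1, 0, h => X.hdegen p 0 i (by omega) (x.at' p 0 (by omega))
  | p + 1, q + 1, h =>
    if hp : p + 1 ≤ i then X.vdegen (p + 1) q (i - (p + 1)) (by omega) (x.at' (p + 1) q (by omega))
    else X.hdegen p (q + 1) i (by omega) (x.at' p (q + 1) (by omega))

theorem degenComp_of_le {r : ℕ} (i : ℕ) (hi : i ≤ r) (x : Bar X r) (p q : ℕ)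
    (h : p + (q + 1) = r + 1) (hp : p ≤ i) :
    degenComp i hi x p (q + 1) h =
      X.vdegen p q (i - p) (by omega) (x.at' p q (by omega)) := by
  cases p with
  | zero => rfl
  | succ p => simp only [degenComp]; rw [dif_pos hp]

theorem degenComp_of_lt {r : ℕ} (i : ℕ) (hi : i ≤ r) (x : Bar X r) (p q : ℕ)
    (h : p + 1 + q = r + 1) (hp : i < p + 1) :
    degenComp i hi x (p + 1) q h =
      X.hdegen p q i (by omega) (x.at' p q (by omega)) := by
  cases q with
  | zero => rfl
  | succ q => simp only [degenComp]; rw [dif_neg (by omega)]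

/-- The `i`-th face map of the bar construction. -/
def face (r i : ℕ) (hi : i ≤ r + 1) (x : Bar X (r + 1)) : Bar X r :=
  ⟨fun a => faceComp i hi x a.1.1 a.1.2 a.2, by
    intro p q h h'
    simp only [faceComp]
    rcases lt_trichotomy (p + 1) i with hp | hp | hp
    · rw [dif_pos (by omega), dif_pos (by omega), (X.vlaws p).d_d q 0 (i - p) (by omega) (by omega),
        x.compat p (q + 1) (by omega) (by omega), X.vface_hface]
      congr 1
    · subst hp
      rw [dif_pos (by omega), dif_neg (by omega)]
      have e1 := (X.vlaws p).d_d q 0 1 (by omega) (by omega) (x.at' p (q + 1 + 1) (by omega))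
      have e2 := (X.hlaws q).d_d p (p + 1) (p + 2) (by omega) (by omega)
        (x.at' (p + 1 + 1) q (by omega))
      have e3 := x.compat p (q + 1) (by omega) (by omega)
      have e4 := x.compat (p + 1) q (by omega) (by omega)
      simp only [Nat.add_sub_cancel_left, Nat.sub_self] at e1 ⊢
      refine e1.trans ?_
      rw [e3, X.vface_hface, e4]
      exact e2
    · rw [dif_neg (by omega), dif_neg (by omega), X.vface_hface, x.compat (p + 1) q (by omega) (by omega)]
      exact ((X.hlaws q).d_d p i (p + 2) (by omega) (by omega) _)⟩

theorem face_at {r i : ℕ} (hi : i ≤ r + 1) (x : Bar X (r + 1)) (p q : ℕ) (h : p + q = r) :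
    (face r i hi x).at' p q h = faceComp i hi x p q h := rfl

/-- The `i`-th degeneracy map of the bar construction. -/
def degen (r i : ℕ) (hi : i ≤ r) (x : Bar X r) : Bar X (r + 1) :=
  ⟨fun a => degenComp i hi x a.1.1 a.1.2 a.2, by
    intro p q h h'
    dsimp only
    rcases lt_trichotomy p i with hp | hp | hp
    · obtain ⟨q, rfl⟩ : ∃ q', q = q' + 1 := ⟨q - 1, by omega⟩
      rw [degenComp_of_le i hi x p _ h (by omega), degenComp_of_le i hi x (p + 1) q h' (by omega),
        (X.vlaws p).d_s_lt q 0 (i - p) (by omega) (by omega),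
        x.compat p q (by omega) (by omega), X.vdegen_hface]
      congr 1
    · subst hp
      rw [degenComp_of_le p hi x p _ h (by omega), degenComp_of_lt p hi x p q h' (by omega)]
      have e1 := (X.vlaws p).d_s_self q 0 (by omega) (x.at' p q (by omega))
      have e2 := (X.hlaws q).d_s_succ p p (by omega) (x.at' p q (by omega))
      simp only [Nat.sub_self]
      exact e1.trans e2.symm
    · obtain ⟨p, rfl⟩ : ∃ p', p = p' + 1 := ⟨p - 1, by omega⟩
      rw [degenComp_of_lt i hi x p _ h (by omega), degenComp_of_lt i hi x (p + 1) q h' (by omega),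
        X.vface_hdegen, x.compat p q (by omega) (by omega)]
      exact ((X.hlaws q).d_s_gt p (p + 2) i (by omega) (by omega) _).symm⟩

theorem degen_at {r i : ℕ} (hi : i ≤ r) (x : Bar X r) (p q : ℕ) (h : p + q = r + 1) :
    (degen r i hi x).at' p q h = degenComp i hi x p q h := rfl

theorem continuous_at {r : ℕ} (p q : ℕ) (h : p + q = r) :
    Continuous (fun x : Bar X r => x.at' p q h) :=
  (continuous_apply (⟨(p, q), h⟩ : AntiDiag r)).comp continuous_subtype_val

theorem continuous_face (r i : ℕ) (hi : i ≤ r + 1) : Continuous (face (X := X) r i hi) := by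
  refine Continuous.subtype_mk (continuous_pi fun a => ?_) _
  simp only [faceComp]
  split_ifs
  · exact (X.continuous_vface _ _ _ _).comp (continuous_at _ _ _)
  · exact (X.continuous_hface _ _ _ _).comp (continuous_at _ _ _)

theorem continuous_degen (r i : ℕ) (hi : i ≤ r) : Continuous (degen (X := X) r i hi) := by
  refine Continuous.subtype_mk (continuous_pi fun a => ?_) _
  obtain ⟨⟨p, q⟩, h⟩ := a
  dsimp only at h ⊢
  rcases le_or_gt p i with hp | hp
  · obtain ⟨q, rfl⟩ : ∃ q', q = q' + 1 := ⟨q - 1, by omega⟩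
    simp only [degenComp_of_le i hi _ p q h hp]
    exact (X.continuous_vdegen _ _ _ _).comp (continuous_at _ _ _)
  · obtain ⟨p, rfl⟩ : ∃ p', p = p' + 1 := ⟨p - 1, by omega⟩
    simp only [degenComp_of_lt i hi _ p q h hp]
    exact (X.continuous_hdegen _ _ _ _).comp (continuous_at _ _ _)

theorem laws (X : BisimplicialSpace.{u}) : SimplicialLaws (Bar X) (face (X := X)) (degen (X := X)) where
  d_d n i j hij hj x := by
    refine ext' fun p q h => ?_
    simp only [face_at, faceComp]
    by_cases h1 : p < i
    · rw [dif_pos h1, dif_pos (by omega), dif_pos (by omega), dif_pos h1,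
        (X.vlaws p).d_d q (i - p) (j - p) (by omega) (by omega)]
      congr 1; omega
    · rw [dif_neg h1]
      by_cases h2 : p + 1 < j
      · rw [dif_pos h2, dif_pos (by omega), dif_neg h1, X.vface_hface]
        congr 2; omega
      · rw [dif_neg h2, dif_neg (by omega), dif_neg (by omega)]
        exact (X.hlaws q).d_d p i j hij (by omega) _
  s_s n i j hij hj x := by
    refine ext' fun p q h => ?_
    simp only [degen_at]
    by_cases h1 : p ≤ i
    · obtain ⟨q, rfl⟩ : ∃ q', q = q' + 1 + 1 := ⟨q - 2, by omega⟩
      rw [degenComp_of_le _ _ _ _ _ _ h1, degenComp_of_le _ _ _ _ _ _ (by omega), degen_at, degen_at,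
        degenComp_of_le _ _ _ _ _ _ h1, degenComp_of_le _ _ _ _ _ _ (by omega),
        (X.vlaws p).s_s q (i - p) (j - p) (by omega) (by omega)]
      congr 1; omega
    · obtain ⟨p, rfl⟩ : ∃ p', p = p' + 1 := ⟨p - 1, by omega⟩
      rw [degenComp_of_lt _ _ _ _ _ _ (by omega), degen_at]
      by_cases h2 : p ≤ j
      · obtain ⟨q, rfl⟩ : ∃ q', q = q' + 1 := ⟨q - 1, by omega⟩
        rw [degenComp_of_le _ _ _ _ _ _ h2, degenComp_of_le _ _ _ _ _ _ (by omega), degen_at,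
          degenComp_of_lt _ _ _ _ _ _ (by omega), ← X.vdegen_hdegen]
        congr 1; omega
      · obtain ⟨p, rfl⟩ : ∃ p', p = p' + 1 := ⟨p - 1, by omega⟩
        rw [degenComp_of_lt _ _ _ _ _ _ (by omega), degenComp_of_lt _ _ _ _ _ _ (by omega), degen_at,
          degenComp_of_lt _ _ _ _ _ _ (by omega)]
        exact (X.hlaws q).s_s p i j hij (by omega) _
  d_s_lt n i j hij hj x := by
    refine ext' fun p q h => ?_
    simp only [face_at, degen_at, faceComp]
    by_cases h1 : p < i
    · obtain ⟨q, rfl⟩ : ∃ q', q = q' + 1 := ⟨q - 1, by omega⟩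
      rw [dif_pos h1, degenComp_of_le _ _ _ _ _ _ (by omega), degenComp_of_le _ _ _ _ _ _ (by omega),
        face_at, faceComp, dif_pos h1, (X.vlaws p).d_s_lt q (i - p) (j - p) (by omega) (by omega)]
      congr 1; omega
    · rw [dif_neg h1]
      by_cases h2 : p + 1 ≤ j
      · obtain ⟨q, rfl⟩ : ∃ q', q = q' + 1 := ⟨q - 1, by omega⟩
        rw [degenComp_of_le _ _ _ _ _ _ h2, degenComp_of_le _ _ _ _ _ _ (by omega), face_at, faceComp,
          dif_neg h1, X.vdegen_hface]
        congr 2; omega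
      · obtain ⟨p, rfl⟩ : ∃ p', p = p' + 1 := ⟨p - 1, by omega⟩
        rw [degenComp_of_lt _ _ _ _ _ _ (by omega), degenComp_of_lt _ _ _ _ _ _ (by omega), face_at,
          faceComp, dif_neg (by omega)]
        exact (X.hlaws q).d_s_lt p i j hij (by omega) _
  d_s_self n i hi x := by
    refine ext' fun p q h => ?_
    simp only [face_at, faceComp, degen_at]
    by_cases h1 : p < i
    · rw [dif_pos h1, degenComp_of_le _ _ _ _ _ _ (by omega)]
      exact (X.vlaws p).d_s_self q (i - p) (by omega) _
    · rw [dif_neg h1, degenComp_of_lt _ _ _ _ _ _ (by omega)]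
      exact (X.hlaws q).d_s_self p i (by omega) _
  d_s_succ n i hi x := by
    refine ext' fun p q h => ?_
    simp only [face_at, faceComp, degen_at]
    by_cases h1 : p < i + 1
    · rw [dif_pos h1, degenComp_of_le _ _ _ _ _ _ (by omega)]
      have := (X.vlaws p).d_s_succ q (i - p) (by omega) (x.at' p q h)
      refine Eq.trans ?_ this
      congr 1; omega
    · rw [dif_neg h1, degenComp_of_lt _ _ _ _ _ _ (by omega)]
      exact (X.hlaws q).d_s_succ p i (by omega) _
  d_s_gt n i j hij hi x := by
    refine ext' fun p q h => ?_
    simp only [face_at, degen_at, faceComp]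
    by_cases h1 : p ≤ j
    · obtain ⟨q, rfl⟩ : ∃ q', q = q' + 1 := ⟨q - 1, by omega⟩
      rw [dif_pos (by omega), degenComp_of_le _ _ _ _ _ _ (by omega),
        degenComp_of_le _ _ _ _ _ _ (by omega),
        face_at, faceComp, dif_pos (by omega),
        (X.vlaws p).d_s_gt q (i - p) (j - p) (by omega) (by omega)]
      congr 2; omega
    · obtain ⟨p, rfl⟩ : ∃ p', p = p' + 1 := ⟨p - 1, by omega⟩
      rw [degenComp_of_lt j _ (face _ _ _ _) _ _ _ (by omega), face_at, faceComp]
      by_cases h2 : p + 1 < i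
      · rw [dif_pos h2, dif_pos (by omega), degenComp_of_lt _ _ _ _ _ _ (by omega), X.vface_hdegen]
        congr 2; omega
      · rw [dif_neg h2, dif_neg (by omega), degenComp_of_lt _ _ _ _ _ _ (by omega)]
        exact (X.hlaws q).d_s_gt p i j hij (by omega) _

end Bar

/-- The bar construction `W̄ X` of a bisimplicial space. -/
def bar (X : BisimplicialSpace.{u}) : SimplicialSpace.{u} where
  obj := Bar X
  face := Bar.face
  degen := Bar.degen
  continuous_face := Bar.continuous_face
  continuous_degen := Bar.continuous_degen
  laws := Bar.laws X

/-! ### Groupoids defined by generators and relations -/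

/-- Composable data `P` over `O` with a relation `rel`, such that modulo the equivalence relation
generated by `rel` one gets a category. -/
structure PreCat (P : Type u) (O : Type v) where
  src : P → O
  tgt : P → O
  one : O → P
  mul : (a b : P) → src a = tgt b → P
  rel : P → P → Prop
  src_rel : ∀ a b, rel a b → src a = src b
  tgt_rel : ∀ a b, rel a b → tgt a = tgt b
  src_one : ∀ x, src (one x) = x
  tgt_one : ∀ x, tgt (one x) = x
  src_mul : ∀ a b h, src (mul a b h) = src b
  tgt_mul : ∀ a b h, tgt (mul a b h) = tgt a
  mul_rel_left : ∀ a a' b h h', rel a a' →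
    Quot.mk rel (mul a b h) = Quot.mk rel (mul a' b h')
  mul_rel_right : ∀ a b b' h h', rel b b' →
    Quot.mk rel (mul a b h) = Quot.mk rel (mul a b' h')
  mul_assoc : ∀ a b c h₁ h₂ h₃ h₄,
    Quot.mk rel (mul (mul a b h₁) c h₃) = Quot.mk rel (mul a (mul b c h₂) h₄)
  one_mul : ∀ a h, Quot.mk rel (mul (one (tgt a)) a h) = Quot.mk rel a
  mul_one : ∀ a h, Quot.mk rel (mul a (one (src a)) h) = Quot.mk rel a

namespace PreCat

variable {P : Type u} {O : Type v} (C : PreCat P O)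

theorem eqv_src {a b : P} (h : Quot.mk C.rel a = Quot.mk C.rel b) : C.src a = C.src b :=
  congrArg (Quot.lift C.src C.src_rel) h

theorem eqv_tgt {a b : P} (h : Quot.mk C.rel a = Quot.mk C.rel b) : C.tgt a = C.tgt b :=
  congrArg (Quot.lift C.tgt C.tgt_rel) h

theorem mul_eqv_left {a a' : P} (b : P) (e : Quot.mk C.rel a = Quot.mk C.rel a') :
    ∀ h h', Quot.mk C.rel (C.mul a b h) = Quot.mk C.rel (C.mul a' b h') := by
  have e' := Quot.eqvGen_exact e
  clear e
  induction e' with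
  | rel a a' r => exact fun h h' => C.mul_rel_left _ _ _ h h' r
  | refl a => exact fun _ _ => rfl
  | symm a a' _ ih => exact fun h h' => (ih h' h).symm
  | trans a a' a'' r _ ih ih' =>
    intro h h'
    have h'' : C.src a' = C.tgt b := (C.eqv_src (Quot.eqvGen_sound r)).symm.trans h
    exact (ih h h'').trans (ih' h'' h')

theorem mul_eqv_right (a : P) {b b' : P} (e : Quot.mk C.rel b = Quot.mk C.rel b') :
    ∀ h h', Quot.mk C.rel (C.mul a b h) = Quot.mk C.rel (C.mul a b' h') := by
  have e' := Quot.eqvGen_exact e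
  clear e
  induction e' with
  | rel b b' r => exact fun h h' => C.mul_rel_right _ _ _ h h' r
  | refl b => exact fun _ _ => rfl
  | symm b b' _ ih => exact fun h h' => (ih h' h).symm
  | trans b b' b'' r _ ih ih' =>
    intro h h'
    have h'' : C.src a = C.tgt b' := h.trans (C.eqv_tgt (Quot.eqvGen_sound r))
    exact (ih h h'').trans (ih' h'' h')

theorem mul_eqv {a a' b b' : P} (e : Quot.mk C.rel a = Quot.mk C.rel a')
    (e' : Quot.mk C.rel b = Quot.mk C.rel b') (h : C.src a = C.tgt b) (h' : C.src a' = C.tgt b') :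
    Quot.mk C.rel (C.mul a b h) = Quot.mk C.rel (C.mul a' b' h') :=
  (C.mul_eqv_left b e h (((C.eqv_src e).symm.trans h))).trans
    (C.mul_eqv_right a' e' _ _)

/-- `a` has a two-sided inverse modulo the relation. -/
def Invertible (a : P) : Prop :=
  ∃ (b : P) (h : C.src a = C.tgt b) (h' : C.src b = C.tgt a),
    Quot.mk C.rel (C.mul a b h) = Quot.mk C.rel (C.one (C.tgt a)) ∧
    Quot.mk C.rel (C.mul b a h') = Quot.mk C.rel (C.one (C.src a))

variable {C}

theorem Invertible.congr {a a' : P} (ha : C.Invertible a)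
    (e : Quot.mk C.rel a = Quot.mk C.rel a') : C.Invertible a' := by
  obtain ⟨b, h, h', e₁, e₂⟩ := ha
  refine ⟨b, (C.eqv_src e).symm.trans h, h'.trans (C.eqv_tgt e), ?_, ?_⟩
  · rw [← C.mul_eqv_left b e h, e₁, C.eqv_tgt e]
  · rw [← C.mul_eqv_right b e h', e₂, C.eqv_src e]

theorem Invertible.mul {a b : P} (ha : C.Invertible a) (hb : C.Invertible b)
    (h : C.src a = C.tgt b) : C.Invertible (C.mul a b h) := by
  obtain ⟨a', h₁, h₂, e₁, e₂⟩ := ha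
  obtain ⟨b', k₁, k₂, f₁, f₂⟩ := hb
  have hba : C.src b' = C.tgt a' := by rw [k₂, ← h, h₁]
  -- the cancellation of an inner pair
  have key : ∀ (x y y' z : P) (hxy : C.src x = C.tgt y) (hyy : C.src y = C.tgt y')
      (hyz : C.src y' = C.tgt z) (h₁ : C.src (C.mul x y hxy) = C.tgt (C.mul y' z hyz))
      (h₂ : C.src x = C.tgt z),
      Quot.mk C.rel (C.mul y y' hyy) = Quot.mk C.rel (C.one (C.tgt y)) →
      Quot.mk C.rel (C.mul (C.mul x y hxy) (C.mul y' z hyz) h₁) =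
        Quot.mk C.rel (C.mul x z h₂) := by
    intro x y y' z hxy hyy hyz h₁ h₂ e
    have hone : C.src (C.one (C.src x)) = C.tgt z := by rw [C.src_one, h₂]
    rw [C.mul_assoc x y (C.mul y' z hyz) hxy (by rw [C.tgt_mul, hyy]) h₁
      (by rw [C.tgt_mul, hxy])]
    refine C.mul_eqv_right x ?_ _ _
    rw [← C.mul_assoc y y' z hyy hyz (by rw [C.src_mul, hyz])]
    refine (C.mul_eqv_left z e _ (by rw [C.src_one, ← hxy, h₂])).trans ?_
    have : C.tgt y = C.tgt z := by rw [← hxy, h₂]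
    refine Eq.trans ?_ (C.one_mul z (C.src_one _))
    congr 2
    exact congrArg C.one this
  refine ⟨C.mul b' a' hba, by rw [C.src_mul, C.tgt_mul, k₁], by rw [C.src_mul, C.tgt_mul, h₂],
    ?_, ?_⟩
  · rw [key a b b' a' h k₁ hba _ h₁ f₁, e₁, C.tgt_mul]
  · rw [key b' a' a b hba h₂ h _ k₂ (by rw [e₂, h₁]), f₂, C.src_mul]

variable (C)

/-- The groupoid of classes of elements of `P` modulo the equivalence relation generated by
`rel`. -/
def toGroupoid (hC : ∀ a, C.Invertible a) : InternalGroupoid (Quot C.rel) O where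
  src := Quot.lift C.src C.src_rel
  tgt := Quot.lift C.tgt C.tgt_rel
  one x := Quot.mk _ (C.one x)
  inv a := Quot.mk _ (hC a.out).choose
  mul a b h := Quot.mk _ (C.mul a.out b.out (by
    rw [← Quot.out_eq a, ← Quot.out_eq b] at h; exact h))
  src_one := C.src_one
  tgt_one := C.tgt_one
  src_inv a := by
    conv_rhs => rw [← Quot.out_eq a]
    exact (hC a.out).choose_spec.choose_spec.choose
  tgt_inv a := by
    conv_rhs => rw [← Quot.out_eq a]
    exact (hC a.out).choose_spec.choose.symm
  src_mul a b h := by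
    conv_rhs => rw [← Quot.out_eq b]
    exact C.src_mul _ _ _
  tgt_mul a b h := by
    conv_rhs => rw [← Quot.out_eq a]
    exact C.tgt_mul _ _ _
  mul_assoc := by
    rintro ⟨a⟩ ⟨b⟩ ⟨c⟩ h₁ h₂ h₃ h₄
    have h₁' : C.src a = C.tgt b := h₁
    have h₂' : C.src b = C.tgt c := h₂
    refine (C.mul_eqv (a' := C.mul a b h₁) (b' := c) ?_ (Quot.out_eq _) _
      (by rw [C.src_mul, h₂'])).trans ((C.mul_assoc a b c h₁ h₂ _ (by rw [C.tgt_mul, h₁'])).trans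
      (C.mul_eqv (a := a) (b := C.mul b c h₂) (Quot.out_eq _).symm ?_ _ _))
    · exact (Quot.out_eq _).trans (C.mul_eqv (Quot.out_eq _) (Quot.out_eq _) _ _)
    · exact (C.mul_eqv (Quot.out_eq _).symm (Quot.out_eq _).symm _ _).trans (Quot.out_eq _).symm
  one_mul := by
    rintro ⟨a⟩ h
    exact (C.mul_eqv (a' := C.one (C.tgt a)) (b' := a) (Quot.out_eq _) (Quot.out_eq _) _
      (C.src_one _)).trans (C.one_mul a _)
  mul_one := by
    rintro ⟨a⟩ h
    exact (C.mul_eqv (a' := a) (b' := C.one (C.src a)) (Quot.out_eq _) (Quot.out_eq _) _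
      (C.tgt_one _).symm).trans (C.mul_one a _)
  inv_mul a h := by
    have e := (hC a.out).choose_spec.choose_spec.choose_spec.2
    refine (C.mul_eqv (Quot.out_eq _) rfl _
      (hC a.out).choose_spec.choose_spec.choose).trans (e.trans ?_)
    conv_rhs => rw [← Quot.out_eq a]
  mul_inv a h := by
    have e := (hC a.out).choose_spec.choose_spec.choose_spec.1
    refine (C.mul_eqv rfl (Quot.out_eq _) _
      (hC a.out).choose_spec.choose).trans (e.trans ?_)
    conv_rhs => rw [← Quot.out_eq a]

end PreCat

/-! ### The groupoid `𝔊(X)` generated by a simplicial space -/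

namespace SimplicialSpace

variable (X : SimplicialSpace.{u})

/-- A formal symbol `y` (marked `true`) or `y⁻¹` (marked `false`), for `y ∈ X_1`. -/
abbrev Letter := X.obj 1 × Bool

/-- The source of `y` is `f_0 y`. -/
def lsrc : X.Letter → X.obj 0
  | (y, true) => X.face 0 0 (by omega) y
  | (y, false) => X.face 0 1 (by omega) y

/-- The target of `y` is `f_1 y`. -/
def ltgt : X.Letter → X.obj 0
  | (y, true) => X.face 0 1 (by omega) y
  | (y, false) => X.face 0 0 (by omega) y

/-- `l` is a composable formal product with target `x` and source `x'`. -/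
def IsWord : X.obj 0 → List X.Letter → X.obj 0 → Prop
  | x, [], x' => x = x'
  | x, a :: l, x' => X.ltgt a = x ∧ IsWord (X.lsrc a) l x'

theorem isWord_append (l m : List X.Letter) (x z : X.obj 0) :
    X.IsWord x (l ++ m) z ↔ ∃ y, X.IsWord x l y ∧ X.IsWord y m z := by
  induction l generalizing x with
  | nil => simp [IsWord]
  | cons a l ih => simp [IsWord, ih, and_assoc]

/-- The space of composable formal products of length `m ≥ 0`, for all `m` (recorded together with
the end points; for `m = 0` these are the formal identities of the points of `X_0`). -/
def Word : Type u :=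
  {w : X.obj 0 × List X.Letter × X.obj 0 // X.IsWord w.1 w.2.1 w.2.2}

instance : TopologicalSpace X.Word :=
  inferInstanceAs
    (TopologicalSpace {w : X.obj 0 × List X.Letter × X.obj 0 // X.IsWord w.1 w.2.1 w.2.2})

/-- The defining relations: `f_1 z ∼ f_2 z · f_0 z` for `z ∈ X_2`, `y · y⁻¹ ∼ δ_0 f_1 y` and
`y⁻¹ · y ∼ δ_0 f_0 y` for `y ∈ X_1`, and `δ_0 x` is the identity of `x ∈ X_0`. -/
inductive LetterRel : List X.Letter → List X.Letter → Prop
  | simplex (z : X.obj 2) : LetterRel [(X.face 1 1 (by omega) z, true)]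
      [(X.face 1 2 (by omega) z, true), (X.face 1 0 (by omega) z, true)]
  | mul_inv (y : X.obj 1) : LetterRel [(y, true), (y, false)]
      [(X.degen 0 0 le_rfl (X.face 0 1 (by omega) y), true)]
  | inv_mul (y : X.obj 1) : LetterRel [(y, false), (y, true)]
      [(X.degen 0 0 le_rfl (X.face 0 0 (by omega) y), true)]
  | one (x : X.obj 0) : LetterRel [(X.degen 0 0 le_rfl x, true)] []

/-- Two formal products with the same end points are related if one results from the other by
applying a defining relation to a subword. -/
def WordRel (w w' : X.Word) : Prop :=
  w.1.1 = w'.1.1 ∧ w.1.2.2 = w'.1.2.2 ∧ ∃ l u v r, X.LetterRel u v ∧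
    w.1.2.1 = l ++ (u ++ r) ∧ w'.1.2.1 = l ++ (v ++ r)

theorem LetterRel.isWord {u v : List X.Letter} (h : X.LetterRel u v) {x y : X.obj 0}
    (hu : X.IsWord x u y) : X.IsWord x v y := by
  cases h with
  | simplex z =>
    simp only [IsWord, lsrc, ltgt] at hu ⊢
    obtain ⟨rfl, rfl⟩ := hu
    refine ⟨?_, ?_, ?_⟩
    · exact (X.laws.d_d 0 1 2 (by omega) (by omega) z).symm ▸ rfl
    · exact (X.laws.d_d 0 0 2 (by omega) (by omega) z).symm
    · exact (X.laws.d_d 0 0 1 (by omega) (by omega) z).symm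
  | mul_inv z =>
    simp only [IsWord, lsrc, ltgt] at hu ⊢
    obtain ⟨rfl, -, rfl⟩ := hu
    exact ⟨X.laws.d_s_succ 0 0 le_rfl _, X.laws.d_s_self 0 0 le_rfl _⟩
  | inv_mul z =>
    simp only [IsWord, lsrc, ltgt] at hu ⊢
    obtain ⟨rfl, -, rfl⟩ := hu
    exact ⟨X.laws.d_s_succ 0 0 le_rfl _, X.laws.d_s_self 0 0 le_rfl _⟩
  | one z =>
    simp only [IsWord, lsrc, ltgt] at hu ⊢
    obtain ⟨rfl, rfl⟩ := hu
    exact (X.laws.d_s_succ 0 0 le_rfl _).trans (X.laws.d_s_self 0 0 le_rfl _).symm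

/-- Formal products, with concatenation. -/
def wordPreCat : PreCat X.Word (X.obj 0) where
  src w := w.1.2.2
  tgt w := w.1.1
  one x := ⟨(x, [], x), rfl⟩
  mul a b h := ⟨(a.1.1, a.1.2.1 ++ b.1.2.1, b.1.2.2),
    (X.isWord_append _ _ _ _).2 ⟨a.1.2.2, a.2, h ▸ b.2⟩⟩
  rel := X.WordRel
  src_rel _ _ h := h.2.1
  tgt_rel _ _ h := h.1
  src_one _ := rfl
  tgt_one _ := rfl
  src_mul _ _ _ := rfl
  tgt_mul _ _ _ := rfl
  mul_rel_left := by
    rintro ⟨⟨x, l, y⟩, ha⟩ ⟨⟨x', l', y'⟩, ha'⟩ ⟨⟨y'', m, z⟩, hb⟩ h h' ⟨e₁, e₂, p, u, v, r, huv, e₃, e₄⟩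
    refine Quot.sound ⟨e₁, rfl, p, u, v, r ++ m, huv, ?_, ?_⟩
    · simp only at e₃; simp [e₃]
    · simp only at e₄; simp [e₄]
  mul_rel_right := by
    rintro ⟨⟨y'', m, z⟩, hb⟩ ⟨⟨x, l, y⟩, ha⟩ ⟨⟨x', l', y'⟩, ha'⟩ h h' ⟨e₁, e₂, p, u, v, r, huv, e₃, e₄⟩
    refine Quot.sound ⟨rfl, e₂, m ++ p, u, v, r, huv, ?_, ?_⟩
    · simp only at e₃; simp [e₃]
    · simp only at e₄; simp [e₄]
  mul_assoc a b c _ _ _ _ := by simp only [List.append_assoc]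
  one_mul a h := rfl
  mul_one := by
    rintro ⟨⟨x, l, y⟩, ha⟩ h
    simp only [List.append_nil]

theorem mk_eq_of_letterRel {x y : X.obj 0} {u v : List X.Letter} (h : X.LetterRel u v)
    (hu : X.IsWord x u y) (hv : X.IsWord x v y) :
    Quot.mk X.WordRel ⟨(x, u, y), hu⟩ = Quot.mk X.WordRel ⟨(x, v, y), hv⟩ :=
  Quot.sound ⟨rfl, rfl, [], u, v, [], h, by simp, by simp⟩

theorem word_invertible (w : X.Word) : X.wordPreCat.Invertible w := by
  obtain ⟨⟨x, l, z⟩, hw⟩ := w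
  have hone : ∀ t (h : X.IsWord t [(X.degen 0 0 le_rfl t, true)] t),
      Quot.mk X.WordRel ⟨(t, [(X.degen 0 0 le_rfl t, true)], t), h⟩ =
        Quot.mk X.WordRel ⟨(t, [], t), rfl⟩ := fun t h =>
    X.mk_eq_of_letterRel (LetterRel.one t) h rfl
  induction l generalizing x with
  | nil =>
    obtain rfl : x = z := hw
    exact ⟨⟨(x, [], x), rfl⟩, rfl, rfl, rfl, rfl⟩
  | cons a l ih =>
    have hx : X.ltgt a = x := hw.1
    subst hx
    have hl : X.IsWord (X.lsrc a) l z := hw.2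
    have := ih _ hl
    refine PreCat.Invertible.mul (C := X.wordPreCat)
      (a := ⟨(X.ltgt a, [a], X.lsrc a), rfl, rfl⟩) (b := ⟨(X.lsrc a, l, z), hl⟩) ?_ this rfl
    obtain ⟨y, b⟩ := a
    cases b with
    | true =>
      refine ⟨⟨(X.lsrc (y, true), [(y, false)], X.ltgt (y, true)), rfl, rfl⟩, rfl, rfl, ?_, ?_⟩
      · exact (X.mk_eq_of_letterRel (LetterRel.mul_inv y) ⟨rfl, rfl, rfl⟩
          ((LetterRel.mul_inv y).isWord X ⟨rfl, rfl, rfl⟩)).trans (hone _ _)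
      · exact (X.mk_eq_of_letterRel (LetterRel.inv_mul y) ⟨rfl, rfl, rfl⟩
          ((LetterRel.inv_mul y).isWord X ⟨rfl, rfl, rfl⟩)).trans (hone _ _)
    | false =>
      refine ⟨⟨(X.lsrc (y, false), [(y, true)], X.ltgt (y, false)), rfl, rfl⟩, rfl, rfl, ?_, ?_⟩
      · exact (X.mk_eq_of_letterRel (LetterRel.inv_mul y) ⟨rfl, rfl, rfl⟩
          ((LetterRel.inv_mul y).isWord X ⟨rfl, rfl, rfl⟩)).trans (hone _ _)
      · exact (X.mk_eq_of_letterRel (LetterRel.mul_inv y) ⟨rfl, rfl, rfl⟩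
          ((LetterRel.mul_inv y).isWord X ⟨rfl, rfl, rfl⟩)).trans (hone _ _)

/-- The arrows of `𝔊(X)`: formal products modulo the relations, with the quotient topology. -/
def GenArrow : Type u := Quot X.WordRel

instance : TopologicalSpace X.GenArrow := inferInstanceAs (TopologicalSpace (Quot X.WordRel))

/-- The groupoid `𝔊(X) ⇉ X_0`. -/
def gen : InternalGroupoid X.GenArrow (X.obj 0) := X.wordPreCat.toGroupoid X.word_invertible

/-- The arrow of `𝔊(X)` represented by `y ∈ X_1`. -/
def genMk (y : X.obj 1) : X.GenArrow :=
  Quot.mk _ ⟨(X.ltgt (y, true), [(y, true)], X.lsrc (y, true)), rfl, rfl⟩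

end SimplicialSpace

/-! ### The Haefliger fundamental groupoid -/

section Haefliger

variable {G : Type u} {M : Type v} [TopologicalSpace G] [TopologicalSpace M]

/-- The path "first `τ`, then `ρ`". -/
def pathComp (ρ τ : C(I, M)) (h : τ 1 = ρ 0) : C(I, M) :=
  (Path.trans (⟨τ, rfl, rfl⟩ : Path (τ 0) (τ 1)) (⟨ρ, h.symm, rfl⟩ : Path (τ 1) (ρ 1))).toContinuousMap

theorem pathComp_zero (ρ τ : C(I, M)) (h : τ 1 = ρ 0) : pathComp ρ τ h 0 = τ 0 :=
  (Path.trans (⟨τ, rfl, rfl⟩ : Path (τ 0) (τ 1)) (⟨ρ, h.symm, rfl⟩ : Path (τ 1) (ρ 1))).source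

theorem pathComp_one (ρ τ : C(I, M)) (h : τ 1 = ρ 0) : pathComp ρ τ h 1 = ρ 1 :=
  (Path.trans (⟨τ, rfl, rfl⟩ : Path (τ 0) (τ 1)) (⟨ρ, h.symm, rfl⟩ : Path (τ 1) (ρ 1))).target

variable (Γ : InternalGroupoid G M)

/-- `(g_n, ρ_n), …, (g_1, ρ_1)` is a composable sequence of pairs, each consisting of an arrow and
a path, with target `x` and source `y`: the target of `g_n` is `x`, the path `ρ_i` ends at the
source of `g_i` and starts at the target of `g_{i-1}`, and `ρ_1` starts at `y`. -/
def IsGPath : M → List (G × C(I, M)) → M → Prop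
  | x, [], y => x = y
  | x, c :: L, y => Γ.tgt c.1 = x ∧ Γ.src c.1 = c.2 1 ∧ IsGPath (c.2 0) L y

set_option linter.unusedSectionVars false in
theorem isGPath_append (L K : List (G × C(I, M))) (x z : M) :
    IsGPath Γ x (L ++ K) z ↔ ∃ y, IsGPath Γ x L y ∧ IsGPath Γ y K z := by
  induction L generalizing x with
  | nil => simp [IsGPath]
  | cons a l ih => simp [IsGPath, ih, and_assoc]

/-- A `G`-path `g_n ρ_n g_{n-1} ⋯ g_1 ρ_1 g_0` of some order `n ≥ 0`, an alternating sequence of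
arrows `g_i` of `G` and paths `ρ_i` in `M`: it is given by its target (the target of the leftmost
arrow), the pairs `(g_n, ρ_n), …, (g_1, ρ_1)`, and the arrow `g_0`. -/
def GPath : Type (max u v) :=
  {c : M × List (G × C(I, M)) × G // IsGPath Γ c.1 c.2.1 (Γ.tgt c.2.2)}

/-- `G`-paths are topologized by the compact-open topology on paths. -/
instance : TopologicalSpace (GPath Γ) :=
  inferInstanceAs (TopologicalSpace
    {c : M × List (G × C(I, M)) × G // IsGPath Γ c.1 c.2.1 (Γ.tgt c.2.2)})

namespace GPath

variable {Γ}

def tgt (c : GPath Γ) : M := c.1.1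

def src (c : GPath Γ) : M := Γ.src c.1.2.2

/-- A `G`-path as a sequence of pairs together with the last arrow. -/
def seq (c : GPath Γ) : List (G × C(I, M)) × G := c.1.2

end GPath

/-- Elementary equivalences of `G`-paths: (i) if `ρ_i` is a constant path, then `g_i ρ_i g_{i-1}`
may be replaced by the product `g_i g_{i-1}`; (ii) if `g_i` is a unit, then `ρ_{i+1} g_i ρ_i` may
be replaced by the concatenation of the two paths. -/
inductive GEquiv : List (G × C(I, M)) × G → List (G × C(I, M)) × G → Prop
  | mul (L R : List (G × C(I, M))) (g h : G) (τ : C(I, M)) (g₀ : G) (hgh : Γ.src g = Γ.tgt h) :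
      GEquiv (L ++ (g, .const I (Γ.src g)) :: (h, τ) :: R, g₀) (L ++ (Γ.mul g h hgh, τ) :: R, g₀)
  | mul_last (L : List (G × C(I, M))) (g h : G) (hgh : Γ.src g = Γ.tgt h) :
      GEquiv (L ++ [(g, .const I (Γ.src g))], h) (L, Γ.mul g h hgh)
  | concat (L R : List (G × C(I, M))) (g : G) (ρ τ : C(I, M)) (g₀ : G) (h : τ 1 = ρ 0) :
      GEquiv (L ++ (g, ρ) :: (Γ.one (ρ 0), τ) :: R, g₀) (L ++ (g, pathComp ρ τ h) :: R, g₀)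

/-- Two `G`-paths with the same end points are related if there is an elementary equivalence or a
deformation between them; a deformation is a continuous family of `G`-paths (necessarily of
constant order) with fixed end points. -/
def GRel (c c' : GPath Γ) : Prop :=
  c.src = c'.src ∧ c.tgt = c'.tgt ∧
    (GEquiv Γ c.seq c'.seq ∨
      ∃ F : C(I, GPath Γ), F 0 = c ∧ F 1 = c' ∧
        ∀ t, (F t).src = c.src ∧ (F t).tgt = c.tgt)

theorem list_continuous_append {α : Type*} [TopologicalSpace α] (R : List α) :
    Continuous (fun L : List α => L ++ R) := by
  rw [continuous_iff_continuousAt]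
  refine List.tendsto_nhds (r := fun L => 𝓝 (L ++ R)) ?_ ?_
  · exact Filter.tendsto_pure_left.2 fun s hs => mem_of_mem_nhds hs
  · intro l a ih
    exact Filter.Tendsto.cons Filter.tendsto_fst (ih.comp Filter.tendsto_snd)

theorem list_continuous_append_left {α : Type*} [TopologicalSpace α] (L : List α) :
    Continuous (fun R : List α => L ++ R) := by
  induction L with
  | nil => exact continuous_id
  | cons a l ih => exact List.continuous_cons.comp (continuous_const.prodMk ih)

theorem list_continuous_concat {α : Type*} [TopologicalSpace α] :
    Continuous (fun p : List α × α => p.1 ++ [p.2]) := by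
  rw [continuous_iff_continuousAt]
  rintro ⟨l, a⟩
  have h0 : ∀ᶠ p : List α × α in 𝓝 (l, a), p.1.length = l.length := by
    have := (List.continuousAt_length l).comp (f := fun p : List α × α => p.1) (x := (l, a))
      continuousAt_fst
    have h1 := this.eventually (p := fun n => n = l.length)
      (by rw [nhds_discrete]; exact Filter.eventually_pure.2 rfl)
    exact h1
  refine ContinuousAt.congr (f := fun p => p.1.insertIdx l.length p.2) ?_ ?_
  · exact List.tendsto_insertIdx (n := l.length) continuousAt_snd continuousAt_fst
  · filter_upwards [h0] with p hp
    rw [← hp, List.insertIdx_length_self]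

/-- `G`-paths, with concatenation: two `G`-paths are joined by inserting a constant path. -/
def gPathPreCat : PreCat (GPath Γ) M where
  src := GPath.src
  tgt := GPath.tgt
  one x := ⟨(x, [], Γ.one x), (Γ.tgt_one x).symm⟩
  mul a b h := ⟨(a.1.1, a.1.2.1 ++ (a.1.2.2, .const I (Γ.src a.1.2.2)) :: b.1.2.1, b.1.2.2),
    (isGPath_append Γ _ _ _ _).2 ⟨_, a.2, rfl, rfl, by
      have h' : Γ.src a.1.2.2 = b.1.1 := h
      change IsGPath Γ (Γ.src a.1.2.2) _ _
      rw [h']; exact b.2⟩⟩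
  rel := GRel Γ
  src_rel _ _ h := h.1
  tgt_rel _ _ h := h.2.1
  src_one := Γ.src_one
  tgt_one _ := rfl
  src_mul _ _ _ := rfl
  tgt_mul _ _ _ := rfl
  mul_rel_left := by
    rintro a a' b h h' ⟨e₁, e₂, e | ⟨F, hF₀, hF₁, hF⟩⟩
    · refine Quot.sound ⟨rfl, e₂, Or.inl ?_⟩
      obtain ⟨⟨x, L, g₀⟩, ha⟩ := a
      obtain ⟨⟨x', L', g₀'⟩, ha'⟩ := a'
      obtain ⟨⟨y, K, k⟩, hb⟩ := b
      have hs : Γ.src g₀ = Γ.src g₀' := e₁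
      change GEquiv Γ (L, g₀) (L', g₀') at e
      change GEquiv Γ (L ++ (g₀, .const I (Γ.src g₀)) :: K, k)
        (L' ++ (g₀', .const I (Γ.src g₀')) :: K, k)
      cases e with
      | mul P R g k' τ _ hgh =>
        simpa using GEquiv.mul P (R ++ (g₀, .const I (Γ.src g₀)) :: K) g k' τ k hgh
      | mul_last _ g _ hgh =>
        have := GEquiv.mul L' K g g₀ (.const I (Γ.src g₀)) k hgh
        rw [← hs]
        simpa using this
      | concat P R g ρ τ _ hρτ =>
        simpa using GEquiv.concat P (R ++ (g₀, .const I (Γ.src g₀)) :: K) g ρ τ k hρτ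
    · have hsrc : ∀ t, (F t).src = b.tgt := fun t => (hF t).1.trans h
      refine Quot.sound ⟨rfl, e₂, Or.inr ⟨⟨fun t => ⟨((F t).1.1, (F t).1.2.1 ++
        ((F t).1.2.2, .const I (Γ.src a.1.2.2)) :: b.1.2.1, b.1.2.2), ?_⟩, ?_⟩, ?_, ?_, ?_⟩⟩
      · refine (isGPath_append Γ _ _ _ _).2 ⟨_, (F t).2, rfl, (hF t).1, ?_⟩
        have h' : Γ.src a.1.2.2 = b.1.1 := h
        change IsGPath Γ (Γ.src a.1.2.2) _ _
        rw [h']; exact b.2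
      · refine Continuous.subtype_mk ?_ _
        have hc : Continuous fun t => (F t).1 := continuous_subtype_val.comp F.continuous
        refine hc.fst.prodMk (Continuous.prodMk ?_ continuous_const)
        have h2 : Continuous fun t => (F t).1.2.1 ++
            [((F t).1.2.2, ContinuousMap.const I (Γ.src a.1.2.2))] :=
          list_continuous_concat.comp (hc.snd.fst.prodMk (hc.snd.snd.prodMk continuous_const))
        refine ((list_continuous_append b.1.2.1).comp h2).congr fun t => ?_
        simp [Function.comp]
      · subst hF₀; rfl
      · subst hF₁
        refine Subtype.ext ?_
        change (_, _ ++ (_, ContinuousMap.const I (Γ.src a.1.2.2)) :: _, _) = _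
        have : Γ.src a.1.2.2 = Γ.src (F 1).1.2.2 := e₁
        rw [this]
      · exact fun t => ⟨rfl, (hF t).2⟩
  mul_rel_right := by
    rintro a b b' h h' ⟨e₁, e₂, e | ⟨F, hF₀, hF₁, hF⟩⟩
    · refine Quot.sound ⟨e₁, rfl, Or.inl ?_⟩
      obtain ⟨⟨x, L, g₀⟩, ha⟩ := a
      obtain ⟨⟨y, K, k⟩, hb⟩ := b
      obtain ⟨⟨y', K', k'⟩, hb'⟩ := b'
      change GEquiv Γ (K, k) (K', k') at e
      change GEquiv Γ (L ++ (g₀, .const I (Γ.src g₀)) :: K, k)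
        (L ++ (g₀, .const I (Γ.src g₀)) :: K', k')
      cases e with
      | mul P R g k' τ _ hgh =>
        simpa using GEquiv.mul (L ++ (g₀, .const I (Γ.src g₀)) :: P) R g k' τ k hgh
      | mul_last _ g k' hgh =>
        simpa using GEquiv.mul_last (L ++ (g₀, .const I (Γ.src g₀)) :: K') g k hgh
      | concat P R g ρ τ _ hρτ =>
        simpa using GEquiv.concat (L ++ (g₀, .const I (Γ.src g₀)) :: P) R g ρ τ k hρτ
    · refine Quot.sound ⟨e₁, rfl, Or.inr ⟨⟨fun t => ⟨(a.1.1, a.1.2.1 ++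
        (a.1.2.2, .const I (Γ.src a.1.2.2)) :: (F t).1.2.1, (F t).1.2.2), ?_⟩, ?_⟩, ?_, ?_, ?_⟩⟩
      · refine (isGPath_append Γ _ _ _ _).2 ⟨_, a.2, rfl, rfl, ?_⟩
        have h' : Γ.src a.1.2.2 = (F t).1.1 := Eq.trans (b := b.tgt) h (hF t).2.symm
        change IsGPath Γ (Γ.src a.1.2.2) _ _
        rw [h']; exact (F t).2
      · refine Continuous.subtype_mk ?_ _
        have hc : Continuous fun t => (F t).1 := continuous_subtype_val.comp F.continuous
        refine continuous_const.prodMk (Continuous.prodMk ?_ hc.snd.snd)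
        exact (list_continuous_append_left _).comp
          (List.continuous_cons.comp (continuous_const.prodMk hc.snd.fst))
      · subst hF₀; rfl
      · subst hF₁; rfl
      · exact fun t => ⟨(hF t).1, rfl⟩
  mul_assoc a b c _ _ _ _ := by simp only [List.append_assoc, List.cons_append]
  one_mul := by
    rintro ⟨⟨x, L, g₀⟩, ha⟩ h
    refine Quot.sound ⟨rfl, rfl, Or.inl ?_⟩
    change GEquiv Γ ((Γ.one x, .const I (Γ.src (Γ.one x))) :: L, g₀) (L, g₀)
    cases L with
    | nil =>
      have hx : x = Γ.tgt g₀ := ha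
      subst hx
      have := GEquiv.mul_last (Γ := Γ) [] (Γ.one (Γ.tgt g₀)) g₀ (Γ.src_one _)
      rw [Γ.one_mul] at this
      exact this
    | cons c R =>
      obtain ⟨k, τ⟩ := c
      have hx : Γ.tgt k = x := ha.1
      subst hx
      have := GEquiv.mul (Γ := Γ) [] R (Γ.one (Γ.tgt k)) k τ g₀ (Γ.src_one _)
      rw [Γ.one_mul] at this
      exact this
  mul_one := by
    rintro ⟨⟨x, L, g₀⟩, ha⟩ h
    refine Quot.sound ⟨Γ.src_one _, rfl, Or.inl ?_⟩
    have := GEquiv.mul_last (Γ := Γ) L g₀ (Γ.one (Γ.src g₀)) (Γ.tgt_one _).symm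
    rw [Γ.mul_one] at this
    exact this

/-- The `G`-path of order `0` given by an arrow. -/
def gArrow (g : G) : GPath Γ := ⟨(Γ.tgt g, [], g), rfl⟩

/-- The `G`-path of order `1` given by an arrow `g`, and a path `ρ` ending at the source of `g`. -/
def gArrowPath (g : G) (ρ : C(I, M)) (h : Γ.src g = ρ 1) : GPath Γ :=
  ⟨(Γ.tgt g, [(g, ρ)], Γ.one (ρ 0)), rfl, h, (Γ.tgt_one _).symm⟩

theorem gArrow_invertible (g : G) : (gPathPreCat Γ).Invertible (gArrow Γ g) := by
  refine ⟨gArrow Γ (Γ.inv g), (Γ.tgt_inv g).symm, Γ.src_inv g, ?_, ?_⟩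
  · refine Quot.sound ⟨(Γ.src_inv g).trans (Γ.src_one _).symm, rfl, Or.inl ?_⟩
    have := GEquiv.mul_last (Γ := Γ) [] g (Γ.inv g) (Γ.tgt_inv g).symm
    rw [Γ.mul_inv] at this
    exact this
  · refine Quot.sound ⟨(Γ.src_one _).symm, Γ.tgt_inv g, Or.inl ?_⟩
    have := GEquiv.mul_last (Γ := Γ) [] (Γ.inv g) g (Γ.src_inv g)
    rw [Γ.inv_mul] at this
    exact this

/-- Going back and forth along a path is trivial. -/
theorem gPath_cancel (ρ τ : C(I, M)) (h : τ 1 = ρ 0) (h' : τ 0 = ρ 1)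
    (H : Path.Homotopy
      (Path.trans (⟨τ, rfl, rfl⟩ : Path (τ 0) (τ 1)) (⟨ρ, h.symm, h'.symm⟩ : Path (τ 1) (τ 0)))
      (Path.refl (τ 0)))
    (h₁ : Γ.src (Γ.one (ρ 1)) = ρ 1) (h₂ : Γ.src (Γ.one (τ 1)) = τ 1) (h₃) :
    Quot.mk (GRel Γ) ((gPathPreCat Γ).mul (gArrowPath Γ (Γ.one (ρ 1)) ρ h₁)
      (gArrowPath Γ (Γ.one (τ 1)) τ h₂) h₃) = Quot.mk (GRel Γ) ((gPathPreCat Γ).one (ρ 1)) := by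
  have hs : Γ.src (Γ.one (ρ 0)) = Γ.tgt (Γ.one (τ 1)) := by rw [Γ.src_one, Γ.tgt_one, h]
  have ht : Γ.tgt (Γ.one (τ 0)) = τ 0 := Γ.tgt_one _
  -- multiply the two units in the middle
  have e₁ : Quot.mk (GRel Γ) ((gPathPreCat Γ).mul (gArrowPath Γ (Γ.one (ρ 1)) ρ h₁)
      (gArrowPath Γ (Γ.one (τ 1)) τ h₂) h₃) = Quot.mk (GRel Γ)
      ⟨(ρ 1, [(Γ.one (ρ 1), ρ), (Γ.one (ρ 0), τ)], Γ.one (τ 0)),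
        Γ.tgt_one _, h₁, Γ.tgt_one _, (Γ.src_one _).trans h.symm, ht.symm⟩ := by
    refine Quot.sound ⟨rfl, Γ.tgt_one _, Or.inl ?_⟩
    have := GEquiv.mul (Γ := Γ) [(Γ.one (ρ 1), ρ)] [] (Γ.one (ρ 0)) (Γ.one (τ 1)) τ (Γ.one (τ 0)) hs
    have e : Γ.mul (Γ.one (ρ 0)) (Γ.one (τ 1)) hs = Γ.one (ρ 0) := by
      have := Γ.mul_one (Γ.one (ρ 0)) (by rw [Γ.src_one, Γ.tgt_one])
      convert! this using 2
      rw [Γ.src_one, h]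
    rw [e] at this
    exact this
  -- concatenate the two paths
  have e₂ : Quot.mk (GRel Γ)
      ⟨(ρ 1, [(Γ.one (ρ 1), ρ), (Γ.one (ρ 0), τ)], Γ.one (τ 0)),
        Γ.tgt_one _, h₁, Γ.tgt_one _, (Γ.src_one _).trans h.symm, ht.symm⟩ = Quot.mk (GRel Γ)
      ⟨(ρ 1, [(Γ.one (ρ 1), pathComp ρ τ h)], Γ.one (τ 0)),
        Γ.tgt_one _, h₁.trans (pathComp_one ρ τ h).symm,
        (pathComp_zero ρ τ h).trans ht.symm⟩ :=
    Quot.sound ⟨rfl, rfl, Or.inl (GEquiv.concat (Γ := Γ) [] [] (Γ.one (ρ 1)) ρ τ (Γ.one (τ 0)) h)⟩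
  -- deform to a constant path
  have hH0 : ∀ t, H (t, 0) = τ 0 := fun t => H.source t
  have hH1 : ∀ t, H (t, 1) = τ 0 := fun t => H.target t
  have e₃ : Quot.mk (GRel Γ)
      ⟨(ρ 1, [(Γ.one (ρ 1), pathComp ρ τ h)], Γ.one (τ 0)),
        Γ.tgt_one _, h₁.trans (pathComp_one ρ τ h).symm,
        (pathComp_zero ρ τ h).trans ht.symm⟩ = Quot.mk (GRel Γ)
      ⟨(ρ 1, [(Γ.one (ρ 1), .const I (Γ.src (Γ.one (ρ 1))))], Γ.one (τ 0)),
        Γ.tgt_one _, rfl, h₁.trans (h'.symm.trans ht.symm)⟩ := by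
    refine Quot.sound ⟨rfl, rfl, Or.inr ⟨⟨fun t => ⟨(ρ 1, [(Γ.one (ρ 1),
      H.toContinuousMap.curry t)], Γ.one (τ 0)), Γ.tgt_one _, ?_, ?_⟩, ?_⟩, ?_, ?_, ?_⟩⟩
    · exact h₁.trans (h'.symm.trans (hH1 t).symm)
    · exact (hH0 t).trans ht.symm
    · refine Continuous.subtype_mk ?_ _
      refine continuous_const.prodMk (Continuous.prodMk ?_ continuous_const)
      exact List.continuous_cons.comp
        ((continuous_const.prodMk H.toContinuousMap.curry.continuous).prodMk continuous_const)
    · refine Subtype.ext ?_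
      change (_, [(_, _)], _) = (_, [(_, _)], _)
      congr 5
      ext s
      exact H.apply_zero s
    · refine Subtype.ext ?_
      change (_, [(_, _)], _) = (_, [(_, _)], _)
      congr 5
      ext s
      exact (H.apply_one s).trans (h'.trans h₁.symm)
    · exact fun t => ⟨rfl, rfl⟩
  refine e₁.trans (e₂.trans (e₃.trans (Quot.sound ⟨?_, rfl, Or.inl ?_⟩)))
  · change Γ.src (Γ.one (τ 0)) = Γ.src (Γ.one (ρ 1))
    rw [h']
  · have hst : Γ.src (Γ.one (ρ 1)) = Γ.tgt (Γ.one (τ 0)) := by rw [h₁, ht, h']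
    have := GEquiv.mul_last (Γ := Γ) [] (Γ.one (ρ 1)) (Γ.one (τ 0)) hst
    have e : Γ.mul (Γ.one (ρ 1)) (Γ.one (τ 0)) hst = Γ.one (ρ 1) := by
      have := Γ.mul_one (Γ.one (ρ 1)) (by rw [Γ.src_one, Γ.tgt_one])
      convert! this using 2
      rw [h₁, h']
    rw [e] at this
    exact this

theorem gPathUnit_invertible (ρ : C(I, M)) (h₁ : Γ.src (Γ.one (ρ 1)) = ρ 1) :
    (gPathPreCat Γ).Invertible (gArrowPath Γ (Γ.one (ρ 1)) ρ h₁) := by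
  let p : Path (ρ 0) (ρ 1) := ⟨ρ, rfl, rfl⟩
  have q1 : p.symm.toContinuousMap 1 = ρ 0 := p.symm.target
  have q0 : p.symm.toContinuousMap 0 = ρ 1 := p.symm.source
  have h₂ : Γ.src (Γ.one (p.symm.toContinuousMap 1)) = p.symm.toContinuousMap 1 := Γ.src_one _
  have H₁ : Path.Homotopy (Path.trans
      (⟨p.symm.toContinuousMap, rfl, rfl⟩ :
        Path (p.symm.toContinuousMap 0) (p.symm.toContinuousMap 1))
      (⟨ρ, q1.symm, q0.symm⟩ : Path (p.symm.toContinuousMap 1) (p.symm.toContinuousMap 0)))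
      (Path.refl (p.symm.toContinuousMap 0)) := by
    generalize hτ : p.symm.toContinuousMap = τ at *
    have hρ : ρ = (Path.symm (⟨τ, rfl, rfl⟩ : Path (τ 0) (τ 1))).toContinuousMap := by
      rw [← hτ]
      ext t
      change ρ t = ρ (unitInterval.symm (unitInterval.symm t))
      simp
    refine Path.Homotopy.cast ((Path.Homotopy.reflTransSymm (⟨τ, rfl, rfl⟩ : Path (τ 0) (τ 1))).symm)
      ?_ rfl
    congr 1
    ext t
    change _ = ρ t
    rw [hρ]; rfl
  have H₂ : Path.Homotopy (Path.trans
      (⟨ρ, rfl, rfl⟩ : Path (ρ 0) (ρ 1))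
      (⟨p.symm.toContinuousMap, q0, q1⟩ : Path (ρ 1) (ρ 0)))
      (Path.refl (ρ 0)) := by
    exact (Path.Homotopy.reflTransSymm p).symm
  refine ⟨gArrowPath Γ (Γ.one (p.symm.toContinuousMap 1)) p.symm.toContinuousMap h₂, ?_, ?_, ?_, ?_⟩
  · change Γ.src (Γ.one (ρ 0)) = Γ.tgt (Γ.one _)
    rw [Γ.src_one, Γ.tgt_one, q1]
  · change Γ.src (Γ.one _) = Γ.tgt (Γ.one _)
    rw [Γ.src_one, Γ.tgt_one, q0]
  · have := gPath_cancel Γ ρ p.symm.toContinuousMap q1 q0 H₁ h₁ h₂ (by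
      change Γ.src (Γ.one (ρ 0)) = Γ.tgt (Γ.one _)
      rw [Γ.src_one, Γ.tgt_one, q1])
    refine this.trans ?_
    have e : (gPathPreCat Γ).tgt (gArrowPath Γ (Γ.one (ρ 1)) ρ h₁) = ρ 1 := Γ.tgt_one _
    exact congrArg (fun x => Quot.mk (GRel Γ) ((gPathPreCat Γ).one x)) e.symm
  · have := gPath_cancel Γ p.symm.toContinuousMap ρ q0.symm q1.symm H₂ h₂ h₁ (by
      change Γ.src (Γ.one _) = Γ.tgt (Γ.one _)
      rw [Γ.src_one, Γ.tgt_one, q0])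
    refine this.trans ?_
    have e : (gPathPreCat Γ).src (gArrowPath Γ (Γ.one (ρ 1)) ρ h₁) = ρ 0 := Γ.src_one _
    exact congrArg (fun x => Quot.mk (GRel Γ) ((gPathPreCat Γ).one x)) (q1.trans e.symm)

theorem gPath_invertible (c : GPath Γ) : (gPathPreCat Γ).Invertible c := by
  obtain ⟨⟨x, L, g₀⟩, hc⟩ := c
  induction L generalizing x with
  | nil =>
    have hx : x = Γ.tgt g₀ := hc
    subst hx
    exact gArrow_invertible Γ g₀
  | cons c L ih =>
    obtain ⟨g, ρ⟩ := c
    have hx : Γ.tgt g = x := hc.1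
    have hg : Γ.src g = ρ 1 := hc.2.1
    have hL : IsGPath Γ (ρ 0) L (Γ.tgt g₀) := hc.2.2
    subst hx
    have hu : Γ.src (Γ.one (ρ 1)) = ρ 1 := Γ.src_one _
    have hgu : Γ.src g = Γ.tgt (Γ.one (ρ 1)) := by rw [hg, Γ.tgt_one]
    have hm : Γ.mul g (Γ.one (ρ 1)) hgu = g := by
      have := Γ.mul_one g (by rw [Γ.tgt_one])
      convert! this using 2
      rw [hg]
    -- first factor: `g` followed by the path
    have i₁ := PreCat.Invertible.mul (gArrow_invertible Γ g) (gPathUnit_invertible Γ ρ hu) hgu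
    have e₁ : Quot.mk (GRel Γ) ((gPathPreCat Γ).mul (gArrow Γ g)
        (gArrowPath Γ (Γ.one (ρ 1)) ρ hu) hgu) = Quot.mk (GRel Γ) (gArrowPath Γ g ρ hg) := by
      refine Quot.sound ⟨rfl, rfl, Or.inl ?_⟩
      have := GEquiv.mul (Γ := Γ) [] [] g (Γ.one (ρ 1)) ρ (Γ.one (ρ 0)) hgu
      rw [hm] at this
      exact this
    have i₂ := i₁.congr e₁
    have i₃ := PreCat.Invertible.mul i₂ (ih (ρ 0) hL) (Γ.src_one _)
    refine i₃.congr (Quot.sound ⟨rfl, rfl, Or.inl ?_⟩)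
    change GEquiv Γ ((g, ρ) :: (Γ.one (ρ 0), .const I (Γ.src (Γ.one (ρ 0)))) :: L, g₀)
      ((g, ρ) :: L, g₀)
    cases L with
    | nil =>
      have h0 : ρ 0 = Γ.tgt g₀ := hL
      have := GEquiv.mul_last (Γ := Γ) [(g, ρ)] (Γ.one (ρ 0)) g₀ (by rw [Γ.src_one, h0])
      have e : Γ.mul (Γ.one (ρ 0)) g₀ (by rw [Γ.src_one, h0]) = g₀ := by
        have := Γ.one_mul g₀ (Γ.src_one _)
        convert! this using 2
        rw [h0]
      rw [e] at this
      exact this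
    | cons c R =>
      obtain ⟨k, τ⟩ := c
      have h0 : Γ.tgt k = ρ 0 := hL.1
      have := GEquiv.mul (Γ := Γ) [(g, ρ)] R (Γ.one (ρ 0)) k τ g₀ (by rw [Γ.src_one, h0])
      have e : Γ.mul (Γ.one (ρ 0)) k (by rw [Γ.src_one, h0]) = k := by
        have := Γ.one_mul k (Γ.src_one _)
        convert! this using 2
        rw [h0]
      rw [e] at this
      exact this

/-- The arrows of the Haefliger fundamental groupoid: `G`-paths modulo the equivalence relation
generated by elementary equivalences and deformations, with the quotient topology. -/
def HaefligerArrow : Type (max u v) := Quot (GRel Γ)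

instance : TopologicalSpace (HaefligerArrow Γ) := inferInstanceAs (TopologicalSpace (Quot (GRel Γ)))

/-- The Haefliger fundamental groupoid of `G ⇉ M`, a groupoid over `M`. -/
def haefliger : InternalGroupoid (HaefligerArrow Γ) M :=
  (gPathPreCat Γ).toGroupoid (gPath_invertible Γ)

/-- The arrow represented by the `G`-path `g ρ`. -/
def haefligerMk (g : G) (ρ : C(I, M)) (h : Γ.src g = ρ 1) : HaefligerArrow Γ :=
  Quot.mk _ (gArrowPath Γ g ρ h)

end Haefliger


/-! ### Smooth structures -/

/-- A structure of smooth (finite-dimensional, real) manifold on a topological space. -/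
structure SmoothStr (X : Type u) [TopologicalSpace X] where
  dim : ℕ
  charts : ChartedSpace (EuclideanSpace ℝ (Fin dim)) X
  isManifold : IsManifold (𝓡 dim) ∞ X

namespace SmoothStr

variable {X : Type u} [TopologicalSpace X] {Y : Type v} [TopologicalSpace Y]

/-- The smooth structure of a manifold. -/
def of (X : Type u) [TopologicalSpace X] (d : ℕ) [c : ChartedSpace (EuclideanSpace ℝ (Fin d)) X]
    [h : IsManifold (𝓡 d) ∞ X] : SmoothStr X := ⟨d, c, h⟩

/-- `f` is a submersion. -/
def IsSubmersion (A : SmoothStr X) (B : SmoothStr Y) (f : X → Y) : Prop :=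
  letI := A.charts
  letI := B.charts
  Manifold.IsSubmersion (𝓡 A.dim) (𝓡 B.dim) ∞ f

/-- `f` is an embedding. -/
def IsEmbedding (A : SmoothStr X) (B : SmoothStr Y) (f : X → Y) : Prop :=
  letI := A.charts
  letI := B.charts
  Manifold.IsSmoothEmbedding (𝓡 A.dim) (𝓡 B.dim) ∞ f

/-- `f` is étale, i.e. a local diffeomorphism. -/
def IsEtale (A : SmoothStr X) (B : SmoothStr Y) (f : X → Y) : Prop :=
  letI := A.charts
  letI := B.charts
  IsLocalDiffeomorph (𝓡 A.dim) (𝓡 B.dim) ∞ f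

/-- `f : ℝⁿ → X` is smooth. -/
def IsPlot (A : SmoothStr X) {n : ℕ} (f : EuclideanSpace ℝ (Fin n) → X) : Prop :=
  letI := A.charts
  ContMDiff (𝓡 n) (𝓡 A.dim) ∞ f

/-- The smooth structure on `X` is the one for which a map into `X` is smooth if and only if its
composites with all the maps `g i : X → Y i` are smooth (this can be tested on maps `ℝⁿ → X`).
If `X` is a fiber product, and the `g i` are the projections, this says that `X` is a submanifold
of the product. It determines the smooth structure of `X`. -/
def InducedBy (A : SmoothStr X) {ι : Type*} {Y : ι → Type*} [∀ i, TopologicalSpace (Y i)]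
    (B : ∀ i, SmoothStr (Y i)) (g : ∀ i, X → Y i) : Prop :=
  ∀ (n : ℕ) (f : EuclideanSpace ℝ (Fin n) → X), A.IsPlot f ↔ ∀ i, (B i).IsPlot (g i ∘ f)

/-- The smooth structure on `Π₁(X)` is the one for which the end point map `Π₁(X) → X × X` is
étale. It is determined by this condition. -/
def IsPathStr (P : SmoothStr (PathClass X)) (A : SmoothStr X) : Prop :=
  letI := A.charts
  letI := P.charts
  IsLocalDiffeomorph (𝓡 P.dim) ((𝓡 A.dim).prod (𝓡 A.dim)) ∞
    (fun γ : PathClass X => (γ.tgt, γ.src))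

end SmoothStr

/-! ### Lie groupoids -/

/-- A groupoid on manifolds `G` and `M` is a Lie groupoid: the source and the target are
submersions and the structure maps are smooth. Smoothness of the multiplication on the submanifold
of composable pairs is expressed with smooth families of composable pairs over `ℝⁿ`. -/
structure InternalGroupoid.IsLie {G : Type u} {M : Type v} [TopologicalSpace G]
    [TopologicalSpace M] (Γ : InternalGroupoid G M) (d m : ℕ)
    [ChartedSpace (EuclideanSpace ℝ (Fin d)) G] [ChartedSpace (EuclideanSpace ℝ (Fin m)) M] :
    Prop where
  submersion_src : Manifold.IsSubmersion (𝓡 d) (𝓡 m) ∞ Γ.src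
  submersion_tgt : Manifold.IsSubmersion (𝓡 d) (𝓡 m) ∞ Γ.tgt
  smooth_one : ContMDiff (𝓡 m) (𝓡 d) ∞ Γ.one
  smooth_inv : ContMDiff (𝓡 d) (𝓡 d) ∞ Γ.inv
  smooth_mul : ∀ (n : ℕ) (f g : EuclideanSpace ℝ (Fin n) → G) (h : ∀ x, Γ.src (f x) = Γ.tgt (g x)),
    ContMDiff (𝓡 n) (𝓡 d) ∞ f → ContMDiff (𝓡 n) (𝓡 d) ∞ g →
      ContMDiff (𝓡 n) (𝓡 d) ∞ fun x => Γ.mul (f x) (g x) (h x)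

/-- The source map of a Lie groupoid as a continuous map. -/
def InternalGroupoid.IsLie.srcC {G : Type u} {M : Type v} [TopologicalSpace G]
    [TopologicalSpace M] {Γ : InternalGroupoid G M} {d m : ℕ}
    [ChartedSpace (EuclideanSpace ℝ (Fin d)) G] [ChartedSpace (EuclideanSpace ℝ (Fin m)) M]
    [IsManifold (𝓡 d) ∞ G] [IsManifold (𝓡 m) ∞ M] (h : Γ.IsLie d m) : C(G, M) :=
  ⟨Γ.src, h.submersion_src.contMDiff.continuous⟩

/-- The target map of a Lie groupoid as a continuous map. -/
def InternalGroupoid.IsLie.tgtC {G : Type u} {M : Type v} [TopologicalSpace G]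
    [TopologicalSpace M] {Γ : InternalGroupoid G M} {d m : ℕ}
    [ChartedSpace (EuclideanSpace ℝ (Fin d)) G] [ChartedSpace (EuclideanSpace ℝ (Fin m)) M]
    [IsManifold (𝓡 d) ∞ G] [IsManifold (𝓡 m) ∞ M] (h : Γ.IsLie d m) : C(G, M) :=
  ⟨Γ.tgt, h.submersion_tgt.contMDiff.continuous⟩

theorem InternalGroupoid.IsLie.srcC_apply {G : Type u} {M : Type v} [TopologicalSpace G]
    [TopologicalSpace M] {Γ : InternalGroupoid G M} {d m : ℕ}
    [ChartedSpace (EuclideanSpace ℝ (Fin d)) G] [ChartedSpace (EuclideanSpace ℝ (Fin m)) M]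
    [IsManifold (𝓡 d) ∞ G] [IsManifold (𝓡 m) ∞ M] (h : Γ.IsLie d m) (g : G) :
    h.srcC g = Γ.src g := rfl

theorem InternalGroupoid.IsLie.tgtC_apply {G : Type u} {M : Type v} [TopologicalSpace G]
    [TopologicalSpace M] {Γ : InternalGroupoid G M} {d m : ℕ}
    [ChartedSpace (EuclideanSpace ℝ (Fin d)) G] [ChartedSpace (EuclideanSpace ℝ (Fin m)) M]
    [IsManifold (𝓡 d) ∞ G] [IsManifold (𝓡 m) ∞ M] (h : Γ.IsLie d m) (g : G) :
    h.tgtC g = Γ.tgt g := rfl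

/-- A Serre fibration: homotopies of cubes can be lifted. -/
def IsSerreFibration {E : Type u} {B : Type v} [TopologicalSpace E] [TopologicalSpace B]
    (p : E → B) : Prop :=
  Continuous p ∧ ∀ (n : ℕ) (f : C(Fin n → I, E)) (H : C((Fin n → I) × I, B)),
    (∀ x, H (x, 0) = p (f x)) →
      ∃ K : C((Fin n → I) × I, E), (∀ x, K (x, 0) = f x) ∧ ∀ z, p (K z) = H z

/-! ### Simplicial manifolds and (local) Lie `n`-groupoids -/

namespace SimplicialSpace

variable (X : SimplicialSpace.{u}) (A : ∀ n, SmoothStr (X.obj n))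

/-- A simplicial manifold: the face maps are surjective submersions and the degeneracy maps are
embeddings. -/
structure IsManifold : Prop where
  submersion_face : ∀ n i hi, (A (n + 1)).IsSubmersion (A n) (X.face n i hi)
  surjective_face : ∀ n i hi, Function.Surjective (X.face n i hi)
  embedding_degen : ∀ n i hi, (A n).IsEmbedding (A (n + 1)) (X.degen n i hi)

/-- The positions of the faces in an `(n+1,k)`-horn. -/
abbrev HornIdx (n k : ℕ) := {i : ℕ // i ≤ n + 1 ∧ i ≠ k}

/-- The horn compatibility equations `f_i x_j = f_{j-1} x_i` for `i < j`. -/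
def HornCompat : (n k : ℕ) → (HornIdx n k → X.obj n) → Prop
  | 0, _, _ => True
  | n + 1, k, x => ∀ i j : HornIdx (n + 1) k, (hij : i.1 < j.1) →
      X.face n i.1 (by have := j.2.1; omega) (x j) =
        X.face n (j.1 - 1) (by have := j.2.1; omega) (x i)

/-- The space of `(n+1,k)`-horns. -/
def Horn (n k : ℕ) : Type u := {x : HornIdx n k → X.obj n // X.HornCompat n k x}

instance (n k : ℕ) : TopologicalSpace (X.Horn n k) :=
  inferInstanceAs (TopologicalSpace {x : HornIdx n k → X.obj n // X.HornCompat n k x})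

/-- The horn map `X_{n+1} → Λ_{n+1,k} X`. -/
def hornMap (n k : ℕ) (x : X.obj (n + 1)) : X.Horn n k :=
  ⟨fun i => X.face n i.1 i.2.1 x, by
    cases n with
    | zero => trivial
    | succ n =>
      intro i j hij
      exact X.laws.d_d n i.1 j.1 hij j.2.1 x⟩

/-- A simplicial manifold with smooth horn spaces, such that the horn maps on `X_q` are submersions
for all `q ≥ 1` and étale for all `q > n`. -/
structure IsEtaleLie (n : ℕ) : Prop where
  manifold : X.IsManifold A
  horn : ∀ q k, k ≤ q + 1 → ∃ B : SmoothStr (X.Horn q k),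
    B.InducedBy (fun _ => A q) (fun i x => x.1 i) ∧
    (A (q + 1)).IsSubmersion B (X.hornMap q k) ∧
    (n < q + 1 → (A (q + 1)).IsEtale B (X.hornMap q k))

/-- A local Lie `n`-groupoid: the horn maps on `X_q` are submersions for all `q ≥ 1`, and injective
étale for all `q > n`. -/
structure IsLocalLie (n : ℕ) : Prop where
  etale : X.IsEtaleLie A n
  injective : ∀ q k, k ≤ q + 1 → n < q + 1 → Function.Injective (X.hornMap q k)

/-- A Lie `n`-groupoid: the horn maps on `X_q` are surjective submersions for all `q ≥ 1`, and
diffeomorphisms (i.e. bijective étale) for all `q > n`. -/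
structure IsLie (n : ℕ) : Prop where
  etale : X.IsEtaleLie A n
  surjective : ∀ q k, k ≤ q + 1 → Function.Surjective (X.hornMap q k)
  injective : ∀ q k, k ≤ q + 1 → n < q + 1 → Function.Injective (X.hornMap q k)

end SimplicialSpace

/-- A bisimplicial manifold. -/
structure BisimplicialSpace.IsManifold (X : BisimplicialSpace.{u})
    (A : ∀ p q, SmoothStr (X.obj p q)) : Prop where
  horizontal : ∀ q, (X.horizontal q).IsManifold fun p => A p q
  vertical : ∀ p, (X.vertical p).IsManifold fun q => A p q

/-! ### The double nerve of the fundamental double groupoid -/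

section Fundamental

variable {G : Type u} {M : Type v} [TopologicalSpace G] [TopologicalSpace M]
  (Γ : InternalGroupoid G M)

/-- The double nerve `N_{p,q} = N_p Π₁(G^{(q)})`. -/
abbrev doubleNerve : BisimplicialSpace.{max u v} := pi1Nerve (nerve Γ)

/-- The standard smooth structures on `G^{(q)}` and `N_{p,q}` (as submanifolds of products), on
`Π₁(G^{(q)})` (étale over `G^{(q)} × G^{(q)}`), and on the bar construction (as a submanifold of a
product). Each of them is determined by the smooth structure of `G`. -/
structure FundamentalSmoothStr (A : SmoothStr G) where
  X : ∀ q, SmoothStr (Nerve Γ q)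
  P : ∀ q, SmoothStr (PathClass (Nerve Γ q))
  N : ∀ p q, SmoothStr ((doubleNerve Γ).obj p q)
  W : ∀ r, SmoothStr ((bar (doubleNerve Γ)).obj r)
  induced_X : ∀ q, (X q).InducedBy (ι := Fin (q + 1) × Fin (q + 1)) (fun _ => A)
    (fun a x => x.arr a.1 a.2)
  path_P : ∀ q, (P q).IsPathStr (X q)
  induced_N : ∀ p q, (N p q).InducedBy (ι := Fin (p + 1) × Fin (p + 1)) (fun _ => P q)
    (fun a (x : Nerve (Pi1 (Nerve Γ q)) p) => x.arr a.1 a.2)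
  induced_W : ∀ r, (W r).InducedBy (ι := AntiDiag r) (fun a => N a.1.1 a.1.2)
    (fun a (x : Bar (doubleNerve Γ) r) => x.at' a.1.1 a.1.2 a.2)

/-- The identification `W̄_0 = N_{0,0} = M`. -/
def baseMap (x : (bar (doubleNerve Γ)).obj 0) : M :=
  let y : Nerve (Pi1 (Nerve Γ 0)) 0 := Bar.at' x 0 0 rfl
  (y.obj 0).obj 0

/-- The component `g` of an element `(g, η)` of `W̄_1 = G ×_{s,t} Π₁(M)`. -/
def arrowPart (x : (bar (doubleNerve Γ)).obj 1) : G :=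
  let y : Nerve (Pi1 (Nerve Γ 1)) 0 := Bar.at' x 0 1 rfl
  (y.obj 0).arr 0 1

/-- The identification `G^{(0)} = M`. -/
def vertexC : C(Nerve Γ 0, M) :=
  ⟨fun y => y.obj 0, (continuous_apply 0).comp (Nerve.continuous_obj 0)⟩

/-- The component `η` of an element `(g, η)` of `W̄_1 = G ×_{s,t} Π₁(M)`. -/
def pathPart (x : (bar (doubleNerve Γ)).obj 1) : PathClass M :=
  let y : Nerve (Pi1 (Nerve Γ 0)) 1 := Bar.at' x 1 0 rfl
  PathClass.map (vertexC Γ) (y.arr 0 1)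

theorem src_arrowPart (x : (bar (doubleNerve Γ)).obj 1) :
    Γ.src (arrowPart Γ x) = (pathPart Γ x).tgt := by
  have h := Bar.compat x 0 0 rfl rfl
  have h' := congrArg (fun y : Nerve (Pi1 (Nerve Γ 0)) 0 => (y.obj 0).obj 0) h
  let y : Nerve (Pi1 (Nerve Γ 1)) 0 := Bar.at' x 0 1 rfl
  let z : Nerve (Pi1 (Nerve Γ 0)) 1 := Bar.at' x 1 0 rfl
  have e₁ : Γ.src ((y.obj 0).arr 0 1) = (y.obj 0).obj 1 := (y.obj 0).src_arr 0 1
  have e₂ : (z.arr 0 1).tgt = z.obj 0 := z.tgt_arr 0 1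
  change Γ.src ((y.obj 0).arr 0 1) = (z.arr 0 1).tgt.obj 0
  rw [e₁, e₂]
  exact h'

/-! ### The quotient of `G ×_{s,t} Π₁(M)` -/

/-- The space `G ×_{s,t} Π₁(M)`. -/
abbrev ArrowPath := {x : G × PathClass M // Γ.src x.1 = x.2.tgt}

variable (s t : C(G, M)) (hs : ∀ g, s g = Γ.src g) (ht : ∀ g, t g = Γ.tgt g)

/-- The pair `(θ · α(1), s_* α · η)`, where `α ∈ Π₁(G)`. -/
def fullPair (θ : G) (α : PathClass G) (η : PathClass M) (h₁ : Γ.src θ = Γ.tgt α.tgt)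
    (h₂ : Γ.src α.src = η.tgt) : ArrowPath Γ :=
  ⟨(Γ.mul θ α.tgt h₁, PathClass.mul (PathClass.map s α) η ((hs _).trans h₂)),
    (Γ.src_mul _ _ _).trans (hs _).symm⟩

/-- The relation `(θ · α(1), s_* α · η) ∼ (θ · α'(1), s_* α' · η)` for `α, α' ∈ Π₁(G)` such that
`t_* α = t_* α'` and `α(0) = α'(0)`. -/
inductive FullRel : ArrowPath Γ → ArrowPath Γ → Prop
  | intro (θ : G) (α α' : PathClass G) (η : PathClass M) (h₁ h₂ h₁' h₂')
      (e : PathClass.map t α = PathClass.map t α') (e' : α.src = α'.src) :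
      FullRel (fullPair Γ s hs θ α η h₁ h₂) (fullPair Γ s hs θ α' η h₁' h₂')

/-- The space `(G ×_{s,t} Π₁(M))/∼`. -/
def FullQuot : Type (max u v) := Quot (FullRel Γ s t hs)

instance : TopologicalSpace (FullQuot Γ s t hs) :=
  inferInstanceAs (TopologicalSpace (Quot (FullRel Γ s t hs)))

/-- The class of `(θ, η)`. -/
def fullMk (θ : G) (η : PathClass M) (h : Γ.src θ = η.tgt) : FullQuot Γ s t hs :=
  Quot.mk _ ⟨(θ, η), h⟩

/-- The groupoid structure on `(G ×_{s,t} Π₁(M))/∼ ⇉ M`, in which the source of `[θ, η]` is the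
source of `η`, the target is the target of `θ`, and
`[θ, t_* α] · [α(0), η] = [θ · α(1), s_* α · η]` for `α ∈ Π₁(G)`. -/
structure IsFullGroupoid (Q : InternalGroupoid (FullQuot Γ s t hs) M) : Prop where
  src_mk : ∀ θ η h, Q.src (fullMk Γ s t hs θ η h) = η.src
  tgt_mk : ∀ θ η h, Q.tgt (fullMk Γ s t hs θ η h) = Γ.tgt θ
  one_eq : ∀ x, Q.one x = fullMk Γ s t hs (Γ.one x) ((Pi1 M).one x) (Γ.src_one x)
  mul_mk : ∀ (θ : G) (α : PathClass G) (η : PathClass M) (h₁ : Γ.src θ = Γ.tgt α.tgt)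
    (h₂ : Γ.src α.src = η.tgt) (h : Q.src (fullMk Γ s t hs θ (PathClass.map t α)
      (h₁.trans (ht _).symm)) = Q.tgt (fullMk Γ s t hs α.src η h₂)),
    Q.mul (fullMk Γ s t hs θ (PathClass.map t α) (h₁.trans (ht _).symm))
      (fullMk Γ s t hs α.src η h₂) h = Quot.mk _ (fullPair Γ s hs θ α η h₁ h₂)

end Fundamental

end

end DoubleGpd

open scoped Manifold ContDiff

/-!
Write `Γ` for the Lie groupoid `G ⇉ M`.

**Smooth structures.** Smoothness is tested on plots, i.e. smooth maps from Euclidean spaces, which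
determine an atlas (`SmoothStr.isChart_iff`). A smooth map is a submersion if and only if it has
smooth local sections (`isSubmersion_of_hasLocalSections`); fiber products along submersions exist
(`exists_fiberProduct`), and smooth structures pull back along local homeomorphisms (`IsLift`).

**The double nerve and its bar construction.** An arrow of `Π₁(X)` has exactly one neighbor with
given end points near its own, obtained by composing it with short paths (`isEtaleVia_pi1`). Hence
`N_{p,q}` is étale over the product of `p + 1` copies of `G^{(q)}`, by its vertices. In an element
`(x_0, …, x_r)` of `W̄_r N`, all vertices are faces of the last vertices of the `x_p`, so that
`W̄_r N` is étale over the product of the `G^{(q)}`, `q ≤ r` (`isLocalHomeomorph_lastVertices`).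
Therefore whether faces and horn maps are submersions or étale is decided on vertices, where it is
a computation with nerves. This gives the bisimplicial manifold and the two étale statements
(`isManifold_horizontal`, `isEtaleLie_vertical`, `BarStr.isEtaleLie`).

If `Π₁(N_• G)` is local Lie of order one, a path class in `G^{(q)}` is determined by the faces in a
horn (`UniquePathFillers`). An element of `N_{p,q}` is a sequence of path classes, and one of
`W̄_r N` is an iterated cone of path classes, so that their horns have at most one filler, too. If
the source map is a Serre fibration, homotopies in `M` lift to `G`, so that the path classes of the
arrows at one vertex of a horn are represented by paths over the same path in `M`, which assemble
pointwise to a path of simplices; this provides the fillers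
(`UniquePathFillers.exists_filler`, `UniquePathFillers.surjective_bar`).

**The Haefliger groupoid** is generated by the arrows of `Γ` and the path classes of `M`, and an
arrow slides along a path of arrows (`hPath_comp_hArr`). Conversely, arrows and path classes that
act on a set compatibly with this sliding (`LeftAction`) yield an action of the Haefliger groupoid:
along a deformation the action of the `G`-path is locally constant
(`LeftAction.eval_eq_of_deformation`). Applied to the action on itself, the same local computation
shows that the Haefliger groupoid is étale over `M × M` (`isEtaleVia_haefliger`), hence a topological groupoid.

**The two isomorphisms.** A `2`-simplex of `W̄ N` amounts to an arrow `θ`, a path class `γ` of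
arrows and a path class `η` of `M`; its relation in `𝔊(W̄ N)` says that `γ` slides, which holds in the
Haefliger groupoid. This is the homomorphism `genToHaefliger`. It is a bijection since the same
relations let the Haefliger groupoid act on `𝔊(W̄ N)` (`genAction`). Its inverse is continuous since
near an arrow the Haefliger groupoid is parametrized by short paths, and words vary continuously
with these (`continuousAt_conj_genPath`).

If the source map is a Serre fibration, a path class acts on the quotient of `G ×_{s,t} Π₁(M)` by
moving a lift of it across the arrow (`exists_fullPath`); the relation `~` says that the choice of
the lift is irrelevant. Again the resulting action (`fullAction`) makes the map to the Haefliger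
groupoid bijective, and that map is open since both sides are étale up to the open map `t`
(`isOpenMap_fullToHaefliger`). The groupoid structure of the quotient is the transported one.
-/

namespace DoubleGpd

noncomputable section

/-! ### Plots -/

/-- The Euclidean space that parametrizes plots. -/
abbrev Euc (n : ℕ) := EuclideanSpace ℝ (Fin n)

section Plots

variable {F H N : Type*} [NormedAddCommGroup F] [NormedSpace ℝ F] [FiniteDimensional ℝ F]
  [TopologicalSpace H] {K : ModelWithCorners ℝ F H} [K.Boundaryless]
  [TopologicalSpace N] [ChartedSpace H N] [IsManifold K ∞ N]

/-- Around each point of an open set `U` there is a smooth parametrization of a neighborhood by a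
whole Euclidean space. -/
theorem exists_plot_near {U : Set N} (hU : IsOpen U) {x : N} (hx : x ∈ U) :
    ∃ (n : ℕ) (p : Euc n → N) (q : N → Euc n), ContMDiff (𝓡 n) K ∞ p ∧ (∀ t, p t ∈ U) ∧
      ContMDiffAt K (𝓡 n) ∞ q x ∧ p (q x) = x ∧ (∀ᶠ y in 𝓝 x, p (q y) = y) := by
  let e : Euc (Module.finrank ℝ F) ≃L[ℝ] F :=
    ContinuousLinearEquiv.ofFinrankEq (by simp)
  let φ := extChartAt K x
  have hO : IsOpen (φ.target ∩ φ.symm ⁻¹' U) :=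
    (continuousOn_extChartAt_symm x).isOpen_inter_preimage (isOpen_extChartAt_target x) hU
  have hO' : IsOpen (e ⁻¹' (φ.target ∩ φ.symm ⁻¹' U)) := hO.preimage e.continuous
  have hc : e.symm (φ x) ∈ e ⁻¹' (φ.target ∩ φ.symm ⁻¹' U) := by
    refine ⟨?_, ?_⟩
    · simp [φ]
    · simp [φ, hx]
  obtain ⟨r, hr, hball⟩ := Metric.isOpen_iff.1 hO' _ hc
  let b := OpenPartialHomeomorph.univBall (e.symm (φ x)) r
  have hb : ∀ t, b t ∈ e ⁻¹' (φ.target ∩ φ.symm ⁻¹' U) := fun t => hball <| by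
    have := b.map_source (x := t) (by simp [b])
    rwa [OpenPartialHomeomorph.univBall_target _ hr] at this
  refine ⟨_, φ.symm ∘ e ∘ b, b.symm ∘ e.symm ∘ φ, ?_, fun t => (hb t).2, ?_, ?_, ?_⟩
  · have h1 : ContMDiff (𝓡 (Module.finrank ℝ F)) 𝓘(ℝ, F) ∞ (e ∘ b) :=
      (e.contDiff.comp OpenPartialHomeomorph.contDiff_univBall).contMDiff
    exact (contMDiffOn_extChartAt_symm (n := ∞) x).comp_contMDiff h1 fun t => (hb t).1
  · have h1 : ContMDiffAt K 𝓘(ℝ, F) ∞ φ x := contMDiffAt_extChartAt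
    have h2 : ContMDiffAt 𝓘(ℝ, F) (𝓡 (Module.finrank ℝ F)) ∞ e.symm (φ x) :=
      e.symm.contDiff.contMDiff.contMDiffAt
    have h3 : ContMDiffAt (𝓡 (Module.finrank ℝ F)) (𝓡 (Module.finrank ℝ F)) ∞ b.symm
        (e.symm (φ x)) := by
      refine ContDiffAt.contMDiffAt ?_
      exact OpenPartialHomeomorph.contDiffOn_univBall_symm.contDiffAt
        (Metric.ball_mem_nhds _ hr)
    exact h3.comp x (h2.comp x h1)
  · have : b (b.symm (e.symm (φ x))) = e.symm (φ x) := b.right_inv (by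
      rw [OpenPartialHomeomorph.univBall_target _ hr]; exact Metric.mem_ball_self hr)
    change φ.symm (e (b (b.symm (e.symm (φ x))))) = x
    rw [this, e.apply_symm_apply]
    exact extChartAt_to_inv x
  · have h1 : ContinuousAt (e.symm ∘ φ) x :=
      e.symm.continuous.continuousAt.comp (continuousAt_extChartAt x)
    filter_upwards [h1.preimage_mem_nhds (Metric.ball_mem_nhds _ hr),
      (isOpen_extChartAt_source x : IsOpen (extChartAt K x).source).mem_nhds (mem_extChartAt_source x)] with y hy hy'
    have : b (b.symm (e.symm (φ y))) = e.symm (φ y) := b.right_inv (by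
      rw [OpenPartialHomeomorph.univBall_target _ hr]; exact hy)
    change φ.symm (e (b (b.symm (e.symm (φ y))))) = y
    rw [this, e.apply_symm_apply]
    exact φ.left_inv hy'

/-- A map on an open set that takes plots to plots is smooth. -/
theorem contMDiffOn_of_plots {F' H' N' : Type*} [NormedAddCommGroup F'] [NormedSpace ℝ F']
    [TopologicalSpace H'] {J : ModelWithCorners ℝ F' H'} [TopologicalSpace N']
    [ChartedSpace H' N'] {U : Set N} (hU : IsOpen U) {f : N → N'}
    (hf : ∀ n (p : Euc n → N), ContMDiff (𝓡 n) K ∞ p → (∀ t, p t ∈ U) →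
      ContMDiff (𝓡 n) J ∞ (f ∘ p)) : ContMDiffOn K J ∞ f U := by
  intro x hx
  obtain ⟨n, p, q, hp, hpU, hq, hpq, hev⟩ := exists_plot_near (K := K) hU hx
  refine ContMDiffAt.contMDiffWithinAt ?_
  have h : ContMDiffAt K J ∞ ((f ∘ p) ∘ q) x := (hf n p hp hpU).contMDiffAt.comp x hq
  refine h.congr_of_eventuallyEq ?_
  filter_upwards [hev] with y hy
  simp [hy]

end Plots

/-- The ball parametrized by the whole Euclidean space. -/
def ballPlot {n : ℕ} (t : Euc n) (r : ℝ) : Euc n → Euc n := OpenPartialHomeomorph.univBall t r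

theorem contDiff_ballPlot {n : ℕ} (t : Euc n) (r : ℝ) : ContDiff ℝ ∞ (ballPlot t r) :=
  OpenPartialHomeomorph.contDiff_univBall

theorem ballPlot_mem {n : ℕ} (t : Euc n) {r : ℝ} (hr : 0 < r) (s : Euc n) :
    ballPlot t r s ∈ Metric.ball t r := by
  have := (OpenPartialHomeomorph.univBall t r).map_source (x := s) (by simp)
  rwa [OpenPartialHomeomorph.univBall_target _ hr] at this

/-- A class of maps from Euclidean spaces to `X` that is stable under smooth reparametrization
and local. -/
structure IsPlotClass {X : Type u} [TopologicalSpace X] (P : ∀ n, (Euc n → X) → Prop) : Prop where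
  continuous : ∀ n p, P n p → Continuous p
  comp : ∀ n k (p : Euc n → X) (q : Euc k → Euc n), P n p → ContDiff ℝ ∞ q → P k (p ∘ q)
  loc : ∀ n (p : Euc n → X), (∀ t, ∃ r > 0, P n (p ∘ ballPlot t r)) → P n p

/-- Smoothness of a map from a Euclidean space can be tested on balls. -/
theorem contMDiff_of_ballPlot {F' H' N' : Type*} [NormedAddCommGroup F'] [NormedSpace ℝ F']
    [TopologicalSpace H'] {J : ModelWithCorners ℝ F' H'} [TopologicalSpace N']
    [ChartedSpace H' N'] {n : ℕ} {p : Euc n → N'}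
    (h : ∀ t, ∃ r > 0, ContMDiff (𝓡 n) J ∞ (p ∘ ballPlot t r)) : ContMDiff (𝓡 n) J ∞ p := by
  intro t
  obtain ⟨r, hr, hp⟩ := h t
  let b := OpenPartialHomeomorph.univBall t r
  have h3 : ContMDiffAt (𝓡 n) (𝓡 n) ∞ b.symm t := by
    refine ContDiffAt.contMDiffAt ?_
    exact OpenPartialHomeomorph.contDiffOn_univBall_symm.contDiffAt (Metric.ball_mem_nhds _ hr)
  have h4 : ContMDiffAt (𝓡 n) J ∞ ((p ∘ ballPlot t r) ∘ b.symm) t := hp.contMDiffAt.comp t h3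
  refine h4.congr_of_eventuallyEq ?_
  filter_upwards [Metric.ball_mem_nhds t hr] with y hy
  have : ballPlot t r (b.symm y) = y := b.right_inv (by
    rw [OpenPartialHomeomorph.univBall_target _ hr]; exact hy)
  simp [this]

theorem exists_ballPlot_mem {X : Type*} [TopologicalSpace X] {n : ℕ} {p : Euc n → X}
    (hp : Continuous p) {U : Set X} (hU : IsOpen U) {t : Euc n} (ht : p t ∈ U) :
    ∃ r > 0, ∀ s, p (ballPlot t r s) ∈ U := by
  obtain ⟨r, hr, h⟩ := Metric.isOpen_iff.1 (hU.preimage hp) t ht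
  exact ⟨r, hr, fun s => h (ballPlot_mem t hr s)⟩

namespace SmoothStr

variable {X : Type u} [TopologicalSpace X] {Y : Type v} [TopologicalSpace Y]
  {Z : Type w} [TopologicalSpace Z]

theorem isPlotClass (A : SmoothStr X) : IsPlotClass (fun _ p => A.IsPlot p) where
  continuous n p hp := by
    let _ := A.charts
    exact ContMDiff.continuous hp
  comp n k p q hp hq := by
    let _ := A.charts
    exact ContMDiff.comp hp hq.contMDiff
  loc n p h := by
    let _ := A.charts
    exact contMDiff_of_ballPlot h

variable {A : SmoothStr X} {B : SmoothStr Y}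

theorem IsPlot.continuous {n : ℕ} {p : Euc n → X} (h : A.IsPlot p) : Continuous p :=
  A.isPlotClass.continuous n p h

theorem IsPlot.comp {n k : ℕ} {p : Euc n → X} (h : A.IsPlot p) {q : Euc k → Euc n}
    (hq : ContDiff ℝ ∞ q) : A.IsPlot (p ∘ q) := A.isPlotClass.comp n k p q h hq

theorem isPlot_const {n : ℕ} (x : X) : A.IsPlot (fun _ : Euc n => x) := by
  let _ := A.charts
  exact contMDiff_const

/-- A map that takes plots to plots. -/
def PlotSmooth (A : SmoothStr X) (B : SmoothStr Y) (f : X → Y) : Prop :=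
  ∀ n (p : Euc n → X), A.IsPlot p → B.IsPlot (f ∘ p)

theorem plotSmooth_iff {f : X → Y} : A.PlotSmooth B f ↔
    let _ := A.charts
    let _ := B.charts
    ContMDiff (𝓡 A.dim) (𝓡 B.dim) ∞ f := by
  let _ := A.charts
  let _ := B.charts
  have _ := A.isManifold
  constructor
  · intro h
    rw [← contMDiffOn_univ]
    exact contMDiffOn_of_plots isOpen_univ fun n p hp _ => h n p hp
  · intro h n p hp
    exact ContMDiff.comp h hp

theorem PlotSmooth.continuous {f : X → Y} (h : A.PlotSmooth B f) : Continuous f := by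
  let _ := A.charts
  let _ := B.charts
  exact (plotSmooth_iff.1 h).continuous

theorem IsSubmersion.plotSmooth {f : X → Y} (h : A.IsSubmersion B f) : A.PlotSmooth B f := by
  let _ := A.charts
  let _ := B.charts
  have _ := A.isManifold
  have _ := B.isManifold
  exact plotSmooth_iff.2 (Manifold.IsSubmersion.contMDiff h)

/-- A topological space with charts that are compatible with a class of plots is a manifold, whose
plots are the given ones. -/
theorem exists_of_charts {P : ∀ n, (Euc n → X) → Prop} (hP : IsPlotClass P) (k : ℕ)
    (κ : X → OpenPartialHomeomorph X (Euc k)) (hκ : ∀ x, x ∈ (κ x).source)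
    (h₁ : ∀ x n (p : Euc n → Euc k), ContDiff ℝ ∞ p → (∀ t, p t ∈ (κ x).target) →
      P n ((κ x).symm ∘ p))
    (h₂ : ∀ x n (p : Euc n → X), P n p → (∀ t, p t ∈ (κ x).source) → ContDiff ℝ ∞ (κ x ∘ p)) :
    ∃ A : SmoothStr X, A.dim = k ∧ ∀ n p, A.IsPlot p ↔ P n p := by
  let c : ChartedSpace (Euc k) X :=
    { atlas := Set.range κ
      chartAt := κ
      mem_chart_source := hκ
      chart_mem_atlas := fun x => ⟨x, rfl⟩ }
  have hm : IsManifold (𝓡 k) ∞ X := by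
    refine isManifold_of_contDiffOn _ _ _ ?_
    rintro _ _ ⟨x, rfl⟩ ⟨y, rfl⟩
    simp only [modelWithCornersSelf_coe, modelWithCornersSelf_coe_symm, Function.comp_id,
      Function.id_comp, Set.preimage_id, Set.range_id, Set.inter_univ]
    rw [← contMDiffOn_iff_contDiffOn]
    refine contMDiffOn_of_plots ((κ x).symm.trans (κ y)).open_source fun n p hp hpU => ?_
    have hp' : ContDiff ℝ ∞ p := contMDiff_iff_contDiff.1 hp
    have hs : ∀ t, p t ∈ (κ x).target ∧ (κ x).symm (p t) ∈ (κ y).source := fun t => by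
      simpa using hpU t
    have := h₂ y n ((κ x).symm ∘ p) (h₁ x n p hp' fun t => (hs t).1) fun t => (hs t).2
    exact contMDiff_iff_contDiff.2 this
  refine ⟨⟨k, c, hm⟩, rfl, fun n p => ?_⟩
  have key : ∀ x : X, ContMDiffOn (𝓡 k) (𝓡 k) ∞ (κ x) (κ x).source := fun x =>
    contMDiffOn_chart (x := x)
  have key' : ∀ x : X, ContMDiffOn (𝓡 k) (𝓡 k) ∞ (κ x).symm (κ x).target := fun x =>
    contMDiffOn_chart_symm (x := x)
  constructor
  · intro hp
    have hp' : ContMDiff (𝓡 n) (𝓡 k) ∞ p := hp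
    refine hP.loc n p fun t => ?_
    obtain ⟨r, hr, hs⟩ := exists_ballPlot_mem hp'.continuous (κ (p t)).open_source (hκ (p t))
    refine ⟨r, hr, ?_⟩
    have h3 : ContMDiff (𝓡 n) (𝓡 k) ∞ (κ (p t) ∘ (p ∘ ballPlot t r)) :=
      (key (p t)).comp_contMDiff (hp'.comp (contDiff_ballPlot t r).contMDiff) hs
    have := h₁ (p t) n _ (contMDiff_iff_contDiff.1 h3) fun s => (κ (p t)).map_source (hs s)
    refine Eq.mp ?_ this
    congr 1
    funext s
    exact (κ (p t)).left_inv (hs s)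
  · intro hp
    have : ContMDiff (𝓡 n) (𝓡 k) ∞ p := by
      refine contMDiff_of_ballPlot fun t => ?_
      obtain ⟨r, hr, hs⟩ := exists_ballPlot_mem (hP.continuous n p hp) (κ (p t)).open_source
        (hκ (p t))
      refine ⟨r, hr, ?_⟩
      have h3 := h₂ (p t) n (p ∘ ballPlot t r) (hP.comp n n p _ hp (contDiff_ballPlot t r)) hs
      have h4 : ContMDiff (𝓡 n) (𝓡 k) ∞ ((κ (p t)).symm ∘ (κ (p t) ∘ (p ∘ ballPlot t r))) :=
        (key' (p t)).comp_contMDiff h3.contMDiff fun s => (κ (p t)).map_source (hs s)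
      refine h4.congr fun s => ?_
      exact ((κ (p t)).left_inv (hs s)).symm
    exact this

/-- The chart at a point takes plots to plots. -/
theorem exists_chart (A : SmoothStr X) (x : X) : ∃ κ : OpenPartialHomeomorph X (Euc A.dim),
    x ∈ κ.source ∧
    (∀ n (p : Euc n → Euc A.dim), ContDiff ℝ ∞ p → (∀ t, p t ∈ κ.target) →
      A.IsPlot (κ.symm ∘ p)) ∧
    (∀ n (p : Euc n → X), A.IsPlot p → (∀ t, p t ∈ κ.source) → ContDiff ℝ ∞ (κ ∘ p)) := by
  let _ := A.charts
  have _ := A.isManifold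
  refine ⟨chartAt (Euc A.dim) x, mem_chart_source _ _, fun n p hp h => ?_, fun n p hp h => ?_⟩
  · exact (contMDiffOn_chart_symm (n := ∞) (x := x)).comp_contMDiff hp.contMDiff h
  · exact contMDiff_iff_contDiff.1
      ((contMDiffOn_chart (n := ∞) (x := x)).comp_contMDiff hp h)

/-- A local homeomorphism to a manifold induces a smooth structure. -/
theorem exists_of_isLocalHomeomorph {f : X → Y} (hf : IsLocalHomeomorph f) (B : SmoothStr Y) :
    ∃ A : SmoothStr X, A.dim = B.dim ∧
      ∀ n (p : Euc n → X), A.IsPlot p ↔ Continuous p ∧ B.IsPlot (f ∘ p) := by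
  choose e he hfe using hf
  choose c hc h₁ h₂ using B.exists_chart
  refine exists_of_charts (P := fun n p => Continuous p ∧ B.IsPlot (f ∘ p)) ?_ B.dim
    (fun x => (e x).trans (c (f x))) (fun x => ?_) (fun x n p hp ht => ?_)
    (fun x n p hp ht => ?_)
  · refine ⟨fun n p h => h.1, fun n k p q h hq => ⟨h.1.comp hq.continuous, h.2.comp hq⟩,
      fun n p h => ⟨?_, ?_⟩⟩
    · rw [continuous_iff_continuousAt]
      intro t
      obtain ⟨r, hr, h, -⟩ := h t
      have hc : ContinuousOn p (Metric.ball t r) := by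
        let b := OpenPartialHomeomorph.univBall t r
        have h4 : ContinuousOn ((p ∘ ballPlot t r) ∘ b.symm) (Metric.ball t r) :=
          h.comp_continuousOn (OpenPartialHomeomorph.continuousOn_univBall_symm t r)
        refine h4.congr fun y hy => ?_
        have : ballPlot t r (b.symm y) = y := b.right_inv (by
          rw [OpenPartialHomeomorph.univBall_target _ hr]; exact hy)
        simp [this]
      exact hc.continuousAt (Metric.ball_mem_nhds _ hr)
    · refine B.isPlotClass.loc n _ fun t => ?_
      obtain ⟨r, hr, -, h⟩ := h t
      exact ⟨r, hr, h⟩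
  · simp only [OpenPartialHomeomorph.trans_source, Set.mem_inter_iff, Set.mem_preimage]
    refine ⟨he x, ?_⟩
    rw [← hfe x]
    exact hc _
  · simp only [OpenPartialHomeomorph.trans_target, Set.mem_inter_iff, Set.mem_preimage] at ht
    refine ⟨?_, ?_⟩
    · refine ContinuousOn.comp_continuous ((e x).trans (c (f x))).continuousOn_symm hp.continuous
        fun t => ?_
      simpa using ht t
    · refine Eq.mp ?_ (h₁ (f x) n p hp fun t => (ht t).1)
      congr 1
      funext t
      have : ∀ y, f y = e x y := fun y => congrFun (hfe x) y
      simp only [Function.comp, OpenPartialHomeomorph.coe_trans_symm]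
      rw [this ((e x).symm _)]
      exact ((e x).right_inv (ht t).2).symm
  · simp only [OpenPartialHomeomorph.trans_source, Set.mem_inter_iff, Set.mem_preimage] at ht
    have := h₂ (f x) n (f ∘ p) hp.2 fun t => by
      have := (ht t).2
      rwa [← hfe x] at this
    refine Eq.mp ?_ this
    congr 1
    funext t
    simp only [Function.comp, OpenPartialHomeomorph.coe_trans]
    rw [← hfe x]

/-- A local homeomorphism between manifolds for which the plots are the lifts of plots is
étale. -/
theorem isEtale_of_isLocalHomeomorph {f : X → Y} (hf : IsLocalHomeomorph f)
    (h : ∀ n (p : Euc n → X), A.IsPlot p ↔ Continuous p ∧ B.IsPlot (f ∘ p)) : A.IsEtale B f := by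
  let _ := A.charts
  let _ := B.charts
  have _ := A.isManifold
  have _ := B.isManifold
  intro x
  obtain ⟨e, he, rfl⟩ := hf x
  refine ⟨⟨e.toPartialEquiv, e.open_source, e.open_target, ?_, ?_⟩, he, fun _ _ => rfl⟩
  · exact (plotSmooth_iff.1 fun n p hp => ((h n p).1 hp).2).contMDiffOn
  · refine contMDiffOn_of_plots e.open_target fun n p hp ht => ?_
    refine (h n _).2 ⟨?_, ?_⟩
    · exact e.continuousOn_symm.comp_continuous hp.continuous ht
    · refine Eq.mp ?_ hp
      change ContMDiff _ _ _ _ = ContMDiff _ _ _ _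
      congr 1
      funext t
      exact (e.right_inv (ht t)).symm

end SmoothStr

/-! ### Submersions and embeddings in terms of plots -/

/-- The inverse function theorem: a smooth map with invertible derivative at a point restricts to
a diffeomorphism of open sets. -/
theorem exists_openPartialHomeomorph_of_hasFDerivAt {E F : Type*} [NormedAddCommGroup E]
    [NormedSpace ℝ E] [CompleteSpace E] [NormedAddCommGroup F] [NormedSpace ℝ F] {f : E → F}
    {U : Set E} (hU : IsOpen U) (hf : ContDiffOn ℝ ∞ f U) {x : E} (hx : x ∈ U) (f' : E ≃L[ℝ] F)
    (hf' : HasFDerivAt f (f' : E →L[ℝ] F) x) :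
    ∃ Φ : OpenPartialHomeomorph E F, x ∈ Φ.source ∧ Φ.source ⊆ U ∧ (∀ y, Φ y = f y) ∧
      ContDiffOn ℝ ∞ Φ.symm Φ.target := by
  have h1 : ContDiffAt ℝ ∞ f x := hf.contDiffAt (hU.mem_nhds hx)
  have hn : (∞ : WithTop ℕ∞) ≠ 0 := by simp
  let Φ₀ := h1.toOpenPartialHomeomorph f hf' hn
  let O : Set E := U ∩ fderiv ℝ f ⁻¹' Set.range ((↑) : (E ≃L[ℝ] F) → E →L[ℝ] F)
  have hO : IsOpen O := by
    refine ContinuousOn.isOpen_inter_preimage ?_ hU ContinuousLinearEquiv.isOpen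
    exact hf.continuousOn_fderiv_of_isOpen hU (by simp)
  have hxO : x ∈ O := ⟨hx, f', hf'.fderiv.symm⟩
  refine ⟨Φ₀.restrOpen O hO, ⟨h1.mem_toOpenPartialHomeomorph_source hf' hn, hxO⟩,
    fun y hy => hy.2.1, fun y => rfl, fun y hy => ?_⟩
  refine ContDiffAt.contDiffWithinAt ?_
  have hy' := (Φ₀.restrOpen O hO).map_target hy
  obtain ⟨hyU, g', hg'⟩ := hy'.2
  have h2 : ContDiffAt ℝ ∞ f ((Φ₀.restrOpen O hO).symm y) := hf.contDiffAt (hU.mem_nhds hyU)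
  refine (Φ₀.restrOpen O hO).contDiffAt_symm (f₀' := g') hy ?_ h2
  rw [hg']
  exact (h2.differentiableAt (by simp)).hasFDerivAt

theorem mem_contDiffGroupoid_of_contDiffOn {k : ℕ} {e : OpenPartialHomeomorph (Euc k) (Euc k)}
    (h₁ : ContDiffOn ℝ ∞ e e.source) (h₂ : ContDiffOn ℝ ∞ e.symm e.target) :
    e ∈ contDiffGroupoid ∞ (𝓡 k) := by
  refine (mem_groupoid_of_pregroupoid ..).2 ⟨?_, ?_⟩
  · simpa [contDiffPregroupoid] using h₁
  · simpa [contDiffPregroupoid] using h₂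

namespace SmoothStr

variable {X : Type u} [TopologicalSpace X] {Y : Type v} [TopologicalSpace Y]
  {Z : Type w} [TopologicalSpace Z] {A : SmoothStr X} {B : SmoothStr Y}

/-- A local homeomorphism to a Euclidean space that is compatible with the smooth structure. -/
structure IsChart (A : SmoothStr X) (κ : OpenPartialHomeomorph X (Euc A.dim)) : Prop where
  symm_plot : ∀ n (p : Euc n → Euc A.dim), ContDiff ℝ ∞ p → (∀ t, p t ∈ κ.target) →
      A.IsPlot (κ.symm ∘ p)
  plot : ∀ n (p : Euc n → X), A.IsPlot p → (∀ t, p t ∈ κ.source) → ContDiff ℝ ∞ (κ ∘ p)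

/-- The charts of the maximal atlas are characterized by plots. -/
theorem isChart_iff (κ : OpenPartialHomeomorph X (Euc A.dim)) : A.IsChart κ ↔
    letI := A.charts
    κ ∈ IsManifold.maximalAtlas (𝓡 A.dim) ∞ X := by
  let _ := A.charts
  have _ := A.isManifold
  constructor
  · intro h e' he'
    have he : e' ∈ IsManifold.maximalAtlas (𝓡 A.dim) ∞ X :=
      IsManifold.subset_maximalAtlas he'
    have k1 := contMDiffOn_of_mem_maximalAtlas he
    have k2 := contMDiffOn_symm_of_mem_maximalAtlas he
    have main : ContDiffOn ℝ ∞ (κ.symm.trans e') (κ.symm.trans e').source := by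
      rw [← contMDiffOn_iff_contDiffOn]
      refine contMDiffOn_of_plots (OpenPartialHomeomorph.open_source _) fun n p hp ht => ?_
      have ht' : ∀ t, p t ∈ κ.target ∧ κ.symm (p t) ∈ e'.source := fun t => by simpa using ht t
      have := h.symm_plot n p (contMDiff_iff_contDiff.1 hp) fun t => (ht' t).1
      exact k1.comp_contMDiff this fun t => (ht' t).2
    have main' : ContDiffOn ℝ ∞ (e'.symm.trans κ) (e'.symm.trans κ).source := by
      rw [← contMDiffOn_iff_contDiffOn]
      refine contMDiffOn_of_plots (OpenPartialHomeomorph.open_source _) fun n p hp ht => ?_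
      have ht' : ∀ t, p t ∈ e'.target ∧ e'.symm (p t) ∈ κ.source := fun t => by simpa using ht t
      have := k2.comp_contMDiff hp fun t => (ht' t).1
      exact (h.plot n _ this fun t => (ht' t).2).contMDiff
    have e1 : (κ.symm.trans e').symm = e'.symm.trans κ := rfl
    have e2 : (e'.symm.trans κ).symm = κ.symm.trans e' := rfl
    refine ⟨mem_contDiffGroupoid_of_contDiffOn main ?_,
      mem_contDiffGroupoid_of_contDiffOn main' ?_⟩
    · rw [e1]; simpa using main'
    · rw [e2]; simpa using main
  · intro h
    refine ⟨fun n p hp ht => ?_, fun n p hp ht => ?_⟩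
    · exact (contMDiffOn_symm_of_mem_maximalAtlas h).comp_contMDiff hp.contMDiff ht
    · exact contMDiff_iff_contDiff.1 ((contMDiffOn_of_mem_maximalAtlas h).comp_contMDiff hp ht)

theorem exists_isChart (A : SmoothStr X) (x : X) :
    ∃ κ : OpenPartialHomeomorph X (Euc A.dim), x ∈ κ.source ∧ A.IsChart κ := by
  obtain ⟨κ, h, h₁, h₂⟩ := A.exists_chart x
  exact ⟨κ, h, h₁, h₂⟩

/-- Composition of a chart with a diffeomorphism of open subsets of the Euclidean space. -/
theorem IsChart.trans {κ : OpenPartialHomeomorph X (Euc A.dim)} (h : A.IsChart κ)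
    {Φ : OpenPartialHomeomorph (Euc A.dim) (Euc A.dim)} (h₁ : ContDiffOn ℝ ∞ Φ Φ.source)
    (h₂ : ContDiffOn ℝ ∞ Φ.symm Φ.target) : A.IsChart (κ.trans Φ) := by
  refine ⟨fun n p hp ht => ?_, fun n p hp ht => ?_⟩
  · simp only [OpenPartialHomeomorph.trans_target, Set.mem_inter_iff, Set.mem_preimage] at ht
    exact h.symm_plot n _ (h₂.comp_contDiff hp fun t => (ht t).1) fun t => (ht t).2
  · simp only [OpenPartialHomeomorph.trans_source, Set.mem_inter_iff, Set.mem_preimage] at ht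
    exact h₁.comp_contDiff (h.plot n _ hp fun t => (ht t).1) fun t => (ht t).2

theorem IsChart.restrOpen {κ : OpenPartialHomeomorph X (Euc A.dim)} (h : A.IsChart κ)
    {U : Set X} (hU : IsOpen U) : A.IsChart (κ.restrOpen U hU) := by
  refine ⟨fun n p hp ht => h.symm_plot n p hp fun t => (ht t).1, fun n p hp ht => ?_⟩
  exact h.plot n p hp fun t => (ht t).1

/-- The normal form of a submersion. -/
theorem IsSubmersion.exists_normalForm {f : X → Y} (h : A.IsSubmersion B f) (x : X) :
    B.dim ≤ A.dim ∧
    ∃ (κ : OpenPartialHomeomorph X (Euc A.dim)) (c : OpenPartialHomeomorph Y (Euc B.dim))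
      (e : Euc A.dim ≃L[ℝ] Euc B.dim × Euc (A.dim - B.dim)), A.IsChart κ ∧ B.IsChart c ∧
      x ∈ κ.source ∧ (∀ y ∈ κ.source, f y ∈ c.source) ∧ ∀ y ∈ κ.source, c (f y) = (e (κ y)).1 := by
  let _ := A.charts
  let _ := B.charts
  obtain ⟨F, _, _, h''⟩ := h
  have h' := h'' x
  have hfin : FiniteDimensional ℝ (Euc B.dim × F) :=
    LinearEquiv.finiteDimensional h'.equiv.toLinearEquiv
  have hfin' : FiniteDimensional ℝ F :=
    Module.Finite.of_surjective (LinearMap.snd ℝ (Euc B.dim) F) LinearMap.snd_surjective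
  have hd := h'.equiv.toLinearEquiv.finrank_eq
  rw [Module.finrank_prod, finrank_euclideanSpace_fin, finrank_euclideanSpace_fin] at hd
  let e₂ : F ≃L[ℝ] Euc (A.dim - B.dim) :=
    ContinuousLinearEquiv.ofFinrankEq (by rw [finrank_euclideanSpace_fin]; omega)
  refine ⟨by omega, h'.domChart, h'.codChart,
    h'.equiv.trans ((ContinuousLinearEquiv.refl ℝ _).prodCongr e₂),
    (isChart_iff _).2 h'.domChart_mem_maximalAtlas, (isChart_iff _).2 h'.codChart_mem_maximalAtlas,
    h'.mem_domChart_source, fun y hy => h'.source_subset_preimage_source hy, fun y hy => ?_⟩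
  have h3 := h'.writtenInCharts
    (show h'.domChart y ∈ (h'.domChart.extend (𝓡 A.dim)).target by
      rw [OpenPartialHomeomorph.extend_target]
      simpa using h'.domChart.map_source hy)
  have h4 : h'.codChart (f (h'.domChart.symm (h'.domChart y))) = (h'.equiv (h'.domChart y)).1 := h3
  rw [h'.domChart.left_inv hy] at h4
  exact h4

/-- Local sections through every point that take plots to plots. -/
def HasLocalSections (A : SmoothStr X) (B : SmoothStr Y) (f : X → Y) : Prop :=
  ∀ x, ∃ V : Set Y, IsOpen V ∧ ∃ (hx : f x ∈ V) (s : V → X), s ⟨f x, hx⟩ = x ∧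
    (∀ v, f (s v) = v) ∧ ∀ n (p : Euc n → Y) (hp : ∀ t, p t ∈ V), B.IsPlot p →
      A.IsPlot fun t => s ⟨p t, hp t⟩

theorem IsSubmersion.hasLocalSections {f : X → Y} (h : A.IsSubmersion B f) :
    A.HasLocalSections B f := by
  intro x
  obtain ⟨-, κ, c, e, hκ, hc, hx, hfc, hf⟩ := h.exists_normalForm x
  let sg : Y → Euc A.dim := fun y => e.symm (c y, (e (κ x)).2)
  have hsg : ContinuousOn sg c.source :=
    e.symm.continuous.comp_continuousOn (c.continuousOn.prodMk continuousOn_const)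
  have hV : IsOpen (c.source ∩ sg ⁻¹' κ.target) :=
    hsg.isOpen_inter_preimage c.open_source κ.open_target
  have hsgx : sg (f x) = κ x := by
    simp only [sg]
    rw [hf x hx]
    exact e.symm_apply_apply _
  refine ⟨c.source ∩ sg ⁻¹' κ.target, hV, ⟨hfc x hx, ?_⟩, fun v => κ.symm (sg v), ?_, fun v => ?_,
    fun n p hp hpl => ?_⟩
  · rw [Set.mem_preimage, hsgx]; exact κ.map_source hx
  · simp only [hsgx]; exact κ.left_inv hx
  · have h1 := κ.map_target v.2.2
    refine c.injOn (hfc _ h1) v.2.1 ?_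
    rw [hf _ h1, κ.right_inv v.2.2]
    simp [sg]
  · refine hκ.symm_plot n _ ?_ fun t => (hp t).2
    exact e.symm.contDiff.comp ((hc.plot n p hpl fun t => (hp t).1).prodMk contDiff_const)

/-- A smooth map with smooth local sections through every point is a submersion. -/
theorem isSubmersion_of_hasLocalSections {f : X → Y} (hf : A.PlotSmooth B f)
    (hs : A.HasLocalSections B f) : A.IsSubmersion B f := by
  let _ := A.charts
  let _ := B.charts
  have _ := A.isManifold
  have _ := B.isManifold
  refine Manifold.IsSubmersionOfComplement.isSubmersion (F := Euc (A.dim - B.dim)) fun x => ?_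
  obtain ⟨κ, hx, hκ⟩ := A.exists_isChart x
  obtain ⟨c, hfx, hc⟩ := B.exists_isChart (f x)
  obtain ⟨V, hV, hxV, s, hsx, hfs, hsp⟩ := hs x
  have hcf := hf.continuous
  -- the map in charts, and its section
  let φ : Euc A.dim → Euc B.dim := fun u => c (f (κ.symm u))
  let U : Set (Euc A.dim) := κ.target ∩ κ.symm ⁻¹' (f ⁻¹' c.source)
  have hU : IsOpen U := κ.continuousOn_symm.isOpen_inter_preimage κ.open_target
    (c.open_source.preimage hcf)
  have hxU : κ x ∈ U := ⟨κ.map_source hx, by simpa [κ.left_inv hx] using hfx⟩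
  have hφ : ContDiffOn ℝ ∞ φ U := by
    rw [← contMDiffOn_iff_contDiffOn]
    refine contMDiffOn_of_plots hU fun n p hp ht => ?_
    have h1 := hκ.symm_plot n p (contMDiff_iff_contDiff.1 hp) fun t => (ht t).1
    exact (hc.plot n _ (hf n _ h1) fun t => (ht t).2).contMDiff
  have hW : IsOpen (c.target ∩ c.symm ⁻¹' V) :=
    c.continuousOn_symm.isOpen_inter_preimage c.open_target hV
  obtain ⟨n, p, q, hp, hpU, hq, hpq, hev⟩ := exists_plot_near (K := 𝓡 B.dim) hW
    (x := c (f x)) ⟨c.map_source hfx, by simpa [c.left_inv hfx] using hxV⟩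
  have hsg : A.IsPlot (fun t => s ⟨c.symm (p t), (hpU t).2⟩) :=
    hsp n (c.symm ∘ p) (fun t => (hpU t).2)
      (hc.symm_plot n p (contMDiff_iff_contDiff.1 hp) fun t => (hpU t).1)
  set sg : Euc n → X := fun t => s ⟨c.symm (p t), (hpU t).2⟩ with hsgdef
  have hsgx : sg (q (c (f x))) = x := by
    simp only [hsgdef, hpq, c.left_inv hfx]; exact hsx
  have hsurj : Function.Surjective (fderiv ℝ φ (κ x)) := by
    have h1 : ContDiffAt ℝ ∞ (κ ∘ sg) (q (c (f x))) := by
      obtain ⟨r, hr, hr'⟩ := exists_ballPlot_mem hsg.continuous κ.open_source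
        (t := q (c (f x))) (by rw [hsgx]; exact hx)
      have h2 := hκ.plot n _ (hsg.comp (contDiff_ballPlot _ r)) hr'
      have h3 : ContDiffAt ℝ ∞ (OpenPartialHomeomorph.univBall (q (c (f x))) r).symm
          (q (c (f x))) :=
        OpenPartialHomeomorph.contDiffOn_univBall_symm.contDiffAt (Metric.ball_mem_nhds _ hr)
      refine (h2.contDiffAt.comp _ h3).congr_of_eventuallyEq ?_
      filter_upwards [Metric.ball_mem_nhds _ hr] with y hy
      have : ballPlot (q (c (f x))) r ((OpenPartialHomeomorph.univBall (q (c (f x))) r).symm y)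
          = y := (OpenPartialHomeomorph.univBall (q (c (f x))) r).right_inv (by
        rw [OpenPartialHomeomorph.univBall_target _ hr]; exact hy)
      simp [this]
    have hq' : ContDiffAt ℝ ∞ q (c (f x)) := contMDiffAt_iff_contDiffAt.1 hq
    have h4 : ContDiffAt ℝ ∞ ((κ ∘ sg) ∘ q) (c (f x)) := h1.comp _ hq'
    have h5 : ((κ ∘ sg) ∘ q) (c (f x)) = κ x := by simp [hsgx]
    have h6 : HasFDerivAt (φ ∘ ((κ ∘ sg) ∘ q))
        ((fderiv ℝ φ (κ x)).comp (fderiv ℝ ((κ ∘ sg) ∘ q) (c (f x)))) (c (f x)) := by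
      refine HasFDerivAt.comp _ ?_ (h4.differentiableAt (by simp)).hasFDerivAt
      rw [h5]
      exact ((hφ.contDiffAt (hU.mem_nhds hxU)).differentiableAt (by simp)).hasFDerivAt
    have h7 : HasFDerivAt (φ ∘ ((κ ∘ sg) ∘ q)) (ContinuousLinearMap.id ℝ _) (c (f x)) := by
      refine (hasFDerivAt_id _).congr_of_eventuallyEq ?_
      have h8 : ∀ᶠ y in 𝓝 (c (f x)), sg (q y) ∈ κ.source := by
        refine (hsg.continuous.continuousAt.comp hq'.continuousAt).preimage_mem_nhds ?_
        simp only [Function.comp, hsgx]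
        exact κ.open_source.mem_nhds hx
      filter_upwards [hev, h8, c.open_target.mem_nhds (c.map_source hfx)] with y hy hy' hy''
      have h10 : f (sg (q y)) = c.symm (p (q y)) := hfs _
      change c (f (κ.symm (κ (sg (q y))))) = y
      rw [κ.left_inv hy', h10, hy, c.right_inv hy'']
    have h9 := h6.unique h7
    intro v
    refine ⟨fderiv ℝ ((κ ∘ sg) ∘ q) (c (f x)) v, ?_⟩
    exact congrArg (fun L : Euc B.dim →L[ℝ] Euc B.dim => L v) h9
  set L := fderiv ℝ φ (κ x) with hL
  -- a complement of the kernel of the derivative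
  have hker : Module.finrank ℝ L.ker = A.dim - B.dim := by
    have := LinearMap.finrank_range_add_finrank_ker (L : Euc A.dim →ₗ[ℝ] Euc B.dim)
    rw [LinearMap.range_eq_top.2 hsurj, finrank_top, finrank_euclideanSpace_fin,
      finrank_euclideanSpace_fin] at this
    omega
  let e₀ : L.ker ≃L[ℝ] Euc (A.dim - B.dim) :=
    ContinuousLinearEquiv.ofFinrankEq (by rw [finrank_euclideanSpace_fin]; exact hker)
  obtain ⟨P₀, hP₀⟩ := Submodule.ClosedComplemented.of_finiteDimensional (𝕜 := ℝ) L.ker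
  let P : Euc A.dim →L[ℝ] Euc (A.dim - B.dim) := (e₀ : _ →L[ℝ] _).comp P₀
  have hinj : Function.Injective (L.prod P) := by
    refine (injective_iff_map_eq_zero (L.prod P)).2 fun v hv => ?_
    have h1 : L v = 0 := congrArg Prod.fst hv
    have h2 : e₀ (P₀ v) = 0 := congrArg Prod.snd hv
    have h3 : P₀ v = 0 := by simpa using h2
    have h4 := hP₀ ⟨v, h1⟩
    rw [h3] at h4
    exact (congrArg Subtype.val h4).symm
  have hdim : B.dim ≤ A.dim := by
    have := LinearMap.finrank_range_add_finrank_ker (L : Euc A.dim →ₗ[ℝ] Euc B.dim)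
    rw [LinearMap.range_eq_top.2 hsurj, finrank_top, finrank_euclideanSpace_fin,
      finrank_euclideanSpace_fin] at this
    omega
  let e : Euc A.dim ≃L[ℝ] Euc B.dim × Euc (A.dim - B.dim) :=
    (LinearEquiv.ofInjectiveOfFinrankEq ((L.prod P : _ →L[ℝ] _) : _ →ₗ[ℝ] _) hinj (by
      rw [Module.finrank_prod, finrank_euclideanSpace_fin, finrank_euclideanSpace_fin,
        finrank_euclideanSpace_fin]; omega)).toContinuousLinearEquiv
  have he : (e : Euc A.dim →L[ℝ] _) = L.prod P := by
    ext1 v; rfl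
  obtain ⟨Φ, hΦx, hΦU, hΦ, hΦs⟩ := exists_openPartialHomeomorph_of_hasFDerivAt
    (f := fun u => (φ u, P u)) hU (hφ.prodMk P.contDiff.contDiffOn) hxU e (by
      rw [he]
      exact ((hφ.contDiffAt (hU.mem_nhds hxU)).differentiableAt
        (by simp)).hasFDerivAt.prodMk P.hasFDerivAt)
  let Ψ : OpenPartialHomeomorph (Euc A.dim) (Euc A.dim) :=
    Φ.trans e.symm.toHomeomorph.toOpenPartialHomeomorph
  have hΨ₁ : ContDiffOn ℝ ∞ Ψ Ψ.source := by
    have h1 : ContDiffOn ℝ ∞ (fun u => e.symm (φ u, P u)) U :=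
      e.symm.contDiff.comp_contDiffOn (hφ.prodMk P.contDiff.contDiffOn)
    refine (h1.mono ?_).congr fun y _ => ?_
    · intro y hy
      have : y ∈ Φ.source := by simpa [Ψ] using hy
      exact hΦU this
    · change e.symm (Φ y) = _
      rw [hΦ]
  have hΨ₂ : ContDiffOn ℝ ∞ Ψ.symm Ψ.target := by
    refine hΦs.comp (t := Φ.target) e.contDiff.contDiffOn fun y hy => ?_
    simpa [Ψ] using hy
  have hchart := hκ.trans hΨ₁ hΨ₂
  have hsrc : ∀ y, y ∈ (κ.trans Ψ).source → y ∈ κ.source ∧ κ y ∈ Φ.source := fun y hy => by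
    simpa [Ψ] using hy
  refine Manifold.IsSubmersionAtOfComplement.mk_of_continuousAt hcf.continuousAt e
    (κ.trans Ψ) c ?_ hfx ((isChart_iff _).1 hchart) ((isChart_iff _).1 hc) ?_
  · simpa [Ψ, hx] using hΦx
  · intro v hv
    have hv' : v ∈ (κ.trans Ψ).target := by simpa using hv
    obtain ⟨h1, h2⟩ := hsrc _ ((κ.trans Ψ).map_target hv')
    have h3 := (κ.trans Ψ).right_inv hv'
    set y := (κ.trans Ψ).symm v with hy
    have h4 : e.symm (φ (κ y), P (κ y)) = v := by
      rw [← h3]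
      change _ = e.symm (Φ (κ y))
      rw [hΦ]
    have h5 : c (f y) = (e v).1 := by
      rw [← h4, e.apply_symm_apply]
      simp [φ, κ.left_inv h1]
    exact h5

/-- A smooth section of a submersion is an embedding. -/
theorem isEmbedding_of_section {r : Y → X} (hr : B.IsSubmersion A r) {s : X → Y}
    (hs : A.PlotSmooth B s) (hrs : ∀ x, r (s x) = x) : A.IsEmbedding B s := by
  let _ := A.charts
  let _ := B.charts
  have _ := A.isManifold
  have _ := B.isManifold
  refine ⟨Manifold.IsImmersionOfComplement.isImmersion (F := Euc (B.dim - A.dim)) fun x => ?_,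
    Topology.IsEmbedding.of_leftInverse hrs hr.plotSmooth.continuous hs.continuous⟩
  obtain ⟨-, κ, c, e, hκ, hc, hx, hfc, hf⟩ := hr.exists_normalForm (s x)
  have hxc : x ∈ c.source := by have := hfc _ hx; rwa [hrs] at this
  let O : Set X := c.source ∩ s ⁻¹' κ.source
  have hO : IsOpen O := c.open_source.inter (κ.open_source.preimage hs.continuous)
  let T : Set (Euc A.dim) := c.target ∩ c.symm ⁻¹' O
  have hT : IsOpen T := c.continuousOn_symm.isOpen_inter_preimage c.open_target hO
  let h : Euc A.dim → Euc (B.dim - A.dim) := fun u => (e (κ (s (c.symm u)))).2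
  have hh : ContDiffOn ℝ ∞ h T := by
    rw [← contMDiffOn_iff_contDiffOn]
    refine contMDiffOn_of_plots hT fun n p hp ht => ?_
    have h1 := hc.symm_plot n p (contMDiff_iff_contDiff.1 hp) fun t => (ht t).1
    have h2 := hκ.plot n _ (hs n _ h1) fun t => (ht t).2.2
    exact (contDiff_snd.comp (e.contDiff.comp h2)).contMDiff
  -- the shear that straightens the image
  let Φ : OpenPartialHomeomorph (Euc B.dim) (Euc B.dim) :=
    { toFun := fun y => e.symm ((e y).1, (e y).2 - h (e y).1)
      invFun := fun y => e.symm ((e y).1, (e y).2 + h (e y).1)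
      source := (fun y => (e y).1) ⁻¹' T
      target := (fun y => (e y).1) ⁻¹' T
      map_source' := fun y hy => by simpa using hy
      map_target' := fun y hy => by simpa using hy
      left_inv' := fun y hy => by simp
      right_inv' := fun y hy => by simp
      open_source := hT.preimage (continuous_fst.comp e.continuous)
      open_target := hT.preimage (continuous_fst.comp e.continuous)
      continuousOn_toFun := by
        have h0 : ContinuousOn (fun y => h (e y).1) ((fun y => (e y).1) ⁻¹' T) :=
          hh.continuousOn.comp (continuous_fst.comp e.continuous).continuousOn fun y hy => hy
        exact e.symm.continuous.comp_continuousOn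
          ((continuous_fst.comp e.continuous).continuousOn.prodMk
            ((continuous_snd.comp e.continuous).continuousOn.sub h0))
      continuousOn_invFun := by
        have h0 : ContinuousOn (fun y => h (e y).1) ((fun y => (e y).1) ⁻¹' T) :=
          hh.continuousOn.comp (continuous_fst.comp e.continuous).continuousOn fun y hy => hy
        exact e.symm.continuous.comp_continuousOn
          ((continuous_fst.comp e.continuous).continuousOn.prodMk
            ((continuous_snd.comp e.continuous).continuousOn.add h0)) }
  have h0 : ContDiffOn ℝ ∞ (fun y => h (e y).1) ((fun y => (e y).1) ⁻¹' T) :=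
    hh.comp (contDiff_fst.comp e.contDiff).contDiffOn fun y hy => hy
  have h1 : ContDiffOn ℝ ∞ (fun y => (e y).1) ((fun y => (e y).1) ⁻¹' T) :=
    (contDiff_fst.comp e.contDiff).contDiffOn
  have h2 : ContDiffOn ℝ ∞ (fun y => (e y).2) ((fun y => (e y).1) ⁻¹' T) :=
    (contDiff_snd.comp e.contDiff).contDiffOn
  have hΦ₁ : ContDiffOn ℝ ∞ Φ Φ.source :=
    e.symm.contDiff.comp_contDiffOn (h1.prodMk (h2.sub h0))
  have hΦ₂ : ContDiffOn ℝ ∞ Φ.symm Φ.target :=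
    e.symm.contDiff.comp_contDiffOn (h1.prodMk (h2.add h0))
  have hin : ∀ x ∈ O, c x ∈ T := fun x hx => by
    refine ⟨c.map_source hx.1, ?_⟩
    rw [Set.mem_preimage, c.left_inv hx.1]; exact hx
  have hfst : ∀ x ∈ O, (e (κ (s x))).1 = c x := fun x hx => by
    rw [← hf _ hx.2, hrs]
  refine Manifold.IsImmersionAtOfComplement.mk_of_continuousAt hs.continuous.continuousAt e.symm
    (c.restrOpen O hO) (κ.trans Φ) ⟨hxc, hxc, hx⟩ ?_ ((isChart_iff _).1 (hc.restrOpen hO))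
    ((isChart_iff _).1 (hκ.trans hΦ₁ hΦ₂)) ?_
  · simp only [OpenPartialHomeomorph.trans_source, Set.mem_inter_iff, Set.mem_preimage]
    refine ⟨hx, ?_⟩
    change (e (κ (s x))).1 ∈ T
    rw [hfst x ⟨hxc, hx⟩]
    exact hin x ⟨hxc, hx⟩
  · intro v hv
    have hv' : v ∈ (c.restrOpen O hO).target := by simpa using hv
    have hy : (c.restrOpen O hO).symm v ∈ O := ((c.restrOpen O hO).map_target hv').2
    have hcy : c ((c.restrOpen O hO).symm v) = v := (c.restrOpen O hO).right_inv hv'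
    have hcv : (c.restrOpen O hO).symm v = c.symm v := rfl
    have h5 : Φ (κ (s ((c.restrOpen O hO).symm v))) = e.symm (v, 0) := by
      change e.symm _ = _
      rw [hfst _ hy, hcy]
      congr 2
      simp [h, hcv]
    simpa using h5

end SmoothStr

/-! ### Local homeomorphisms -/

theorem isLocalHomeomorph_of_isOpenMap {X Y : Type*} [TopologicalSpace X] [TopologicalSpace Y]
    {f : X → Y} (hc : Continuous f) (ho : IsOpenMap f) (hi : ∀ x, ∃ U ∈ 𝓝 x, Set.InjOn f U) :
    IsLocalHomeomorph f := by
  rw [isLocalHomeomorph_iff_isOpenEmbedding_restrict]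
  intro x
  obtain ⟨U, hU, hf⟩ := hi x
  obtain ⟨V, hVU, hV, hxV⟩ := mem_nhds_iff.1 hU
  refine ⟨V, hV.mem_nhds hxV, .of_continuous_injective_isOpenMap (hc.comp continuous_subtype_val)
    (Set.injOn_iff_injective.1 (hf.mono hVU)) (ho.comp hV.isOpenMap_subtype_val)⟩

theorem exists_isOpen_injOn {X Y : Type*} [TopologicalSpace X] [TopologicalSpace Y]
    {f : X → Y} (hf : IsLocalHomeomorph f) (x : X) :
    ∃ U : Set X, IsOpen U ∧ x ∈ U ∧ Set.InjOn f U := by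
  obtain ⟨e, he, rfl⟩ := hf x
  exact ⟨e.source, e.open_source, he, e.injOn⟩

theorem IsLocalHomeomorph.piMap {ι : Type*} [Finite ι] {X Y : ι → Type*}
    [∀ i, TopologicalSpace (X i)] [∀ i, TopologicalSpace (Y i)] {f : ∀ i, X i → Y i}
    (hf : ∀ i, IsLocalHomeomorph (f i)) : IsLocalHomeomorph (Pi.map f) := by
  refine isLocalHomeomorph_of_isOpenMap (Continuous.piMap fun i => (hf i).continuous)
    (IsOpenMap.piMap (fun i => (hf i).isOpenMap) (Filter.eventually_cofinite.2 (Set.toFinite _)))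
    fun x => ?_
  choose U hU hxU hinj using fun i => exists_isOpen_injOn (hf i) (x i)
  refine ⟨Set.univ.pi U, set_pi_mem_nhds Set.finite_univ fun i _ => (hU i).mem_nhds (hxU i),
    fun y hy z hz h => funext fun i => hinj i (hy i trivial) (hz i trivial) (congrFun h i)⟩

/-- If `T` is open in the preimage of `S` under a local homeomorphism, then the restriction
`T → S` is a local homeomorphism. -/
theorem IsLocalHomeomorph.restrict {E B : Type*} [TopologicalSpace E] [TopologicalSpace B]
    {f : E → B} (hf : IsLocalHomeomorph f) {T : Set E} {S : Set B} (h : Set.MapsTo f T S)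
    (hT : ∀ x ∈ T, ∃ O ∈ 𝓝 x, O ∩ f ⁻¹' S ⊆ T) : IsLocalHomeomorph (h.restrict f T S) := by
  refine isLocalHomeomorph_of_isOpenMap (hf.continuous.restrict h) ?_ fun x => ?_
  · rw [isOpenMap_iff_nhds_le]
    intro x
    obtain ⟨O, hO, hOT⟩ := hT x x.2
    intro W hW
    rw [Filter.mem_map] at hW
    obtain ⟨W₁, hW₁, hW₁'⟩ := mem_nhds_subtype T x _ |>.1 hW
    have h2 : f '' (W₁ ∩ O) ∈ 𝓝 (f x) := hf.isOpenMap.image_mem_nhds (Filter.inter_mem hW₁ hO)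
    refine mem_nhds_subtype S _ _ |>.2 ⟨_, h2, ?_⟩
    rintro ⟨s, hs⟩ ⟨y, ⟨hy, hyO⟩, rfl⟩
    have hyT : y ∈ T := hOT ⟨hyO, hs⟩
    exact hW₁' (a := ⟨y, hyT⟩) hy
  · obtain ⟨U, hU, hxU, hinj⟩ := exists_isOpen_injOn hf x.1
    refine ⟨Subtype.val ⁻¹' U, (hU.preimage continuous_subtype_val).mem_nhds hxU, ?_⟩
    intro y hy z hz hyz
    exact Subtype.ext (hinj hy hz (congrArg Subtype.val hyz))

/-! ### Constructions of smooth structures -/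

namespace SmoothStr

/-- Finite products of manifolds. -/
theorem exists_pi {ι : Type*} [Finite ι] {X : ι → Type u} [∀ i, TopologicalSpace (X i)]
    (A : ∀ i, SmoothStr (X i)) : ∃ C : SmoothStr (∀ i, X i),
      ∀ n (p : Euc n → ∀ i, X i), C.IsPlot p ↔ ∀ i, (A i).IsPlot fun t => p t i := by
  have := Fintype.ofFinite ι
  choose κ hx hκ using fun i => (A i).exists_isChart
  let e : (∀ i, Euc (A i).dim) ≃L[ℝ] Euc (∑ i, (A i).dim) :=
    ContinuousLinearEquiv.ofFinrankEq (by simp [Module.finrank_pi_fintype])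
  obtain ⟨C, -, hC⟩ := exists_of_charts
    (P := fun n (p : Euc n → ∀ i, X i) => ∀ i, (A i).IsPlot fun t => p t i)
    ⟨fun n p h => continuous_pi fun i => (h i).continuous, fun n k p q h hq i => (h i).comp hq,
      fun n p h i => (A i).isPlotClass.loc n _ fun t => by
        obtain ⟨r, hr, h⟩ := h t
        exact ⟨r, hr, h i⟩⟩ (∑ i, (A i).dim)
    (fun x => (OpenPartialHomeomorph.pi fun i => κ i (x i)).trans
      e.toHomeomorph.toOpenPartialHomeomorph) (fun x => by simp [hx])
    (fun x n p hp ht i => by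
      have h1 : ∀ t j, e.symm (p t) j ∈ (κ j (x j)).target := fun t j => by
        have := ht t
        simp only [OpenPartialHomeomorph.trans_target, Set.mem_inter_iff, Set.mem_preimage] at this
        exact this.2 j trivial
      have h2 : ContDiff ℝ ∞ (fun t => e.symm (p t)) := e.symm.contDiff.comp hp
      exact (hκ i (x i)).symm_plot n (fun t => e.symm (p t) i) (contDiff_pi.1 h2 i)
        fun t => h1 t i)
    (fun x n p hp ht => by
      have h1 : ∀ t j, p t j ∈ (κ j (x j)).source := fun t j => by
        have := ht t
        simp only [OpenPartialHomeomorph.trans_source, Set.mem_inter_iff] at this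
        exact this.1 j trivial
      refine e.contDiff.comp (contDiff_pi.2 fun i => ?_)
      exact (hκ i (x i)).plot n _ (hp i) fun t => h1 t i)
  exact ⟨C, hC⟩

variable {X : Type u} [TopologicalSpace X] {Y : Type v} [TopologicalSpace Y]
  {Z : Type w} [TopologicalSpace Z] {A : SmoothStr X} {B : SmoothStr Y} {C : SmoothStr Z}

/-- A map that takes plots in an open set to plots is continuous on it. -/
theorem continuous_of_plots {V : Set Y} (hV : IsOpen V) (s : V → X)
    (hs : ∀ n (p : Euc n → Y) (hp : ∀ t, p t ∈ V), B.IsPlot p →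
      A.IsPlot fun t => s ⟨p t, hp t⟩) : Continuous s := by
  rcases V.eq_empty_or_nonempty with rfl | ⟨v, hv⟩
  · exact continuous_of_const fun x => x.2.elim
  let _ := A.charts
  let _ := B.charts
  have _ := B.isManifold
  classical
  let f : Y → X := fun y => if h : y ∈ V then s ⟨y, h⟩ else s ⟨v, hv⟩
  have hfs : ∀ y (h : y ∈ V), f y = s ⟨y, h⟩ := fun y h => dif_pos h
  have h1 : ContMDiffOn (𝓡 B.dim) (𝓡 A.dim) ∞ f V := contMDiffOn_of_plots hV fun n p hp ht => by
    have : f ∘ p = fun t => s ⟨p t, ht t⟩ := funext fun t => hfs _ _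
    rw [this]
    exact hs n p ht hp
  refine (continuousOn_iff_continuous_domRestrict.1 h1.continuousOn).congr fun y => ?_
  exact hfs y.1 y.2

/-- The fiber product of a submersion and a smooth map is a manifold. -/
theorem exists_fiberProduct {f : X → Z} {g : Y → Z} (hf : A.IsSubmersion C f)
    (hg : B.PlotSmooth C g) : ∃ D : SmoothStr {p : X × Y // f p.1 = g p.2},
      D.dim = A.dim - C.dim + B.dim ∧ ∀ n (p : Euc n → {p : X × Y // f p.1 = g p.2}),
        D.IsPlot p ↔ A.IsPlot (fun t => (p t).1.1) ∧ B.IsPlot (fun t => (p t).1.2) := by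
  classical
  have hn := fun x => (hf.exists_normalForm x).2
  choose κ c e hκ hc hx hfc hfe using hn
  choose b hb hbc using B.exists_isChart
  have hfr : Module.finrank ℝ (Euc (A.dim - C.dim) × Euc B.dim) =
      Module.finrank ℝ (Euc (A.dim - C.dim + B.dim)) := by
    rw [Module.finrank_prod, finrank_euclideanSpace_fin, finrank_euclideanSpace_fin,
      finrank_euclideanSpace_fin]
  let L : (Euc (A.dim - C.dim) × Euc B.dim) ≃L[ℝ] Euc (A.dim - C.dim + B.dim) :=
    ContinuousLinearEquiv.ofFinrankEq hfr
  have hgc := hg.continuous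
  -- the set of parameters of the chart at a point
  let T₁ : X → Y → Set (Euc B.dim) := fun x y =>
    (b y).target ∩ (b y).symm ⁻¹' (g ⁻¹' (c x).source)
  have hT₁ : ∀ x y, IsOpen (T₁ x y) := fun x y =>
    (b y).continuousOn_symm.isOpen_inter_preimage (b y).open_target
      ((c x).open_source.preimage hgc)
  let h : X → Y → Euc (A.dim - C.dim) × Euc B.dim → Euc A.dim := fun x y z =>
    (e x).symm (c x (g ((b y).symm z.2)), z.1)
  have hh : ∀ x y, ContinuousOn (h x y) (Prod.snd ⁻¹' T₁ x y) := fun x y => by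
    refine (e x).symm.continuous.comp_continuousOn (ContinuousOn.prodMk ?_ continuousOn_fst)
    refine (c x).continuousOn.comp (hgc.comp_continuousOn ((b y).continuousOn_symm.comp
      continuousOn_snd fun z hz => hz.1)) fun z hz => hz.2
  let T : X → Y → Set (Euc (A.dim - C.dim) × Euc B.dim) := fun x y =>
    Prod.snd ⁻¹' T₁ x y ∩ h x y ⁻¹' (κ x).target
  have hT : ∀ x y, IsOpen (T x y) := fun x y =>
    (hh x y).isOpen_inter_preimage ((hT₁ x y).preimage continuous_snd) (κ x).open_target
  have hfg : ∀ x y z, z ∈ T x y → f ((κ x).symm (h x y z)) = g ((b y).symm z.2) := by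
    intro x y z hz
    have h1 := (κ x).map_target hz.2
    refine (c x).injOn (hfc x _ h1) hz.1.2 ?_
    rw [hfe x _ h1, (κ x).right_inv hz.2]
    simp [h]
  have hκh : ∀ x y (q : {p : X × Y // f p.1 = g p.2}), q.1.1 ∈ (κ x).source →
      q.1.2 ∈ (b y).source →
      h x y ((e x (κ x q.1.1)).2, b y q.1.2) = κ x q.1.1 := by
    intro x y q h1 h2
    simp only [h]
    rw [(b y).left_inv h2, ← q.2, hfe x _ h1]
    exact (e x).symm_apply_apply _
  let Φ : (q : {p : X × Y // f p.1 = g p.2}) → OpenPartialHomeomorph {p : X × Y // f p.1 = g p.2}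
      (Euc (A.dim - C.dim) × Euc B.dim) := fun q₀ =>
    let x := q₀.1.1
    let y := q₀.1.2
    { toFun := fun q => ((e x (κ x q.1.1)).2, b y q.1.2)
      invFun := fun z => if hz : z ∈ T x y then ⟨((κ x).symm (h x y z), (b y).symm z.2),
        hfg x y z hz⟩ else q₀
      source := {q | q.1.1 ∈ (κ x).source ∧ q.1.2 ∈ (b y).source}
      target := T x y
      map_source' := by
        rintro q ⟨h1, h2⟩
        refine ⟨⟨(b y).map_source h2, ?_⟩, ?_⟩
        · rw [Set.mem_preimage, (b y).left_inv h2, Set.mem_preimage, ← q.2]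
          exact hfc x _ h1
        · rw [Set.mem_preimage, hκh x y q h1 h2]
          exact (κ x).map_source h1
      map_target' := fun z hz => by
        simp only [dif_pos hz]
        exact ⟨(κ x).map_target hz.2, (b y).map_target hz.1.1⟩
      left_inv' := by
        rintro q ⟨h1, h2⟩
        have hz : ((e x (κ x q.1.1)).2, b y q.1.2) ∈ T x y := by
          refine ⟨⟨(b y).map_source h2, ?_⟩, ?_⟩
          · rw [Set.mem_preimage, (b y).left_inv h2, Set.mem_preimage, ← q.2]
            exact hfc x _ h1
          · rw [Set.mem_preimage, hκh x y q h1 h2]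
            exact (κ x).map_source h1
        simp only [dif_pos hz]
        refine Subtype.ext (Prod.ext ?_ ?_)
        · change (κ x).symm (h x y _) = _
          rw [hκh x y q h1 h2, (κ x).left_inv h1]
        · exact (b y).left_inv h2
      right_inv' := fun z hz => by
        simp only [dif_pos hz]
        rw [(κ x).right_inv hz.2, (b y).right_inv hz.1.1]
        simp [h]
      open_source := ((κ x).open_source.preimage (continuous_fst.comp continuous_subtype_val)).inter
        ((b y).open_source.preimage (continuous_snd.comp continuous_subtype_val))
      open_target := hT x y
      continuousOn_toFun := by
        refine ContinuousOn.prodMk ?_ ?_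
        · exact (continuous_snd.comp (e x).continuous).comp_continuousOn
            ((κ x).continuousOn.comp (continuous_fst.comp continuous_subtype_val).continuousOn
              fun q hq => hq.1)
        · exact (b y).continuousOn.comp (continuous_snd.comp continuous_subtype_val).continuousOn
              fun q hq => hq.2
      continuousOn_invFun := by
        refine (Topology.IsInducing.continuousOn_iff (g := Subtype.val) ⟨rfl⟩).2 ?_
        have h1 : ContinuousOn (fun z => ((κ x).symm (h x y z), (b y).symm z.2)) (T x y) := by
          refine ContinuousOn.prodMk ?_ ?_
          · exact (κ x).continuousOn_symm.comp ((hh x y).mono fun z hz => hz.1) fun z hz => hz.2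
          · exact (b y).continuousOn_symm.comp continuousOn_snd fun z hz => hz.1.1
        refine h1.congr fun z hz => ?_
        simp only [Function.comp, dif_pos hz] }
  have hΦs : ∀ q₀ z, z ∈ T q₀.1.1 q₀.1.2 → ((Φ q₀).symm z).1 =
      ((κ q₀.1.1).symm (h q₀.1.1 q₀.1.2 z), (b q₀.1.2).symm z.2) := fun q₀ z hz => by
    change (dite _ _ _ : {p : X × Y // f p.1 = g p.2}).1 = _
    rw [dif_pos hz]
  obtain ⟨D, hD, hDp⟩ := exists_of_charts
    (P := fun n (p : Euc n → {p : X × Y // f p.1 = g p.2}) =>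
      A.IsPlot (fun t => (p t).1.1) ∧ B.IsPlot (fun t => (p t).1.2))
    ⟨fun n p h => (h.1.continuous.prodMk h.2.continuous).subtype_mk _,
      fun n k p q h hq => ⟨h.1.comp hq, h.2.comp hq⟩, fun n p h =>
        ⟨A.isPlotClass.loc n _ fun t => by
          obtain ⟨r, hr, h⟩ := h t
          exact ⟨r, hr, h.1⟩, B.isPlotClass.loc n _ fun t => by
          obtain ⟨r, hr, h⟩ := h t
          exact ⟨r, hr, h.2⟩⟩⟩ (A.dim - C.dim + B.dim)
    (fun q => (Φ q).trans L.toHomeomorph.toOpenPartialHomeomorph)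
    (fun q => by
      simp only [OpenPartialHomeomorph.trans_source, Set.mem_inter_iff]
      exact ⟨⟨hx _, hb _⟩, trivial⟩)
    (fun q n p hp ht => by
      have ht' : ∀ t, L.symm (p t) ∈ T q.1.1 q.1.2 := fun t => by
        have := ht t
        simp only [OpenPartialHomeomorph.trans_target, Set.mem_inter_iff, Set.mem_preimage] at this
        exact this.2
      have h2 : ContDiff ℝ ∞ (fun t => L.symm (p t)) := L.symm.contDiff.comp hp
      have h3 : B.IsPlot ((b q.1.2).symm ∘ fun t => (L.symm (p t)).2) :=
        (hbc _).symm_plot n _ (contDiff_snd.comp h2) fun t => (ht' t).1.1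
      have h4 := (hc q.1.1).plot n _ (hg n _ h3) fun t => (ht' t).1.2
      refine ⟨?_, ?_⟩
      · have h5 := (hκ q.1.1).symm_plot n (fun t => h q.1.1 q.1.2 (L.symm (p t)))
          ((e q.1.1).symm.contDiff.comp (h4.prodMk (contDiff_fst.comp h2))) fun t => (ht' t).2
        refine Eq.mp ?_ h5
        congr 1
        funext t
        exact (congrArg Prod.fst (hΦs q _ (ht' t))).symm
      · refine Eq.mp ?_ h3
        congr 1
        funext t
        exact (congrArg Prod.snd (hΦs q _ (ht' t))).symm)
    (fun q n p hp ht => by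
      have ht' : ∀ t, (p t).1.1 ∈ (κ q.1.1).source ∧ (p t).1.2 ∈ (b q.1.2).source := fun t => by
        have := ht t
        simp only [OpenPartialHomeomorph.trans_source, Set.mem_inter_iff] at this
        exact this.1
      refine L.contDiff.comp (ContDiff.prodMk ?_ ?_)
      · exact contDiff_snd.comp ((e q.1.1).contDiff.comp
          ((hκ q.1.1).plot n _ hp.1 fun t => (ht' t).1))
      · exact (hbc q.1.2).plot n _ hp.2 fun t => (ht' t).2)
  exact ⟨D, hD, hDp⟩

/-- A smooth structure on `Π₁(X)` for which the end point map is a local homeomorphism and the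
plots are the lifts of plots is the standard one. -/
theorem isPathStr_of_plots {P : SmoothStr (PathClass X)}
    (hl : IsLocalHomeomorph fun γ : PathClass X => (γ.tgt, γ.src))
    (h : ∀ n (p : Euc n → PathClass X), P.IsPlot p ↔
      Continuous p ∧ A.IsPlot (fun t => (p t).tgt) ∧ A.IsPlot (fun t => (p t).src)) :
    P.IsPathStr A := by
  let _ := A.charts
  let _ := P.charts
  have _ := A.isManifold
  have _ := P.isManifold
  intro x
  obtain ⟨e, he, hee⟩ := hl x
  have h1 : ContMDiff (𝓡 P.dim) (𝓡 A.dim) ∞ (fun γ : PathClass X => γ.tgt) :=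
    plotSmooth_iff.1 fun n p hp => ((h n p).1 hp).2.1
  have h2 : ContMDiff (𝓡 P.dim) (𝓡 A.dim) ∞ (fun γ : PathClass X => γ.src) :=
    plotSmooth_iff.1 fun n p hp => ((h n p).1 hp).2.2
  refine ⟨⟨e.toPartialEquiv, e.open_source, e.open_target, ?_, ?_⟩, he, fun y _ => congrFun hee y⟩
  · have h3 := (h1.prodMk h2).contMDiffOn (s := e.source)
    have : (e.toPartialEquiv.toFun) = fun γ : PathClass X => (γ.tgt, γ.src) := hee.symm
    rw [this]
    exact h3
  · refine contMDiffOn_of_plots e.open_target fun n p hp ht => ?_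
    have h4 : ∀ t, ((e.symm (p t)).tgt, (e.symm (p t)).src) = p t := fun t => by
      have := congrFun hee (e.symm (p t))
      exact this.trans (e.right_inv (ht t))
    refine (h n _).2 ⟨?_, ?_, ?_⟩
    · exact e.continuousOn_symm.comp_continuous hp.continuous ht
    · have : ContMDiff (𝓡 n) (𝓡 A.dim) ∞ (fun t => (p t).1) := contMDiff_fst.comp hp
      refine Eq.mp ?_ this
      change ContMDiff _ _ _ _ = ContMDiff _ _ _ _
      congr 1
      funext t
      exact (congrArg Prod.fst (h4 t)).symm
    · have : ContMDiff (𝓡 n) (𝓡 A.dim) ∞ (fun t => (p t).2) := contMDiff_snd.comp hp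
      refine Eq.mp ?_ this
      change ContMDiff _ _ _ _ = ContMDiff _ _ _ _
      congr 1
      funext t
      exact (congrArg Prod.snd (h4 t)).symm

/-- The smooth structure on `X` is the one for which the local homeomorphism `f : X → Y` is
étale. -/
structure IsLift (A : SmoothStr X) (B : SmoothStr Y) (f : X → Y) : Prop where
  isLocalHomeomorph : IsLocalHomeomorph f
  isPlot_iff : ∀ n (p : Euc n → X), A.IsPlot p ↔ Continuous p ∧ B.IsPlot (f ∘ p)

theorem exists_isLift {f : X → Y} (hf : IsLocalHomeomorph f) (B : SmoothStr Y) :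
    ∃ A : SmoothStr X, A.IsLift B f := by
  obtain ⟨A, -, hA⟩ := exists_of_isLocalHomeomorph hf B
  exact ⟨A, hf, hA⟩

section Lift

variable {E E' : Type*} [TopologicalSpace E] [TopologicalSpace E'] {D : SmoothStr E}
  {D' : SmoothStr E'} {f : E → X} {f' : E' → Y}

theorem IsLift.plotSmooth (h : D.IsLift A f) (h' : D'.IsLift B f') {F : E → E'} {F₀ : X → Y}
    (hF : Continuous F) (hc : ∀ x, f' (F x) = F₀ (f x)) (hF₀ : A.PlotSmooth B F₀) :
    D.PlotSmooth D' F := fun n p hp => (h'.isPlot_iff n _).2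
  ⟨hF.comp hp.continuous, by
    have := hF₀ n _ ((h.isPlot_iff n p).1 hp).2
    refine Eq.mp ?_ this
    congr 1
    funext t
    exact (hc (p t)).symm⟩

/-- A map between étale spaces over the same manifold is étale. -/
theorem IsLift.isEtale_of_comp {f' : E' → X} (h : D.IsLift A f) (h' : D'.IsLift A f') {F : E → E'}
    (hF : Continuous F) (hc : ∀ x, f' (F x) = f x) : D.IsEtale D' F := by
  have hc' : f' ∘ F = f := funext hc
  refine isEtale_of_isLocalHomeomorph (IsLocalHomeomorph.of_comp
    (by rw [hc']; exact h.isLocalHomeomorph) h'.isLocalHomeomorph hF) fun n p => ?_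
  rw [h.isPlot_iff, h'.isPlot_iff]
  have e : f' ∘ (F ∘ p) = f ∘ p := by rw [← hc']; rfl
  rw [e]
  exact ⟨fun hp => ⟨hp.1, hF.comp hp.1, hp.2⟩, fun hp => ⟨hp.1, hp.2.2⟩⟩

/-- A map between étale spaces that covers a submersion is a submersion. -/
theorem IsLift.hasLocalSections (h : D.IsLift A f) (h' : D'.IsLift B f') {F : E → E'}
    {F₀ : X → Y} (hF : Continuous F) (hc : ∀ x, f' (F x) = F₀ (f x))
    (hs : A.HasLocalSections B F₀) : D.HasLocalSections D' F := by
  intro x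
  obtain ⟨V, hV, hxV, s, hsx, hFs, hsp⟩ := hs (f x)
  have hsc := continuous_of_plots hV s hsp
  obtain ⟨e, he, hfe⟩ := h.isLocalHomeomorph x
  obtain ⟨U, hU, hxU, hinj⟩ := exists_isOpen_injOn h'.isLocalHomeomorph (F x)
  let O : Set X := e.target ∩ e.symm ⁻¹' (F ⁻¹' U)
  have hO : IsOpen O := e.continuousOn_symm.isOpen_inter_preimage e.open_target (hU.preimage hF)
  have hfx : f' (F x) ∈ V := by rw [hc]; exact hxV
  have hsfx : s ⟨f' (F x), hfx⟩ = f x := by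
    rw [← hsx]; congr 1; exact Subtype.ext (hc x)
  have hex : e.symm (f x) = x := by rw [hfe]; exact e.left_inv he
  let W : Set Y := Subtype.val '' (s ⁻¹' O)
  have hW : IsOpen W := hV.isOpenMap_subtype_val _ (hO.preimage hsc)
  have hWV : ∀ y (hy : y ∈ W), ∃ h : y ∈ V, s ⟨y, h⟩ ∈ O := by
    rintro _ ⟨y, hy, rfl⟩; exact ⟨y.2, hy⟩
  refine ⟨U ∩ f' ⁻¹' W, hU.inter (hW.preimage h'.isLocalHomeomorph.continuous), ⟨hxU, ?_⟩,
    fun z => e.symm (s ⟨f' z, (hWV _ z.2.2).1⟩), ?_, fun z => ?_, fun n p hp hpl => ?_⟩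
  · refine ⟨⟨f' (F x), hfx⟩, ?_, rfl⟩
    change s _ ∈ O
    rw [hsfx]
    refine ⟨by rw [hfe]; exact e.map_source he, ?_⟩
    rw [Set.mem_preimage, hex]; exact hxU
  · simp only [hsfx, hex]
  · obtain ⟨hz, hz'⟩ := hWV _ z.2.2
    refine hinj hz'.2 z.2.1 ?_
    rw [hc]
    have : f (e.symm (s ⟨f' z, hz⟩)) = s ⟨f' z, hz⟩ := by
      rw [hfe]; exact e.right_inv hz'.1
    rw [this, hFs]
  · have hz := fun t => hWV _ (hp t).2
    have h1 := hsp n (f' ∘ p) (fun t => (hz t).1) ((h'.isPlot_iff n p).1 hpl).2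
    refine (h.isPlot_iff n _).2 ⟨?_, ?_⟩
    · exact e.continuousOn_symm.comp_continuous h1.continuous fun t => (hz t).2.1
    · refine Eq.mp ?_ h1
      congr 1
      funext t
      have : f (e.symm (s ⟨f' (p t), (hz t).1⟩)) = s ⟨f' (p t), (hz t).1⟩ := by
        rw [hfe]; exact e.right_inv (hz t).2.1
      exact this.symm

end Lift

end SmoothStr

/-! ### Calculus in groupoids -/

namespace InternalGroupoid

variable {A : Type u} {O : Type v} (Γ : InternalGroupoid A O)

attribute [simp] src_one tgt_one src_inv tgt_inv

open Classical in
/-- The product as a total operation; its value is `a` if the product of `a` and `b` is not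
defined. -/
def comp (a b : A) : A := if h : Γ.src a = Γ.tgt b then Γ.mul a b h else a

variable {Γ} {a b c : A}

theorem comp_eq (h : Γ.src a = Γ.tgt b) : Γ.comp a b = Γ.mul a b h := dif_pos h

@[simp]
theorem tgt_comp : Γ.tgt (Γ.comp a b) = Γ.tgt a := by
  by_cases h : Γ.src a = Γ.tgt b
  · rw [comp_eq h, Γ.tgt_mul]
  · rw [comp, dif_neg h]

@[simp]
theorem src_comp (h : Γ.src a = Γ.tgt b) : Γ.src (Γ.comp a b) = Γ.src b := by
  rw [comp_eq h, Γ.src_mul]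

theorem comp_assoc (h₁ : Γ.src a = Γ.tgt b) (h₂ : Γ.src b = Γ.tgt c) :
    Γ.comp (Γ.comp a b) c = Γ.comp a (Γ.comp b c) := by
  have h₃ : Γ.src (Γ.mul a b h₁) = Γ.tgt c := by rw [Γ.src_mul, h₂]
  have h₄ : Γ.src a = Γ.tgt (Γ.mul b c h₂) := by rw [Γ.tgt_mul, h₁]
  rw [comp_eq h₁, comp_eq h₂, comp_eq h₃, comp_eq h₄, Γ.mul_assoc]

theorem one_comp {x : O} (h : x = Γ.tgt a) : Γ.comp (Γ.one x) a = a := by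
  subst h
  rw [comp_eq (Γ.src_one _), Γ.one_mul]

theorem comp_one {x : O} (h : Γ.src a = x) : Γ.comp a (Γ.one x) = a := by
  subst h
  rw [comp_eq (Γ.tgt_one _).symm, Γ.mul_one]

theorem inv_comp : Γ.comp (Γ.inv a) a = Γ.one (Γ.src a) := by
  rw [comp_eq (Γ.src_inv _), Γ.inv_mul]

theorem comp_inv : Γ.comp a (Γ.inv a) = Γ.one (Γ.tgt a) := by
  rw [comp_eq (Γ.tgt_inv _).symm, Γ.mul_inv]

theorem inv_comp_cancel (h : Γ.src a = Γ.tgt b) : Γ.comp (Γ.inv a) (Γ.comp a b) = b := by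
  rw [← comp_assoc (Γ.src_inv _) h, inv_comp, one_comp h]

theorem comp_inv_cancel (h : Γ.tgt a = Γ.tgt b) : Γ.comp a (Γ.comp (Γ.inv a) b) = b := by
  rw [← comp_assoc (Γ.tgt_inv _).symm (by simpa using h), comp_inv, one_comp h]

theorem comp_inv_cancel_right (h : Γ.src a = Γ.tgt b) : Γ.comp (Γ.comp a b) (Γ.inv b) = a := by
  rw [comp_assoc h (Γ.tgt_inv _).symm, comp_inv, comp_one h]

theorem inv_comp_cancel_right (h : Γ.src a = Γ.src b) : Γ.comp (Γ.comp a (Γ.inv b)) b = a := by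
  rw [comp_assoc (by simpa using h) (Γ.src_inv _), inv_comp, comp_one h]

theorem comp_left_cancel (h₁ : Γ.src a = Γ.tgt b) (h₂ : Γ.src a = Γ.tgt c)
    (h : Γ.comp a b = Γ.comp a c) : b = c := by
  rw [← inv_comp_cancel h₁, h, inv_comp_cancel h₂]

theorem comp_right_cancel (h₁ : Γ.src a = Γ.tgt c) (h₂ : Γ.src b = Γ.tgt c)
    (h : Γ.comp a c = Γ.comp b c) : a = b := by
  rw [← comp_inv_cancel_right h₁, h, comp_inv_cancel_right h₂]

theorem eq_inv_of_comp (h₁ : Γ.src a = Γ.tgt b) {x : O} (h : Γ.comp a b = Γ.one x) :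
    a = Γ.inv b := by
  have hx : Γ.tgt a = x := by simpa using congrArg Γ.tgt h
  have hx' : Γ.src b = x := by simpa [h₁] using congrArg Γ.src h
  have := comp_inv_cancel_right h₁
  rw [h, one_comp (by rw [Γ.tgt_inv, hx'])] at this
  exact this.symm

@[simp]
theorem inv_inv_eq : Γ.inv (Γ.inv a) = a :=
  (eq_inv_of_comp (Γ.tgt_inv a).symm comp_inv).symm

@[simp]
theorem inv_one_eq (x : O) : Γ.inv (Γ.one x) = Γ.one x :=
  (eq_inv_of_comp (x := x) (by simp) (one_comp (Γ.tgt_one _).symm)).symm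

theorem inv_comp_rev (h : Γ.src a = Γ.tgt b) :
    Γ.inv (Γ.comp a b) = Γ.comp (Γ.inv b) (Γ.inv a) := by
  refine (eq_inv_of_comp (x := Γ.src b) (by simp [h]) ?_).symm
  rw [comp_assoc (by simp [h]) (by simp), inv_comp_cancel h, inv_comp]

theorem comp_comp_conj {x y z w : A} (h₁ : Γ.src x = Γ.tgt y) (h₂ : Γ.src y = Γ.tgt a)
    (h₃ : Γ.src a = Γ.tgt z) (h₄ : Γ.src z = Γ.tgt w) :
    Γ.comp (Γ.comp (Γ.comp x y) a) (Γ.comp z w) =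
      Γ.comp (Γ.comp x (Γ.comp (Γ.comp y a) z)) w := by
  rw [comp_assoc h₁ h₂, ← comp_assoc (a := Γ.comp x _) (by simp [*]) h₄,
    comp_assoc (a := x) (by simp [*]) (by simp [*])]

theorem IsTopological.continuous_comp [TopologicalSpace A] [TopologicalSpace O]
    (h : Γ.IsTopological) {Z : Type*} [TopologicalSpace Z] {f g : Z → A} (hf : Continuous f)
    (hg : Continuous g) (hfg : ∀ z, Γ.src (f z) = Γ.tgt (g z)) :
    Continuous fun z => Γ.comp (f z) (g z) := by
  have := h.continuous_mul.comp ((hf.prodMk hg).subtype_mk hfg)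
  refine this.congr fun z => ?_
  exact (comp_eq (hfg z)).symm

/-! ### Groupoids that are étale over the pair groupoid -/

/-- The topology on the arrows of `Γ` is the one for which `(t, s)` is étale, expressed by local
families of arrows: `τ x v` is an arrow from `x` to `v`, for `v` near `x`, and the neighbors of an
arrow `a` are the products `τ v · a · (τ u)⁻¹`. -/
structure IsEtaleVia [TopologicalSpace A] [TopologicalSpace O] (Γ : InternalGroupoid A O)
    (τ : O → O → A) : Prop where
  self : ∀ x, τ x x = Γ.one x
  ends : ∀ x, ∀ᶠ v in 𝓝 x, Γ.src (τ x v) = x ∧ Γ.tgt (τ x v) = v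
  nhds : ∀ a, 𝓝 a = Filter.map (fun z : O × O => Γ.comp (Γ.comp (τ (Γ.tgt a) z.1) a)
    (Γ.inv (τ (Γ.src a) z.2))) (𝓝 (Γ.tgt a, Γ.src a))

namespace IsEtaleVia

variable [TopologicalSpace A] [TopologicalSpace O] {τ : O → O → A}

theorem eventually_ends (h : Γ.IsEtaleVia τ) (a : A) : ∀ᶠ z in 𝓝 (Γ.tgt a, Γ.src a),
    (Γ.src (τ (Γ.tgt a) z.1) = Γ.tgt a ∧ Γ.tgt (τ (Γ.tgt a) z.1) = z.1) ∧
    (Γ.src (τ (Γ.src a) z.2) = Γ.src a ∧ Γ.tgt (τ (Γ.src a) z.2) = z.2) := by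
  rw [nhds_prod_eq]
  exact (h.ends (Γ.tgt a)).prod_mk (h.ends (Γ.src a))

/-- The map `(v, u) ↦ τ v · a · (τ u)⁻¹` is a section of `(t, s)`. -/
theorem eventually_eq (h : Γ.IsEtaleVia τ) (a : A) : ∀ᶠ z in 𝓝 (Γ.tgt a, Γ.src a),
    (Γ.tgt (Γ.comp (Γ.comp (τ (Γ.tgt a) z.1) a) (Γ.inv (τ (Γ.src a) z.2))),
      Γ.src (Γ.comp (Γ.comp (τ (Γ.tgt a) z.1) a) (Γ.inv (τ (Γ.src a) z.2)))) = z := by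
  filter_upwards [h.eventually_ends a] with z hz
  refine Prod.ext ?_ ?_
  · simp [hz.1.2]
  · simp [hz.1.1, hz.2.1, hz.2.2]

theorem eventually_nhds (h : Γ.IsEtaleVia τ) (a : A) : ∀ᶠ b in 𝓝 a,
    Γ.src (τ (Γ.tgt a) (Γ.tgt b)) = Γ.tgt a ∧ Γ.tgt (τ (Γ.tgt a) (Γ.tgt b)) = Γ.tgt b ∧
    Γ.src (τ (Γ.src a) (Γ.src b)) = Γ.src a ∧ Γ.tgt (τ (Γ.src a) (Γ.src b)) = Γ.src b ∧
    b = Γ.comp (Γ.comp (τ (Γ.tgt a) (Γ.tgt b)) a) (Γ.inv (τ (Γ.src a) (Γ.src b))) := by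
  rw [h.nhds, Filter.eventually_map]
  filter_upwards [h.eventually_eq a, h.eventually_ends a] with z hz hz'
  have e1 := congrArg Prod.fst hz
  have e2 := congrArg Prod.snd hz
  dsimp only at e1 e2
  rw [e1, e2]
  exact ⟨hz'.1.1, hz'.1.2, hz'.2.1, hz'.2.2, rfl⟩

theorem tendsto (h : Γ.IsEtaleVia τ) (a : A) : Filter.Tendsto (fun z : O × O => Γ.comp (Γ.comp (τ (Γ.tgt a) z.1) a)
    (Γ.inv (τ (Γ.src a) z.2))) (𝓝 (Γ.tgt a, Γ.src a)) (𝓝 a) := by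
  rw [h.nhds a]; exact Filter.tendsto_map

theorem map_nhds (h : Γ.IsEtaleVia τ) (a : A) :
    Filter.map (fun a => (Γ.tgt a, Γ.src a)) (𝓝 a) = 𝓝 (Γ.tgt a, Γ.src a) := by
  rw [h.nhds, Filter.map_map]
  conv_rhs => rw [← Filter.map_id (f := 𝓝 (Γ.tgt a, Γ.src a))]
  refine Filter.map_congr ?_
  filter_upwards [h.eventually_eq a] with z hz
  exact hz

theorem continuous_ends (h : Γ.IsEtaleVia τ) : Continuous fun a => (Γ.tgt a, Γ.src a) :=
  continuous_iff_continuousAt.2 fun a => (h.map_nhds a).le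

theorem isLocalHomeomorph (h : Γ.IsEtaleVia τ) : IsLocalHomeomorph fun a => (Γ.tgt a, Γ.src a) := by
  refine isLocalHomeomorph_of_isOpenMap h.continuous_ends
    (isOpenMap_iff_nhds_le.2 fun a => (h.map_nhds a).ge) fun a => ?_
  refine ⟨_, h.eventually_nhds a, fun b hb c hc hbc => ?_⟩
  have h1 : Γ.tgt b = Γ.tgt c := congrArg Prod.fst hbc
  have h2 : Γ.src b = Γ.src c := congrArg Prod.snd hbc
  rw [hb.2.2.2.2, hc.2.2.2.2, h1, h2]

/-- All structure maps are determined near an arrow by their effect on source and target, since the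
local families `τ` cancel in the formulas. -/
theorem isTopological (h : Γ.IsEtaleVia τ) : Γ.IsTopological where
  continuous_src := continuous_snd.comp h.continuous_ends
  continuous_tgt := continuous_fst.comp h.continuous_ends
  continuous_one := by
    refine continuous_iff_continuousAt.2 fun x => ?_
    have h1 := h.tendsto (Γ.one x)
    rw [Γ.src_one, Γ.tgt_one] at h1
    have h2 : Filter.Tendsto (fun v : O => (v, v)) (𝓝 x) (𝓝 (x, x)) :=
      (continuous_id.prodMk continuous_id).tendsto x
    refine (h1.comp h2).congr' ?_
    filter_upwards [h.ends x] with v hv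
    simp only [Function.comp]
    rw [comp_one hv.1, comp_inv, hv.2]
  continuous_inv := by
    refine continuous_iff_continuousAt.2 fun a => ?_
    have h1 := h.tendsto (Γ.inv a)
    rw [Γ.src_inv, Γ.tgt_inv] at h1
    have h2 : Filter.Tendsto (fun b => (Γ.src b, Γ.tgt b)) (𝓝 a) (𝓝 (Γ.src a, Γ.tgt a)) :=
      (continuous_swap.comp h.continuous_ends).tendsto a
    refine (h1.comp h2).congr' ?_
    filter_upwards [h.eventually_nhds a] with b hb
    obtain ⟨e1, e2, e3, e4, e5⟩ := hb
    simp only [Function.comp]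
    conv_rhs => rw [e5]
    rw [inv_comp_rev (by simp [e1, e3]), inv_comp_rev e1, inv_inv_eq,
      comp_assoc (by simp [e3]) (by simp [e1])]
  continuous_mul := by
    refine continuous_iff_continuousAt.2 fun p => ?_
    obtain ⟨⟨a, b⟩, hab⟩ := p
    have hab' : Γ.src a = Γ.tgt b := hab
    have h1 := h.tendsto (Γ.comp a b)
    rw [tgt_comp, src_comp hab] at h1
    have hfst : Filter.Tendsto (fun p : {p : A × A // Γ.src p.1 = Γ.tgt p.2} => p.1.1)
        (𝓝 ⟨(a, b), hab⟩) (𝓝 a) := (continuous_fst.comp continuous_subtype_val).tendsto _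
    have hsnd : Filter.Tendsto (fun p : {p : A × A // Γ.src p.1 = Γ.tgt p.2} => p.1.2)
        (𝓝 ⟨(a, b), hab⟩) (𝓝 b) := (continuous_snd.comp continuous_subtype_val).tendsto _
    have h2 : Filter.Tendsto (fun p : {p : A × A // Γ.src p.1 = Γ.tgt p.2} =>
        (Γ.tgt p.1.1, Γ.src p.1.2)) (𝓝 ⟨(a, b), hab⟩) (𝓝 (Γ.tgt a, Γ.src b)) :=
      (((continuous_fst.comp h.continuous_ends).tendsto a).comp hfst).prodMk_nhds
        (((continuous_snd.comp h.continuous_ends).tendsto b).comp hsnd)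
    have h3 := h1.comp h2
    rw [comp_eq hab] at h3
    refine h3.congr' ?_
    filter_upwards [hfst.eventually (h.eventually_nhds a), hsnd.eventually (h.eventually_nhds b)]
      with p ha hb
    obtain ⟨⟨a', b'⟩, hp⟩ := p
    obtain ⟨e1, e2, e3, e4, e5⟩ := ha
    obtain ⟨f1, f2, f3, f4, f5⟩ := hb
    have hp' : Γ.src a' = Γ.tgt b' := hp
    simp only [Function.comp] at *
    rw [← comp_eq hp']
    -- the two middle factors cancel
    rw [← hab', ← hp'] at f5 f1 f2
    generalize τ (Γ.src a) (Γ.src a') = m at *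
    generalize τ (Γ.tgt a) (Γ.tgt a') = l at *
    generalize τ (Γ.src b) (Γ.src b') = r at *
    conv_rhs => rw [e5, f5]
    rw [comp_assoc (c := Γ.comp (Γ.comp m b) (Γ.inv r)) (by simp [e1, e3]) (by simp),
      comp_assoc (a := m) (by simp [f1, hab']) (by simp [f3]), inv_comp_cancel (by simp [f1, hab']),
      ← comp_assoc (by simp [e1, hab']) (by simp [f3]), comp_assoc (a := l) e1 hab', comp_eq hab]

end IsEtaleVia

end InternalGroupoid

/-! ### Path classes in locally simply connected spaces -/

namespace PathClass

open InternalGroupoid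

variable {X : Type u} [TopologicalSpace X] {Y : Type v} [TopologicalSpace Y]

@[simp] theorem pi1_src (γ : PathClass X) : (Pi1 X).src γ = γ.src := rfl
@[simp] theorem pi1_tgt (γ : PathClass X) : (Pi1 X).tgt γ = γ.tgt := rfl
@[simp] theorem src_mk' (p : C(I, X)) : (mk' p).src = p 0 := rfl
@[simp] theorem tgt_mk' (p : C(I, X)) : (mk' p).tgt = p 1 := rfl
@[simp] theorem src_map (f : C(X, Y)) (γ : PathClass X) : (map f γ).src = f γ.src := rfl
@[simp] theorem tgt_map (f : C(X, Y)) (γ : PathClass X) : (map f γ).tgt = f γ.tgt := rfl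

@[simp] theorem src_comp' {a b : PathClass X} (h : a.src = b.tgt) : ((Pi1 X).comp a b).src = b.src :=
  InternalGroupoid.src_comp (Γ := Pi1 X) h

@[simp] theorem tgt_comp' {a b : PathClass X} : ((Pi1 X).comp a b).tgt = a.tgt :=
  InternalGroupoid.tgt_comp (Γ := Pi1 X)

@[simp] theorem src_inv' {a : PathClass X} : ((Pi1 X).inv a).src = a.tgt := rfl
@[simp] theorem tgt_inv' {a : PathClass X} : ((Pi1 X).inv a).tgt = a.src := rfl
@[simp] theorem src_one' {x : X} : ((Pi1 X).one x).src = x := rfl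
@[simp] theorem tgt_one' {x : X} : ((Pi1 X).one x).tgt = x := rfl

theorem map_comp (f : C(X, Y)) {a b : PathClass X} (h : a.src = b.tgt) :
    map f ((Pi1 _).comp a b) = (Pi1 _).comp (map f a) (map f b) := by
  rw [comp_eq (Γ := Pi1 X) h, comp_eq (Γ := Pi1 Y) (a := map f a) (b := map f b) (congrArg f h)]
  exact map_mul f a b h (congrArg f h)

theorem map_pi1_one (f : C(X, Y)) (x : X) : map f ((Pi1 X).one x) = (Pi1 Y).one (f x) := rfl

theorem map_inv (f : C(X, Y)) (a : PathClass X) : map f ((Pi1 X).inv a) = (Pi1 Y).inv (map f a) := by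
  refine eq_inv_of_comp (Γ := Pi1 Y) (x := f a.src) rfl ?_
  exact (map_comp f (a := (Pi1 X).inv a) (b := a) rfl).symm.trans
    (congrArg (map f) (inv_comp (Γ := Pi1 X)))

theorem mk'_path {x y : X} (p : Path x y) :
    mk' p.toContinuousMap = ⟨x, y, Path.Homotopic.Quotient.mk p⟩ := by
  obtain ⟨p, rfl, rfl⟩ := p
  rfl

theorem mk'_const (x : X) : mk' (.const I x) = (Pi1 X).one x := rfl

theorem comp_mk' {p q : C(I, X)} (h : q 1 = p 0) : (Pi1 _).comp (mk' p) (mk' q) = mk' (pathComp p q h) := by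
  rw [comp_eq (Γ := Pi1 X) (a := mk' p) (b := mk' q) h.symm, pathComp, mk'_path]
  rfl

theorem inv_mk' (p : C(I, X)) :
    (Pi1 X).inv (mk' p) = mk' (Path.symm (⟨p, rfl, rfl⟩ : Path (p 0) (p 1))).toContinuousMap := by
  rw [mk'_path]
  rfl

theorem mk'_eq_of_homotopy {p q : C(I, X)} (F : C(I × I, X)) (h₀ : ∀ s, F (0, s) = p s)
    (h₁ : ∀ s, F (1, s) = q s) (k₀ : ∀ t, F (t, 0) = p 0) (k₁ : ∀ t, F (t, 1) = p 1) :
    mk' p = mk' q := by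
  have e0 : q 0 = p 0 := by rw [← h₁, k₀]
  have e1 : q 1 = p 1 := by rw [← h₁, k₁]
  have : mk' q = mk' (⟨q, e0, e1⟩ : Path (p 0) (p 1)).toContinuousMap := rfl
  rw [this, mk'_path]
  change PathClass.mk _ _ _ = PathClass.mk _ _ _
  congr 1
  refine Quotient.sound ⟨⟨⟨F, h₀, h₁⟩, ?_⟩⟩
  rintro t s (rfl | rfl)
  · exact k₀ t
  · exact k₁ t

theorem continuous_pathComp {Z : Type*} [TopologicalSpace Z] {f g : Z → C(I, X)}
    (hf : Continuous f) (hg : Continuous g) (h : ∀ z, g z 1 = f z 0) :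
    Continuous fun z => pathComp (f z) (g z) (h z) := by
  refine ContinuousMap.continuous_of_continuous_uncurry _ ?_
  exact Path.trans_continuous_family
    (fun z => (⟨g z, rfl, rfl⟩ : Path (g z 0) (g z 1)))
    (ContinuousEval.continuous_eval.comp (hg.prodMap continuous_id))
    (fun z => (⟨f z, (h z).symm, rfl⟩ : Path (g z 1) (f z 1)))
    (ContinuousEval.continuous_eval.comp (hf.prodMap continuous_id))

theorem continuous_pathSymm : Continuous fun p : C(I, X) =>
    (Path.symm (⟨p, rfl, rfl⟩ : Path (p 0) (p 1))).toContinuousMap := by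
  have : (fun p : C(I, X) => (Path.symm (⟨p, rfl, rfl⟩ : Path (p 0) (p 1))).toContinuousMap) =
      fun p : C(I, X) => p.comp ⟨unitInterval.symm, unitInterval.continuous_symm⟩ := by
    funext p; rfl
  rw [this]
  exact ContinuousMap.continuous_precomp _

/-- The class `γ` can be represented by a path in `V`. -/
def InSet (V : Set X) (γ : PathClass X) : Prop := ∃ p : C(I, X), (∀ s, p s ∈ V) ∧ mk' p = γ

theorem InSet.mono {V W : Set X} (h : V ⊆ W) {γ : PathClass X} (hγ : InSet V γ) : InSet W γ := by
  obtain ⟨p, hp, rfl⟩ := hγ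
  exact ⟨p, fun s => h (hp s), rfl⟩

theorem InSet.comp {V : Set X} {a b : PathClass X} (ha : InSet V a) (hb : InSet V b)
    (h : a.src = b.tgt) : InSet V ((Pi1 X).comp a b) := by
  obtain ⟨p, hp, rfl⟩ := ha
  obtain ⟨q, hq, rfl⟩ := hb
  refine ⟨pathComp p q h.symm, fun s => ?_, (comp_mk' h.symm).symm⟩
  change (Path.trans _ _) s ∈ V
  rw [Path.trans_apply]
  split_ifs
  · exact hq _
  · exact hp _

theorem InSet.map {V : Set X} {W : Set Y} {a : PathClass X} (ha : InSet V a) (f : C(X, Y))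
    (h : ∀ x ∈ V, f x ∈ W) : InSet W (map f a) := by
  obtain ⟨p, hp, rfl⟩ := ha
  exact ⟨f.comp p, fun s => h _ (hp s), rfl⟩

/-- Paths in `V` with the same end points are homotopic in `X`. -/
def IsSimple (V : Set X) : Prop :=
  ∀ γ γ' : PathClass X, InSet V γ → InSet V γ' → γ.src = γ'.src → γ.tgt = γ'.tgt → γ = γ'

end PathClass

open PathClass InternalGroupoid

/-- Each point of `X` has arbitrarily small neighborhoods `V` with a continuous choice of paths in
`V` from the point to the points of `V`, and such that paths in `V` with the same end points are
homotopic. -/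
class LocallySimple (X : Type u) [TopologicalSpace X] : Prop where
  exists_nhd : ∀ x : X, ∀ U ∈ 𝓝 x, ∃ V ⊆ U, IsOpen V ∧ x ∈ V ∧ IsSimple V ∧
    ∃ τ : V → C(I, X), Continuous τ ∧ ∀ v, τ v 0 = x ∧ τ v 1 = v ∧ ∀ s, τ v s ∈ V

/-- The preimages of small balls under a chart are simple; the paths are straight in the chart. -/
theorem SmoothStr.locallySimple {X : Type u} [TopologicalSpace X] (A : SmoothStr X) :
    LocallySimple X := by
  refine ⟨fun x U hU => ?_⟩
  obtain ⟨κ, hx, -⟩ := A.exists_chart x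
  obtain ⟨U', hU', hUo, hxU⟩ := mem_nhds_iff.1 hU
  have ho : IsOpen (κ.target ∩ κ.symm ⁻¹' U') :=
    κ.continuousOn_symm.isOpen_inter_preimage κ.open_target hUo
  obtain ⟨r, hr, hb⟩ := Metric.isOpen_iff.1 ho (κ x)
    ⟨κ.map_source hx, by rw [Set.mem_preimage, κ.left_inv hx]; exact hxU⟩
  let V : Set X := κ.source ∩ κ ⁻¹' Metric.ball (κ x) r
  have hV : IsOpen V := κ.continuousOn.isOpen_inter_preimage κ.open_source Metric.isOpen_ball
  have hVt : ∀ y ∈ Metric.ball (κ x) r, κ.symm y ∈ V := fun y hy =>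
    ⟨κ.map_target (hb hy).1, by rw [Set.mem_preimage, κ.right_inv (hb hy).1]; exact hy⟩
  have hconv : ∀ y ∈ Metric.ball (κ x) r, ∀ z ∈ Metric.ball (κ x) r, ∀ t : I,
      (1 - (t : ℝ)) • y + (t : ℝ) • z ∈ Metric.ball (κ x) r := fun y hy z hz t =>
    (convex_ball (κ x) r) hy hz (by linarith [t.2.2]) t.2.1 (by ring)
  have hsc : ContinuousOn κ.symm (Metric.ball (κ x) r) :=
    κ.continuousOn_symm.mono fun y hy => (hb hy).1
  refine ⟨V, fun y hy => hU' ?_, hV, ⟨hx, Metric.mem_ball_self hr⟩, ?_, ?_⟩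
  · have := (hb hy.2).2
    rwa [Set.mem_preimage, κ.left_inv hy.1] at this
  · rintro _ _ ⟨p, hp, rfl⟩ ⟨q, hq, rfl⟩ h0 h1
    have hκp : Continuous fun s => κ (p s) := κ.continuousOn.comp_continuous p.continuous
      fun s => (hp s).1
    have hκq : Continuous fun s => κ (q s) := κ.continuousOn.comp_continuous q.continuous
      fun s => (hq s).1
    refine mk'_eq_of_homotopy ⟨fun z => κ.symm ((1 - (z.1 : ℝ)) • κ (p z.2) + (z.1 : ℝ) • κ (q z.2)),
      hsc.comp_continuous ?_ fun z => hconv _ (hp _).2 _ (hq _).2 _⟩ ?_ ?_ ?_ ?_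
    · exact ((continuous_const.sub (continuous_subtype_val.comp continuous_fst)).smul
        (hκp.comp continuous_snd)).add ((continuous_subtype_val.comp continuous_fst).smul
        (hκq.comp continuous_snd))
    · intro s
      simp [κ.left_inv (hp s).1]
    · intro s
      simp [κ.left_inv (hq s).1]
    · intro t
      have h0' : q 0 = p 0 := h0.symm
      simp only [ContinuousMap.coe_mk, h0', ← add_smul]
      simp [κ.left_inv (hp 0).1]
    · intro t
      have h0' : q 1 = p 1 := h1.symm
      simp only [ContinuousMap.coe_mk, h0', ← add_smul]
      simp [κ.left_inv (hp 1).1]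
  · let f : V × I → X := fun z =>
      κ.symm ((1 - (z.2 : ℝ)) • κ x + (z.2 : ℝ) • κ z.1)
    have hf : Continuous f := by
      refine hsc.comp_continuous ?_ fun z => hconv _ (Metric.mem_ball_self hr) _ z.1.2.2 _
      have hκ : Continuous fun v : V => κ v := κ.continuousOn.comp_continuous
        continuous_subtype_val fun v => v.2.1
      exact ((continuous_const.sub (continuous_subtype_val.comp continuous_snd)).smul
        continuous_const).add ((continuous_subtype_val.comp continuous_snd).smul
        (hκ.comp continuous_fst))
    refine ⟨fun v => (ContinuousMap.curry ⟨f, hf⟩) v, ContinuousMap.continuous _, fun v =>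
      ⟨?_, ?_, fun s => ?_⟩⟩
    · simp [f, κ.left_inv hx]
    · simp [f, κ.left_inv v.2.1]
    · exact hVt _ (hconv _ (Metric.mem_ball_self hr) _ v.2.2 _)

section Line

/-- The affine path from `a` to `b` in the unit interval. -/
def linePath (a b : I) : C(I, I) :=
  ⟨fun s => ⟨(1 - (s : ℝ)) * a + s * b, by
    have := convex_Icc (0 : ℝ) 1 a.2 b.2 (by linarith [s.2.2] : 0 ≤ 1 - (s : ℝ)) s.2.1 (by ring)
    simpa using this⟩, by fun_prop⟩

/-- The class of paths from `a` to `b` in the unit interval. -/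
def line (a b : I) : PathClass I := mk' (linePath a b)

@[simp] theorem src_line (a b : I) : (line a b).src = a := Subtype.ext (by simp [line, linePath])
@[simp] theorem tgt_line (a b : I) : (line a b).tgt = b := Subtype.ext (by simp [line, linePath])

theorem inSet_line {a b : I} (h : a ≤ b) : InSet (Set.Icc a b) (line a b) := by
  refine ⟨linePath a b, fun s => ?_, rfl⟩
  have hab : (a : ℝ) ≤ b := h
  have h1 := convex_Icc (a : ℝ) b ⟨le_rfl, hab⟩ ⟨hab, le_rfl⟩
    (by linarith [s.2.2] : 0 ≤ 1 - (s : ℝ)) s.2.1 (by ring)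
  exact ⟨h1.1, h1.2⟩

theorem isSimple_unitInterval : IsSimple (Set.univ : Set I) := by
  rintro ⟨a, b, γ⟩ ⟨a', b', γ'⟩ - - h h'
  obtain rfl : a = a' := h
  obtain rfl : b = b' := h'
  congr 1
  have : ContractibleSpace I := (convex_Icc (0 : ℝ) 1).contractibleSpace ⟨0, by simp⟩
  exact Subsingleton.elim _ _

theorem eq_line (γ : PathClass I) : γ = line γ.src γ.tgt := by
  obtain ⟨p, rfl⟩ := mk'_surjective γ
  exact isSimple_unitInterval _ _ ⟨_, fun _ => trivial, rfl⟩ ⟨_, fun _ => trivial, rfl⟩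
    (src_line _ _).symm (tgt_line _ _).symm

theorem line_comp (a b c : I) : (Pi1 _).comp (line b c) (line a b) = line a c := by
  rw [eq_line ((Pi1 _).comp _ _)]; simp

theorem line_self (a : I) : line a a = (Pi1 I).one a := by
  rw [eq_line ((Pi1 I).one a)]; simp

theorem map_line {X : Type u} [TopologicalSpace X] (p : C(I, X)) : map p (line 0 1) = mk' p := by
  have : line 0 1 = mk' (ContinuousMap.id I) := by
    rw [eq_line (mk' (ContinuousMap.id I))]; simp
  rw [this]; rfl

end Line

section

variable {X : Type u} [TopologicalSpace X] [LocallySimple X]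

/-- A path `q` near `p` is homotopic to `p`, up to short paths between the end points. -/
theorem eventually_mk'_eq (p : C(I, X)) {V V' : Set X} (hV : V ∈ 𝓝 (p 1)) (hV' : V' ∈ 𝓝 (p 0)) :
    ∀ᶠ q in 𝓝 p, ∃ a b : PathClass X, InSet V a ∧ InSet V' b ∧ a.src = p 1 ∧ a.tgt = q 1 ∧
      b.src = p 0 ∧ b.tgt = q 0 ∧ (Pi1 _).comp (mk' q) b = (Pi1 _).comp a (mk' p) := by
  choose S hSU hSo hxS hS τ hτ hτ' using fun x : X => LocallySimple.exists_nhd x Set.univ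
    Filter.univ_mem
  obtain ⟨t, ht0, htm, ⟨m, hm⟩, htc⟩ := exists_monotone_Icc_subset_open_cover_unitInterval
    (c := fun s : I => p ⁻¹' S (p s)) (fun s => (hSo _).preimage p.continuous)
    (fun s _ => Set.mem_iUnion.2 ⟨s, hxS _⟩)
  have key : ∀ n, ∀ V ∈ 𝓝 (p (t n)), ∀ᶠ q in 𝓝 p, ∃ a b : PathClass X, InSet V a ∧ InSet V' b ∧
      a.src = p (t n) ∧ a.tgt = q (t n) ∧ b.src = p 0 ∧ b.tgt = q 0 ∧
      (Pi1 _).comp (map q (line 0 (t n))) b = (Pi1 _).comp a (map p (line 0 (t n))) := by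
    intro n
    induction n with
    | zero =>
      intro V hV
      rw [ht0] at hV ⊢
      obtain ⟨W, hW, hWo, hpW, -, φ, -, hφ⟩ := LocallySimple.exists_nhd (p 0) (V ∩ V')
        (Filter.inter_mem hV hV')
      filter_upwards [(continuous_eval_const (F := C(I, X)) (0 : I)).continuousAt.eventually
        (hWo.mem_nhds hpW)] with q hq
      have hi : InSet W (mk' (φ ⟨q 0, hq⟩)) := ⟨_, (hφ _).2.2, rfl⟩
      refine ⟨_, _, hi.mono fun y hy => (hW hy).1, hi.mono fun y hy => (hW hy).2, (hφ _).1,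
        (hφ _).2.1, (hφ _).1, (hφ _).2.1, ?_⟩
      rw [line_self, map_pi1_one, map_pi1_one]
      exact (one_comp (Γ := Pi1 X) (hφ ⟨q 0, hq⟩).2.1.symm).trans
        (comp_one (Γ := Pi1 X) (a := mk' (φ ⟨q 0, hq⟩)) (hφ ⟨q 0, hq⟩).1).symm
    | succ n ih =>
      intro V hV
      obtain ⟨i, hi⟩ := htc n
      have hle : t n ≤ t (n + 1) := htm (Nat.le_succ n)
      have hmem : ∀ s ∈ Set.Icc (t n) (t (n + 1)), p s ∈ S (p i) := fun s hs => hi hs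
      obtain ⟨W, hW, hWo, hpW, -, φ, -, hφ⟩ := LocallySimple.exists_nhd (p (t (n + 1)))
        (V ∩ S (p i)) (Filter.inter_mem hV ((hSo _).mem_nhds (hmem _ ⟨hle, le_rfl⟩)))
      filter_upwards [(continuous_eval_const (F := C(I, X)) (t (n + 1))).continuousAt.eventually
        (hWo.mem_nhds hpW), ih (S (p i)) ((hSo _).mem_nhds (hmem _ ⟨le_rfl, hle⟩)),
        ContinuousMap.eventually_mapsTo isCompact_Icc (hSo (p i)) hmem] with q hq hq' hq''
      obtain ⟨a, b, ha, hb, ha0, ha1, hb0, hb1, hab⟩ := hq'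
      have hin : InSet W (mk' (φ ⟨q (t (n + 1)), hq⟩)) := ⟨_, (hφ _).2.2, rfl⟩
      have h0 : (mk' (φ ⟨q (t (n + 1)), hq⟩)).src = p (t (n + 1)) := (hφ _).1
      have h1 : (mk' (φ ⟨q (t (n + 1)), hq⟩)).tgt = q (t (n + 1)) := (hφ _).2.1
      generalize mk' (φ ⟨q (t (n + 1)), hq⟩) = a' at *
      refine ⟨a', b, hin.mono fun y hy => (hW hy).1, hb, h0, h1, hb0, hb1, ?_⟩
      have e : (Pi1 _).comp (map q (line (t n) (t (n + 1)))) a = (Pi1 _).comp a' (map p (line (t n) (t (n + 1)))) := by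
        refine hS (p i) _ _ (InSet.comp ((inSet_line hle).map q hq'') ha (by simp [ha1]))
          (InSet.comp (hin.mono fun y hy => (hW hy).2) ((inSet_line hle).map p hmem)
            (by simp [h0])) ?_ ?_
        · rw [src_comp' (by simp [ha1]), src_comp' (by simp [h0]), ha0]; simp
        · simp [h1]
      rw [← line_comp 0 (t n), map_comp _ (by simp), map_comp _ (by simp),
        comp_assoc (by simp) (by simp [hb1]), hab, ← comp_assoc (by simp [ha1]) (by simp [ha0]), e,
        comp_assoc (by simp [h0]) (by simp)]
  have := key m V (by rw [hm m le_rfl]; exact hV)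
  simpa only [hm m le_rfl, map_line] using this

end

/-! ### The topology of the fundamental groupoid -/

/-- A choice, for each point `x`, of a neighborhood as in `LocallySimple`, and of paths from `x` to
the points of this neighborhood. -/
structure ShortPaths (X : Type u) [TopologicalSpace X] where
  nhd : X → Set X
  isOpen : ∀ x, IsOpen (nhd x)
  mem : ∀ x, x ∈ nhd x
  simple : ∀ x, IsSimple (nhd x)
  path : ∀ x, nhd x → C(I, X)
  continuous_path : ∀ x, Continuous (path x)
  path_zero : ∀ x v, path x v 0 = x
  path_one : ∀ x v, path x v 1 = v
  path_mem : ∀ x v s, path x v s ∈ nhd x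

theorem nonempty_shortPaths (X : Type u) [TopologicalSpace X] [LocallySimple X] :
    Nonempty (ShortPaths X) := by
  choose S hSU hSo hxS hS τ hτ hτ' using fun x : X => LocallySimple.exists_nhd x Set.univ
    Filter.univ_mem
  exact ⟨⟨S, hSo, hxS, hS, τ, hτ, fun x v => (hτ' x v).1, fun x v => (hτ' x v).2.1,
    fun x v => (hτ' x v).2.2⟩⟩

namespace ShortPaths

variable {X : Type u} [TopologicalSpace X] (T : ShortPaths X)

open Classical in
/-- The class of the short path from `x` to `v`. -/
def cls (x v : X) : PathClass X := if h : v ∈ T.nhd x then mk' (T.path x ⟨v, h⟩) else (Pi1 X).one x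

variable {T} {x v : X}

theorem cls_eq (h : v ∈ T.nhd x) : T.cls x v = mk' (T.path x ⟨v, h⟩) := dif_pos h

theorem inSet_cls (h : v ∈ T.nhd x) : InSet (T.nhd x) (T.cls x v) :=
  ⟨_, T.path_mem _ _, (cls_eq h).symm⟩

theorem src_cls (h : v ∈ T.nhd x) : (T.cls x v).src = x := by
  rw [cls_eq h]; exact T.path_zero _ _

theorem tgt_cls (h : v ∈ T.nhd x) : (T.cls x v).tgt = v := by
  rw [cls_eq h]; exact T.path_one _ _

theorem cls_self (x : X) : T.cls x x = (Pi1 X).one x := by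
  refine T.simple x _ _ (inSet_cls (T.mem x)) ⟨.const I x, fun _ => T.mem x, mk'_const x⟩ ?_ ?_
  · exact src_cls (T.mem x)
  · exact tgt_cls (T.mem x)

theorem comp_cls {a : PathClass X} (ha : InSet (T.nhd x) a) (h : a.src ∈ T.nhd x)
    (h' : a.tgt ∈ T.nhd x) : (Pi1 X).comp a (T.cls x a.src) = T.cls x a.tgt := by
  refine T.simple x _ _ (ha.comp (inSet_cls h) (tgt_cls h).symm) (inSet_cls h') ?_ ?_
  · rw [src_comp' (tgt_cls h).symm, src_cls h, src_cls h']
  · rw [tgt_comp', tgt_cls h']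

theorem inSet_tgt {V : Set X} {a : PathClass X} (ha : InSet V a) : a.tgt ∈ V := by
  obtain ⟨p, hp, rfl⟩ := ha
  exact hp 1

end ShortPaths

open ShortPaths

/-- A groupoid `Δ` over `O`, whose arrows are a quotient of a space `P` such that neighbors in `P`
differ in `Δ` only by the images of short paths, is étale over `O × O`. -/
theorem isEtaleVia_of_isQuotientMap {A : Type u} {O : Type v} {P : Type w} [TopologicalSpace A]
    [TopologicalSpace O] [TopologicalSpace P] (T : ShortPaths O) (Δ : InternalGroupoid A O)
    (J : PathClass O → A) (hJs : ∀ γ, Δ.src (J γ) = γ.src) (hJt : ∀ γ, Δ.tgt (J γ) = γ.tgt)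
    (hJ1 : ∀ x, J ((Pi1 O).one x) = Δ.one x)
    (hJm : ∀ a b, a.src = b.tgt → J ((Pi1 O).comp a b) = Δ.comp (J a) (J b))
    (π : P → A) (hπ : Topology.IsQuotientMap π)
    (h₁ : ∀ p, ∀ V ∈ 𝓝 (Δ.tgt (π p)), ∀ V' ∈ 𝓝 (Δ.src (π p)), ∀ᶠ q in 𝓝 p, ∃ a b : PathClass O,
      InSet V a ∧ InSet V' b ∧ a.src = Δ.tgt (π p) ∧ a.tgt = Δ.tgt (π q) ∧ b.src = Δ.src (π p) ∧
      b.tgt = Δ.src (π q) ∧ Δ.comp (π q) (J b) = Δ.comp (J a) (π p))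
    (h₂ : ∀ a, ContinuousAt (fun z : O × O => Δ.comp (Δ.comp (J (T.cls (Δ.tgt a) z.1)) a)
      (Δ.inv (J (T.cls (Δ.src a) z.2)))) (Δ.tgt a, Δ.src a)) :
    Δ.IsEtaleVia fun x v => J (T.cls x v) where
  self x := by rw [cls_self, hJ1]
  ends x := by
    filter_upwards [(T.isOpen x).mem_nhds (T.mem x)] with v hv
    rw [hJs, hJt, src_cls hv, tgt_cls hv]
    exact ⟨rfl, rfl⟩
  nhds a := by
    set F : O × O → A := fun z => Δ.comp (Δ.comp (J (T.cls (Δ.tgt a) z.1)) a)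
      (Δ.inv (J (T.cls (Δ.src a) z.2))) with hF
    have hFa : F (Δ.tgt a, Δ.src a) = a := by
      simp only [hF, cls_self, hJ1, inv_one_eq]
      rw [one_comp rfl, comp_one rfl]
    have hFc : ContinuousAt F (Δ.tgt a, Δ.src a) := h₂ a
    refine le_antisymm ?_ (by rwa [ContinuousAt, hFa] at hFc)
    intro W hW
    rw [Filter.mem_map, nhds_prod_eq, Filter.mem_prod_iff] at hW
    obtain ⟨V₀, hV₀, V₁, hV₁, hVW⟩ := hW
    obtain ⟨V, hVV, hV, haV⟩ := mem_nhds_iff.1 (Filter.inter_mem hV₀ ((T.isOpen _).mem_nhds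
      (T.mem (Δ.tgt a))))
    obtain ⟨V', hVV', hV', haV'⟩ := mem_nhds_iff.1 (Filter.inter_mem hV₁ ((T.isOpen _).mem_nhds
      (T.mem (Δ.src a))))
    let N : Set A := {b | Δ.tgt b ∈ V ∧ Δ.src b ∈ V' ∧ F (Δ.tgt b, Δ.src b) = b}
    have hNW : N ⊆ W := fun b hb => by
      rw [← hb.2.2]
      exact hVW ⟨(hVV hb.1).1, (hVV' hb.2.1).1⟩
    have hN : IsOpen N := by
      rw [← hπ.isOpen_preimage, isOpen_iff_mem_nhds]
      rintro p ⟨hp, hp', hpF⟩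
      filter_upwards [h₁ p V (hV.mem_nhds hp) V' (hV'.mem_nhds hp')] with q hq
      obtain ⟨c, e, hc, he, hc0, hc1, he0, he1, hce⟩ := hq
      have hqV : Δ.tgt (π q) ∈ V := hc1 ▸ inSet_tgt hc
      have hqV' : Δ.src (π q) ∈ V' := he1 ▸ inSet_tgt he
      refine ⟨hqV, hqV', ?_⟩
      have e1 := comp_cls (T := T) (hc.mono fun y hy => (hVV hy).2) (by rw [hc0]; exact (hVV hp).2)
        (by rw [hc1]; exact (hVV hqV).2)
      have e2 := comp_cls (T := T) (he.mono fun y hy => (hVV' hy).2)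
        (by rw [he0]; exact (hVV' hp').2) (by rw [he1]; exact (hVV' hqV').2)
      rw [hc0, hc1] at e1
      rw [he0, he1] at e2
      have k1 := src_cls (hVV hp).2
      have k2 := tgt_cls (hVV hp).2
      have k3 := src_cls (hVV' hp').2
      have k4 := tgt_cls (hVV' hp').2
      have e1' := congrArg J e1
      have e2' := congrArg J e2
      rw [hJm _ _ (by rw [hc0, k2])] at e1'
      rw [hJm _ _ (by rw [he0, k4])] at e2'
      have e3 : π q = Δ.comp (Δ.comp (J c) (π p)) (Δ.inv (J e)) := by
        rw [← hce, comp_inv_cancel_right (by rw [hJt, he1])]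
      conv_rhs => rw [e3, ← hpF]
      simp only [hF]
      rw [← e1', ← e2']
      generalize hm : T.cls (Δ.tgt a) (Δ.tgt (π p)) = m at *
      generalize hl : T.cls (Δ.src a) (Δ.src (π p)) = l at *
      rw [inv_comp_rev (by rw [hJs, hJt, he0, k4])]
      exact comp_comp_conj (by rw [hJs, hJt, hc0, k2]) (by rw [hJs, k1])
        (by rw [tgt_inv, hJs, k3]) (by rw [src_inv, tgt_inv, hJs, hJt, he0, k4])
    exact Filter.mem_of_superset (hN.mem_nhds ⟨haV, haV', hFa⟩) hNW

section

variable {X : Type u} [TopologicalSpace X]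

theorem continuousAt_conj (T : ShortPaths X) {A : Type*} [TopologicalSpace A] (x y : X)
    (F : X × X → A) (f : C(I, X) × C(I, X) → A)
    (hf : ContinuousOn f {z | z.1 0 = x ∧ z.2 0 = y})
    (hF : ∀ v (hv : v ∈ T.nhd x) u (hu : u ∈ T.nhd y), F (v, u) = f (T.path x ⟨v, hv⟩, T.path y ⟨u, hu⟩)) :
    ContinuousAt F (x, y) := by
  have ho : IsOpen (T.nhd x ×ˢ T.nhd y) := (T.isOpen x).prod (T.isOpen y)
  refine ContinuousOn.continuousAt (s := T.nhd x ×ˢ T.nhd y) ?_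
    (ho.mem_nhds ⟨T.mem x, T.mem y⟩)
  rw [continuousOn_iff_continuous_domRestrict]
  have h1 : Continuous fun z : (T.nhd x ×ˢ T.nhd y : Set (X × X)) =>
      (T.path x ⟨z.1.1, z.2.1⟩, T.path y ⟨z.1.2, z.2.2⟩) :=
    ((T.continuous_path x).comp (by fun_prop)).prodMk ((T.continuous_path y).comp (by fun_prop))
  refine (hf.comp_continuous h1 fun z => ⟨T.path_zero _ _, T.path_zero _ _⟩).congr fun z => ?_
  exact (hF _ _ _ _).symm

variable [LocallySimple X]

/-- The fundamental groupoid is étale over `X × X`. -/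
theorem isEtaleVia_pi1 (T : ShortPaths X) : (Pi1 X).IsEtaleVia T.cls := by
  refine isEtaleVia_of_isQuotientMap T (Pi1 X) id (fun _ => rfl) (fun _ => rfl) (fun _ => rfl)
    (fun _ _ _ => rfl) mk' ⟨⟨rfl⟩, mk'_surjective⟩ (fun p V hV V' hV' => eventually_mk'_eq p hV hV')
    fun a => ?_
  obtain ⟨p, rfl⟩ := mk'_surjective a
  have hc : Continuous fun z : {z : C(I, X) × C(I, X) // z.1 0 = p 1 ∧ z.2 0 = p 0} =>
      mk' (pathComp (pathComp z.1.1 p z.2.1.symm)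
        (Path.symm (⟨z.1.2, rfl, rfl⟩ : Path (z.1.2 0) (z.1.2 1))).toContinuousMap
        ((Path.target _).trans (z.2.2.trans (pathComp_zero _ _ _).symm))) :=
    continuous_mk'.comp (continuous_pathComp (continuous_pathComp
      (continuous_fst.comp continuous_subtype_val) continuous_const _)
      (continuous_pathSymm.comp (continuous_snd.comp continuous_subtype_val)) _)
  refine continuousAt_conj T _ _ _ (fun z => (Pi1 X).comp ((Pi1 X).comp (mk' z.1) (mk' p))
    ((Pi1 X).inv (mk' z.2))) ?_ ?_
  · rw [continuousOn_iff_continuous_domRestrict]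
    refine hc.congr fun z => ?_
    change _ = (Pi1 X).comp ((Pi1 X).comp (mk' z.1.1) (mk' p)) ((Pi1 X).inv (mk' z.1.2))
    rw [comp_mk' z.2.1.symm, inv_mk', comp_mk']
  · intro v hv u hu
    simp only [id]
    rw [cls_eq, cls_eq]

theorem isTopological_pi1 : (Pi1 X).IsTopological :=
  (isEtaleVia_pi1 (nonempty_shortPaths X).some).isTopological

theorem isLocalHomeomorph_ends : IsLocalHomeomorph fun γ : PathClass X => (γ.tgt, γ.src) :=
  (isEtaleVia_pi1 (nonempty_shortPaths X).some).isLocalHomeomorph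

end

open InternalGroupoid

/-! ### Nerves -/

section

variable {G : Type u} {M : Type v} {Γ : InternalGroupoid G M}

namespace Nerve

variable {n : ℕ}

@[simp] theorem src_arr' (y : Nerve Γ n) (i j) : Γ.src (y.arr i j) = y.obj j := y.src_arr i j
@[simp] theorem tgt_arr' (y : Nerve Γ n) (i j) : Γ.tgt (y.arr i j) = y.obj i := y.tgt_arr i j

theorem comp_arr (y : Nerve Γ n) (i j k) : Γ.comp (y.arr i j) (y.arr j k) = y.arr i k := by
  rw [comp_eq (by simp), y.mul_arr]

theorem inv_arr (y : Nerve Γ n) (i j) : Γ.inv (y.arr i j) = y.arr j i :=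
  (eq_inv_of_comp (x := y.obj j) (by simp) (by rw [comp_arr, y.arr_self])).symm

/-- A simplex is determined by the arrows starting at one of its vertices. -/
theorem ext_arr (c : Fin (n + 1)) {y z : Nerve Γ n} (h : ∀ v, y.arr v c = z.arr v c) : y = z := by
  refine Nerve.ext (funext fun v => ?_) (funext fun v => funext fun w => ?_)
  · rw [← y.tgt_arr v c, h, z.tgt_arr]
  · rw [← y.comp_arr v c w, ← z.comp_arr v c w, ← y.inv_arr w c, ← z.inv_arr w c, h, h]

/-- The simplex spanned by arrows `a v` with the same source. -/
def cone (a : Fin (n + 1) → G) (x : M) (h : ∀ v, Γ.src (a v) = x) : Nerve Γ n where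
  obj v := Γ.tgt (a v)
  arr v w := Γ.comp (a v) (Γ.inv (a w))
  src_arr v w := by rw [src_comp (by simp [h]), src_inv]
  tgt_arr v w := tgt_comp
  arr_self v := comp_inv
  mul_arr i j k := by
    rw [← comp_eq, comp_assoc (by simp [h]) (by simp), inv_comp_cancel (by simp [h])]

theorem cone_arr {a : Fin (n + 1) → G} {x : M} {h : ∀ v, Γ.src (a v) = x} {c : Fin (n + 1)}
    (hc : a c = Γ.one x) (v) : (cone a x h).arr v c = a v := by
  change Γ.comp _ _ = _
  rw [hc, inv_one_eq, comp_one (h v)]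

/-- The simplex with a further vertex, in position `i`, to which `g` leads from the vertex `c`. -/
def attach (i : ℕ) (hi : i ≤ n + 1) (y : Nerve Γ n) (c : Fin (n + 1)) (g : G)
    (h : Γ.src g = y.obj c) : Nerve Γ (n + 1) :=
  cone (fun k => if hk : k.1 < i then y.arr ⟨k.1, by omega⟩ c else
    if hk' : k.1 = i then g else y.arr ⟨k.1 - 1, by have := k.2; omega⟩ c) (y.obj c) fun k => by
      split_ifs <;> simp [h]

theorem attach_arr_skip {i : ℕ} {hi : i ≤ n + 1} {y : Nerve Γ n} {c : Fin (n + 1)} {g : G}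
    {h : Γ.src g = y.obj c} (v : Fin (n + 1)) :
    (attach i hi y c g h).arr (skip n i v) (skip n i c) = y.arr v c := by
  have key : ∀ v : Fin (n + 1), (if hk : (skip n i v).1 < i then y.arr ⟨(skip n i v).1, by omega⟩ c else
    if hk' : (skip n i v).1 = i then g
      else y.arr ⟨(skip n i v).1 - 1, by have := (skip n i v).2; omega⟩ c) = y.arr v c := by
    intro v
    by_cases hv : v.1 < i
    · rw [dif_pos (by simp [skip, hv])]
      congr 1; exact Fin.ext (by simp [skip, hv])
    · rw [dif_neg (by simp [skip, hv]; omega), dif_neg (by simp [skip, hv]; omega)]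
      congr 1; exact Fin.ext (by simp [skip, hv])
  rw [attach, cone_arr]
  · exact key v
  · exact (key c).trans (y.arr_self c)

theorem attach_arr_self {i : ℕ} {hi : i ≤ n + 1} {y : Nerve Γ n} {c : Fin (n + 1)} {g : G}
    {h : Γ.src g = y.obj c} :
    (attach i hi y c g h).arr ⟨i, by omega⟩ (skip n i c) = g := by
  have h1 := attach_arr_skip (i := i) (hi := hi) (h := h) c
  rw [y.arr_self] at h1
  have h2 : Γ.src ((attach i hi y c g h).arr ⟨i, by omega⟩ (skip n i c)) = y.obj c := by
    rw [src_arr', ← (attach i hi y c g h).tgt_arr _ (skip n i c), h1, Γ.tgt_one]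
  rw [attach] at h1 ⊢
  rw [cone_arr]
  · simp
  · have h3 : (cone _ _ _ : Nerve Γ (n + 1)).arr (skip n i c) (skip n i c) = _ := h1
    change Γ.comp _ _ = _ at h3
    by_cases hv : c.1 < i
    · rw [dif_pos (by simp [skip, hv]), ← y.arr_self]
      congr 1; exact Fin.ext (by simp [skip, hv])
    · rw [dif_neg (by simp [skip, hv]; omega), dif_neg (by simp [skip, hv]; omega), ← y.arr_self]
      congr 1; exact Fin.ext (by simp [skip, hv])

theorem reindex_attach {i : ℕ} {hi : i ≤ n + 1} {y : Nerve Γ n} {c : Fin (n + 1)} {g : G}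
    {h : Γ.src g = y.obj c} : reindex (skip n i) (attach i hi y c g h) = y :=
  ext_arr c fun v => attach_arr_skip (hi := hi) (h := h) v

theorem eq_or_eq_skip {i : ℕ} (hi : i ≤ n + 1) (k : Fin (n + 2)) :
    k = ⟨i, by omega⟩ ∨ ∃ v, k = skip n i v := by
  rcases lt_trichotomy k.1 i with h | h | h
  · exact .inr ⟨⟨k.1, by omega⟩, Fin.ext (by simp [skip, h])⟩
  · exact .inl (Fin.ext h)
  · refine .inr ⟨⟨k.1 - 1, by omega⟩, Fin.ext ?_⟩
    simp only [skip]
    split_ifs <;> omega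

theorem attach_reindex {i : ℕ} (hi : i ≤ n + 1) (y : Nerve Γ (n + 1)) (c : Fin (n + 1)) :
    attach i hi (reindex (skip n i) y) c (y.arr ⟨i, by omega⟩ (skip n i c)) (by simp [reindex]) = y := by
  refine ext_arr (skip n i c) fun v => ?_
  rcases eq_or_eq_skip hi v with rfl | ⟨v, rfl⟩
  · exact attach_arr_self
  · exact attach_arr_skip v

end Nerve

end

/-! ### Smooth groupoids -/

/-- The structure maps of the groupoid are smooth, and source and target are submersions. -/
structure InternalGroupoid.IsSmooth {G : Type u} {M : Type v} [TopologicalSpace G]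
    [TopologicalSpace M] (Γ : InternalGroupoid G M) (A : SmoothStr G) (B : SmoothStr M) : Prop where
  submersion_src : A.IsSubmersion B Γ.src
  submersion_tgt : A.IsSubmersion B Γ.tgt
  one : B.PlotSmooth A Γ.one
  inv : A.PlotSmooth A Γ.inv
  comp : ∀ n (f g : Euc n → G), (∀ t, Γ.src (f t) = Γ.tgt (g t)) → A.IsPlot f → A.IsPlot g →
    A.IsPlot fun t => Γ.comp (f t) (g t)

section

variable {G : Type u} {M : Type v} [TopologicalSpace G] [TopologicalSpace M]
  {Γ : InternalGroupoid G M}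

theorem InternalGroupoid.IsLie.isSmooth {d m : ℕ} [ChartedSpace (EuclideanSpace ℝ (Fin d)) G]
    [IsManifold (𝓡 d) ∞ G] [ChartedSpace (EuclideanSpace ℝ (Fin m)) M] [IsManifold (𝓡 m) ∞ M]
    (h : Γ.IsLie d m) : Γ.IsSmooth (SmoothStr.of G d) (SmoothStr.of M m) where
  submersion_src := h.submersion_src
  submersion_tgt := h.submersion_tgt
  one := SmoothStr.plotSmooth_iff.2 h.smooth_one
  inv := SmoothStr.plotSmooth_iff.2 h.smooth_inv
  comp n f g hfg hf hg := by
    have := h.smooth_mul n f g hfg hf hg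
    have e : (fun t => Γ.comp (f t) (g t)) = fun t => Γ.mul (f t) (g t) (hfg t) :=
      funext fun t => comp_eq (hfg t)
    rw [e]
    exact this

variable {A : SmoothStr G} {B : SmoothStr M}

theorem InternalGroupoid.IsSmooth.isTopological (h : Γ.IsSmooth A B) : Γ.IsTopological where
  continuous_src := h.submersion_src.plotSmooth.continuous
  continuous_tgt := h.submersion_tgt.plotSmooth.continuous
  continuous_one := h.one.continuous
  continuous_inv := h.inv.continuous
  continuous_mul := by
    obtain ⟨D, -, hD⟩ := SmoothStr.exists_fiberProduct h.submersion_src h.submersion_tgt.plotSmooth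
    have : D.PlotSmooth A fun p => Γ.comp p.1.1 p.1.2 := fun n p hp =>
      h.comp n _ _ (fun t => (p t).2) ((hD n p).1 hp).1 ((hD n p).1 hp).2
    exact this.continuous.congr fun p => comp_eq p.2

/-! ### The topology and the smooth structure of nerves -/

namespace Nerve

variable {n : ℕ}

theorem continuous_iff {Z : Type*} [TopologicalSpace Z] (hΓ : Γ.IsTopological) (c : Fin (n + 1))
    {f : Z → Nerve Γ n} : Continuous f ↔ ∀ v, Continuous fun z => (f z).arr v c := by
  constructor
  · intro h v
    exact (continuous_apply c).comp ((continuous_apply v).comp ((continuous_arr n).comp h))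
  · intro h
    refine continuous_induced_rng.2 (Continuous.prodMk (continuous_pi fun v => ?_)
      (continuous_pi fun v => continuous_pi fun w => ?_))
    · exact (hΓ.continuous_tgt.comp (h v)).congr fun z => (f z).tgt_arr v c
    · refine (hΓ.continuous_comp (h v) (hΓ.continuous_inv.comp (h w)) fun z => by simp).congr
        fun z => ?_
      simp only [Function.comp]
      rw [inv_arr, comp_arr]

end Nerve

open Nerve SmoothStr

/-- `X` is the standard smooth structure on `G^{(n)}`. -/
abbrev IsNerveStr {n : ℕ} (X : SmoothStr (Nerve Γ n)) (A : SmoothStr G) : Prop :=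
  X.InducedBy (ι := Fin (n + 1) × Fin (n + 1)) (fun _ => A) (fun a x => x.arr a.1 a.2)

/-- Smoothness of a family of simplices can be tested on the arrows from one of the vertices. -/
theorem IsNerveStr.isPlot_iff {n : ℕ} {X : SmoothStr (Nerve Γ n)} (hX : IsNerveStr X A)
    (h : Γ.IsSmooth A B) (c : Fin (n + 1)) {k : ℕ} {p : Euc k → Nerve Γ n} :
    X.IsPlot p ↔ ∀ v, A.IsPlot fun t => (p t).arr v c := by
  refine (hX k p).trans ⟨fun hp v => hp (v, c), fun hp a => ?_⟩
  have := h.comp k _ _ (fun t => ?_) (hp a.1) (h.inv k _ (hp a.2))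
  · refine Eq.mp ?_ this
    congr 1
    funext t
    simp only [Function.comp]
    rw [inv_arr, comp_arr]
  · simp

theorem IsNerveStr.plotSmooth_obj {n : ℕ} {X : SmoothStr (Nerve Γ n)} (hX : IsNerveStr X A)
    (h : Γ.IsSmooth A B) (v : Fin (n + 1)) : X.PlotSmooth B fun y => y.obj v := fun k p hp => by
  have := h.submersion_tgt.plotSmooth k _ ((hX k p).1 hp (v, v))
  refine Eq.mp ?_ this
  congr 1
  funext t
  simp [Function.comp]

/-- `G^{(n)}` is a manifold. -/
theorem exists_isNerveStr (h : Γ.IsSmooth A B) (n : ℕ) : ∃ X : SmoothStr (Nerve Γ n),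
    IsNerveStr X A := by
  have ht := h.isTopological
  induction n with
  | zero =>
    let e : Nerve Γ 0 ≃ₜ M :=
      { toFun := fun y => y.obj 0
        invFun := fun x => cone (fun _ => Γ.one x) x fun _ => Γ.src_one x
        left_inv := fun y => ext_arr 0 fun v => by
          
          refine (cone_arr (a := fun _ => Γ.one (y.obj 0)) (c := 0) rfl v).trans ?_
          obtain rfl : v = 0 := Subsingleton.elim (α := Fin 1) _ _
          exact (y.arr_self 0).symm
        right_inv := fun x => Γ.tgt_one x
        continuous_toFun := (continuous_apply 0).comp (continuous_obj 0)
        continuous_invFun := (Nerve.continuous_iff ht 0).2 fun v =>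
          ht.continuous_one.congr fun x => (cone_arr (a := fun _ => Γ.one x) (x := x) (h := fun _ => Γ.src_one x)
            (c := 0) rfl v).symm }
    obtain ⟨X, -, hX⟩ := SmoothStr.exists_of_isLocalHomeomorph e.isOpenEmbedding.isLocalHomeomorph B
    refine ⟨X, fun k p => ?_⟩
    rw [hX]
    constructor
    · rintro ⟨-, hp⟩ ⟨v, w⟩
      have := h.one k _ hp
      refine Eq.mp ?_ this
      congr 1
      funext t
      rw [Subsingleton.elim (α := Fin 1) v 0, Subsingleton.elim (α := Fin 1) w 0]
      exact ((p t).arr_self 0).symm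
    · intro hp
      refine ⟨(Nerve.continuous_iff ht 0).2 fun v => (hp (v, 0)).continuous, ?_⟩
      have := h.submersion_tgt.plotSmooth k _ (hp (0, 0))
      refine Eq.mp ?_ this
      congr 1
      funext t
      exact (p t).tgt_arr 0 0
  | succ n ih =>
    obtain ⟨X₀, hX₀⟩ := ih
    obtain ⟨D, -, hD⟩ := SmoothStr.exists_fiberProduct h.submersion_src (hX₀.plotSmooth_obj h 0)
    let e : Nerve Γ (n + 1) ≃ₜ {p : G × Nerve Γ n // Γ.src p.1 = p.2.obj 0} :=
      { toFun := fun y => ⟨(y.arr 0 1, reindex (skip n 0) y), y.src_arr 0 1⟩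
        invFun := fun p => attach 0 (by omega) p.1.2 0 p.1.1 p.2
        left_inv := fun y => attach_reindex (i := 0) (by omega) y 0
        right_inv := fun p => Subtype.ext (Prod.ext (attach_arr_self (i := 0) (hi := by omega) (h := p.2))
          (reindex_attach (i := 0) (hi := by omega) (h := p.2)))
        continuous_toFun := (Continuous.prodMk ((Nerve.continuous_iff ht 1).1 continuous_id 0)
          (continuous_reindex _)).subtype_mk _
        continuous_invFun := by
          refine (Nerve.continuous_iff ht (skip n 0 0)).2 fun v => ?_
          rcases eq_or_eq_skip (Nat.zero_le _) v with rfl | ⟨v, rfl⟩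
          · exact (continuous_fst.comp continuous_subtype_val).congr fun p => attach_arr_self.symm
          · exact ((Nerve.continuous_iff ht 0).1 (continuous_snd.comp continuous_subtype_val)
              v).congr fun p => (attach_arr_skip v).symm }
    obtain ⟨X, -, hX⟩ := SmoothStr.exists_of_isLocalHomeomorph e.isOpenEmbedding.isLocalHomeomorph D
    refine ⟨X, fun k p => ?_⟩
    rw [hX, hD]
    constructor
    · rintro ⟨-, hp, hp'⟩
      have hp'' := (hX₀ k _).1 hp'
      -- the arrows to the vertex `1`
      have h1 : ∀ v : Fin (n + 2), A.IsPlot fun t => (p t).arr v 1 := fun v => by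
        rcases eq_or_eq_skip (Nat.zero_le _) v with rfl | ⟨v, rfl⟩
        · exact hp
        · exact hp'' (v, 0)
      intro a
      have := h.comp k _ _ (fun t => by simp) (h1 a.1) (h.inv k _ (h1 a.2))
      refine Eq.mp ?_ this
      congr 1
      funext t
      simp only [Function.comp]
      rw [inv_arr, comp_arr]
    · intro hp
      exact ⟨(Nerve.continuous_iff ht 0).2 fun v => (hp (v, 0)).continuous, hp (0, 1),
        (hX₀ k _).2 fun a => hp (_, _)⟩

/-- The faces of the nerve have smooth local sections: the missing vertex can be attached with a
local section of the source map. -/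
theorem hasLocalSections_nerve (h : Γ.IsSmooth A B) {n : ℕ} {X : SmoothStr (Nerve Γ (n + 1))}
    {X₀ : SmoothStr (Nerve Γ n)} (hX : IsNerveStr X A) (hX₀ : IsNerveStr X₀ A) (i : ℕ)
    (hi : i ≤ n + 1) : X.HasLocalSections X₀ (reindex (skip n i)) := by
  intro y
  obtain ⟨V, hV, hyV, s, hs, hs', hsp⟩ := h.submersion_src.hasLocalSections
    (y.arr ⟨i, by omega⟩ (skip n i 0))
  have hyV' : y.obj (skip n i 0) ∈ V := by rw [← y.src_arr ⟨i, by omega⟩]; exact hyV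
  refine ⟨(fun z => z.obj 0) ⁻¹' V, hV.preimage ((continuous_apply 0).comp (continuous_obj n)),
    hyV', fun z => attach i hi z.1 0 (s ⟨z.1.obj 0, z.2⟩) (hs' _), ?_, fun z => reindex_attach,
    fun k p hp hpl => (hX.isPlot_iff h (skip n i 0)).2 fun v => ?_⟩
  · have e : s ⟨(reindex (skip n i) y).obj 0, hyV'⟩ = y.arr ⟨i, by omega⟩ (skip n i 0) := by
      rw [← hs]; congr 1; exact Subtype.ext (y.src_arr _ _).symm
    simp only [e]
    exact attach_reindex hi y 0
  · rcases eq_or_eq_skip hi v with rfl | ⟨v, rfl⟩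
    · simp only [attach_arr_self]
      exact hsp k _ hp (hX₀.plotSmooth_obj h 0 k p hpl)
    · simp only [attach_arr_skip]
      exact (hX₀.isPlot_iff h 0).1 hpl v

theorem plotSmooth_reindex {n m : ℕ} {X : SmoothStr (Nerve Γ n)} {X' : SmoothStr (Nerve Γ m)}
    (hX : IsNerveStr X A) (hX' : IsNerveStr X' A) (φ : Fin (m + 1) → Fin (n + 1)) :
    X.PlotSmooth X' (reindex φ) := fun k p hp =>
  (hX' k _).2 fun a => (hX k p).1 hp (φ a.1, φ a.2)

end

open InternalGroupoid PathClass Nerve SmoothStr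

/-! ### Local homeomorphisms with prescribed sections -/

theorem isLocalHomeomorph_of_localSections {X Y : Type*} [TopologicalSpace X] [TopologicalSpace Y]
    {f : X → Y} (hc : Continuous f) (hi : ∀ x, ∃ U ∈ 𝓝 x, Set.InjOn f U)
    (hs : ∀ x, ∃ s : Y → X, ContinuousAt s (f x) ∧ s (f x) = x ∧ ∀ᶠ y in 𝓝 (f x), f (s y) = y) :
    IsLocalHomeomorph f := by
  refine isLocalHomeomorph_of_isOpenMap hc (isOpenMap_iff_nhds_le.2 fun x => ?_) hi
  obtain ⟨s, hsc, hsx, hfs⟩ := hs x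
  intro W hW
  have h1 : ∀ᶠ y in 𝓝 (f x), s y ∈ f ⁻¹' W := hsc (by rw [hsx]; exact hW)
  filter_upwards [h1, hfs] with y hy hy'
  rwa [← hy']

/-- Two lifts of the same map to a space with a locally injective map agree on an open set. -/
theorem exists_nhds_eq_of_lift {Z E B : Type*} [TopologicalSpace Z] [TopologicalSpace E]
    {π : E → B} (hi : ∀ x, ∃ U ∈ 𝓝 x, Set.InjOn π U) {u v : Z → E} (hu : Continuous u)
    (hv : Continuous v) {z : Z} (hz : u z = v z) :
    ∃ O ∈ 𝓝 z, ∀ y ∈ O, π (u y) = π (v y) → u y = v y := by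
  obtain ⟨U, hU, hinj⟩ := hi (u z)
  refine ⟨u ⁻¹' U ∩ v ⁻¹' U, Filter.inter_mem (hu.continuousAt hU)
    (hv.continuousAt (by rw [← hz]; exact hU)), fun y hy h => hinj hy.1 hy.2 h⟩

theorem exists_nhds_injOn {X Y : Type*} [TopologicalSpace X] [TopologicalSpace Y]
    {f : X → Y} (hf : IsLocalHomeomorph f) (x : X) : ∃ U ∈ 𝓝 x, Set.InjOn f U := by
  obtain ⟨U, hU, hx, h⟩ := exists_isOpen_injOn hf x
  exact ⟨U, hU.mem_nhds hx, h⟩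

/-! ### Nerves of étale groupoids -/

section

variable {A : Type u} {O : Type v} {Γ : InternalGroupoid A O} {n : ℕ}

/-- The simplex obtained from `y` by composing with arrows `b v` that start at its vertices. -/
def Nerve.conj (y : Nerve Γ n) (b : Fin (n + 1) → A) (hb : ∀ v, Γ.src (b v) = y.obj v) :
    Nerve Γ n where
  obj v := Γ.tgt (b v)
  arr v w := Γ.comp (Γ.comp (b v) (y.arr v w)) (Γ.inv (b w))
  src_arr v w := by simp [hb]
  tgt_arr v w := by simp
  arr_self v := by rw [y.arr_self, comp_one (hb v), comp_inv]
  mul_arr i j k := by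
    rw [← comp_eq, comp_assoc (c := Γ.comp _ _) (by simp [hb]) (by simp),
      comp_assoc (a := b j) (by simp [hb]) (by simp [hb]), inv_comp_cancel (by simp [hb]),
      ← comp_assoc (by simp [hb]) (by simp [hb]), comp_assoc (a := b i) (by simp [hb]) (by simp),
      y.comp_arr]

variable [TopologicalSpace A] [TopologicalSpace O]

theorem continuousAt_nerve {Z : Type*} [TopologicalSpace Z] {f : Z → Nerve Γ n} {z : Z}
    (h₁ : ∀ v, ContinuousAt (fun z => (f z).obj v) z)
    (h₂ : ∀ v w, ContinuousAt (fun z => (f z).arr v w) z) : ContinuousAt f z := by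
  have : Topology.IsInducing (fun x : Nerve Γ n => (x.obj, x.arr)) := ⟨rfl⟩
  rw [this.continuousAt_iff]
  exact ContinuousAt.prodMk (continuousAt_pi.2 h₁)
    (continuousAt_pi.2 fun v => continuousAt_pi.2 fun w => h₂ v w)

/-- The nerve of an étale groupoid is étale over the tuples of vertices. -/
theorem isLocalHomeomorph_obj {τ : O → O → A} (h : Γ.IsEtaleVia τ) :
    IsLocalHomeomorph (Nerve.obj : Nerve Γ n → _) := by
  refine isLocalHomeomorph_of_localSections (continuous_obj n) (fun y => ?_) fun y => ?_
  · choose U hU hinj using fun v w => exists_nhds_injOn h.isLocalHomeomorph (y.arr v w)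
    refine ⟨{z | ∀ v w, z.arr v w ∈ U v w}, ?_, fun z hz z' hz' e => ?_⟩
    · have hc : ∀ v w, Continuous fun z : Nerve Γ n => z.arr v w := fun v w =>
        (continuous_apply w).comp ((continuous_apply v).comp (continuous_arr n))
      have := Filter.eventually_all.2 fun v => Filter.eventually_all.2 fun w =>
        (hc v w).continuousAt.eventually (hU v w)
      exact this
    · refine Nerve.ext e (funext fun v => funext fun w => hinj v w (hz v w) (hz' v w) ?_)
      simp only [src_arr', tgt_arr', e]
  · classical
    have hgood : ∀ᶠ z : Fin (n + 1) → O in 𝓝 y.obj, ∀ v, Γ.src (τ (y.obj v) (z v)) = y.obj v ∧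
        Γ.tgt (τ (y.obj v) (z v)) = z v := Filter.eventually_all.2 fun v =>
      (continuous_apply v).continuousAt.eventually (h.ends (y.obj v))
    let s : (Fin (n + 1) → O) → Nerve Γ n := fun z =>
      if hz : ∀ v, Γ.src (τ (y.obj v) (z v)) = y.obj v ∧ Γ.tgt (τ (y.obj v) (z v)) = z v then
        y.conj (fun v => τ (y.obj v) (z v)) fun v => (hz v).1 else y
    have hs : ∀ z, (∀ v, Γ.src (τ (y.obj v) (z v)) = y.obj v ∧ Γ.tgt (τ (y.obj v) (z v)) = z v) →
        (∀ v, (s z).obj v = z v) ∧ ∀ v w, (s z).arr v w = Γ.comp (Γ.comp (τ (y.obj v) (z v))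
          (y.arr v w)) (Γ.inv (τ (y.obj w) (z w))) := fun z hz => by
      simp only [s, dif_pos hz]
      exact ⟨fun v => (hz v).2, fun v w => rfl⟩
    refine ⟨s, continuousAt_nerve (fun v => ?_) fun v w => ?_, ?_, ?_⟩
    · refine ((continuous_apply v).continuousAt (x := y.obj)).congr ?_
      filter_upwards [hgood] with z hz
      exact ((hs z hz).1 v).symm
    · have h1 := h.tendsto (y.arr v w)
      rw [src_arr', tgt_arr'] at h1
      have h2 : Filter.Tendsto (fun z : Fin (n + 1) → O => (z v, z w)) (𝓝 y.obj)
          (𝓝 (y.obj v, y.obj w)) :=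
        ((continuous_apply v).prodMk (continuous_apply w)).tendsto y.obj
      have h3 := hs y.obj hgood.self_of_nhds
      rw [ContinuousAt, h3.2 v w]
      have h4 : Γ.comp (Γ.comp (τ (y.obj v) (y.obj v)) (y.arr v w)) (Γ.inv (τ (y.obj w) (y.obj w))) =
          y.arr v w := by
        rw [h.self, h.self, inv_one_eq, one_comp (by simp), comp_one (by simp)]
      rw [h4]
      refine (h1.comp h2).congr' ?_
      filter_upwards [hgood] with z hz
      exact ((hs z hz).2 v w).symm
    · have h3 := hs y.obj hgood.self_of_nhds
      refine Nerve.ext (funext h3.1) (funext fun v => funext fun w => ?_)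
      rw [h3.2, h.self, h.self, inv_one_eq, one_comp (by simp), comp_one (by simp)]
    · filter_upwards [hgood] with z hz
      exact funext (hs z hz).1

end

/-! ### Smooth structures on path classes and on their nerves -/

section

variable {X : Type u} [TopologicalSpace X]

theorem exists_isPathStr (A : SmoothStr X) : ∃ P : SmoothStr (PathClass X), P.IsPathStr A ∧
    ∀ n (p : Euc n → PathClass X), P.IsPlot p ↔
      Continuous p ∧ A.IsPlot (fun t => (p t).tgt) ∧ A.IsPlot (fun t => (p t).src) := by
  have _ := A.locallySimple
  obtain ⟨C, hC⟩ := SmoothStr.exists_pi fun _ : Fin 2 => A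
  let e : X × X ≃ₜ (Fin 2 → X) := (Homeomorph.finTwoArrow (X := X)).symm
  have hl : IsLocalHomeomorph fun γ : PathClass X => e (γ.tgt, γ.src) :=
    e.isOpenEmbedding.isLocalHomeomorph.comp isLocalHomeomorph_ends
  obtain ⟨P, -, hP⟩ := SmoothStr.exists_of_isLocalHomeomorph hl C
  have hP' : ∀ n (p : Euc n → PathClass X), P.IsPlot p ↔
      Continuous p ∧ A.IsPlot (fun t => (p t).tgt) ∧ A.IsPlot (fun t => (p t).src) := fun n p => by
    rw [hP, hC, Fin.forall_fin_two]
    rfl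
  exact ⟨P, isPathStr_of_plots isLocalHomeomorph_ends hP', hP'⟩

/-- `N` is the standard smooth structure on the nerve of the fundamental groupoid, `C` is the
smooth structure on the tuples of vertices. -/
theorem exists_pi1NerveStr (A : SmoothStr X) (P : SmoothStr (PathClass X))
    (hP : ∀ n (p : Euc n → PathClass X), P.IsPlot p ↔
      Continuous p ∧ A.IsPlot (fun t => (p t).tgt) ∧ A.IsPlot (fun t => (p t).src)) (m : ℕ)
    (C : SmoothStr (Fin (m + 1) → X))
    (hC : ∀ n (p : Euc n → Fin (m + 1) → X), C.IsPlot p ↔ ∀ i, A.IsPlot fun t => p t i) :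
    ∃ N : SmoothStr (Nerve (Pi1 X) m), N.IsLift C Nerve.obj ∧
      N.InducedBy (ι := Fin (m + 1) × Fin (m + 1)) (fun _ => P) (fun a x => x.arr a.1 a.2) := by
  have _ := A.locallySimple
  obtain ⟨T⟩ := nonempty_shortPaths X
  obtain ⟨N, hN⟩ := exists_isLift (isLocalHomeomorph_obj (n := m) (isEtaleVia_pi1 T)) C
  refine ⟨N, hN, fun n p => ?_⟩
  rw [hN.isPlot_iff, hC]
  have et : ∀ i j, (fun t => ((p t).arr i j).tgt) = fun t => (p t).obj i := fun i j =>
    funext fun t => (p t).tgt_arr i j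
  have es : ∀ i j, (fun t => ((p t).arr i j).src) = fun t => (p t).obj j := fun i j =>
    funext fun t => (p t).src_arr i j
  constructor
  · rintro ⟨hc, hp⟩ ⟨i, j⟩
    refine (hP n _).2 ⟨(continuous_apply j).comp ((continuous_apply i).comp
      ((continuous_arr m).comp hc)), ?_, ?_⟩
    · exact (et i j).symm ▸ hp i
    · exact (es i j).symm ▸ hp j
  · intro hp
    refine ⟨(Nerve.continuous_iff isTopological_pi1 0).2 fun v => (hp (v, 0)).continuous,
      fun i => ?_⟩
    have := ((hP n _).1 (hp (i, i))).2.1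
    exact (et i i) ▸ this

end

/-! ### Simplicial manifolds -/

theorem SimplicialSpace.isManifold_of_hasLocalSections {X : SimplicialSpace.{u}}
    {A : ∀ n, SmoothStr (X.obj n)}
    (hd : ∀ n i hi, (A (n + 1)).PlotSmooth (A n) (X.face n i hi))
    (hd' : ∀ n i hi, (A (n + 1)).HasLocalSections (A n) (X.face n i hi))
    (hs : ∀ n i hi, (A n).PlotSmooth (A (n + 1)) (X.degen n i hi)) : X.IsManifold A where
  submersion_face n i hi := isSubmersion_of_hasLocalSections (hd n i hi) (hd' n i hi)
  surjective_face n i hi x := by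
    rcases Nat.lt_or_ge i (n + 1) with h | h
    · exact ⟨X.degen n i (by omega) x, X.laws.d_s_self n i (by omega) x⟩
    · obtain rfl : i = n + 1 := by omega
      exact ⟨X.degen n n le_rfl x, X.laws.d_s_succ n n le_rfl x⟩
  embedding_degen n i hi := isEmbedding_of_section (r := X.face n i (by omega))
    (isSubmersion_of_hasLocalSections (hd n i _) (hd' n i _)) (hs n i hi) (X.laws.d_s_self n i hi)

theorem SmoothStr.hasLocalSections_pi {ι : Type*} {X Y : ι → Type*}
    [∀ i, TopologicalSpace (X i)] [∀ i, TopologicalSpace (Y i)] [Finite ι]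
    {A : ∀ i, SmoothStr (X i)} {B : ∀ i, SmoothStr (Y i)} {A' : SmoothStr (∀ i, X i)}
    {B' : SmoothStr (∀ i, Y i)}
    (hA : ∀ n (p : Euc n → ∀ i, X i), A'.IsPlot p ↔ ∀ i, (A i).IsPlot fun t => p t i)
    (hB : ∀ n (p : Euc n → ∀ i, Y i), B'.IsPlot p ↔ ∀ i, (B i).IsPlot fun t => p t i)
    {f : ∀ i, X i → Y i} (hf : ∀ i, (A i).HasLocalSections (B i) (f i)) :
    A'.HasLocalSections B' (Pi.map f) := by
  intro x
  choose V hV hxV s hs hfs hsp using fun i => hf i (x i)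
  refine ⟨Set.univ.pi V, isOpen_set_pi Set.finite_univ fun i _ => hV i, fun i _ => hxV i,
    fun z i => s i ⟨z.1 i, z.2 i trivial⟩, funext fun i => hs i, fun z => funext fun i => hfs i _,
    fun n p hp hpl => (hA n _).2 fun i => hsp i n _ (fun t => hp t i trivial) ((hB n p).1 hpl i)⟩

/-- The horns of dimension `1` are points of `X_0`. -/
theorem SimplicialSpace.exists_horn_zero {X : SimplicialSpace.{u}} {A : ∀ n, SmoothStr (X.obj n)}
    (hX : X.IsManifold A) (k : ℕ) (hk : k ≤ 1) : ∃ B : SmoothStr (X.Horn 0 k),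
      B.InducedBy (fun _ => A 0) (fun i x => x.1 i) ∧
      (A 1).IsSubmersion B (X.hornMap 0 k) := by
  let i₀ : HornIdx 0 k := ⟨1 - k, by omega, by omega⟩
  have hi : ∀ i : HornIdx 0 k, i = i₀ := fun i => Subtype.ext (by
    have := i.2; simp only [i₀]; omega)
  let e : X.Horn 0 k ≃ₜ X.obj 0 :=
    { toFun := fun x => x.1 i₀
      invFun := fun y => ⟨fun _ => y, trivial⟩
      left_inv := fun x => Subtype.ext (funext fun i => by rw [hi i])
      right_inv := fun y => rfl
      continuous_toFun := (continuous_apply i₀).comp continuous_subtype_val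
      continuous_invFun := (continuous_pi fun _ => continuous_id).subtype_mk _ }
  obtain ⟨B, hB⟩ := exists_isLift e.isOpenEmbedding.isLocalHomeomorph (A 0)
  have hB' : ∀ n (p : Euc n → X.Horn 0 k), B.IsPlot p ↔ (A 0).IsPlot fun t => (p t).1 i₀ :=
    fun n p => by
      rw [hB.isPlot_iff]
      exact ⟨fun h => h.2, fun h => ⟨(e.comp_continuous_iff).1 h.continuous, h⟩⟩
  refine ⟨B, fun n p => ?_, isSubmersion_of_hasLocalSections (fun n p hp => ?_) fun x => ?_⟩
  · rw [hB']
    exact ⟨fun h i => by rw [hi i]; exact h, fun h => h i₀⟩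
  · exact (hB' n _).2 ((hX.submersion_face 0 _ _).plotSmooth n p hp)
  · obtain ⟨V, hV, hxV, s, hs, hfs, hsp⟩ := (hX.submersion_face 0 i₀.1 i₀.2.1).hasLocalSections x
    refine ⟨e ⁻¹' V, hV.preimage e.continuous, hxV, fun y => s ⟨e y, y.2⟩, hs, fun y => ?_,
      fun n p hp hpl => hsp n _ hp ((hB' n p).1 hpl)⟩
    exact e.injective (hfs ⟨e y, y.2⟩)

section Horns

variable {E : SimplicialSpace.{u}} {D : ∀ n, SmoothStr (E.obj n)} {n k : ℕ}
  {Y₁ : Type v} {Y₀ : Type w} [TopologicalSpace Y₁]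

/-- The horns of dimension `n + 2 ≥ 2` in the image of `E_{n+1} → Y₁`, where `d i : Y₁ → Y₀` are
the maps covered by the faces of `E_{n+1}`. -/
def HornSet (n k : ℕ) (d : ∀ i, i ≤ n + 1 → Y₁ → Y₀) :
    Set (SimplicialSpace.HornIdx (n + 1) k → Y₁) :=
  {z | ∀ i j : SimplicialSpace.HornIdx (n + 1) k, (hij : i.1 < j.1) →
    d i.1 (by have := j.2.1; omega) (z j) = d (j.1 - 1) (by have := j.2.1; omega) (z i)}

variable {d : ∀ i, i ≤ n + 1 → Y₁ → Y₀} {π₁ : E.obj (n + 1) → Y₁} {π₀ : E.obj n → Y₀}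
  (hd : ∀ i hi x, π₀ (E.face n i hi x) = d i hi (π₁ x))

instance finite_hornIdx (n k : ℕ) : Finite (SimplicialSpace.HornIdx n k) :=
  Finite.of_injective (fun i => (⟨i.1, by have := i.2.1; omega⟩ : Fin (n + 2))) fun i j h =>
    Subtype.ext (congrArg Fin.val h)

/-- The map from horns in `E` to horns in `Y₁`. -/
def hornProj (x : E.Horn (n + 1) k) : HornSet n k d :=
  ⟨fun i => π₁ (x.1 i), fun i j hij => by rw [← hd, ← hd, x.2 i j hij]⟩

/-- If `E` is étale over `Y`, then so are the spaces of horns. -/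
theorem isLocalHomeomorph_hornProj (hπ₁ : IsLocalHomeomorph π₁)
    (hπ₀ : ∀ x, ∃ U ∈ 𝓝 x, Set.InjOn π₀ U) :
    IsLocalHomeomorph (hornProj hd : E.Horn (n + 1) k → HornSet n k d) := by
  have h1 := IsLocalHomeomorph.piMap fun _ : SimplicialSpace.HornIdx (n + 1) k => hπ₁
  have h2 : Set.MapsTo (Pi.map fun _ : SimplicialSpace.HornIdx (n + 1) k => π₁)
      {x | E.HornCompat (n + 1) k x} (HornSet n k d) := fun x hx => (hornProj hd ⟨x, hx⟩).2
  refine IsLocalHomeomorph.restrict h1 h2 fun x hx => ?_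
  have h3 : ∀ i j : SimplicialSpace.HornIdx (n + 1) k, ∃ O ∈ 𝓝 x, ∀ y ∈ O, (hij : i.1 < j.1) →
      π₀ (E.face n i.1 (by have := j.2.1; omega) (y j)) =
        π₀ (E.face n (j.1 - 1) (by have := j.2.1; omega) (y i)) →
      E.face n i.1 (by have := j.2.1; omega) (y j) =
        E.face n (j.1 - 1) (by have := j.2.1; omega) (y i) := by
    intro i j
    by_cases hij : i.1 < j.1
    · obtain ⟨O, hO, h⟩ := exists_nhds_eq_of_lift hπ₀
        (u := fun y : SimplicialSpace.HornIdx (n + 1) k → E.obj (n + 1) =>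
          E.face n i.1 (by have := j.2.1; omega) (y j))
        (v := fun y => E.face n (j.1 - 1) (by have := j.2.1; omega) (y i))
        ((E.continuous_face _ _ _).comp (continuous_apply j))
        ((E.continuous_face _ _ _).comp (continuous_apply i)) (hx i j hij)
      exact ⟨O, hO, fun y hy _ => h y hy⟩
    · exact ⟨Set.univ, Filter.univ_mem, fun y _ h => absurd h hij⟩
  choose O hO h using h3
  refine ⟨⋂ i, ⋂ j, O i j, Filter.iInter_mem.2 fun i => Filter.iInter_mem.2 fun j => hO i j,
    fun y hy i j hij => ?_⟩
  refine h i j y (Set.mem_iInter.1 (Set.mem_iInter.1 hy.1 i) j) hij ?_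
  rw [hd, hd]
  exact hy.2 i j hij

variable {A₁ : SmoothStr Y₁} {C : SmoothStr (HornSet n k d)}

/-- A smooth structure on the horns of `Y` gives one on the horns of `E`. -/
theorem exists_hornStr (hD : (D (n + 1)).IsLift A₁ π₁)
    (hπ₀ : ∀ x, ∃ U ∈ 𝓝 x, Set.InjOn π₀ U) (hd : ∀ i hi x, π₀ (E.face n i hi x) = d i hi (π₁ x))
    (hC : ∀ m (p : Euc m → HornSet n k d), C.IsPlot p ↔ ∀ i, A₁.IsPlot fun t => (p t).1 i) :
    ∃ B : SmoothStr (E.Horn (n + 1) k), B.IsLift C (hornProj hd) ∧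
      B.InducedBy (fun _ => D (n + 1)) (fun i x => x.1 i) := by
  obtain ⟨B, hB⟩ := exists_isLift
    (isLocalHomeomorph_hornProj (k := k) hd hD.isLocalHomeomorph hπ₀) C
  refine ⟨B, hB, fun m p => ?_⟩
  rw [hB.isPlot_iff, hC]
  constructor
  · rintro ⟨hp, h⟩ i
    exact (hD.isPlot_iff m _).2 ⟨(continuous_apply i).comp (continuous_subtype_val.comp hp), h i⟩
  · intro h
    refine ⟨(continuous_pi fun i => (h i).continuous).subtype_mk _, fun i => ?_⟩
    exact ((hD.isPlot_iff m _).1 (h i)).2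

variable {Y₂ : Type*} [TopologicalSpace Y₂] {A₂ : SmoothStr Y₂} {π₂ : E.obj (n + 2) → Y₂}
  {d₂ : ∀ i, i ≤ n + 2 → Y₂ → Y₁}

/-- If the horns of `Y` have unique fillers, then the horn map of `E` is étale. -/
theorem exists_hornStr_isEtale (hD₂ : (D (n + 2)).IsLift A₂ π₂) (hD : (D (n + 1)).IsLift A₁ π₁)
    (hπ₀ : ∀ x, ∃ U ∈ 𝓝 x, Set.InjOn π₀ U) (hd : ∀ i hi x, π₀ (E.face n i hi x) = d i hi (π₁ x))
    (hd₂ : ∀ i hi x, π₁ (E.face (n + 1) i hi x) = d₂ i hi (π₂ x))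
    (hds : ∀ i hi, A₂.PlotSmooth A₁ (d₂ i hi))
    (hf₁ : ∀ z : HornSet n k d, ∃ y, ∀ i : SimplicialSpace.HornIdx (n + 1) k,
      d₂ i.1 i.2.1 y = z.1 i)
    (hf₂ : ∀ y y', (∀ i : SimplicialSpace.HornIdx (n + 1) k, d₂ i.1 i.2.1 y = d₂ i.1 i.2.1 y') →
      y = y')
    (hf₃ : ∀ m (p : Euc m → Y₂), (∀ i : SimplicialSpace.HornIdx (n + 1) k,
      A₁.IsPlot fun t => d₂ i.1 i.2.1 (p t)) → A₂.IsPlot p)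
    (hfc : ∀ f : HornSet n k d → Y₂, (∀ i : SimplicialSpace.HornIdx (n + 1) k,
      Continuous fun z => d₂ i.1 i.2.1 (f z)) → Continuous f)
    (hcompat : ∀ y, (fun i : SimplicialSpace.HornIdx (n + 1) k => d₂ i.1 i.2.1 y) ∈ HornSet n k d) :
    ∃ B : SmoothStr (E.Horn (n + 1) k), B.InducedBy (fun _ => D (n + 1)) (fun i x => x.1 i) ∧
      (D (n + 2)).IsSubmersion B (E.hornMap (n + 1) k) ∧
      (D (n + 2)).IsEtale B (E.hornMap (n + 1) k) := by
  choose fill hf₁ using hf₁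
  have hfill : Continuous fill := hfc fill fun i => by
    simp only [hf₁]
    exact (continuous_apply i).comp continuous_subtype_val
  let e : HornSet n k d ≃ₜ Y₂ :=
    { toFun := fill
      invFun := fun y => ⟨_, hcompat y⟩
      left_inv := fun z => Subtype.ext (funext fun i => hf₁ z i)
      right_inv := fun y => hf₂ _ _ fun i => hf₁ _ i
      continuous_toFun := hfill
      continuous_invFun := (continuous_pi fun i => (hds _ _).continuous).subtype_mk _ }
  obtain ⟨C, hC⟩ := exists_isLift e.isOpenEmbedding.isLocalHomeomorph A₂
  have hC' : ∀ m (p : Euc m → HornSet n k d), C.IsPlot p ↔ ∀ i, A₁.IsPlot fun t => (p t).1 i := by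
    intro m p
    rw [hC.isPlot_iff]
    constructor
    · rintro ⟨-, h⟩ i
      refine Eq.mp ?_ (hds i.1 i.2.1 m _ h)
      congr 1
      funext t
      exact hf₁ _ _
    · intro h
      exact ⟨(continuous_pi fun i => (h i).continuous).subtype_mk _, hf₃ m (fun t => fill (p t)) fun i => by
        simp only [hf₁]
        exact h i⟩
  obtain ⟨B, hB, hBi⟩ := exists_hornStr (k := k) hD hπ₀ hd hC'
  have hB₂ : B.IsLift A₂ (fill ∘ hornProj hd) := by
    refine ⟨hC.isLocalHomeomorph.comp hB.isLocalHomeomorph, fun m p => ?_⟩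
    rw [hB.isPlot_iff, hC.isPlot_iff]
    exact ⟨fun h => ⟨h.1, h.2.2⟩, fun h => ⟨h.1, hB.isLocalHomeomorph.continuous.comp h.1, h.2⟩⟩
  have hcont : Continuous (E.hornMap (n + 1) k) :=
    (continuous_pi fun i => E.continuous_face _ _ _).subtype_mk _
  have hcomm : ∀ x, (fill ∘ hornProj hd) (E.hornMap (n + 1) k x) = π₂ x := fun x =>
    hf₂ _ _ fun i => by
      simp only [Function.comp]
      rw [hf₁]
      exact hd₂ _ _ _
  refine ⟨B, hBi, isSubmersion_of_hasLocalSections ?_ ?_, hD₂.isEtale_of_comp hB₂ hcont hcomm⟩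
  · exact hD₂.plotSmooth hB₂ hcont (F₀ := id) hcomm fun m p hp => hp
  · refine hD₂.hasLocalSections hB₂ hcont (F₀ := id) hcomm fun x => ?_
    exact ⟨Set.univ, isOpen_univ, trivial, fun y => y.1, rfl, fun _ => rfl, fun m p _ hp => hp⟩

end Horns

/-! ### Horns in nerves -/

/-- The weakly increasing surjection that is left inverse to `skip n i`. -/
def unskip (n i : ℕ) (k : Fin (n + 2)) : Fin (n + 1) :=
  ⟨min n (if k.1 < i then k.1 else k.1 - 1), by omega⟩

theorem unskip_skip (n i : ℕ) (k : Fin (n + 1)) : unskip n i (skip n i k) = k := by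
  apply Fin.ext
  simp only [unskip, skip]
  split_ifs <;> omega

theorem skip_unskip {n i : ℕ} (hi : i ≤ n + 1) {k : Fin (n + 2)} (hk : k.1 ≠ i) :
    skip n i (unskip n i k) = k := by
  apply Fin.ext
  simp only [unskip, skip]
  split_ifs <;> omega

theorem skip_ne (n i : ℕ) (k : Fin (n + 1)) : (skip n i k).1 ≠ i := by
  simp only [skip]
  split_ifs <;> omega

namespace Nerve

variable {G : Type u} {M : Type v} {Γ : InternalGroupoid G M} {n : ℕ} {ι : Type*} {ix : ι → ℕ}

/-- The `z i` are the faces with numbers `ix i` of a putative simplex of dimension `n + 2`. -/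
def FaceCompat (ix : ι → ℕ) (z : ι → Nerve Γ (n + 1)) : Prop :=
  ∀ i j, ix i < ix j → reindex (skip n (ix i)) (z j) = reindex (skip n (ix j - 1)) (z i)

theorem FaceCompat.arr_eq_of_lt {z : ι → Nerve Γ (n + 1)} (hz : FaceCompat ix z)
    (hix : ∀ i, ix i ≤ n + 2) {i j : ι} (hij : ix i < ix j) {v w : Fin (n + 3)} (hv : v.1 ≠ ix i)
    (hv' : v.1 ≠ ix j) (hw : w.1 ≠ ix i) (hw' : w.1 ≠ ix j) :
    (z i).arr (unskip _ (ix i) v) (unskip _ (ix i) w) =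
      (z j).arr (unskip _ (ix j) v) (unskip _ (ix j) w) := by
  have hj := hix j
  have key : ∀ v : Fin (n + 3), v.1 ≠ ix i → v.1 ≠ ix j → ∃ v' : Fin (n + 1),
      unskip _ (ix i) v = skip n (ix j - 1) v' ∧ unskip _ (ix j) v = skip n (ix i) v' := by
    intro v hv hv'
    have hv2 := v.2
    refine ⟨unskip _ (ix i) (unskip _ (ix j) v), ?_, ?_⟩
    · apply Fin.ext
      simp only [unskip, skip]
      split_ifs <;> omega
    · apply Fin.ext
      simp only [unskip, skip]
      split_ifs <;> omega
  obtain ⟨v', e₁, e₂⟩ := key v hv hv'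
  obtain ⟨w', e₃, e₄⟩ := key w hw hw'
  rw [e₁, e₂, e₃, e₄]
  have h := hz i j hij
  exact (congrArg (fun y : Nerve Γ n => y.arr v' w') h).symm

theorem FaceCompat.arr_eq {z : ι → Nerve Γ (n + 1)} (hz : FaceCompat ix z)
    (hix : ∀ i, ix i ≤ n + 2) (hinj : Function.Injective ix) {i j : ι} {v w : Fin (n + 3)}
    (hv : v.1 ≠ ix i) (hv' : v.1 ≠ ix j) (hw : w.1 ≠ ix i) (hw' : w.1 ≠ ix j) :
    (z i).arr (unskip _ (ix i) v) (unskip _ (ix i) w) =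
      (z j).arr (unskip _ (ix j) v) (unskip _ (ix j) w) := by
  rcases lt_trichotomy (ix i) (ix j) with h | h | h
  · exact hz.arr_eq_of_lt hix h hv hv' hw hw'
  · rw [hinj h]
  · exact (hz.arr_eq_of_lt hix h hv' hv hw' hw).symm

open Classical in
/-- One of the positions `a` and `b`, different from the vertex `v`. -/
def avoid (ix : ι → ℕ) (a b : ι) (v : Fin (n + 3)) : ι := if v.1 = ix a then b else a

theorem avoid_ne (hinj : Function.Injective ix) {a b : ι} (hab : a ≠ b) (v : Fin (n + 3)) :
    v.1 ≠ ix (avoid ix a b v) := by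
  rw [avoid]
  split_ifs with h
  · exact fun h' => hab (hinj (h.symm.trans h'))
  · exact h

/-- The simplex with the faces `z i`. It is determined by the arrows that start at a vertex `c`
contained in all these faces, and two faces suffice to find them. -/
def fillFaces {z : ι → Nerve Γ (n + 1)} (hz : FaceCompat ix z) (hix : ∀ i, ix i ≤ n + 2)
    (hinj : Function.Injective ix) (a b : ι) (c : Fin (n + 3))
    (hc : ∀ i, c.1 ≠ ix i) : Nerve Γ (n + 2) :=
  cone (fun v => (z (avoid ix a b v)).arr (unskip _ (ix (avoid ix a b v)) v)
    (unskip _ (ix (avoid ix a b v)) c)) ((z a).obj (unskip _ (ix a) c)) fun v => by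
      rw [src_arr', ← (z a).tgt_arr _ (unskip _ (ix a) c),
        hz.arr_eq hix hinj (hc a) (hc (avoid ix a b v)) (hc _) (hc _), tgt_arr']

section

variable {z : ι → Nerve Γ (n + 1)} {hz : FaceCompat ix z} {hix : ∀ i, ix i ≤ n + 2}
    {hinj : Function.Injective ix} {a b : ι} {c : Fin (n + 3)} {hc : ∀ i, c.1 ≠ ix i}

theorem fillFaces_arr (v) : (fillFaces hz hix hinj a b c hc).arr v c =
    (z (avoid ix a b v)).arr (unskip _ (ix (avoid ix a b v)) v)
      (unskip _ (ix (avoid ix a b v)) c) := by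
  rw [fillFaces, cone_arr]
  rw [(z _).arr_self, ← (z a).tgt_arr _ (unskip _ (ix a) c),
    hz.arr_eq hix hinj (hc a) (hc (avoid ix a b c)) (hc _) (hc _), tgt_arr']

theorem reindex_fillFaces (hab : a ≠ b) (i : ι) :
    reindex (skip _ (ix i)) (fillFaces hz hix hinj a b c hc) = z i := by
  refine ext_arr (unskip _ (ix i) c) fun v => ?_
  change (fillFaces hz hix hinj a b c hc).arr _ (skip _ _ (unskip _ _ c)) = _
  rw [skip_unskip (hix i) (hc i), fillFaces_arr]
  have := hz.arr_eq hix hinj (avoid_ne hinj hab (skip _ (ix i) v)) (skip_ne _ (ix i) v) (hc _)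
    (hc i)
  rw [this, unskip_skip]

end

theorem exists_faces {z : ι → Nerve Γ (n + 1)} (hz : FaceCompat ix z) (hix : ∀ i, ix i ≤ n + 2)
    (hinj : Function.Injective ix) {a b : ι} (hab : a ≠ b) {c : Fin (n + 3)}
    (hc : ∀ i, c.1 ≠ ix i) : ∃ y : Nerve Γ (n + 2), ∀ i, reindex (skip _ (ix i)) y = z i :=
  ⟨fillFaces hz hix hinj a b c hc, reindex_fillFaces hab⟩

theorem arr_eq_of_face (hix : ∀ i, ix i ≤ n + 2) (hinj : Function.Injective ix) {a b : ι}
    (hab : a ≠ b) {c : Fin (n + 3)} (hc : ∀ i, c.1 ≠ ix i) (y : Nerve Γ (n + 2)) (v) :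
    y.arr v c = (reindex (skip _ (ix (avoid ix a b v))) y).arr (unskip _ (ix (avoid ix a b v)) v)
      (unskip _ (ix (avoid ix a b v)) c) := by
  change _ = y.arr (skip _ _ _) (skip _ _ _)
  rw [skip_unskip (hix _) (avoid_ne hinj hab v), skip_unskip (hix _) (hc _)]

/-- A simplex is determined by two of its faces that have a common vertex. -/
theorem eq_of_faces (hix : ∀ i, ix i ≤ n + 2) (hinj : Function.Injective ix) {a b : ι}
    (hab : a ≠ b) {c : Fin (n + 3)} (hc : ∀ i, c.1 ≠ ix i) {y y' : Nerve Γ (n + 2)}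
    (h : ∀ i, reindex (skip _ (ix i)) y = reindex (skip _ (ix i)) y') : y = y' :=
  ext_arr c fun v => by
    rw [arr_eq_of_face hix hinj hab hc, arr_eq_of_face hix hinj hab hc, h]

theorem isPlot_of_faces [TopologicalSpace G] [TopologicalSpace M] {A : SmoothStr G}
    {B : SmoothStr M} (h : Γ.IsSmooth A B) {X₁ : SmoothStr (Nerve Γ (n + 1))}
    {X₂ : SmoothStr (Nerve Γ (n + 2))} (hX₁ : IsNerveStr X₁ A) (hX₂ : IsNerveStr X₂ A)
    (hix : ∀ i, ix i ≤ n + 2) (hinj : Function.Injective ix) {a b : ι} (hab : a ≠ b)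
    {c : Fin (n + 3)} (hc : ∀ i, c.1 ≠ ix i) {k : ℕ} {y : Euc k → Nerve Γ (n + 2)}
    (hp : ∀ i, X₁.IsPlot fun t => reindex (skip _ (ix i)) (y t)) : X₂.IsPlot y := by
  refine (hX₂.isPlot_iff h c).2 fun v => ?_
  simp only [arr_eq_of_face hix hinj hab hc]
  exact (hX₁ k _).1 (hp _) (_, _)

theorem continuous_of_faces [TopologicalSpace G] [TopologicalSpace M] (h : Γ.IsTopological)
    (hix : ∀ i, ix i ≤ n + 2) (hinj : Function.Injective ix) {a b : ι} (hab : a ≠ b)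
    {c : Fin (n + 3)} (hc : ∀ i, c.1 ≠ ix i) {Z : Type*} [TopologicalSpace Z]
    {y : Z → Nerve Γ (n + 2)} (hp : ∀ i, Continuous fun t => reindex (skip _ (ix i)) (y t)) :
    Continuous y := by
  refine (continuous_iff h c).2 fun v => ?_
  simp only [arr_eq_of_face hix hinj hab hc]
  exact (continuous_iff h _).1 (hp _) _

end Nerve

/-! ### The double nerve -/

section

variable {G : Type u} {M : Type v} [TopologicalSpace G] [TopologicalSpace M]

/-- The standard smooth structures on the spaces `G^{(q)}`, `Π₁(G^{(q)})` and `N_{p,q}`. The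
structure on `N_{p,q}` is lifted from the tuples of vertices. -/
structure NerveStr (Γ : InternalGroupoid G M) (A : SmoothStr G) where
  X : ∀ q, SmoothStr (Nerve Γ q)
  P : ∀ q, SmoothStr (PathClass (Nerve Γ q))
  C : ∀ p q, SmoothStr (Fin (p + 1) → Nerve Γ q)
  N : ∀ p q, SmoothStr (Nerve (Pi1 (Nerve Γ q)) p)
  isNerveStr : ∀ q, IsNerveStr (X q) A
  isPathStr : ∀ q, (P q).IsPathStr (X q)
  isPlot_C : ∀ p q n (f : Euc n → (Fin (p + 1) → Nerve Γ q)),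
    (C p q).IsPlot f ↔ ∀ i, (X q).IsPlot fun t => f t i
  isLift : ∀ p q, (N p q).IsLift (C p q) Nerve.obj
  inducedBy : ∀ p q, (N p q).InducedBy (ι := Fin (p + 1) × Fin (p + 1)) (fun _ => P q)
    (fun a x => x.arr a.1 a.2)

variable {Γ : InternalGroupoid G M} {A : SmoothStr G} {B : SmoothStr M}

theorem nonempty_nerveStr (h : Γ.IsSmooth A B) : Nonempty (NerveStr Γ A) := by
  choose X hX using exists_isNerveStr h
  choose P hP hP' using fun q => exists_isPathStr (X q)
  choose C hC using fun p q => SmoothStr.exists_pi fun _ : Fin (p + 1) => X q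
  choose N hN hN' using fun p q => exists_pi1NerveStr (X q) (P q) (hP' q) p (C p q) (hC p q)
  exact ⟨⟨X, P, C, N, hX, hP, hC, hN, hN'⟩⟩

namespace NerveStr

variable (S : NerveStr Γ A)

theorem plotSmooth_reindex_N {m n : ℕ} (q : ℕ) (φ : Fin (m + 1) → Fin (n + 1)) :
    (S.N n q).PlotSmooth (S.N m q) (Nerve.reindex φ) :=
  (S.isLift n q).plotSmooth (S.isLift m q) (Nerve.continuous_reindex φ)
    (F₀ := fun y i => y (φ i)) (fun _ => rfl)
    fun k p hp => (S.isPlot_C _ _ _ _).2 fun i => (S.isPlot_C _ _ _ _).1 hp (φ i)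

theorem plotSmooth_tuple {n m : ℕ} (p : ℕ) (φ : Fin (m + 1) → Fin (n + 1)) :
    (S.C p n).PlotSmooth (S.C p m) fun y v => Nerve.reindex φ (y v) := fun k f hf =>
  (S.isPlot_C _ _ _ _).2 fun v =>
    plotSmooth_reindex (S.isNerveStr n) (S.isNerveStr m) φ k _ ((S.isPlot_C _ _ _ _).1 hf v)

theorem plotSmooth_mapPi1 {m n : ℕ} (p : ℕ) (φ : Fin (m + 1) → Fin (n + 1)) :
    (S.N p n).PlotSmooth (S.N p m) (Nerve.mapPi1 ⟨Nerve.reindex φ, Nerve.continuous_reindex φ⟩) :=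
  (S.isLift p n).plotSmooth (S.isLift p m) (Nerve.continuous_mapPi1 _ _)
    (F₀ := fun y v => Nerve.reindex φ (y v)) (fun _ => rfl) (S.plotSmooth_tuple p φ)

theorem isManifold_horizontal (q : ℕ) :
    ((doubleNerve Γ).horizontal q).IsManifold fun p => S.N p q := by
  refine SimplicialSpace.isManifold_of_hasLocalSections (fun n i hi => S.plotSmooth_reindex_N q _)
    (fun n i hi => ?_) fun n i hi => S.plotSmooth_reindex_N q _
  refine (S.isLift (n + 1) q).hasLocalSections (S.isLift n q) (Nerve.continuous_reindex _)
      (F₀ := fun y j => y (skip n i j)) (fun _ => rfl) fun y => ?_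
  classical
  refine ⟨Set.univ, isOpen_univ, trivial, fun z j => if j.1 = i then y j else z.1 (unskip n i j),
    funext fun j => ?_, fun z => funext fun j => ?_,
    fun k p hp hpl => (S.isPlot_C _ _ _ _).2 fun j => ?_⟩
  · dsimp only
    split_ifs with hj
    · rfl
    · rw [skip_unskip hi hj]
  · simp only [if_neg (skip_ne n i j), unskip_skip]
  · by_cases hj : j.1 = i
    · simp only [if_pos hj]
      exact isPlot_const _
    · simp only [if_neg hj]
      exact (S.isPlot_C _ _ _ _).1 hpl _

theorem isManifold_vertical (h : Γ.IsSmooth A B) (p : ℕ) :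
    ((doubleNerve Γ).vertical p).IsManifold (S.N p) := by
  refine SimplicialSpace.isManifold_of_hasLocalSections (fun n i hi => S.plotSmooth_mapPi1 p _)
    (fun n i hi => ?_) fun n i hi => S.plotSmooth_mapPi1 p _
  refine (S.isLift p (n + 1)).hasLocalSections (S.isLift p n) (Nerve.continuous_mapPi1 _ _)
      (F₀ := fun y v => Nerve.reindex (skip n i) (y v)) (fun _ => rfl) ?_
  exact hasLocalSections_pi (S.isPlot_C _ _) (S.isPlot_C _ _) fun v =>
      hasLocalSections_nerve h (S.isNerveStr _) (S.isNerveStr _) i hi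

theorem isManifold (h : Γ.IsSmooth A B) : (doubleNerve Γ).IsManifold S.N :=
  ⟨S.isManifold_horizontal, S.isManifold_vertical h⟩

theorem injOn_obj (S : NerveStr Γ A) (p q : ℕ) (x : Nerve (Pi1 (Nerve Γ q)) p) :
    ∃ U ∈ 𝓝 x, Set.InjOn Nerve.obj U :=
  exists_nhds_injOn (S.isLift p q).isLocalHomeomorph x

/-- A horn index other than a given one. -/
theorem exists_hornIdx_ne (n k : ℕ) : ∃ a b : SimplicialSpace.HornIdx (n + 1) k, a ≠ b := by
  rcases Nat.lt_trichotomy k 1 with hk | rfl | hk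
  · exact ⟨⟨1, by omega⟩, ⟨2, by omega⟩, fun h => by simp at h⟩
  · exact ⟨⟨0, by omega⟩, ⟨2, by omega⟩, fun h => by simp at h⟩
  · exact ⟨⟨0, by omega⟩, ⟨1, by omega⟩, fun h => by simp at h⟩

/-- The columns of the double nerve are étale local Lie 1-groupoids: the column `N_{p,•}` is étale
over a power of the nerve of `G`, in which the horns of dimension at least `2` have unique
fillers. -/
theorem isEtaleLie_vertical (h : Γ.IsSmooth A B) (p : ℕ) :
    ((doubleNerve Γ).vertical p).IsEtaleLie (S.N p) 1 := by
  refine ⟨S.isManifold_vertical h p, fun q k hk => ?_⟩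
  cases q with
  | zero =>
    obtain ⟨B, hB, hB'⟩ := SimplicialSpace.exists_horn_zero (S.isManifold_vertical h p) k hk
    exact ⟨B, hB, hB', fun h => absurd h (by omega)⟩
  | succ n =>
    obtain ⟨a, b, hab⟩ := exists_hornIdx_ne n k
    have hix : ∀ i : SimplicialSpace.HornIdx (n + 1) k, i.1 ≤ n + 2 := fun i => i.2.1
    have hinj : Function.Injective fun i : SimplicialSpace.HornIdx (n + 1) k => i.1 :=
      Subtype.val_injective
    let c : Fin (n + 3) := ⟨k, by omega⟩
    have hc : ∀ i : SimplicialSpace.HornIdx (n + 1) k, c.1 ≠ i.1 := fun i => i.2.2.symm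
    let d : ∀ {m : ℕ} (i : ℕ), i ≤ m + 1 → (Fin (p + 1) → Nerve Γ (m + 1)) →
      Fin (p + 1) → Nerve Γ m := fun {m} i _ y v => Nerve.reindex (skip m i) (y v)
    have hz : ∀ (z : HornSet n k (d (m := n))) (v : Fin (p + 1)), Nerve.FaceCompat
        (fun i : SimplicialSpace.HornIdx (n + 1) k => i.1) fun i => z.1 i v :=
      fun z v i j hij => congrFun (z.2 i j hij) v
    obtain ⟨B, hB, hB', hB''⟩ := exists_hornStr_isEtale (E := (doubleNerve Γ).vertical p) (D := S.N p) (n := n) (k := k)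
      (S.isLift p (n + 2)) (S.isLift p (n + 1)) (S.injOn_obj p n) (d := d) (d₂ := d)
      (fun i hi x => rfl) (fun i hi x => rfl) (fun i hi => S.plotSmooth_tuple p _)
      (fun z => by
        choose y hy using fun v => Nerve.exists_faces (hz z v) hix hinj hab hc
        exact ⟨y, fun i => funext fun v => hy v i⟩)
      (fun y y' e => funext fun v => Nerve.eq_of_faces hix hinj hab hc fun i => congrFun (e i) v)
      (fun m f hf => (S.isPlot_C _ _ _ _).2 fun v =>
        Nerve.isPlot_of_faces h (S.isNerveStr _) (S.isNerveStr _) hix hinj hab hc fun i =>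
          (S.isPlot_C _ _ _ _).1 (hf i) v)
      (fun f hf => continuous_pi fun v => Nerve.continuous_of_faces h.isTopological hix hinj hab hc
        fun i => (continuous_apply v).comp (hf i))
      (fun y i j hij => funext fun v => (Nerve.laws Γ).d_d n i.1 j.1 hij j.2.1 (y v))
    exact ⟨B, hB, hB', fun _ => hB''⟩

end NerveStr

end

/-! ### The bar construction is étale over products of nerves -/

instance finite_antiDiag (r : ℕ) : Finite (AntiDiag r) :=
  Finite.of_injective (fun a : AntiDiag r => (⟨a.1.1, by have := a.2; omega⟩ : Fin (r + 1)))
    fun a b h => by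
      have h1 : a.1.1 = b.1.1 := congrArg Fin.val h
      have h2 := a.2
      have h3 := b.2
      exact Subtype.ext (Prod.ext h1 (by omega))

section

variable {G : Type u} {M : Type v} (Γ : InternalGroupoid G M)

/-- The product of the spaces `G^{(q)}`, `q ≤ r`. The component of index `(p, q)` is the last
vertex of the component `x_p` of an element of the bar construction. -/
abbrev LastVertices (r : ℕ) := (a : AntiDiag r) → Nerve Γ a.1.2

variable {Γ}

/-- The map of last vertices induced by the `i`-th face map of the bar construction. -/
def lastFace {r : ℕ} (i : ℕ) (y : LastVertices Γ (r + 1)) : LastVertices Γ r := fun a =>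
  if a.1.1 < i then reindex (skip _ (i - a.1.1)) (y ⟨(a.1.1, a.1.2 + 1), by have := a.2; omega⟩)
  else y ⟨(a.1.1 + 1, a.1.2), by have := a.2; omega⟩

theorem lastFace_of_lt {r i : ℕ} (y : LastVertices Γ (r + 1)) {p q : ℕ} (h : p + q = r)
    (hp : p < i) : lastFace i y ⟨(p, q), h⟩ =
      reindex (skip _ (i - p)) (y ⟨(p, q + 1), by omega⟩) := if_pos hp

theorem lastFace_of_le {r i : ℕ} (y : LastVertices Γ (r + 1)) {p q : ℕ} (h : p + q = r)
    (hp : i ≤ p) : lastFace i y ⟨(p, q), h⟩ = y ⟨(p + 1, q), by omega⟩ := if_neg (by simpa using hp)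

/-- The vertices of an element of the bar construction with given last vertices. -/
def vertexOf {r : ℕ} (y : LastVertices Γ r) : (p q : ℕ) → p + q = r → Fin (p + 1) → Nerve Γ q
  | 0, q, h => fun _ => y ⟨(0, q), h⟩
  | p + 1, q, h => Fin.lastCases (y ⟨(p + 1, q), h⟩)
    fun i => reindex (skip q 0) (vertexOf y p (q + 1) (by omega) i)

theorem vertexOf_last {r : ℕ} (y : LastVertices Γ r) {p q : ℕ} (h : p + q = r) :
    vertexOf y p q h (Fin.last p) = y ⟨(p, q), h⟩ := by
  cases p with
  | zero => rfl
  | succ p => simp [vertexOf]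

theorem vertexOf_castSucc {r : ℕ} (y : LastVertices Γ r) {p q : ℕ} (h : p + 1 + q = r)
    (i : Fin (p + 1)) : vertexOf y (p + 1) q h i.castSucc =
      reindex (skip q 0) (vertexOf y p (q + 1) (by omega) i) := by
  simp [vertexOf]

/-- The vertices of the elements of the bar construction. -/
def BarVertices (Γ : InternalGroupoid G M) (r : ℕ) :
    Set ((a : AntiDiag r) → Fin (a.1.1 + 1) → Nerve Γ a.1.2) :=
  {y | ∀ p q (h : p + (q + 1) = r) (h' : p + 1 + q = r) (i : Fin (p + 1)),
    reindex (skip q 0) (y ⟨(p, q + 1), h⟩ i) = y ⟨(p + 1, q), h'⟩ i.castSucc}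

theorem eq_vertexOf {r : ℕ} {y : (a : AntiDiag r) → Fin (a.1.1 + 1) → Nerve Γ a.1.2}
    (hy : y ∈ BarVertices Γ r) (p q : ℕ) (h : p + q = r) :
    y ⟨(p, q), h⟩ = vertexOf (fun a => y a (Fin.last _)) p q h := by
  induction p generalizing q with
  | zero =>
    funext i
    obtain rfl : i = Fin.last 0 := Subsingleton.elim (α := Fin 1) _ _
    rfl
  | succ p ih =>
    funext i
    refine Fin.lastCases ?_ (fun i => ?_) i
    · exact (vertexOf_last (fun a => y a (Fin.last _)) h).symm
    · rw [vertexOf_castSucc, ← ih, hy p q (by omega) h]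

variable [TopologicalSpace G] [TopologicalSpace M]

theorem continuous_vertexOf {r p q : ℕ} (h : p + q = r) (i : Fin (p + 1)) :
    Continuous fun y : LastVertices Γ r => vertexOf y p q h i := by
  induction p generalizing q with
  | zero => exact continuous_apply _
  | succ p ih =>
    refine Fin.lastCases ?_ (fun i => ?_) i
    · simp only [vertexOf_last]
      exact continuous_apply _
    · simp only [vertexOf_castSucc]
      exact (continuous_reindex _).comp (ih _ i)

/-- The last vertices of the components of an element of the bar construction. -/
def lastVertices {r : ℕ} (x : Bar (doubleNerve Γ) r) : LastVertices Γ r := fun a =>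
  Nerve.obj (Γ := Pi1 (Nerve Γ a.1.2)) (n := a.1.1) (x.1 a) (Fin.last _)

/-- The components of an element of the double bar construction as simplices of nerves. -/
def barAt {r : ℕ} (x : Bar (doubleNerve Γ) r) (p q : ℕ) (h : p + q = r) :
    Nerve (Pi1 (Nerve Γ q)) p := x.at' p q h

theorem barAt_obj_castSucc {r : ℕ} (x : Bar (doubleNerve Γ) r) (p q : ℕ) (h : p + (q + 1) = r)
    (h' : p + 1 + q = r) (i : Fin (p + 1)) :
    reindex (skip q 0) ((barAt x p (q + 1) h).obj i) = (barAt x (p + 1) q h').obj i.castSucc := by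
  have := congrArg (fun z : Nerve (Pi1 (Nerve Γ q)) p => z.obj i) (x.compat p q h h')
  refine Eq.trans this ?_
  change (barAt x (p + 1) q h').obj _ = _
  congr 1
  apply Fin.ext
  simp [skip]
  omega

theorem barAt_obj {r : ℕ} (x : Bar (doubleNerve Γ) r) (p q : ℕ) (h : p + q = r) :
    (barAt x p q h).obj = vertexOf (lastVertices x) p q h :=
  eq_vertexOf (y := fun a => (barAt x a.1.1 a.1.2 a.2).obj) (fun p q h h' i =>
    barAt_obj_castSucc x p q h h' i) p q h

theorem lastVertices_face {r i : ℕ} (hi : i ≤ r + 1) (x : Bar (doubleNerve Γ) (r + 1)) :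
    lastVertices (Bar.face r i hi x) = lastFace i (lastVertices x) := by
  funext ⟨⟨p, q⟩, h⟩
  change p + q = r at h
  rcases Nat.lt_or_ge p i with hp | hp
  · rw [lastFace_of_lt _ _ hp]
    change Nerve.obj (Γ := Pi1 (Nerve Γ q)) (n := p) (Bar.faceComp i hi x p q h) (Fin.last p) = _
    rw [Bar.faceComp, dif_pos hp]
    rfl
  · rw [lastFace_of_le _ _ hp]
    change Nerve.obj (Γ := Pi1 (Nerve Γ q)) (n := p) (Bar.faceComp i hi x p q h) (Fin.last p) = _
    rw [Bar.faceComp, dif_neg (by omega)]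
    change (barAt x (p + 1) q _).obj (skip p i (Fin.last p)) = (barAt x (p + 1) q _).obj (Fin.last _)
    congr 1
    apply Fin.ext
    simp [skip]
    omega

variable {A : SmoothStr G} {B : SmoothStr M}

/-- All vertices of an element of the bar construction are faces of the last ones, and the
compatibility of the path classes is an open condition once it holds for the vertices. -/
theorem isLocalHomeomorph_lastVertices (S : NerveStr Γ A) (r : ℕ) :
    IsLocalHomeomorph (lastVertices : Bar (doubleNerve Γ) r → LastVertices Γ r) := by
  -- all vertices
  have h1 := IsLocalHomeomorph.piMap fun a : AntiDiag r =>
    (S.isLift a.1.1 a.1.2).isLocalHomeomorph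
  have h2 : Set.MapsTo (Pi.map fun a : AntiDiag r =>
      (Nerve.obj : Nerve (Pi1 (Nerve Γ a.1.2)) a.1.1 → _)) {x | BarCompat (doubleNerve Γ) r x}
      (BarVertices Γ r) := fun x hx p q h h' i =>
    barAt_obj_castSucc (⟨x, hx⟩ : Bar (doubleNerve Γ) r) p q h h' i
  have h3 := IsLocalHomeomorph.restrict h1 h2 fun x hx => by
    have h4 : ∀ p : Fin r, ∃ O ∈ 𝓝 x, ∀ y ∈ O, y ∈ (Pi.map fun a : AntiDiag r =>
        (Nerve.obj : Nerve (Pi1 (Nerve Γ a.1.2)) a.1.1 → _)) ⁻¹' BarVertices Γ r →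
        ∀ q (h : p.1 + (q + 1) = r) (h' : p.1 + 1 + q = r),
        Nerve.mapPi1 ⟨Nerve.reindex (skip q 0), Nerve.continuous_reindex _⟩ (y ⟨(p.1, q + 1), h⟩) =
          Nerve.reindex (skip p.1 (p.1 + 1)) (y ⟨(p.1 + 1, q), h'⟩) := by
      intro p
      obtain ⟨q, hq⟩ : ∃ q, p.1 + (q + 1) = r := ⟨r - p.1 - 1, by have := p.2; omega⟩
      obtain ⟨O, hO, h⟩ := exists_nhds_eq_of_lift (S.injOn_obj p.1 q)
        (u := fun y : (a : AntiDiag r) → Nerve (Pi1 (Nerve Γ a.1.2)) a.1.1 =>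
          Nerve.mapPi1 ⟨Nerve.reindex (skip q 0), Nerve.continuous_reindex _⟩
            (y ⟨(p.1, q + 1), hq⟩))
        (v := fun y => Nerve.reindex (skip p.1 (p.1 + 1)) (y ⟨(p.1 + 1, q), by omega⟩))
        ((Nerve.continuous_mapPi1 _ _).comp (continuous_apply _))
        ((Nerve.continuous_reindex _).comp (continuous_apply _)) (hx p.1 q hq (by omega))
      refine ⟨O, hO, fun y hy hy' q' e e' => ?_⟩
      obtain rfl : q' = q := by omega
      refine h y hy (funext fun i => (hy' p.1 q' e e' i).trans ?_)
      change (y ⟨(p.1 + 1, q'), e'⟩).obj _ = (y ⟨(p.1 + 1, q'), e'⟩).obj _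
      congr 1
      apply Fin.ext
      simp [skip]
      omega
    choose O hO h using h4
    refine ⟨⋂ p, O p, Filter.iInter_mem.2 hO, fun y hy p q e e' => ?_⟩
    exact h ⟨p, by omega⟩ y (Set.mem_iInter.1 hy.1 _) hy.2 q e e'
  -- the last vertices determine all vertices
  let e : BarVertices Γ r ≃ₜ LastVertices Γ r :=
    { toFun := fun y a => y.1 a (Fin.last _)
      invFun := fun y => ⟨fun a => vertexOf y a.1.1 a.1.2 a.2, fun p q h h' i =>
        (vertexOf_castSucc y h' i).symm⟩
      left_inv := fun y => Subtype.ext (funext fun a => (eq_vertexOf y.2 a.1.1 a.1.2 a.2).symm)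
      right_inv := fun y => funext fun a => vertexOf_last y a.2
      continuous_toFun := continuous_pi fun a =>
        (continuous_apply _).comp ((continuous_apply a).comp continuous_subtype_val)
      continuous_invFun := (continuous_pi fun a => continuous_pi fun i =>
        continuous_vertexOf a.2 i).subtype_mk _ }
  exact e.isOpenEmbedding.isLocalHomeomorph.comp h3

/-- The standard smooth structures on the bar construction and on the products of nerves over
which it is étale. -/
structure BarStr (S : NerveStr Γ A) where
  D : ∀ r, SmoothStr (LastVertices Γ r)
  W : ∀ r, SmoothStr (Bar (doubleNerve Γ) r)
  isPlot_D : ∀ r n (f : Euc n → LastVertices Γ r),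
    (D r).IsPlot f ↔ ∀ a, (S.X _).IsPlot fun t => f t a
  isLift : ∀ r, (W r).IsLift (D r) lastVertices
  inducedBy : ∀ r, (W r).InducedBy (ι := AntiDiag r) (fun a => S.N a.1.1 a.1.2)
    (fun a x => barAt x a.1.1 a.1.2 a.2)

/-- The last vertices being smooth, all vertices are, so that the lifted structure is the one induced
by the components. -/
theorem nonempty_barStr (S : NerveStr Γ A) : Nonempty (BarStr S) := by
  choose D hD using fun r => SmoothStr.exists_pi fun a : AntiDiag r => S.X a.1.2
  choose W hW using fun r => exists_isLift (isLocalHomeomorph_lastVertices S r) (D r)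
  refine ⟨⟨D, W, hD, hW, fun r n f => ?_⟩⟩
  rw [(hW r).isPlot_iff, hD]
  constructor
  · rintro ⟨hc, hf⟩ ⟨⟨p, q⟩, h⟩
    refine ((S.isLift p q).isPlot_iff n _).2 ⟨(Bar.continuous_at _ _ _).comp hc, ?_⟩
    refine (S.isPlot_C _ _ _ _).2 fun i => ?_
    have e : (fun t => (Nerve.obj ∘ (fun x => barAt x p q h) ∘ f) t i) =
        fun t => vertexOf (lastVertices (f t)) p q h i := funext fun t =>
      congrFun (barAt_obj (f t) p q h) i
    refine e ▸ ?_
    clear e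
    induction p generalizing q with
    | zero => exact hf ⟨(0, q), h⟩
    | succ p ih =>
      refine Fin.lastCases ?_ (fun i => ?_) i
      · simp only [vertexOf_last]
        exact hf ⟨(p + 1, q), h⟩
      · simp only [vertexOf_castSucc]
        exact plotSmooth_reindex (S.isNerveStr _) (S.isNerveStr _) _ n _ (ih _ _ i)
  · intro hf
    refine ⟨(continuous_pi fun a => (hf a).continuous).subtype_mk _, fun a => ?_⟩
    exact (S.isPlot_C _ _ _ _).1 (((S.isLift a.1.1 a.1.2).isPlot_iff n _).1 (hf a)).2 (Fin.last _)

end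

/-! ### Simplices with prescribed faces -/

section

variable {G : Type u} {M : Type v} {Γ : InternalGroupoid G M} {r : ℕ} {ι : Type*} {ix : ι → ℕ}

/-- The condition on the component `y` of index `(p, q)` of an element of `LastVertices Γ (r + 1)`
for its faces with numbers `ix i` to be the `z i`. -/
def IsComponent (ix : ι → ℕ) (z : ι → LastVertices Γ r) :
    (p q : ℕ) → p + q = r + 1 → Nerve Γ q → Prop
  | 0, 0, _, _ => True
  | 0, q + 1, h, y => ∀ i, 0 < ix i → reindex (skip q (ix i)) y = z i ⟨(0, q), by omega⟩
  | p + 1, 0, h, y => ∀ i, ix i ≤ p → y = z i ⟨(p, 0), by omega⟩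
  | p + 1, q + 1, h, y => (∀ i, ix i ≤ p → y = z i ⟨(p, q + 1), by omega⟩) ∧
    ∀ i, p + 1 < ix i → reindex (skip q (ix i - (p + 1))) y = z i ⟨(p + 1, q), by omega⟩

/-- A description of `IsComponent` that does not distinguish the cases `p = 0` and `q = 0`. -/
theorem isComponent_iff {z : ι → LastVertices Γ r} {p q : ℕ}
    {h : p + q = r + 1} {y : Nerve Γ q} : IsComponent ix z p q h y ↔
      (∀ p' (e : p = p' + 1) i, ix i ≤ p' → y = z i ⟨(p', q), by omega⟩) ∧
      ∀ q' (e : q = q' + 1) i, p < ix i →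
        reindex (skip q' (ix i - p)) (e ▸ y) = z i ⟨(p, q'), by omega⟩ := by
  rcases p with _ | p <;> rcases q with _ | q
  · omega
  · refine ⟨fun h => ⟨fun p' e => absurd e (by omega), fun q' e i hi => ?_⟩, fun h i hi => ?_⟩
    · obtain rfl : q = q' := by omega
      exact h i hi
    · exact h.2 q rfl i hi
  · refine ⟨fun h => ⟨fun p' e i hi => ?_, fun q' e => absurd e (by omega)⟩, fun h i hi => ?_⟩
    · obtain rfl : p = p' := by omega
      exact h i hi
    · exact h.1 p rfl i hi
  · refine ⟨fun h => ⟨fun p' e i hi => ?_, fun q' e i hi => ?_⟩, fun h => ⟨fun i hi => ?_, fun i hi => ?_⟩⟩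
    · obtain rfl : p = p' := by omega
      exact h.1 i hi
    · obtain rfl : q = q' := by omega
      exact h.2 i hi
    · exact h.1 p rfl i hi
    · exact h.2 q rfl i hi

/-- The equations for the faces decouple into conditions on the single components. -/
theorem lastFace_eq_iff {z : ι → LastVertices Γ r} {y : LastVertices Γ (r + 1)} : (∀ i, lastFace (ix i) y = z i) ↔
      ∀ p q h, IsComponent ix z p q h (y ⟨(p, q), h⟩) := by
  constructor
  · intro hy p q h
    refine isComponent_iff.2 ⟨?_, ?_⟩
    · rintro p rfl i hi
      rw [← hy, lastFace_of_le _ _ hi]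
    · rintro q rfl i hi
      rw [← hy, lastFace_of_lt _ _ hi]
  · intro hy i
    funext ⟨⟨p, q⟩, h⟩
    change p + q = r at h
    rcases Nat.lt_or_ge p (ix i) with hp | hp
    · rw [lastFace_of_lt _ _ hp]
      exact (isComponent_iff.1 (hy p (q + 1) (by omega))).2 q rfl i hp
    · rw [lastFace_of_le _ _ hp]
      exact (isComponent_iff.1 (hy (p + 1) q (by omega))).1 p rfl i hp

end

section

variable {G : Type u} {M : Type v} [TopologicalSpace G] [TopologicalSpace M]
  {Γ : InternalGroupoid G M} {A : SmoothStr G} {B : SmoothStr M} {S : NerveStr Γ A} {r : ℕ}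
  {ι : Type*} {ix : ι → ℕ} {Z : Type*} [TopologicalSpace Z]

/-- A family of components with prescribed faces depending smoothly on `z` near `z₀`, with the
value `y₀` at `z₀`. -/
def LocalComponent (S : NerveStr Γ A) (C : SmoothStr Z) (ix : ι → ℕ) (z₀ : Z)
    (f : Z → ι → LastVertices Γ r) (p q : ℕ) (h : p + q = r + 1) (y₀ : Nerve Γ q) : Prop :=
  ∃ (V : Set Z) (_ : IsOpen V) (hz : z₀ ∈ V) (s : V → Nerve Γ q), s ⟨z₀, hz⟩ = y₀ ∧
    (∀ z, IsComponent ix (f z.1) p q h (s z)) ∧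
    ∀ k (g : Euc k → Z) (hg : ∀ t, g t ∈ V), C.IsPlot g → (S.X q).IsPlot fun t => s ⟨g t, hg t⟩

variable {C : SmoothStr Z} {z₀ : Z} {f : Z → ι → LastVertices Γ r} {p q : ℕ}

theorem localComponent_of_forall {h : p + q = r + 1} {s : Z → Nerve Γ q}
    (hs : ∀ z, IsComponent ix (f z) p q h (s z)) (hs' : C.PlotSmooth (S.X q) s) :
    LocalComponent S C ix z₀ f p q h (s z₀) :=
  ⟨Set.univ, isOpen_univ, trivial, fun z => s z.1, rfl, fun z => hs z.1, fun k g _ hg => hs' k g hg⟩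

/-- If only one face condition applies to the component `(p, q)`, one can use a local section of a
face map of the nerve. -/
theorem localComponent_of_unique (hΓ : Γ.IsSmooth A B) (hix : ∀ i, ix i ≤ r + 1) {i : ι}
    {h : p + (q + 1) = r + 1} (hi : p < ix i) (hi' : ∀ j, j = i ∨ ix j = p)
    (hf : C.PlotSmooth (S.X q) fun z => f z i ⟨(p, q), by omega⟩) {y₀ : Nerve Γ (q + 1)}
    (hy₀ : reindex (skip q (ix i - p)) y₀ = f z₀ i ⟨(p, q), by omega⟩) :
    LocalComponent S C ix z₀ f p (q + 1) h y₀ := by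
  obtain ⟨V, hV, hyV, s, hs, hs', hsp⟩ := hasLocalSections_nerve hΓ (S.isNerveStr _)
    (S.isNerveStr _) (ix i - p) (by have := hix i; omega) y₀
  have hpq : p + q = r := by omega
  refine ⟨(fun z => f z i ⟨(p, q), hpq⟩) ⁻¹' V, hV.preimage hf.continuous,
    by rw [Set.mem_preimage, ← hy₀]; exact hyV,
    fun z => s ⟨f z.1 i ⟨(p, q), hpq⟩, z.2⟩, ?_, fun z => ?_, fun k g hg hg' => ?_⟩
  · exact Eq.trans (congrArg s (Subtype.ext hy₀.symm)) hs
  · refine isComponent_iff.2 ⟨?_, ?_⟩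
    · rintro p' rfl j hj
      rcases hi' j with rfl | hj' <;> omega
    · rintro q' e j hj
      obtain rfl : q = q' := by omega
      rcases hi' j with rfl | hj'
      · exact hs' _
      · omega
  · exact hsp k _ hg (hf k g hg')

/-- A local section of the map that takes some faces can be found component by component. -/
theorem hasLocalSections_of_localComponent {F : LastVertices Γ (r + 1) → Z}
    {D : SmoothStr (LastVertices Γ (r + 1))}
    (hD : ∀ n (g : Euc n → LastVertices Γ (r + 1)), D.IsPlot g ↔ ∀ a, (S.X _).IsPlot fun t => g t a)
    (hF : ∀ y z, (∀ i, lastFace (ix i) y = f z i) → F y = z)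
    (key : ∀ y p q h, LocalComponent S C ix (F y) f p q h (y ⟨(p, q), h⟩)) :
    D.HasLocalSections C F := by
  intro y
  choose V hV hyV s hs hsc hsp using fun a : AntiDiag (r + 1) => key y a.1.1 a.1.2 a.2
  refine ⟨⋂ a, V a, isOpen_iInter_of_finite hV, Set.mem_iInter.2 hyV,
    fun z a => s a ⟨z.1, Set.mem_iInter.1 z.2 a⟩, funext fun a => hs a, fun z => ?_,
    fun k g hg hg' => (hD _ _).2 fun a => hsp a k g _ hg'⟩
  exact hF _ _ (lastFace_eq_iff.2 fun p q h => hsc ⟨(p, q), h⟩ _)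

end

section

variable {G : Type u} {M : Type v} [TopologicalSpace G] [TopologicalSpace M]
  {Γ : InternalGroupoid G M} {A : SmoothStr G} {B : SmoothStr M} {S : NerveStr Γ A}

namespace BarStr

variable (T : BarStr S)

theorem plotSmooth_lastFace {r i : ℕ} :
    (T.D (r + 1)).PlotSmooth (T.D r) (lastFace i) := by
  refine fun k f hf => (T.isPlot_D _ _ _).2 fun ⟨⟨p, q⟩, h⟩ => ?_
  change p + q = r at h
  rcases Nat.lt_or_ge p i with hp | hp
  · simp only [Function.comp, lastFace_of_lt _ h hp]
    exact plotSmooth_reindex (S.isNerveStr _) (S.isNerveStr _) _ k _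
      ((T.isPlot_D _ _ _).1 hf ⟨(p, q + 1), by omega⟩)
  · simp only [Function.comp, lastFace_of_le _ h hp]
    exact (T.isPlot_D _ _ _).1 hf ⟨(p + 1, q), by omega⟩

theorem plotSmooth_face {r i : ℕ} (hi : i ≤ r + 1) :
    (T.W (r + 1)).PlotSmooth (T.W r) (Bar.face r i hi) :=
  (T.isLift _).plotSmooth (T.isLift _) (Bar.continuous_face _ _ _) (lastVertices_face hi)
    T.plotSmooth_lastFace

theorem plotSmooth_degen {r i : ℕ} (hi : i ≤ r) :
    (T.W r).PlotSmooth (T.W (r + 1)) (Bar.degen r i hi) := by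
  refine fun k f hf => (T.inducedBy _ _ _).2 fun ⟨⟨p, q⟩, h⟩ => ?_
  change p + q = r + 1 at h
  have hf' := fun p q h => (T.inducedBy _ _ _).1 hf ⟨(p, q), h⟩
  rcases Nat.lt_or_ge i p with hp | hp
  · obtain ⟨p, rfl⟩ : ∃ p', p = p' + 1 := ⟨p - 1, by omega⟩
    have e : (fun x => barAt x (p + 1) q h) ∘ Bar.degen r i hi ∘ f =
        fun t => Nerve.reindex (rep p i (by omega)) (barAt (f t) p q (by omega)) :=
      funext fun t => Bar.degenComp_of_lt i hi (f t) p q h hp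
    exact e ▸ S.plotSmooth_reindex_N q _ k _ (hf' p q (by omega))
  · obtain ⟨q, rfl⟩ : ∃ q', q = q' + 1 := ⟨q - 1, by omega⟩
    have e : (fun x => barAt x p (q + 1) h) ∘ Bar.degen r i hi ∘ f =
        fun t => Nerve.mapPi1 ⟨Nerve.reindex (rep q (i - p) (by omega)),
          Nerve.continuous_reindex _⟩ (barAt (f t) p q (by omega)) :=
      funext fun t => Bar.degenComp_of_le i hi (f t) p q h hp
    exact e ▸ S.plotSmooth_mapPi1 p _ k _ (hf' p q (by omega))

/-- The components of a local section of `lastFace i` are local sections of a face map of the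
nerve of `G` if `p < i`, constant if `p = i`, and given if `p > i`. -/
theorem hasLocalSections_lastFace (h : Γ.IsSmooth A B) {r i : ℕ} (hi : i ≤ r + 1) :
    (T.D (r + 1)).HasLocalSections (T.D r) (lastFace i) := by
  have hix : ∀ _ : Unit, i ≤ r + 1 := fun _ => hi
  refine hasLocalSections_of_localComponent (ix := fun _ : Unit => i) (f := fun z _ => z)
    (T.isPlot_D _) (fun y z hz => hz ()) fun y p q hpq => ?_
  rcases lt_trichotomy p i with hp | rfl | hp
  · obtain ⟨q, rfl⟩ : ∃ q', q = q' + 1 := ⟨q - 1, by omega⟩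
    refine localComponent_of_unique (i := ()) h hix hp (fun _ => .inl rfl)
      (fun k g hg => (T.isPlot_D _ _ _).1 hg ⟨(p, q), by omega⟩) (lastFace_of_lt y _ hp).symm
  · refine localComponent_of_forall (s := fun _ => y ⟨(p, q), hpq⟩)
      (fun z => isComponent_iff.2 ⟨?_, ?_⟩) fun k g hg => isPlot_const _
    · intro p' e _ h'
      omega
    · intro q' e _ h'
      omega
  · obtain ⟨p, rfl⟩ : ∃ p', p = p' + 1 := ⟨p - 1, by omega⟩
    have hpq' : p + q = r := by omega
    rw [← lastFace_of_le (i := i) y hpq' (by omega)]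
    refine localComponent_of_forall (s := fun z => z ⟨(p, q), by omega⟩)
      (fun z => isComponent_iff.2 ⟨?_, ?_⟩)
      fun k g hg => (T.isPlot_D _ _ _).1 hg ⟨(p, q), by omega⟩
    · intro p' e _ h'
      obtain rfl : p = p' := by omega
      rfl
    · intro q' e _ h'
      omega

theorem isManifold (h : Γ.IsSmooth A B) : (bar (doubleNerve Γ)).IsManifold T.W :=
  SimplicialSpace.isManifold_of_hasLocalSections (fun _ _ hi => T.plotSmooth_face hi)
    (fun _ _ hi => (T.isLift _).hasLocalSections (T.isLift _) (Bar.continuous_face _ _ _)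
      (lastVertices_face hi) (T.hasLocalSections_lastFace h hi))
    fun _ _ hi => T.plotSmooth_degen hi

end BarStr

end

/-! ### Horns in the bar construction -/

section

variable {G : Type u} {M : Type v} {Γ : InternalGroupoid G M}

theorem lastFace_lastFace {r i j : ℕ} (hij : i < j) (hj : j ≤ r + 2)
    (y : LastVertices Γ (r + 2)) :
    lastFace i (lastFace j y) = lastFace (j - 1) (lastFace i y) := by
  funext ⟨⟨p, q⟩, h⟩
  change p + q = r at h
  by_cases h1 : p < i
  · rw [lastFace_of_lt _ _ h1, lastFace_of_lt _ _ (by omega), lastFace_of_lt _ _ (by omega),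
      lastFace_of_lt _ _ h1]
    have := (Nerve.laws Γ).d_d q (i - p) (j - p) (by omega) (by omega) (y ⟨(p, q + 2), by omega⟩)
    refine this.trans ?_
    congr 2
    omega
  · rw [lastFace_of_le _ _ (by omega)]
    by_cases h2 : p + 1 < j
    · rw [lastFace_of_lt _ _ h2, lastFace_of_lt _ _ (by omega), lastFace_of_le _ _ (by omega)]
      congr 2
      omega
    · rw [lastFace_of_le _ _ (by omega), lastFace_of_le _ _ (by omega),
        lastFace_of_le _ _ (by omega)]

variable {n k : ℕ}

/-- The horns in the spaces of last vertices. -/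
abbrev LastHorn (Γ : InternalGroupoid G M) (n k : ℕ) :=
  HornSet (Y₁ := LastVertices Γ (n + 1)) (Y₀ := LastVertices Γ n) n k fun i _ => lastFace i

theorem lastHorn_compat (z : LastHorn Γ n k) {i j : SimplicialSpace.HornIdx (n + 1) k}
    (hij : i.1 < j.1) {p q : ℕ} (h : p + q = n) :
    lastFace i.1 (z.1 j) ⟨(p, q), h⟩ = lastFace (j.1 - 1) (z.1 i) ⟨(p, q), h⟩ :=
  congrFun (z.2 i j hij) ⟨(p, q), h⟩

theorem isComponent_of_horn (z : LastHorn Γ n k) {i₀ : SimplicialSpace.HornIdx (n + 1) k}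
    (hi₀ : ∀ j : SimplicialSpace.HornIdx (n + 1) k, i₀.1 ≤ j.1) {p q : ℕ}
    (h : p + 1 + q = n + 1 + 1) (hp : i₀.1 ≤ p) :
    IsComponent (fun i : SimplicialSpace.HornIdx (n + 1) k => i.1) z.1 (p + 1) q h
      (z.1 i₀ ⟨(p, q), by omega⟩) := by
  refine isComponent_iff.2 ⟨?_, ?_⟩
  · intro p' e i hi
    obtain rfl : p = p' := by omega
    rcases (hi₀ i).eq_or_lt with e | hlt
    · rw [Subtype.ext e]
    · obtain ⟨p, rfl⟩ : ∃ p', p = p' + 1 := ⟨p - 1, by omega⟩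
      have := lastHorn_compat z hlt (p := p) (q := q) (by omega)
      rw [lastFace_of_le _ _ (by omega), lastFace_of_le _ _ (by omega)] at this
      exact this.symm
  · rintro q' rfl i hi
    have hlt : i₀.1 < i.1 := by omega
    have := lastHorn_compat z hlt (p := p) (q := q') (by omega)
    rw [lastFace_of_le _ _ (by omega), lastFace_of_lt _ _ (by omega)] at this
    refine Eq.trans ?_ this.symm
    congr 2
    omega

theorem faceCompat_of_horn (z : LastHorn Γ n k) {p q : ℕ} (h : p + (q + 1) = n + 1) :
    Nerve.FaceCompat (fun i : {i : SimplicialSpace.HornIdx (n + 1) k // p < i.1} => i.1.1 - p)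
      fun i => z.1 i.1 ⟨(p, q + 1), h⟩ := by
  intro i j hij
  have h1 := i.2
  have h2 := j.2
  dsimp only at hij
  have hlt : i.1.1 < j.1.1 := by omega
  have := lastHorn_compat z hlt (p := p) (q := q) (by omega)
  rw [lastFace_of_lt _ _ h1, lastFace_of_lt _ _ (by omega)] at this
  refine this.trans ?_
  congr 2
  dsimp only
  omega

theorem isComponent_iff_of_le {z : SimplicialSpace.HornIdx (n + 1) k → LastVertices Γ (n + 1)}
    {p q : ℕ} {h : p + (q + 1) = n + 1 + 1}
    (hp : ∀ j : SimplicialSpace.HornIdx (n + 1) k, p ≤ j.1) {y : Nerve Γ (q + 1)} :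
    IsComponent (fun i : SimplicialSpace.HornIdx (n + 1) k => i.1) z p (q + 1) h y ↔
      ∀ i : {i : SimplicialSpace.HornIdx (n + 1) k // p < i.1},
        reindex (skip q (i.1.1 - p)) y = z i.1 ⟨(p, q), by omega⟩ := by
  rw [isComponent_iff]
  constructor
  · intro h' i
    exact h'.2 q rfl i.1 i.2
  · refine fun h' => ⟨fun p' e i hi => ?_, fun q' e i hi => ?_⟩
    · have := hp i
      omega
    · obtain rfl : q = q' := by omega
      exact h' ⟨i, hi⟩

/-- A component of a simplex with given horn is given by the face of lowest number, or determined
by two of its faces, or only subject to one condition; the last case only occurs in dimension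
`2`. -/
theorem hornIdx_cases (hk : k ≤ n + 2) {p q : ℕ} (h : p + q = n + 1 + 1) :
    (∃ p', p = p' + 1 ∧ ∃ i₀ : SimplicialSpace.HornIdx (n + 1) k, i₀.1 ≤ p' ∧
      ∀ j : SimplicialSpace.HornIdx (n + 1) k, i₀.1 ≤ j.1) ∨
    ((∀ j : SimplicialSpace.HornIdx (n + 1) k, p ≤ j.1) ∧ ∃ q', q = q' + 1 + 1 ∧
      ∃ a b : {i : SimplicialSpace.HornIdx (n + 1) k // p < i.1}, a ≠ b) ∨
    (n = 0 ∧ (∀ j : SimplicialSpace.HornIdx (n + 1) k, p ≤ j.1) ∧ ∃ q', q = q' + 1 ∧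
      ∃ i : SimplicialSpace.HornIdx (n + 1) k, p < i.1 ∧ ∀ j, j = i ∨ j.1 = p) := by
  have ne : ∀ {i j : {i : SimplicialSpace.HornIdx (n + 1) k // p < i.1}}, i.1.1 ≠ j.1.1 → i ≠ j :=
    fun h h' => h (congrArg (fun i => i.1.1) h')
  have hsub : ∀ i j : SimplicialSpace.HornIdx (n + 1) k, i.1 = j.1 → i = j :=
    fun i j => Subtype.ext
  by_cases hk0 : k = 0
  · subst hk0
    have hj : ∀ j : SimplicialSpace.HornIdx (n + 1) 0, 1 ≤ j.1 := fun j => by have := j.2; omega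
    by_cases hp : 2 ≤ p
    · exact .inl ⟨p - 1, by omega, ⟨1, by omega⟩, by simp only; omega, hj⟩
    by_cases hp0 : p = 0
    · exact .inr (.inl ⟨fun j => by omega, n, by omega, ⟨⟨1, by omega⟩, by simp only; omega⟩,
        ⟨⟨2, by omega⟩, by simp only; omega⟩, ne (by simp)⟩)
    obtain rfl : p = 1 := by omega
    by_cases hn : n = 0
    · subst hn
      refine .inr (.inr ⟨rfl, hj, 0, by omega, ⟨2, by omega⟩, by simp, fun j => ?_⟩)
      have := j.2
      by_cases hj2 : j.1 = 2
      · exact .inl (hsub _ _ hj2)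
      · exact .inr (by omega)
    · exact .inr (.inl ⟨hj, n - 1, by omega, ⟨⟨2, by omega⟩, by simp⟩,
        ⟨⟨3, by omega⟩, by simp⟩, ne (by simp)⟩)
  · by_cases hp : 1 ≤ p
    · exact .inl ⟨p - 1, by omega, ⟨0, by omega⟩, by simp, fun j => by simp⟩
    obtain rfl : p = 0 := by omega
    by_cases hn : n = 0
    · subst hn
      refine .inr (.inr ⟨rfl, fun j => by omega, 1, by omega, ⟨3 - k, by omega⟩,
        by simp only; omega, fun j => ?_⟩)
      have := j.2
      by_cases hj2 : j.1 = 3 - k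
      · exact .inl (hsub _ _ hj2)
      · exact .inr (by omega)
    · refine .inr (.inl ⟨fun j => by omega, n, by omega,
        ⟨⟨if k = 1 then 2 else 1, by split_ifs <;> omega⟩, by dsimp only; split_ifs <;> omega⟩,
        ⟨⟨if k = 3 then 2 else 3, by split_ifs <;> omega⟩, by dsimp only; split_ifs <;> omega⟩,
        ne ?_⟩)
      dsimp only
      split_ifs <;> omega

theorem hornIdx_sub_le {p q : ℕ} (h : p + (q + 2) = n + 1 + 1)
    (i : {i : SimplicialSpace.HornIdx (n + 1) k // p < i.1}) : i.1.1 - p ≤ q + 2 := by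
  have := i.1.2
  omega

theorem hornIdx_sub_injective {p : ℕ} : Function.Injective
    fun i : {i : SimplicialSpace.HornIdx (n + 1) k // p < i.1} => i.1.1 - p := fun i j hij => by
  have h1 := i.2
  have h2 := j.2
  exact Subtype.ext (Subtype.ext (by simp only at hij; omega))

theorem zero_ne_hornIdx_sub {p q : ℕ} (i : {i : SimplicialSpace.HornIdx (n + 1) k // p < i.1}) :
    (0 : Fin (q + 3)).1 ≠ i.1.1 - p := by
  have := i.2
  simp only [Fin.val_zero]
  omega

/-- The horn of an element of the space of last vertices. -/
def lastHorn (n k : ℕ) (y : LastVertices Γ (n + 2)) : LastHorn Γ n k :=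
  ⟨fun i => lastFace i.1 y, fun i j hij => lastFace_lastFace hij j.2.1 y⟩

/-- In dimension at least `3` the horns in the spaces of last vertices have unique fillers. -/
theorem exists_lastHorn (hn : n ≠ 0) (hk : k ≤ n + 2) (z : LastHorn Γ n k) :
    ∃ y : LastVertices Γ (n + 2), ∀ i : SimplicialSpace.HornIdx (n + 1) k,
      lastFace i.1 y = z.1 i := by
  have key : ∀ a : AntiDiag (n + 1 + 1), ∃ y : Nerve Γ a.1.2,
      IsComponent (fun i : SimplicialSpace.HornIdx (n + 1) k => i.1) z.1 a.1.1 a.1.2 a.2 y := by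
    rintro ⟨⟨p, q⟩, hpq⟩
    rcases hornIdx_cases hk hpq with ⟨p, rfl, i₀, hp, hi₀⟩ | ⟨hp, q, rfl, a, b, hab⟩ | ⟨h, -⟩
    · exact ⟨_, isComponent_of_horn z hi₀ hpq hp⟩
    · change p + (q + 2) = n + 1 + 1 at hpq
      obtain ⟨y, hy⟩ := Nerve.exists_faces
        (faceCompat_of_horn z (p := p) (q := q) (by omega)) (hornIdx_sub_le hpq)
        hornIdx_sub_injective hab zero_ne_hornIdx_sub
      exact ⟨y, (isComponent_iff_of_le hp).2 hy⟩
    · exact absurd h hn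
  choose y hy using key
  exact ⟨y, lastFace_eq_iff.2 fun p q h => hy ⟨(p, q), h⟩⟩

theorem eq_of_lastHorn (hn : n ≠ 0) (hk : k ≤ n + 2) {y y' : LastVertices Γ (n + 2)}
    (h : ∀ i : SimplicialSpace.HornIdx (n + 1) k, lastFace i.1 y = lastFace i.1 y') : y = y' := by
  funext ⟨⟨p, q⟩, hpq⟩
  have hy := lastFace_eq_iff.1 h p q hpq
  have hy' := lastFace_eq_iff.1 (fun i : SimplicialSpace.HornIdx (n + 1) k =>
    (rfl : lastFace i.1 y' = (fun i => lastFace i.1 y') i)) p q hpq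
  rcases hornIdx_cases hk hpq with ⟨p, rfl, i₀, hp, hi₀⟩ | ⟨hp, q, rfl, a, b, hab⟩ | ⟨h, -⟩
  · exact ((isComponent_iff.1 hy).1 p rfl i₀ hp).trans ((isComponent_iff.1 hy').1 p rfl i₀ hp).symm
  · change p + (q + 2) = n + 1 + 1 at hpq
    rw [isComponent_iff_of_le hp] at hy hy'
    exact Nerve.eq_of_faces (hornIdx_sub_le hpq) hornIdx_sub_injective hab zero_ne_hornIdx_sub
      fun i => (hy i).trans (hy' i).symm
  · exact absurd h hn

end

section

variable {G : Type u} {M : Type v} [TopologicalSpace G] [TopologicalSpace M]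
  {Γ : InternalGroupoid G M} {A : SmoothStr G} {B : SmoothStr M} {S : NerveStr Γ A} (T : BarStr S)
  {n k : ℕ}

namespace BarStr

/-- The horn map of the spaces of last vertices is a submersion. -/
theorem hasLocalSections_lastHorn (h : Γ.IsSmooth A B) (hk : k ≤ n + 2)
    {C : SmoothStr (LastHorn Γ n k)}
    (hC : ∀ m (p : Euc m → LastHorn Γ n k), C.IsPlot p ↔ ∀ i, (T.D _).IsPlot fun t => (p t).1 i) :
    (T.D (n + 2)).HasLocalSections C (lastHorn n k) := by
  have hix : ∀ i : SimplicialSpace.HornIdx (n + 1) k, i.1 ≤ n + 1 + 1 := fun i => i.2.1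
  have hz : ∀ (i : SimplicialSpace.HornIdx (n + 1) k) p q h,
      C.PlotSmooth (S.X q) fun z : LastHorn Γ n k => z.1 i ⟨(p, q), h⟩ := fun i p q h m f hf =>
    (T.isPlot_D _ _ _).1 ((hC m f).1 hf i) ⟨(p, q), h⟩
  refine hasLocalSections_of_localComponent (ix := fun i : SimplicialSpace.HornIdx (n + 1) k => i.1)
    (f := Subtype.val) (T.isPlot_D _) (fun y z hz => Subtype.ext (funext hz)) fun y p q hpq => ?_
  have hy := lastFace_eq_iff.1 (fun i : SimplicialSpace.HornIdx (n + 1) k =>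
    (rfl : lastFace i.1 y = (lastHorn n k y).1 i)) p q hpq
  rcases hornIdx_cases hk hpq with ⟨p, rfl, i₀, hp, hi₀⟩ | ⟨hp, q, rfl, a, b, hab⟩ |
    ⟨-, hp, q, rfl, i, hi, hi'⟩
  · rw [(isComponent_iff.1 hy).1 p rfl i₀ hp]
    exact localComponent_of_forall (fun z => isComponent_of_horn z hi₀ hpq hp) (hz i₀ _ _ _)
  · rw [isComponent_iff_of_le hp] at hy
    choose s hs using fun z : LastHorn Γ n k => Nerve.exists_faces
      (faceCompat_of_horn z (p := p) (q := q) (by omega)) (hornIdx_sub_le hpq)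
      hornIdx_sub_injective hab zero_ne_hornIdx_sub
    have e : y ⟨(p, q + 2), hpq⟩ = s (lastHorn n k y) :=
      Nerve.eq_of_faces (hornIdx_sub_le hpq) hornIdx_sub_injective hab zero_ne_hornIdx_sub
        fun i => (hy i).trans (hs (lastHorn n k y) i).symm
    refine (congrArg _ e).mpr (localComponent_of_forall
      (fun z => (isComponent_iff_of_le hp).2 (hs z)) fun m g hg => ?_)
    refine Nerve.isPlot_of_faces h (S.isNerveStr _) (S.isNerveStr _) (hornIdx_sub_le hpq)
      hornIdx_sub_injective hab zero_ne_hornIdx_sub fun i => ?_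
    simp only [Function.comp, hs]
    exact hz _ _ _ _ m g hg
  · exact localComponent_of_unique h hix hi hi' (hz i _ _ _)
      ((isComponent_iff.1 hy).2 q rfl i hi)

/-- For horns of dimension at least `3`, every component is a face or determined by two faces of a
nerve, hence as smooth as the horn. -/
theorem isPlot_of_lastHorn (h : Γ.IsSmooth A B) (hn : n ≠ 0) (hk : k ≤ n + 2) {m : ℕ}
    {y : Euc m → LastVertices Γ (n + 2)}
    (hp : ∀ i : SimplicialSpace.HornIdx (n + 1) k, (T.D _).IsPlot fun t => lastFace i.1 (y t)) :
    (T.D _).IsPlot y := by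
  refine (T.isPlot_D _ _ _).2 fun ⟨⟨p, q⟩, hpq⟩ => ?_
  have hy := fun t => lastFace_eq_iff.1 (fun i : SimplicialSpace.HornIdx (n + 1) k =>
    (rfl : lastFace i.1 (y t) = (fun i => lastFace i.1 (y t)) i)) p q hpq
  have hp' := fun i p q h => (T.isPlot_D _ _ _).1 (hp i) ⟨(p, q), h⟩
  rcases hornIdx_cases hk hpq with ⟨p, rfl, i₀, hp, hi₀⟩ | ⟨hp, q, rfl, a, b, hab⟩ | ⟨h, -⟩
  · have e := fun t => (isComponent_iff.1 (hy t)).1 p rfl i₀ hp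
    simp only [e]
    exact hp' _ _ _ _
  · change p + (q + 2) = n + 1 + 1 at hpq
    refine Nerve.isPlot_of_faces h (S.isNerveStr _) (S.isNerveStr _) (hornIdx_sub_le hpq)
      hornIdx_sub_injective hab zero_ne_hornIdx_sub fun i => ?_
    have e := fun t => (isComponent_iff_of_le hp).1 (hy t) i
    simp only [e]
    exact hp' _ _ _ _
  · exact absurd h hn

theorem continuous_of_lastHorn (h : Γ.IsTopological) (hn : n ≠ 0) (hk : k ≤ n + 2) {Z : Type*}
    [TopologicalSpace Z] {y : Z → LastVertices Γ (n + 2)}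
    (hp : ∀ i : SimplicialSpace.HornIdx (n + 1) k, Continuous fun t => lastFace i.1 (y t)) :
    Continuous y := by
  refine continuous_pi fun ⟨⟨p, q⟩, hpq⟩ => ?_
  have hy := fun t => lastFace_eq_iff.1 (fun i : SimplicialSpace.HornIdx (n + 1) k =>
    (rfl : lastFace i.1 (y t) = (fun i => lastFace i.1 (y t)) i)) p q hpq
  have hp' := fun i p q h => (continuous_apply ⟨(p, q), h⟩).comp (hp i)
  rcases hornIdx_cases hk hpq with ⟨p, rfl, i₀, hp, hi₀⟩ | ⟨hp, q, rfl, a, b, hab⟩ | ⟨h, -⟩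
  · have e := fun t => (isComponent_iff.1 (hy t)).1 p rfl i₀ hp
    simp only [e]
    exact hp' _ _ _ _
  · change p + (q + 2) = n + 1 + 1 at hpq
    refine Nerve.continuous_of_faces h (hornIdx_sub_le hpq)
      hornIdx_sub_injective hab zero_ne_hornIdx_sub fun i => ?_
    have e := fun t => (isComponent_iff_of_le hp).1 (hy t) i
    simp only [e]
    exact hp' _ _ _ _
  · exact absurd h hn

/-- The horns of dimension `2` in the spaces of last vertices form a fiber product. -/
theorem exists_lastHornStr (h : Γ.IsSmooth A B) (hk : k ≤ 2) : ∃ C : SmoothStr (LastHorn Γ 0 k),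
    ∀ m (p : Euc m → LastHorn Γ 0 k), C.IsPlot p ↔ ∀ i, (T.D _).IsPlot fun t => (p t).1 i := by
  obtain ⟨a, b, hab, hj⟩ : ∃ a b : SimplicialSpace.HornIdx 1 k, a.1 < b.1 ∧ ∀ j, j = a ∨ j = b := by
    refine ⟨⟨if k = 0 then 1 else 0, by split_ifs <;> omega⟩,
      ⟨if k = 2 then 1 else 2, by split_ifs <;> omega⟩, by dsimp only; split_ifs <;> omega,
      fun j => ?_⟩
    have := j.2
    by_cases hj : j.1 = if k = 0 then 1 else 0
    · exact .inl (Subtype.ext hj)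
    · refine .inr (Subtype.ext ?_)
      dsimp only
      split_ifs at hj ⊢ <;> omega
  have ha := a.2
  have hb := b.2
  have ha1 : a.1 ≤ 0 + 1 := by omega
  obtain ⟨D, -, hD⟩ := SmoothStr.exists_fiberProduct
    (isSubmersion_of_hasLocalSections T.plotSmooth_lastFace (T.hasLocalSections_lastFace h ha1))
    (T.plotSmooth_lastFace (r := 0) (i := b.1 - 1))
  let e : LastHorn Γ 0 k ≃ₜ {p : LastVertices Γ 1 × LastVertices Γ 1 //
      lastFace a.1 p.1 = lastFace (b.1 - 1) p.2} :=
    { toFun := fun z => ⟨(z.1 b, z.1 a), z.2 a b hab⟩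
      invFun := fun p => ⟨fun j => if j.1 = a.1 then p.1.2 else p.1.1, fun i j hij => by
        rcases hj i with rfl | rfl <;> rcases hj j with rfl | rfl
        · omega
        · dsimp only
          rw [if_neg (by omega), if_pos rfl]
          exact p.2
        · omega
        · omega⟩
      left_inv := fun z => Subtype.ext (funext fun j => by
        rcases hj j with rfl | rfl
        · exact if_pos rfl
        · exact if_neg (by omega))
      right_inv := fun p => Subtype.ext (Prod.ext (if_neg (by omega)) (if_pos rfl))
      continuous_toFun := (((continuous_apply b).comp continuous_subtype_val).prodMk
        ((continuous_apply a).comp continuous_subtype_val)).subtype_mk _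
      continuous_invFun := (continuous_pi fun j => by
        by_cases hj : j.1 = a.1
        · simp only [if_pos hj]
          exact continuous_snd.comp continuous_subtype_val
        · simp only [if_neg hj]
          exact continuous_fst.comp continuous_subtype_val).subtype_mk _ }
  obtain ⟨C, hC⟩ := exists_isLift e.isOpenEmbedding.isLocalHomeomorph D
  refine ⟨C, fun m p => ?_⟩
  rw [hC.isPlot_iff, hD]
  constructor
  · rintro ⟨-, h1, h2⟩ i
    rcases hj i with rfl | rfl
    · exact h2
    · exact h1
  · exact fun hp => ⟨(continuous_pi fun i => (hp i).continuous).subtype_mk _, hp b, hp a⟩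

/-- The bar construction is an étale local Lie 2-groupoid. -/
theorem isEtaleLie (h : Γ.IsSmooth A B) : (bar (doubleNerve Γ)).IsEtaleLie T.W 2 := by
  refine ⟨T.isManifold h, fun q k hk => ?_⟩
  have hinj : ∀ r (x : Bar (doubleNerve Γ) r), ∃ U ∈ 𝓝 x, Set.InjOn lastVertices U := fun r =>
    exists_nhds_injOn (T.isLift r).isLocalHomeomorph
  rcases q with _ | _ | n
  · obtain ⟨C, hC, hC'⟩ := SimplicialSpace.exists_horn_zero (T.isManifold h) k hk
    exact ⟨C, hC, hC', fun h => absurd h (by omega)⟩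
  · obtain ⟨C, hC⟩ := T.exists_lastHornStr h hk
    obtain ⟨E, hE, hE'⟩ := exists_hornStr (E := bar (doubleNerve Γ)) (n := 0) (k := k)
      (d := fun i _ => lastFace i) (T.isLift 1) (hinj 0) (fun i hi x => lastVertices_face hi x) hC
    have hcont : Continuous ((bar (doubleNerve Γ)).hornMap 1 k) :=
      (continuous_pi fun i => Bar.continuous_face _ _ _).subtype_mk _
    have hcomm : ∀ x, hornProj (d := fun i _ => lastFace i)
        (fun i hi x => lastVertices_face hi x) ((bar (doubleNerve Γ)).hornMap 1 k x) =
          lastHorn 0 k (lastVertices x) := fun x =>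
      Subtype.ext (funext fun i => lastVertices_face i.2.1 x)
    refine ⟨E, hE', isSubmersion_of_hasLocalSections ?_ ?_, fun h => absurd h (by omega)⟩
    · exact (T.isLift 2).plotSmooth hE hcont hcomm fun m p hp =>
        (hC m _).2 fun i => T.plotSmooth_lastFace m p hp
    · exact (T.isLift 2).hasLocalSections hE hcont hcomm (T.hasLocalSections_lastHorn h hk hC)
  · obtain ⟨E, hE, hE', hE''⟩ := exists_hornStr_isEtale (E := bar (doubleNerve Γ)) (n := n + 1)
      (k := k) (d := fun i _ => lastFace i) (d₂ := fun i _ => lastFace i) (T.isLift (n + 3))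
      (T.isLift (n + 2)) (hinj (n + 1)) (fun i hi x => lastVertices_face hi x)
      (fun i hi x => lastVertices_face hi x) (fun i hi => T.plotSmooth_lastFace)
      (fun z => exists_lastHorn n.succ_ne_zero hk z)
      (fun y y' => eq_of_lastHorn n.succ_ne_zero hk)
      (fun m p => T.isPlot_of_lastHorn h n.succ_ne_zero hk)
      (fun f => continuous_of_lastHorn h.isTopological n.succ_ne_zero hk)
      fun y => (lastHorn (n + 1) k y).2
    exact ⟨E, hE, hE', fun _ => hE''⟩

end BarStr

end

/-! ### Lifting paths and homotopies -/

namespace PathClass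

theorem eq_of_simplyConnected {X : Type u} [TopologicalSpace X] [SimplyConnectedSpace X]
    {γ γ' : PathClass X} (h₀ : γ.src = γ'.src) (h₁ : γ.tgt = γ'.tgt) : γ = γ' := by
  obtain ⟨x, y, c⟩ := γ
  obtain ⟨x', y', c'⟩ := γ'
  obtain rfl : x = x' := h₀
  obtain rfl : y = y' := h₁
  exact congrArg _ (Subsingleton.elim c c')

theorem exists_homotopy {X : Type u} [TopologicalSpace X] {p q : C(I, X)} (h : mk' p = mk' q) :
    ∃ F : C(I × I, X), (∀ s, F (0, s) = p s) ∧ (∀ s, F (1, s) = q s) ∧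
      (∀ t, F (t, 0) = p 0) ∧ ∀ t, F (t, 1) = p 1 := by
  have key : ∀ γ : PathClass X, γ = mk' p → ∀ q' : Path γ.src γ.tgt,
      γ = ⟨γ.src, γ.tgt, .mk q'⟩ → ∃ F : C(I × I, X), (∀ s, F (0, s) = p s) ∧
        (∀ s, F (1, s) = q' s) ∧ (∀ t, F (t, 0) = p 0) ∧ ∀ t, F (t, 1) = p 1 := by
    rintro γ rfl q' h
    have h' : (Path.Homotopic.Quotient.mk (⟨p, rfl, rfl⟩ : Path (p 0) (p 1))) = .mk q' := by
      injection h
    obtain ⟨F⟩ := Path.Homotopic.Quotient.exact h'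
    exact ⟨F.toContinuousMap, F.apply_zero, F.apply_one, F.source, F.target⟩
  exact key (mk' q) h.symm ⟨q, rfl, rfl⟩ rfl

end PathClass

section Serre

variable {E : Type u} {B : Type v} [TopologicalSpace E] [TopologicalSpace B] {π : E → B}

theorem IsSerreFibration.exists_path (hπ : IsSerreFibration π) (β : C(I, B)) (e : E)
    (h : π e = β 0) : ∃ α : C(I, E), α 0 = e ∧ ∀ t, π (α t) = β t := by
  obtain ⟨K, h₀, h₁⟩ := hπ.2 0 (.const _ e) (β.comp .snd) fun x => h.symm
  exact ⟨K.comp ((ContinuousMap.const I 0).prodMk (.id I)), h₀ 0, fun t => h₁ (0, t)⟩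

/-- The path in the square along the left, the upper and the right edge. -/
def threeEdges : C(I, I × I) :=
  ⟨fun t => (Set.projIcc 0 1 zero_le_one (3 * (t : ℝ) - 1),
    Set.projIcc 0 1 zero_le_one (3 * min (t : ℝ) (1 - t))), by fun_prop⟩

theorem threeEdges_zero : threeEdges 0 = (0, 0) := by
  refine Prod.ext (Set.projIcc_of_le_left zero_le_one ?_) (Set.projIcc_of_le_left zero_le_one ?_) <;> norm_num

theorem threeEdges_one : threeEdges 1 = (1, 0) := by
  refine Prod.ext (Set.projIcc_of_right_le zero_le_one ?_) (Set.projIcc_of_le_left zero_le_one ?_) <;> norm_num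

theorem threeEdges_cases (t : I) :
    (threeEdges t).2 = 1 ∨ (threeEdges t).1 = 0 ∨ (threeEdges t).1 = 1 := by
  rcases le_total (3 * (t : ℝ)) 1 with h | h
  · exact .inr (.inl (Set.projIcc_of_le_left zero_le_one (by linarith)))
  · rcases le_total (3 * (t : ℝ)) 2 with h' | h'
    · refine .inl (Set.projIcc_of_right_le zero_le_one ?_)
      rcases min_cases (t : ℝ) (1 - t) with ⟨e, -⟩ | ⟨e, -⟩ <;> rw [e] <;> linarith
    · exact .inr (.inr (Set.projIcc_of_right_le zero_le_one (by linarith)))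

instance : ContractibleSpace I := (convex_Icc (0 : ℝ) 1).contractibleSpace ⟨0, by simp⟩

/-- If the image of a path under a Serre fibration is homotopic to `β`, then the path is homotopic
to one over a reparametrization of `β`, which is always the same one. -/
theorem IsSerreFibration.exists_path_of_homotopic (hπ : IsSerreFibration π) {β : C(I, B)}
    {a : PathClass E} (h : map ⟨π, hπ.1⟩ a = mk' β) :
    ∃ α : C(I, E), mk' α = a ∧ ∀ t, π (α t) = β (threeEdges t).1 := by
  obtain ⟨α, rfl⟩ := mk'_surjective a
  obtain ⟨F, h₀, h₁, k₀, k₁⟩ := exists_homotopy ((map_mk' _ _).symm.trans h)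
  obtain ⟨K, hK, hK'⟩ := hπ.2 1 (α.comp ⟨fun x => x 0, continuous_apply 0⟩)
    (F.comp ⟨fun z => (z.2, z.1 0), by fun_prop⟩) fun x => h₀ (x 0)
  let K' : C(I × I, E) := K.comp ⟨fun z => (fun _ => z.1, z.2), by fun_prop⟩
  have hw : mk' threeEdges = mk' ((ContinuousMap.id I).prodMk (.const I 0)) :=
    eq_of_simplyConnected threeEdges_zero threeEdges_one
  refine ⟨K'.comp threeEdges, ?_, fun t => ?_⟩
  · rw [← map_mk', hw, map_mk']
    congr 1
    ext t
    exact hK _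
  · have hβ₀ : F (1, 0) = β 0 := h₁ 0
    have hβ₁ : F (1, 1) = β 1 := h₁ 1
    refine (hK' _).trans ?_
    change F ((threeEdges t).2, (threeEdges t).1) = _
    rcases threeEdges_cases t with e | e | e <;> rw [e]
    · exact h₁ _
    · rw [k₀, ← hβ₀, k₀]
    · rw [k₁, ← hβ₁, k₁]

end Serre

/-! ### Path classes in the nerve -/

section

variable {G : Type u} {M : Type v} {Γ : InternalGroupoid G M}

namespace Nerve

/-- The 1-simplex given by an arrow. -/
def single (g : G) : Nerve Γ 1 :=
  cone ![g, Γ.one (Γ.src g)] (Γ.src g) (Fin.forall_fin_two.2 ⟨rfl, Γ.src_one _⟩)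

theorem single_arr (g : G) : (single g : Nerve Γ 1).arr 0 1 = g :=
  cone_arr (a := ![g, Γ.one (Γ.src g)]) (h := Fin.forall_fin_two.2 ⟨rfl, Γ.src_one _⟩) (c := 1) rfl 0

theorem ext_one {y z : Nerve Γ 1} (h : y.arr 0 1 = z.arr 0 1) : y = z := by
  refine ext_arr 1 (Fin.forall_fin_two.2 ⟨h, ?_⟩)
  rw [y.arr_self, z.arr_self, ← src_arr' y 0 1, ← src_arr' z 0 1, h]

end Nerve

variable [TopologicalSpace G] [TopologicalSpace M]

/-- Reindexing as a continuous map. -/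
def reindexC {m n : ℕ} (φ : Fin (m + 1) → Fin (n + 1)) : C(Nerve Γ n, Nerve Γ m) :=
  ⟨reindex φ, continuous_reindex φ⟩

/-- An arrow of a simplex of the nerve as a continuous map. -/
def arrC {n : ℕ} (v w : Fin (n + 1)) : C(Nerve Γ n, G) :=
  ⟨fun y => y.arr v w, (continuous_apply w).comp ((continuous_apply v).comp (continuous_arr n))⟩

/-- A vertex of a simplex of the nerve as a continuous map. -/
def objC {n : ℕ} (v : Fin (n + 1)) : C(Nerve Γ n, M) :=
  ⟨fun y => y.obj v, (continuous_apply v).comp (continuous_obj n)⟩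

/-- The faces of a path class in the nerve. -/
def pface {n : ℕ} (i : ℕ) (γ : PathClass (Nerve Γ (n + 1))) : PathClass (Nerve Γ n) :=
  map (reindexC (skip n i)) γ

theorem map_arrC_pface {n : ℕ} (i : ℕ) (γ : PathClass (Nerve Γ (n + 1))) (v w : Fin (n + 1)) :
    map (arrC v w) (pface i γ) = map (arrC (skip n i v) (skip n i w)) γ := map_map _ _ _

theorem pface_pface {n i j : ℕ} (hij : i < j) (hj : j ≤ n + 2)
    (γ : PathClass (Nerve Γ (n + 2))) : pface i (pface j γ) = pface (j - 1) (pface i γ) := by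
  rw [pface, pface, pface, pface, map_map, map_map]
  congr 1
  ext1 y
  exact (Nerve.laws Γ).d_d n i j hij hj y

theorem pface_comp {n i : ℕ} {a b : PathClass (Nerve Γ (n + 1))} (h : a.src = b.tgt) :
    pface i ((Pi1 _).comp a b) = (Pi1 _).comp (pface i a) (pface i b) := map_comp _ h

theorem pface_inv {n i : ℕ} (a : PathClass (Nerve Γ (n + 1))) :
    pface i ((Pi1 _).inv a) = (Pi1 _).inv (pface i a) := map_inv _ _

theorem PathClass.map_injective_of_leftInverse {X Y : Type*} [TopologicalSpace X]
    [TopologicalSpace Y] {f : C(X, Y)} {g : C(Y, X)} (h : ∀ x, g (f x) = x) :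
    Function.Injective (map f) := fun γ γ' e => by
  have e' := congrArg (map g) e
  have hgf : g.comp f = .id X := ContinuousMap.ext h
  rwa [map_map, map_map, hgf, map_id, map_id] at e'

/-- The horns in `Π₁(N_• G)` of dimension at least 2 have at most one filler. -/
def UniquePathFillers (Γ : InternalGroupoid G M) : Prop :=
  ∀ n k, k ≤ n + 2 → ∀ γ γ' : PathClass (Nerve Γ (n + 2)),
    (∀ i, i ≤ n + 2 → i ≠ k → pface i γ = pface i γ') → γ = γ'

theorem uniquePathFillers_of_injective
    (h : ∀ q k, k ≤ q + 1 → 1 < q + 1 →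
      Function.Injective (((doubleNerve Γ).vertical 1).hornMap q k)) : UniquePathFillers Γ := by
  intro n k hk γ γ' e
  have h' := @h (n + 1) k hk (by omega) (single γ : Nerve (Pi1 (Nerve Γ (n + 2))) 1) (single γ')
    (Subtype.ext (funext fun i => ext_one ?_))
  · exact (single_arr (Γ := Pi1 (Nerve Γ (n + 2))) γ).symm.trans ((congrArg (fun y :
      Nerve (Pi1 (Nerve Γ (n + 2))) 1 => y.arr 0 1) h').trans (single_arr _))
  · change pface i.1 ((single γ : Nerve (Pi1 (Nerve Γ (n + 2))) 1).arr 0 1) =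
      pface i.1 ((single γ' : Nerve (Pi1 (Nerve Γ (n + 2))) 1).arr 0 1)
    rw [single_arr, single_arr]
    exact e i.1 i.2.1 i.2.2

/-- A path class in the nerve is determined by its images under the arrows that start at a fixed
vertex. -/
theorem UniquePathFillers.eq_of_map_arrC (hU : UniquePathFillers Γ) (hΓ : Γ.IsTopological)
    {n : ℕ} (c : Fin (n + 2)) {γ γ' : PathClass (Nerve Γ (n + 1))}
    (h : ∀ b, map (arrC b c) γ = map (arrC b c) γ') : γ = γ' := by
  induction n with
  | zero =>
    have hc : ∃ b : Fin 2, ∀ v, v = b ∨ v = c := by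
      refine ⟨if c = 0 then 1 else 0, fun v => ?_⟩
      split_ifs <;> fin_cases c <;> fin_cases v <;> simp_all
    obtain ⟨b, hb⟩ := hc
    classical
    have hs : ∀ (g : G) (v : Fin 2), Γ.src (if v = c then Γ.one (Γ.src g) else g) = Γ.src g := by
      intro g v
      split_ifs
      · exact Γ.src_one _
      · rfl
    let f : G → Nerve Γ 1 := fun g => cone _ (Γ.src g) (hs g)
    have hf : Continuous f := (Nerve.continuous_iff hΓ c).2 fun v => by
      have e : ∀ g, (f g).arr v c = if v = c then Γ.one (Γ.src g) else g :=
        fun g => cone_arr (h := hs g) (if_pos rfl) v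
      simp only [e]
      split_ifs
      · exact hΓ.continuous_one.comp hΓ.continuous_src
      · exact continuous_id
    refine map_injective_of_leftInverse (f := arrC b c) (g := ⟨f, hf⟩) (fun y => ?_) (h b)
    refine ext_arr c fun v => ?_
    refine (cone_arr (h := hs (y.arr b c)) (if_pos rfl) v).trans ?_
    split_ifs with hv
    · rw [hv, y.arr_self]
      exact congrArg _ (y.src_arr b c)
    · rcases hb v with rfl | e
      · rfl
      · exact absurd e hv
  | succ n ih =>
    refine hU n c.1 (by omega) γ γ' fun i hi hic => ih (unskip _ i c) fun b => ?_
    rw [map_arrC_pface, map_arrC_pface, skip_unskip hi (Ne.symm hic), h]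

/-- The compatibility condition for horns of path classes. -/
def PathHornCompat : (n k : ℕ) → (SimplicialSpace.HornIdx n k → PathClass (Nerve Γ n)) → Prop
  | 0, _, _ => True
  | n + 1, k, δ => ∀ i j : SimplicialSpace.HornIdx (n + 1) k, i.1 < j.1 →
      pface i.1 (δ j) = pface (j.1 - 1) (δ i)

theorem exists_common_vertex {n i j : ℕ} (hij : i < j) (hj : j ≤ n + 2) {v : Fin (n + 3)}
    (hv : v.1 ≠ i) (hv' : v.1 ≠ j) : ∃ v' : Fin (n + 1),
      unskip _ i v = skip n (j - 1) v' ∧ unskip _ j v = skip n i v' := by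
  have hv2 := v.2
  refine ⟨unskip _ i (unskip _ j v), ?_, ?_⟩
  · apply Fin.ext
    simp only [unskip, skip]
    split_ifs <;> omega
  · apply Fin.ext
    simp only [unskip, skip]
    split_ifs <;> omega

theorem PathHornCompat.map_arrC_eq {n k : ℕ}
    {δ : SimplicialSpace.HornIdx (n + 1) k → PathClass (Nerve Γ (n + 1))}
    (hδ : PathHornCompat (n + 1) k δ) {i j : SimplicialSpace.HornIdx (n + 1) k} {v w : Fin (n + 3)}
    (hv : v.1 ≠ i.1) (hv' : v.1 ≠ j.1) (hw : w.1 ≠ i.1) (hw' : w.1 ≠ j.1) :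
    map (arrC (unskip _ i.1 v) (unskip _ i.1 w)) (δ i) =
      map (arrC (unskip _ j.1 v) (unskip _ j.1 w)) (δ j) := by
  have key : ∀ i j : SimplicialSpace.HornIdx (n + 1) k, i.1 < j.1 → v.1 ≠ i.1 → v.1 ≠ j.1 →
      w.1 ≠ i.1 → w.1 ≠ j.1 → map (arrC (unskip _ i.1 v) (unskip _ i.1 w)) (δ i) =
      map (arrC (unskip _ j.1 v) (unskip _ j.1 w)) (δ j) := by
    intro i j hij hv hv' hw hw'
    obtain ⟨v', e₁, e₂⟩ := exists_common_vertex hij j.2.1 hv hv'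
    obtain ⟨w', e₃, e₄⟩ := exists_common_vertex hij j.2.1 hw hw'
    rw [e₁, e₂, e₃, e₄, ← map_arrC_pface, ← map_arrC_pface, hδ i j hij]
  rcases lt_trichotomy i.1 j.1 with h | h | h
  · exact key i j h hv hv' hw hw'
  · rw [Subtype.ext h]
  · exact (key j i h hv' hv hw' hw).symm

/-- A family of paths of arrows with the same path of sources spans a path in the nerve. -/
theorem exists_path_nerve (hΓ : Γ.IsTopological) {n : ℕ} (c : Fin (n + 1)) (β : C(I, M))
    (α : Fin (n + 1) → C(I, G)) (h : ∀ v, v ≠ c → ∀ t, Γ.src (α v t) = β t) :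
    ∃ p : C(I, Nerve Γ n), (∀ v, v ≠ c → ∀ t, (p t).arr v c = α v t) ∧ ∀ t, (p t).obj c = β t := by
  classical
  let a : I → Fin (n + 1) → G := fun t v => if v = c then Γ.one (β t) else α v t
  have ha : ∀ t v, Γ.src (a t v) = β t := by
    intro t v
    by_cases hv : v = c
    · simp only [a, if_pos hv, Γ.src_one]
    · simp only [a, if_neg hv]
      exact h v hv t
  have hac : ∀ t, a t c = Γ.one (β t) := fun t => if_pos rfl
  have hp : Continuous fun t => cone (a t) (β t) (ha t) := by
    refine (Nerve.continuous_iff hΓ c).2 fun v => ?_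
    simp only [cone_arr (hac _)]
    by_cases hv : v = c
    · simp only [a, if_pos hv]
      exact hΓ.continuous_one.comp β.continuous
    · simp only [a, if_neg hv]
      exact (α v).continuous
  refine ⟨⟨_, hp⟩, fun v hv t => (cone_arr (h := ha t) (hac t) v).trans (if_neg hv), fun t => ?_⟩
  change Γ.tgt (a t c) = β t
  rw [hac, Γ.tgt_one]

/-- Horns of path classes have fillers. By the lifting property, the path classes starting at the
vertex `k` are represented by paths of arrows over one and the same path in `M`. -/
theorem UniquePathFillers.exists_filler (hU : UniquePathFillers Γ) (hΓ : Γ.IsTopological)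
    (hS : IsSerreFibration Γ.src) {n k : ℕ} (hk : k ≤ n + 1)
    (δ : SimplicialSpace.HornIdx n k → PathClass (Nerve Γ n)) (hδ : PathHornCompat n k δ)
    (s : Nerve Γ (n + 1)) (hs : ∀ j, reindex (skip n j.1) s = (δ j).src) :
    ∃ γ : PathClass (Nerve Γ (n + 1)), (∀ j, pface j.1 γ = δ j) ∧ γ.src = s := by
  let c : Fin (n + 2) := ⟨k, by omega⟩
  cases n with
  | zero =>
    obtain ⟨j, hj, hj'⟩ : ∃ j : SimplicialSpace.HornIdx 0 k,
        (∀ i, i = j) ∧ ∀ v : Fin 2, v ≠ c → v.1 = j.1 := by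
      refine ⟨⟨1 - k, by omega, by omega⟩, fun i => Subtype.ext ?_, fun v hv => ?_⟩
      · have := i.2
        change i.1 = 1 - k
        omega
      · have : v.1 ≠ k := fun e => hv (Fin.ext e)
        change v.1 = 1 - k
        omega
    have hc : c.1 ≠ j.1 := j.2.2.symm
    obtain ⟨d, hd⟩ := mk'_surjective (δ j)
    have hd0 : d 0 = reindex (skip 0 j.1) s := by rw [hs, ← hd]; rfl
    obtain ⟨α, hα, hα'⟩ := hS.exists_path ((objC (Γ := Γ) (n := 0) 0).comp d) (s.arr ⟨j.1, by have := j.2.1; omega⟩ c) (by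
      rw [s.src_arr]
      change _ = (d 0).obj 0
      rw [hd0]
      change s.obj c = s.obj (skip 0 j.1 0)
      rw [← skip_unskip j.2.1 hc]
      congr 2)
    obtain ⟨p, hp, hp'⟩ := exists_path_nerve hΓ c ((objC 0).comp d) (fun _ => α)
      fun v _ => hα'
    refine ⟨mk' p, fun i => ?_, ?_⟩
    · rw [hj i, ← hd]
      refine (map_mk' _ _).trans ?_
      congr 1
      ext1 t
      refine ext_arr 0 fun v => ?_
      obtain rfl : v = 0 := Fin.fin_one_eq_zero v
      rw [Nerve.arr_self, Nerve.arr_self]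
      congr 1
      refine Eq.trans ?_ (hp' t)
      change (p t).obj (skip 0 j.1 0) = _
      rw [← skip_unskip j.2.1 hc]
      congr 2
    · change p 0 = s
      refine ext_arr c fun v => ?_
      by_cases hv : v = c
      · rw [hv, Nerve.arr_self, Nerve.arr_self, hp']
        congr 1
        rw [← s.src_arr ⟨j.1, by have := j.2.1; omega⟩ c, ← hα, hα']
      · rw [hp v hv, hα]
        congr 1
        exact Fin.ext (hj' v hv).symm
  | succ n =>
    obtain ⟨a, b, hab⟩ := NerveStr.exists_hornIdx_ne n k
    have hix : ∀ i : SimplicialSpace.HornIdx (n + 1) k, i.1 ≤ n + 2 := fun i => i.2.1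
    have hinj : Function.Injective fun i : SimplicialSpace.HornIdx (n + 1) k => i.1 :=
      Subtype.val_injective
    have hc : ∀ i : SimplicialSpace.HornIdx (n + 1) k, c.1 ≠ i.1 := fun i => i.2.2.symm
    let f : Fin (n + 3) → SimplicialSpace.HornIdx (n + 1) k := avoid (fun i => i.1) a b
    have hf : ∀ v, v.1 ≠ (f v).1 := avoid_ne hinj hab
    let e : Fin (n + 3) → PathClass G :=
      fun v => map (arrC (unskip _ (f v).1 v) (unskip _ (f v).1 c)) (δ (f v))
    have he : ∀ v i, v.1 ≠ i.1 → e v = map (arrC (unskip _ i.1 v) (unskip _ i.1 c)) (δ i) :=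
      fun v i hi => hδ.map_arrC_eq (hf v) hi (hc _) (hc _)
    let srcC : C(G, M) := ⟨Γ.src, hS.1⟩
    have hobj : ∀ i j, map (objC (unskip _ i.1 c)) (δ i) = map (objC (unskip _ j.1 c)) (δ j) := by
      intro i j
      have h := congrArg (map srcC) (hδ.map_arrC_eq (hc i) (hc j) (hc i) (hc j))
      rw [map_map, map_map] at h
      convert h using 2 <;> ext1 y <;> exact (Nerve.src_arr _ _ _).symm
    obtain ⟨β, hβ⟩ := mk'_surjective (map (objC (unskip _ a.1 c)) (δ a))
    have hsrc : ∀ v, map srcC (e v) = mk' β := by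
      intro v
      rw [hβ, hobj a (f v), map_map]
      congr 1
      ext1 y
      exact Nerve.src_arr _ _ _
    choose α hα hα' using fun v => hS.exists_path_of_homotopic (hsrc v)
    obtain ⟨p, hp, hp'⟩ := exists_path_nerve hΓ c
      (β.comp ⟨fun t => (threeEdges t).1, by fun_prop⟩) α fun v _ => hα' v
    have harr : ∀ v, map (arrC v c) (mk' p) = e v := by
      intro v
      by_cases hv : v = c
      · have h2 : e c = map ⟨Γ.one, hΓ.continuous_one⟩ (map srcC (e c)) := by
          simp only [e, map_map]
          congr 1
          ext1 y
          change y.arr _ _ = Γ.one (Γ.src (y.arr _ _))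
          rw [y.src_arr, y.arr_self]
        have h3 : mk' β = mk' (β.comp ⟨fun t => (threeEdges t).1, by fun_prop⟩) := by
          rw [← hsrc c, ← hα c, map_mk']
          congr 1
          ext1 t
          exact hα' c t
        rw [hv, h2, hsrc, h3, map_mk', map_mk']
        congr 1
        ext1 t
        change (p t).arr c c = Γ.one _
        rw [(p t).arr_self, hp']
      · rw [map_mk', ← hα v]
        congr 1
        ext1 t
        exact hp v hv t
    have hface : ∀ j : SimplicialSpace.HornIdx (n + 1) k, pface j.1 (mk' p) = δ j := by
      intro j
      refine hU.eq_of_map_arrC hΓ (unskip _ j.1 c) fun b => ?_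
      rw [map_arrC_pface, skip_unskip j.2.1 (hc j), harr, he _ j (skip_ne _ _ _), unskip_skip]
    refine ⟨mk' p, hface, eq_of_faces hix hinj hab hc fun i => ?_⟩
    rw [hs, ← hface]
    rfl

/-- Horns of path classes have fillers with a prescribed target. -/
theorem UniquePathFillers.exists_filler_tgt (hU : UniquePathFillers Γ) (hΓ : Γ.IsTopological)
    (hS : IsSerreFibration Γ.src) {n k : ℕ} (hk : k ≤ n + 1)
    (δ : SimplicialSpace.HornIdx n k → PathClass (Nerve Γ n)) (hδ : PathHornCompat n k δ)
    (s : Nerve Γ (n + 1)) (hs : ∀ j, reindex (skip n j.1) s = (δ j).tgt) :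
    ∃ γ : PathClass (Nerve Γ (n + 1)), (∀ j, pface j.1 γ = δ j) ∧ γ.tgt = s := by
  obtain ⟨γ, h, h'⟩ := hU.exists_filler hΓ hS hk (fun j => (Pi1 _).inv (δ j)) (by
    cases n with
    | zero => trivial
    | succ n =>
      intro i j hij
      rw [pface_inv, pface_inv, hδ i j hij]) s hs
  refine ⟨(Pi1 _).inv γ, fun j => ?_, h'⟩
  rw [pface_inv, h, inv_inv_eq]

/-! ### The columns of the double nerve -/

theorem UniquePathFillers.injective_vertical (hU : UniquePathFillers Γ) (p q k : ℕ)
    (hk : k ≤ q + 1) (hq : 1 < q + 1) :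
    Function.Injective (((doubleNerve Γ).vertical p).hornMap q k) := by
  obtain ⟨n, rfl⟩ : ∃ n, q = n + 1 := ⟨q - 1, by omega⟩
  intro (x : Nerve (Pi1 (Nerve Γ (n + 2))) p) (x' : Nerve (Pi1 (Nerve Γ (n + 2))) p) h
  refine ext_arr 0 fun v => hU n k hk _ _ fun i hi hik => ?_
  have h' : Nerve.mapPi1 (reindexC (skip _ i)) x = Nerve.mapPi1 (reindexC (skip _ i)) x' :=
    congrFun (congrArg Subtype.val h) ⟨i, hi, hik⟩
  exact congrArg (fun z : Nerve (Pi1 (Nerve Γ (n + 1))) p => z.arr v 0) h'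

/-- A filler is found for each path class from the `0`-th vertex; the uniqueness of fillers makes the
first of them constant, so that they form a simplex. -/
theorem UniquePathFillers.surjective_vertical (hU : UniquePathFillers Γ) (hΓ : Γ.IsTopological)
    (hS : IsSerreFibration Γ.src) {p : ℕ}
    (hf : ∀ n i hi, Function.Surjective (((doubleNerve Γ).vertical p).face n i hi)) (q k : ℕ)
    (hk : k ≤ q + 1) : Function.Surjective (((doubleNerve Γ).vertical p).hornMap q k) := by
  intro z
  cases q with
  | zero =>
    have hj : (1 - k) ≤ 0 + 1 ∧ (1 - k) ≠ k := by omega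
    obtain ⟨x, hx⟩ := hf 0 (1 - k) hj.1 (z.1 ⟨1 - k, hj⟩)
    refine ⟨x, Subtype.ext (funext fun i => ?_)⟩
    obtain ⟨i, hi, hik⟩ := i
    obtain rfl : i = 1 - k := by omega
    exact hx
  | succ n =>
    let z' : SimplicialSpace.HornIdx (n + 1) k → Nerve (Pi1 (Nerve Γ (n + 1))) p := z.1
    have hz : ∀ i j, i.1 < j.1 → Nerve.mapPi1 (reindexC (skip n i.1)) (z' j) =
      Nerve.mapPi1 (reindexC (skip n (j.1 - 1))) (z' i) := z.2
    obtain ⟨a, b, hab⟩ := NerveStr.exists_hornIdx_ne n k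
    have hix : ∀ i : SimplicialSpace.HornIdx (n + 1) k, i.1 ≤ n + 2 := fun i => i.2.1
    have hinj : Function.Injective fun i : SimplicialSpace.HornIdx (n + 1) k => i.1 :=
      Subtype.val_injective
    let c : Fin (n + 3) := ⟨k, by omega⟩
    have hc : ∀ i : SimplicialSpace.HornIdx (n + 1) k, c.1 ≠ i.1 := fun i => i.2.2.symm
    obtain ⟨Y, hY⟩ := Nerve.exists_faces (z := fun i => (z' i).obj 0) (fun i j hij =>
      congrArg (fun x : Nerve (Pi1 (Nerve Γ n)) p => x.obj 0) (hz i j hij)) hix hinj hab hc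
    choose γ hγ hγ' using fun v : Fin (p + 1) => hU.exists_filler hΓ hS hk
      (fun j => (z' j).arr v 0) (fun i j hij =>
        congrArg (fun x : Nerve (Pi1 (Nerve Γ n)) p => x.arr v 0) (hz i j hij)) Y
        fun j => (hY j).trans ((z' j).src_arr v 0).symm
    have hγ0 : γ 0 = (Pi1 _).one Y := hU n k hk _ _ fun i hi hik => by
      have h := hγ 0 ⟨i, hi, hik⟩
      dsimp only at h
      rw [h, (z' _).arr_self, ← hY]
      rfl
    refine ⟨(cone γ Y hγ' : Nerve (Pi1 (Nerve Γ (n + 2))) p), Subtype.ext (funext fun i => ?_)⟩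
    change Nerve.mapPi1 (reindexC (skip _ i.1)) (cone γ Y hγ') = z' i
    refine ext_arr 0 fun v => ?_
    exact (congrArg (pface i.1) (cone_arr (Γ := Pi1 (Nerve Γ (n + 2))) (h := hγ') hγ0 v)).trans
      (hγ v i)

theorem NerveStr.isLie_vertical {A : SmoothStr G} {B : SmoothStr M} (S : NerveStr Γ A)
    (h : Γ.IsSmooth A B) (hU : UniquePathFillers Γ) (hS : IsSerreFibration Γ.src) (p : ℕ) :
    ((doubleNerve Γ).vertical p).IsLie (S.N p) 1 :=
  ⟨S.isEtaleLie_vertical h p, hU.surjective_vertical h.isTopological hS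
    (S.isManifold_vertical h p).surjective_face, hU.injective_vertical p⟩

end

/-! ### Simplices of the bar construction as iterated cones -/

section

variable {G : Type u} {M : Type v} {Γ : InternalGroupoid G M} [TopologicalSpace G]
  [TopologicalSpace M] {r : ℕ}

/-- The last edge of the component `x_{p+1}` of a simplex of the bar construction. -/
def edge (x : Bar (doubleNerve Γ) r) (p q : ℕ) (h : p + 1 + q = r) : PathClass (Nerve Γ q) :=
  (barAt x (p + 1) q h).arr (Fin.last p).castSucc (Fin.last (p + 1))

theorem src_edge (x : Bar (doubleNerve Γ) r) (p q : ℕ) (h : p + 1 + q = r) :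
    (edge x p q h).src = lastVertices x ⟨(p + 1, q), h⟩ := (barAt x (p + 1) q h).src_arr _ _

theorem tgt_edge (x : Bar (doubleNerve Γ) r) (p q : ℕ) (h : p + 1 + q = r) :
    (edge x p q h).tgt = reindex (skip q 0) (lastVertices x ⟨(p, q + 1), by omega⟩) :=
  ((barAt x (p + 1) q h).tgt_arr _ _).trans (barAt_obj_castSucc x p q (by omega) h _).symm

theorem castSucc_eq_skip {n : ℕ} (i : Fin (n + 1)) : i.castSucc = skip n (n + 1) i :=
  Fin.ext (by have := i.2; simp [skip]; omega)

theorem barAt_arr_castSucc (x : Bar (doubleNerve Γ) r) (p q : ℕ) (h : p + 1 + q = r)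
    (i j : Fin (p + 1)) : (barAt x (p + 1) q h).arr i.castSucc j.castSucc =
      pface 0 ((barAt x p (q + 1) (by omega)).arr i j) := by
  have h' := congrArg (fun y : Nerve (Pi1 (Nerve Γ q)) p => y.arr i j)
    (x.compat p q (by omega) h)
  rw [castSucc_eq_skip, castSucc_eq_skip]
  exact h'.symm

/-- A simplex of the bar construction is determined by the last vertices and the last edges of its
components. -/
theorem bar_ext_edge {x x' : Bar (doubleNerve Γ) r} (h : lastVertices x = lastVertices x')
    (h' : ∀ p q hpq, edge x p q hpq = edge x' p q hpq) : x = x' := by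
  refine Bar.ext' fun p => ?_
  change ∀ q hpq, barAt x p q hpq = barAt x' p q hpq
  induction p with
  | zero =>
    intro q hpq
    refine ext_arr 0 fun v => ?_
    obtain rfl : v = 0 := Fin.fin_one_eq_zero v
    rw [Nerve.arr_self, Nerve.arr_self]
    exact congrArg _ (congrFun h ⟨(0, q), hpq⟩)
  | succ p ih =>
    intro q hpq
    refine ext_arr (Fin.last _) fun v => ?_
    induction v using Fin.lastCases with
    | last =>
      rw [Nerve.arr_self, Nerve.arr_self]
      exact congrArg _ (congrFun h ⟨(p + 1, q), hpq⟩)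
    | cast i =>
      rw [← comp_arr _ i.castSucc (Fin.last p).castSucc,
        ← comp_arr (barAt x' (p + 1) q hpq) i.castSucc (Fin.last p).castSucc,
        barAt_arr_castSucc, barAt_arr_castSucc, ih]
      exact congrArg _ (h' p q hpq)

/-- The simplex with a further vertex in the last position, from which `e` leads to the previous
last vertex. -/
def Nerve.snoc {A : Type*} {O : Type*} {Δ : InternalGroupoid A O} {n : ℕ} (y : Nerve Δ n) (e : A)
    (h : Δ.tgt e = y.obj (Fin.last n)) : Nerve Δ (n + 1) :=
  attach (n + 1) le_rfl y (Fin.last n) (Δ.inv e) ((Δ.src_inv e).trans h)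

theorem Nerve.snoc_arr {A : Type*} {O : Type*} {Δ : InternalGroupoid A O} {n : ℕ} (y : Nerve Δ n)
    (e : A) (h : Δ.tgt e = y.obj (Fin.last n)) :
    (snoc y e h).arr (Fin.last n).castSucc (Fin.last (n + 1)) = e := by
  have e' := congrArg Δ.inv (attach_arr_self (i := n + 1) (hi := le_rfl)
    (h := ((Δ.src_inv e).trans h)))
  rwa [inv_arr, inv_inv_eq, ← castSucc_eq_skip] at e'

theorem Nerve.snoc_obj {A : Type*} {O : Type*} {Δ : InternalGroupoid A O} {n : ℕ} (y : Nerve Δ n)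
    (e : A) (h : Δ.tgt e = y.obj (Fin.last n)) :
    (snoc y e h).obj (Fin.last (n + 1)) = Δ.src e := by
  rw [← src_arr' _ (Fin.last n).castSucc, snoc_arr]

theorem Nerve.reindex_snoc {A : Type*} {O : Type*} {Δ : InternalGroupoid A O} {n : ℕ}
    (y : Nerve Δ n) (e : A) (h : Δ.tgt e = y.obj (Fin.last n)) :
    reindex (skip n (n + 1)) (snoc y e h) = y :=
  reindex_attach (hi := le_rfl) (h := (Δ.src_inv e).trans h)

/-- The components of a simplex of the bar construction with given last vertices and last
edges. -/
def barOfEdges (Y : LastVertices Γ r)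
    (E : ∀ p q, p + 1 + q = r → PathClass (Nerve Γ q))
    (h₀ : ∀ p q h, (E p q h).src = Y ⟨(p + 1, q), h⟩)
    (h₁ : ∀ p q h, (E p q h).tgt = reindex (skip q 0) (Y ⟨(p, q + 1), by omega⟩)) :
    ∀ p q (h : p + q = r),
      {y : Nerve (Pi1 (Nerve Γ q)) p // y.obj (Fin.last p) = Y ⟨(p, q), h⟩}
  | 0, q, h => ⟨cone (fun _ => (Pi1 _).one (Y ⟨(0, q), h⟩)) (Y ⟨(0, q), h⟩) fun _ => rfl, rfl⟩
  | p + 1, q, h => ⟨snoc (mapPi1 (reindexC (skip q 0))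
      (barOfEdges Y E h₀ h₁ p (q + 1) (by omega)).1) (E p q h) ((h₁ p q h).trans
        (congrArg (reindex (skip q 0)) (barOfEdges Y E h₀ h₁ p (q + 1) (by omega)).2).symm),
      (snoc_obj _ _ _).trans (h₀ p q h)⟩

theorem exists_bar_of_edges (Y : LastVertices Γ r)
    (E : ∀ p q, p + 1 + q = r → PathClass (Nerve Γ q))
    (h₀ : ∀ p q h, (E p q h).src = Y ⟨(p + 1, q), h⟩)
    (h₁ : ∀ p q h, (E p q h).tgt = reindex (skip q 0) (Y ⟨(p, q + 1), by omega⟩)) :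
    ∃ x : Bar (doubleNerve Γ) r, lastVertices x = Y ∧ ∀ p q h, edge x p q h = E p q h := by
  have hs : ∀ p q h, (Pi1 _).tgt (E p q h) = (mapPi1 (reindexC (skip q 0))
      (barOfEdges Y E h₀ h₁ p (q + 1) (by omega)).1).obj (Fin.last p) := fun p q h =>
    (h₁ p q h).trans (congrArg (reindex (skip q 0)) (barOfEdges Y E h₀ h₁ p (q + 1) _).2).symm
  exact ⟨⟨fun a => (barOfEdges Y E h₀ h₁ a.1.1 a.1.2 a.2).1, fun p q _ h => (reindex_snoc _ _ (hs p q h)).symm⟩,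
    funext fun a => (barOfEdges Y E h₀ h₁ a.1.1 a.1.2 a.2).2, fun p q h => snoc_arr _ _ (hs p q h)⟩

/-- The vertex of the component `x_0`. -/
def top (x : Bar (doubleNerve Γ) r) : Nerve Γ r := lastVertices x ⟨(0, r), Nat.zero_add r⟩

/-- The edge of the component `x_1`. -/
def edge₀ (x : Bar (doubleNerve Γ) (r + 1)) : PathClass (Nerve Γ r) :=
  edge x 0 r (by omega)

theorem src_edge₀ (x : Bar (doubleNerve Γ) (r + 1)) :
    (edge₀ x).src = top (Bar.face r 0 (Nat.zero_le _) x) := src_edge x 0 r _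

theorem tgt_edge₀ (x : Bar (doubleNerve Γ) (r + 1)) :
    (edge₀ x).tgt = reindex (skip r 0) (top x) := tgt_edge x 0 r _

theorem top_face {i : ℕ} (hi : i ≤ r + 1) (h : i ≠ 0) (x : Bar (doubleNerve Γ) (r + 1)) :
    top (Bar.face r i hi x) = reindex (skip r i) (top x) := by
  rw [top, lastVertices_face, lastFace_of_lt _ _ (Nat.pos_of_ne_zero h)]
  rfl

theorem edge₀_face {i : ℕ} (hi : i ≤ r + 2) (h : 2 ≤ i) (x : Bar (doubleNerve Γ) (r + 2)) :
    edge₀ (Bar.face (r + 1) i hi x) = pface (i - 1) (edge₀ x) := by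
  have e : (Bar.face (r + 1) i hi x).at' 1 r (by omega) = _ := dif_pos (show 1 < i by omega)
  exact congrArg (fun y : Nerve (Pi1 (Nerve Γ r)) 1 => y.arr 0 1) e

theorem edge₀_face_one (x : Bar (doubleNerve Γ) (r + 2)) :
    edge₀ (Bar.face (r + 1) 1 (by omega) x) =
      (Pi1 _).comp (pface 0 (edge₀ x)) (edge₀ (Bar.face (r + 1) 0 (by omega) x)) := by
  have e : edge₀ (Bar.face (r + 1) 1 (by omega) x) = (barAt x 2 r (by omega)).arr 0 2 := rfl
  have e' : edge₀ (Bar.face (r + 1) 0 (by omega) x) = (barAt x 2 r (by omega)).arr 1 2 := rfl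
  rw [e, e', ← comp_arr _ 0 1 2]
  congr 1
  exact barAt_arr_castSucc x 1 r (by omega) 0 1

theorem bar_zero_ext {x x' : Bar (doubleNerve Γ) 0} (h : top x = top x') : x = x' := by
  refine bar_ext_edge (funext ?_) fun p q h => absurd h (by omega)
  rintro ⟨⟨p, q⟩, e⟩
  obtain rfl : p = 0 := by simp only at e; omega
  obtain rfl : q = 0 := by simp only at e; omega
  exact h

/-- A simplex `x` of the bar construction is determined by its vertex in `x_0`, its edge in `x_1`,
and its face `f_0 x`. -/
theorem bar_ext_cons {x x' : Bar (doubleNerve Γ) (r + 1)} (h : top x = top x')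
    (h' : edge₀ x = edge₀ x')
    (h'' : Bar.face r 0 (Nat.zero_le _) x = Bar.face r 0 (Nat.zero_le _) x') : x = x' := by
  refine bar_ext_edge (funext ?_) ?_
  · rintro ⟨⟨p, q⟩, e⟩
    cases p with
    | zero =>
      obtain rfl : q = r + 1 := by simp only at e; omega
      exact h
    | succ p =>
      exact congrFun (congrArg lastVertices h'') ⟨(p, q), by simp only at e ⊢; omega⟩
  · intro p q e
    cases p with
    | zero =>
      obtain rfl : q = r := by omega
      exact h'
    | succ p => exact congrArg (fun z => edge z p q (by omega)) h''

/-- The cone with base `w` whose new components are given by the vertex `y` and the edge `γ`. -/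
theorem exists_cons (y : Nerve Γ (r + 1)) (γ : PathClass (Nerve Γ r)) (w : Bar (doubleNerve Γ) r)
    (h₁ : γ.tgt = reindex (skip r 0) y) (h₀ : γ.src = top w) :
    ∃ x : Bar (doubleNerve Γ) (r + 1), top x = y ∧ edge₀ x = γ ∧
      Bar.face r 0 (Nat.zero_le _) x = w := by
  let Y : LastVertices Γ (r + 1) := fun
    | ⟨(0, q), h⟩ => (show r + 1 = q by simp only at h; omega) ▸ y
    | ⟨(p + 1, q), h⟩ => lastVertices w ⟨(p, q), by simp only at h; omega⟩
  let E : ∀ p q, p + 1 + q = r + 1 → PathClass (Nerve Γ q) := fun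
    | 0, q, h => (show r = q by omega) ▸ γ
    | p + 1, q, h => edge w p q (by omega)
  obtain ⟨x, hx, hx'⟩ := exists_bar_of_edges Y E (fun p q h => by
    cases p with
    | zero =>
      obtain rfl : q = r := by omega
      exact h₀
    | succ p => exact src_edge w p q _) (fun p q h => by
    cases p with
    | zero =>
      obtain rfl : q = r := by omega
      exact h₁
    | succ p => exact tgt_edge w p q _)
  refine ⟨x, congrFun hx _, hx' 0 r _, bar_ext_edge (funext ?_) fun p q h => hx' (p + 1) q _⟩
  rintro ⟨⟨p, q⟩, e⟩
  exact congrFun hx ⟨(p + 1, q), by simp only at e ⊢; omega⟩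

end

/-! ### Fillers of horns in the bar construction -/

section

variable {G : Type u} {M : Type v} {Γ : InternalGroupoid G M} [TopologicalSpace G]
  [TopologicalSpace M]

theorem PathClass.src_comp {X : Type*} [TopologicalSpace X] {a b : PathClass X}
    (h : a.src = b.tgt) : ((Pi1 X).comp a b).src = b.src :=
  InternalGroupoid.src_comp (Γ := Pi1 X) h

theorem PathClass.tgt_comp {X : Type*} [TopologicalSpace X] {a b : PathClass X} :
    ((Pi1 X).comp a b).tgt = a.tgt :=
  InternalGroupoid.tgt_comp (Γ := Pi1 X)

theorem bar_face_face {r i j : ℕ} (hij : i < j) (hj : j ≤ r + 2) (x : Bar (doubleNerve Γ) (r + 2)) :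
    Bar.face r i (by omega) (Bar.face (r + 1) j hj x) =
      Bar.face r (j - 1) (by omega) (Bar.face (r + 1) i (by omega) x) :=
  (Bar.laws (doubleNerve Γ)).d_d r i j hij hj x

/-- A simplex of the bar construction of dimension at least 3 is determined by any of its horns,
since this is so for its last vertices, and for path classes in the nerve of `G`. -/
theorem UniquePathFillers.injective_bar (hU : UniquePathFillers Γ) (q k : ℕ) (hk : k ≤ q + 1)
    (hq : 2 < q + 1) : Function.Injective ((bar (doubleNerve Γ)).hornMap q k) := by
  obtain ⟨n, rfl⟩ : ∃ n, q = n + 2 := ⟨q - 2, by omega⟩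
  intro (x : Bar (doubleNerve Γ) (n + 3)) (x' : Bar (doubleNerve Γ) (n + 3)) hx
  have h : ∀ i (hi : i ≤ n + 3), i ≠ k → Bar.face (n + 2) i hi x = Bar.face (n + 2) i hi x' :=
    fun i hi hik => congrFun (congrArg Subtype.val hx) ⟨i, hi, hik⟩
  have hL : lastVertices x = lastVertices x' :=
    eq_of_lastHorn (n := n + 1) (k := k) (by omega) (by omega) fun i => by
      rw [← lastVertices_face i.2.1, ← lastVertices_face i.2.1, h _ i.2.1 i.2.2]
  have htop : top x = top x' := congrFun hL _
  have hedge : edge₀ x = edge₀ x' := by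
    refine hU n (k - 1) (by omega) _ _ fun i hi hik => ?_
    by_cases hi0 : i = 0
    · subst hi0
      have h1 := congrArg edge₀ (h 1 (by omega) (by omega))
      rw [edge₀_face_one, edge₀_face_one, h 0 (by omega) (by omega)] at h1
      refine comp_right_cancel ?_ ?_ h1
      · rw [← h 0 (by omega) (by omega)]
        change reindex (skip _ 0) (edge₀ x).src = (edge₀ _).tgt
        rw [src_edge₀, tgt_edge₀]
      · change reindex (skip _ 0) (edge₀ x').src = (edge₀ _).tgt
        rw [src_edge₀, tgt_edge₀]
    · have h1 := congrArg edge₀ (h (i + 1) (by omega) (by omega))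
      rw [edge₀_face _ (by omega), edge₀_face _ (by omega)] at h1
      exact h1
  refine bar_ext_cons htop hedge ?_
  rcases Nat.eq_zero_or_pos k with rfl | hk0
  · refine bar_ext_cons ?_ ?_ ?_
    · rw [← src_edge₀, hedge, src_edge₀]
    · have h1 := congrArg edge₀ (h 1 (by omega) (by omega))
      rw [edge₀_face_one, edge₀_face_one, hedge] at h1
      refine comp_left_cancel ?_ ?_ h1
      · rw [← hedge]
        change reindex (skip _ 0) (edge₀ x).src = (edge₀ _).tgt
        rw [src_edge₀, tgt_edge₀]
      · change reindex (skip _ 0) (edge₀ x').src = (edge₀ _).tgt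
        rw [src_edge₀, tgt_edge₀]
    · have e := bar_face_face (i := 0) (j := 1) (by omega) (by omega) x
      have e' := bar_face_face (i := 0) (j := 1) (by omega) (by omega) x'
      rw [h 1 (by omega) (by omega)] at e
      exact e.symm.trans e'
  · exact h 0 (by omega) (by omega)

end

section

variable {G : Type u} {M : Type v} {Γ : InternalGroupoid G M} [TopologicalSpace G]
  [TopologicalSpace M] {n k : ℕ}

/-- The composability condition in the formula for the edge of `f_1 x`. -/
theorem src_pface_edge₀ (x : Bar (doubleNerve Γ) (n + 2)) :
    (pface 0 (edge₀ x)).src = (edge₀ (Bar.face (n + 1) 0 (by omega) x)).tgt := by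
  change reindex (skip _ 0) (edge₀ x).src = _
  rw [src_edge₀, tgt_edge₀]

/-- The compatibility condition for horns in the bar construction. -/
def BarHornCompat (z : SimplicialSpace.HornIdx (n + 1) k → Bar (doubleNerve Γ) (n + 1)) : Prop :=
  ∀ i j : SimplicialSpace.HornIdx (n + 1) k, (hij : i.1 < j.1) →
    Bar.face n i.1 (by have := j.2.1; omega) (z j) =
      Bar.face n (j.1 - 1) (by have := j.2.1; omega) (z i)

/-- A horn without the 0-th face in the bar construction has a filler. -/
theorem UniquePathFillers.exists_filler_bar_zero (hU : UniquePathFillers Γ) (hΓ : Γ.IsTopological)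
    (hS : IsSerreFibration Γ.src)
    (z : SimplicialSpace.HornIdx (n + 1) 0 → Bar (doubleNerve Γ) (n + 1)) (hz : BarHornCompat z) :
    ∃ x : Bar (doubleNerve Γ) (n + 2), ∀ i, Bar.face (n + 1) i.1 i.2.1 x = z i := by
  obtain ⟨a, b, hab⟩ := NerveStr.exists_hornIdx_ne n 0
  have hix : ∀ i : SimplicialSpace.HornIdx (n + 1) 0, i.1 ≤ n + 2 := fun i => i.2.1
  have hinj : Function.Injective fun i : SimplicialSpace.HornIdx (n + 1) 0 => i.1 :=
    Subtype.val_injective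
  obtain ⟨y, hy⟩ := Nerve.exists_faces (z := fun i => top (z i)) (fun i j hij => by
      have h1 := congrArg top (hz i j hij)
      rwa [top_face _ i.2.2, top_face _ (by have := i.2.2; omega)] at h1) hix hinj hab
    (c := 0) fun i => i.2.2.symm
  let z₁ := z ⟨1, by omega⟩
  let s : SimplicialSpace.HornIdx n 0 → SimplicialSpace.HornIdx (n + 1) 0 :=
    fun j => ⟨j.1 + 1, by have := j.2.1; omega, by omega⟩
  obtain ⟨γ, hγ, hγ'⟩ := hU.exists_filler_tgt hΓ hS (n := n) (k := 0) (by omega)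
    (fun j => edge₀ (z (s j))) (by
      cases n with
      | zero => trivial
      | succ n =>
        intro i j hij
        have h1 := congrArg edge₀ (hz (s i) (s j) (Nat.succ_lt_succ hij))
        have := i.2.2
        have := j.2.2
        rwa [edge₀_face _ (show 2 ≤ i.1 + 1 by omega), edge₀_face _ (show 2 ≤ j.1 + 1 - 1 by omega)] at h1)
    (reindex (skip _ 0) y) fun j => by
      rw [tgt_edge₀, ← hy]
      have := j.2.2
      exact ((Nerve.laws Γ).d_d n 0 (j.1 + 1) (by omega) (by have := j.2.1; omega) y).symm
  have hcomp : ((Pi1 _).inv (pface 0 γ)).src = (edge₀ z₁).tgt := by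
    rw [tgt_edge₀, ← hy]
    change reindex (skip _ 0) γ.tgt = _
    rw [hγ']
    exact ((Nerve.laws Γ).d_d n 0 1 (by omega) (by omega) y).symm
  obtain ⟨w, hw, hw', hw''⟩ := exists_cons γ.src ((Pi1 _).comp ((Pi1 _).inv (pface 0 γ)) (edge₀ z₁))
    (Bar.face n 0 (by omega) z₁) PathClass.tgt_comp
    ((PathClass.src_comp hcomp).trans (src_edge₀ z₁))
  obtain ⟨x, hx, hx', hx''⟩ := exists_cons y γ w hγ' hw.symm
  have hγw : (Pi1 _).comp (pface 0 γ) (edge₀ w) = edge₀ z₁ := by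
    rw [hw']
    exact comp_inv_cancel (Γ := Pi1 (Nerve Γ n)) hcomp
  refine ⟨x, fun i => ?_⟩
  obtain ⟨i, hi, hi0⟩ := i
  dsimp only at hi0 ⊢
  obtain rfl | hi2 : i = 1 ∨ 2 ≤ i := by omega
  · refine bar_ext_cons ?_ ?_ ?_
    · rw [top_face _ (by omega), hx]
      exact hy ⟨1, hi, hi0⟩
    · rw [edge₀_face_one, hx', hx'', hγw]
    · rw [bar_face_face (by omega), hx'']
      exact hw''
  · have hγi : pface (i - 1) γ = edge₀ (z ⟨i, hi, hi0⟩) := by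
      have := hγ ⟨i - 1, by omega, by omega⟩
      refine this.trans ?_
      congr 2
      exact Subtype.ext (show i - 1 + 1 = i by omega)
    refine bar_ext_cons ?_ ?_ ?_
    · rw [top_face _ (by omega), hx]
      exact hy ⟨i, hi, hi0⟩
    · rw [edge₀_face _ hi2, hx', hγi]
    · rw [bar_face_face (by omega), hx'']
      have htop : top (Bar.face n (i - 1) (by omega) w) =
          top (Bar.face n 0 (by omega) (z ⟨i, hi, hi0⟩)) := by
        rw [top_face _ (by omega), hw, ← src_edge₀, ← hγi]
        rfl
      have h1i : Bar.face n 1 (by omega) (z ⟨i, hi, hi0⟩) = Bar.face n (i - 1) (by omega) z₁ :=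
        hz ⟨1, by omega⟩ ⟨i, hi, hi0⟩ (by dsimp only; omega)
      cases n with
      | zero => exact bar_zero_ext htop
      | succ n =>
        refine bar_ext_cons htop ?_ ?_
        · -- the edge of `f_1 (z i)` is the product of `pface 0 (edge₀ (z i))` and the edge of
          -- `f_0 (z i)`, so it suffices to compare the products
          have e1 := congrArg edge₀ h1i
          rw [edge₀_face_one, ← hγi] at e1
          have hc := src_pface_edge₀ (z ⟨i, hi, hi0⟩)
          rw [← hγi] at hc
          have hs : (pface 0 γ).src = (edge₀ w).tgt := by
            rw [tgt_edge₀, hw]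
            rfl
          refine comp_left_cancel (Γ := Pi1 (Nerve Γ n)) (a := pface 0 (pface (i - 1) γ)) ?_ hc
            (Eq.trans ?_ e1.symm)
          · change _ = (edge₀ _).tgt
            rw [tgt_edge₀, top_face _ (by omega), hw]
            rfl
          · rw [pface_pface (by omega) (by omega)]
            obtain rfl | hi3 : i = 2 ∨ 3 ≤ i := by omega
            · change (Pi1 _).comp (pface 0 _) (edge₀ (Bar.face _ 1 _ w)) =
                edge₀ (Bar.face _ 1 _ z₁)
              rw [edge₀_face_one, edge₀_face_one, hw'', ← hγw, pface_comp hs,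
                comp_assoc (Γ := Pi1 (Nerve Γ n)) (a := pface 0 (pface 0 γ))
                  (b := pface 0 (edge₀ w)) (congrArg (reindex (skip n 0)) hs)]
              refine (src_pface_edge₀ w).trans ?_
              rw [hw'']
              rfl
            · rw [edge₀_face _ (by omega), edge₀_face _ (by omega), ← hγw, pface_comp hs]
        · have e2 := bar_face_face (i := 0) (j := i - 1) (by omega) (by omega) w
          have e3 := bar_face_face (i := 0) (j := i - 1) (by omega) (by omega) z₁
          have e4 := bar_face_face (i := 0) (j := 1) (by omega) (by omega) (z ⟨i, hi, hi0⟩)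
          rw [hw''] at e2
          rw [h1i] at e4
          exact e2.trans (e3.symm.trans e4)

/-- A horn with a 0-th face in the bar construction has a filler. -/
theorem UniquePathFillers.exists_filler_bar_succ (hU : UniquePathFillers Γ) (hΓ : Γ.IsTopological)
    (hS : IsSerreFibration Γ.src) (hk : k ≤ n + 1)
    (z : SimplicialSpace.HornIdx (n + 1) (k + 1) → Bar (doubleNerve Γ) (n + 1))
    (hz : BarHornCompat z) :
    ∃ x : Bar (doubleNerve Γ) (n + 2), ∀ i, Bar.face (n + 1) i.1 i.2.1 x = z i := by
  obtain ⟨a, b, hab⟩ := NerveStr.exists_hornIdx_ne n (k + 1)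
  have hix : ∀ i : SimplicialSpace.HornIdx (n + 1) (k + 1), i.1 ≤ n + 2 := fun i => i.2.1
  have hinj : Function.Injective fun i : SimplicialSpace.HornIdx (n + 1) (k + 1) => i.1 :=
    Subtype.val_injective
  let s : SimplicialSpace.HornIdx n k → SimplicialSpace.HornIdx (n + 1) (k + 1) :=
    fun j => ⟨j.1 + 1, by have := j.2.1; omega, by have := j.2.2; omega⟩
  let w := z ⟨0, by omega⟩
  have hz0 : ∀ j : SimplicialSpace.HornIdx n k, Bar.face n 0 (by omega) (z (s j)) =
      Bar.face n j.1 (by have := j.2.1; omega) w := fun j =>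
    hz ⟨0, by omega⟩ (s j) (by dsimp only [s]; omega)
  let δ : SimplicialSpace.HornIdx n k → PathClass (Nerve Γ n) := fun j =>
    if j.1 = 0 then (Pi1 _).comp (edge₀ (z (s j))) ((Pi1 _).inv (edge₀ w)) else edge₀ (z (s j))
  have hcomp : ∀ j : SimplicialSpace.HornIdx n k, j.1 = 0 →
      (edge₀ (z (s j))).src = ((Pi1 _).inv (edge₀ w)).tgt := by
    intro j hj
    have h1 := hz0 j
    refine (src_edge₀ _).trans (Eq.trans ?_ (src_edge₀ w).symm)
    rw [h1]
    congr 2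
  have hδ0 : ∀ j : SimplicialSpace.HornIdx n k, j.1 = 0 →
      (Pi1 _).comp (δ j) (edge₀ w) = edge₀ (z (s j)) := by
    intro j hj
    simp only [δ, if_pos hj]
    exact inv_comp_cancel_right (Γ := Pi1 (Nerve Γ n)) (hcomp j hj)
  have hδ1 : ∀ j : SimplicialSpace.HornIdx n k, j.1 ≠ 0 → δ j = edge₀ (z (s j)) :=
    fun j hj => if_neg hj
  have hδtgt : ∀ j, (δ j).tgt = reindex (skip n 0) (top (z (s j))) := by
    intro j
    by_cases hj : j.1 = 0
    · simp only [δ, if_pos hj]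
      exact PathClass.tgt_comp.trans (tgt_edge₀ _)
    · rw [hδ1 j hj, tgt_edge₀]
  have hδsrc : ∀ j, reindex (skip n j.1) (top w) = (δ j).src := by
    intro j
    by_cases hj : j.1 = 0
    · simp only [δ, if_pos hj]
      refine Eq.trans ?_ (PathClass.src_comp (hcomp j hj)).symm
      rw [hj]
      exact (tgt_edge₀ w).symm
    · rw [hδ1 j hj, src_edge₀, hz0, top_face _ hj]
  have hδ : PathHornCompat n k δ := by
    cases n with
    | zero => trivial
    | succ n =>
      intro i j hij
      rw [hδ1 j (by omega)]
      have h1 := congrArg edge₀ (hz (s i) (s j) (Nat.succ_lt_succ hij))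
      by_cases hi : i.1 = 0
      · have hsi : (δ i).src = (edge₀ w).tgt := by
          rw [← hδsrc, tgt_edge₀, hi]
        have h0i : Bar.face (n + 1) 0 (by omega) (z (s i)) = Bar.face (n + 1) 0 (by omega) w := by
          rw [hz0]
          congr 1
        have hij' : Bar.face (n + 1) 1 (by omega) (z (s j)) =
            Bar.face (n + 1) j.1 (by have := j.2.1; omega) (z (s i)) := by
          have h2 := hz (s i) (s j) (Nat.succ_lt_succ hij)
          refine Eq.trans ?_ h2
          congr 1
          exact (congrArg (· + 1) hi).symm
        have h3 := congrArg edge₀ hij'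
        rw [edge₀_face_one, hz0] at h3
        have hcj := src_pface_edge₀ (z (s j))
        rw [hz0] at hcj
        rw [hi]
        refine comp_right_cancel (Γ := Pi1 (Nerve Γ n)) hcj ?_ (h3.trans ?_)
        · change reindex (skip n (j.1 - 1)) (δ i).src = (edge₀ _).tgt
          rw [hsi, tgt_edge₀, tgt_edge₀, top_face _ (by omega)]
          exact ((Nerve.laws Γ).d_d n 0 j.1 (by omega) (by have := j.2.1; omega) _).symm
        · obtain hj | hj : j.1 = 1 ∨ 2 ≤ j.1 := by omega
          · have e : ∀ y : Bar (doubleNerve Γ) (n + 2),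
                Bar.face (n + 1) j.1 (by have := j.2.1; omega) y =
                  Bar.face (n + 1) 1 (by omega) y := by
              intro y
              congr 1
            rw [e, e, edge₀_face_one, edge₀_face_one, h0i, ← hδ0 i hi, hj, pface_comp hsi,
              comp_assoc (Γ := Pi1 (Nerve Γ n)) (a := pface 0 (δ i)) (b := pface 0 (edge₀ w))
                (congrArg (reindex (skip n 0)) hsi) (src_pface_edge₀ w)]
          · rw [edge₀_face _ hj, edge₀_face _ hj, ← hδ0 i hi, pface_comp hsi]
      · rw [hδ1 i hi]
        rwa [edge₀_face _ (show 2 ≤ i.1 + 1 by omega),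
          edge₀_face _ (show 2 ≤ j.1 + 1 - 1 by omega)] at h1
  obtain ⟨γ, hγ, hγ'⟩ := hU.exists_filler hΓ hS hk δ hδ (top w) hδsrc
  obtain ⟨y, hy⟩ := Nerve.exists_faces (ix := fun i : SimplicialSpace.HornIdx (n + 1) (k + 1) => i.1)
    (z := fun i => if i.1 = 0 then γ.tgt else top (z i)) (fun i j hij => by
      dsimp only at hij ⊢
      rw [if_neg (by omega)]
      by_cases hi : i.1 = 0
      · have hj : j = s ⟨j.1 - 1, by have := j.2.1; omega, by have := j.2.2; omega⟩ :=
          Subtype.ext (show j.1 = j.1 - 1 + 1 by omega)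
        rw [if_pos hi, hi]
        have h1 := congrArg PathClass.tgt (hγ ⟨j.1 - 1, by have := j.2.1; omega, by have := j.2.2; omega⟩)
        rw [hδtgt, ← hj] at h1
        exact h1.symm
      · rw [if_neg hi]
        have h1 := congrArg top (hz i j hij)
        rwa [top_face _ hi, top_face _ (by omega)] at h1) hix hinj hab
    (c := ⟨k + 1, by omega⟩) fun i => i.2.2.symm
  have hy0 : reindex (skip _ 0) y = γ.tgt := (hy ⟨0, by omega⟩).trans (if_pos rfl)
  obtain ⟨x, hx, hx', hx''⟩ := exists_cons y γ w hy0.symm hγ'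
  refine ⟨x, fun i => ?_⟩
  by_cases hi : i.1 = 0
  · obtain ⟨i, hi', hi''⟩ := i
    obtain rfl : i = 0 := hi
    exact hx''
  · have hj : i = s ⟨i.1 - 1, by have := i.2.1; omega, by have := i.2.2; omega⟩ :=
      Subtype.ext (show i.1 = i.1 - 1 + 1 by omega)
    refine bar_ext_cons ?_ ?_ ?_
    · rw [top_face _ hi, hx]
      exact (hy i).trans (if_neg hi)
    · generalize hj' : (⟨i.1 - 1, by have := i.2.1; omega, by have := i.2.2; omega⟩ : SimplicialSpace.HornIdx n k) = j at hj
      subst hj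
      by_cases hi1 : j.1 = 0
      · have e : edge₀ (Bar.face (n + 1) (s j).1 (s j).2.1 x) =
            edge₀ (Bar.face (n + 1) 1 (by omega) x) := by
          congr 2
          exact congrArg (· + 1) hi1
        have := hγ j
        rw [e, edge₀_face_one, hx', hx'', ← hδ0 j hi1, ← hγ j, hi1]
      · rw [edge₀_face _ (show 2 ≤ j.1 + 1 by omega), hx', ← hδ1 j hi1, ← hγ j]
        rfl
    · rw [bar_face_face (by omega), hx'']
      exact (hz ⟨0, by omega⟩ i (by dsimp only; omega)).symm

theorem UniquePathFillers.surjective_bar (hU : UniquePathFillers Γ) (hΓ : Γ.IsTopological)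
    (hS : IsSerreFibration Γ.src)
    (hf : ∀ n i hi, Function.Surjective ((bar (doubleNerve Γ)).face n i hi)) (q k : ℕ)
    (hk : k ≤ q + 1) : Function.Surjective ((bar (doubleNerve Γ)).hornMap q k) := by
  intro z
  cases q with
  | zero =>
    have hj : (1 - k) ≤ 0 + 1 ∧ (1 - k) ≠ k := by omega
    obtain ⟨x, hx⟩ := hf 0 (1 - k) hj.1 (z.1 ⟨1 - k, hj⟩)
    refine ⟨x, Subtype.ext (funext fun i => ?_)⟩
    obtain ⟨i, hi, hik⟩ := i
    obtain rfl : i = 1 - k := by omega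
    exact hx
  | succ n =>
    cases k with
    | zero =>
      obtain ⟨x, hx⟩ := hU.exists_filler_bar_zero hΓ hS z.1 z.2
      exact ⟨x, Subtype.ext (funext hx)⟩
    | succ k =>
      obtain ⟨x, hx⟩ := hU.exists_filler_bar_succ hΓ hS (by omega) z.1 z.2
      exact ⟨x, Subtype.ext (funext hx)⟩

theorem BarStr.isLocalLie {A : SmoothStr G} {B : SmoothStr M} {S : NerveStr Γ A} (T : BarStr S)
    (h : Γ.IsSmooth A B) (hU : UniquePathFillers Γ) : (bar (doubleNerve Γ)).IsLocalLie T.W 2 :=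
  ⟨T.isEtaleLie h, hU.injective_bar⟩

theorem BarStr.isLie {A : SmoothStr G} {B : SmoothStr M} {S : NerveStr Γ A} (T : BarStr S)
    (h : Γ.IsSmooth A B) (hU : UniquePathFillers Γ) (hS : IsSerreFibration Γ.src) :
    (bar (doubleNerve Γ)).IsLie T.W 2 :=
  ⟨T.isEtaleLie h, hU.surjective_bar h.isTopological hS (T.isManifold h).surjective_face,
    hU.injective_bar⟩

end

section

variable {G : Type u} {M : Type v} {Γ : InternalGroupoid G M} [TopologicalSpace G]
  [TopologicalSpace M]

/-- The smooth structures on the double nerve and on its bar construction. -/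
def BarStr.toFundamentalSmoothStr {A : SmoothStr G} {S : NerveStr Γ A} (T : BarStr S) :
    FundamentalSmoothStr Γ A where
  X := S.X
  P := S.P
  N := S.N
  W := T.W
  induced_X := S.isNerveStr
  path_P := S.isPathStr
  induced_N := S.inducedBy
  induced_W := T.inducedBy

theorem exists_fundamentalSmoothStr {A : SmoothStr G} {B : SmoothStr M} (h : Γ.IsSmooth A B) :
    ∃ S : FundamentalSmoothStr Γ A, (doubleNerve Γ).IsManifold S.N ∧
      (∀ p, ((doubleNerve Γ).vertical p).IsEtaleLie (S.N p) 1) ∧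
      (bar (doubleNerve Γ)).IsEtaleLie S.W 2 ∧
      (((doubleNerve Γ).vertical 1).IsLocalLie (S.N 1) 1 →
        (bar (doubleNerve Γ)).IsLocalLie S.W 2 ∧
        (IsSerreFibration Γ.src →
          (∀ p, ((doubleNerve Γ).vertical p).IsLie (S.N p) 1) ∧
          (bar (doubleNerve Γ)).IsLie S.W 2)) := by
  obtain ⟨S⟩ := nonempty_nerveStr h
  obtain ⟨T⟩ := nonempty_barStr S
  refine ⟨T.toFundamentalSmoothStr, S.isManifold h, S.isEtaleLie_vertical h, T.isEtaleLie h,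
    fun hL => ?_⟩
  have hU : UniquePathFillers Γ := uniquePathFillers_of_injective hL.injective
  exact ⟨T.isLocalLie h hU, fun hS => ⟨S.isLie_vertical h hU hS, T.isLie h hU hS⟩⟩

end

/-! ### The Haefliger groupoid in terms of arrows and path classes -/

theorem PreCat.comp_mk {P : Type u} {O : Type v} (C : PreCat P O) (hC : ∀ a, C.Invertible a)
    {a b : P} (h : C.src a = C.tgt b) :
    (C.toGroupoid hC).comp (Quot.mk _ a) (Quot.mk _ b) = Quot.mk _ (C.mul a b h) := by
  rw [comp_eq (show (C.toGroupoid hC).src (Quot.mk _ a) = (C.toGroupoid hC).tgt (Quot.mk _ b)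
    from h)]
  exact C.mul_eqv (Quot.out_eq _) (Quot.out_eq _) _ _

section

variable {G : Type u} {M : Type v} [TopologicalSpace G] [TopologicalSpace M]
  (Γ : InternalGroupoid G M)

/-- The source of a topological groupoid as a continuous map. -/
abbrev InternalGroupoid.IsTopological.srcMap {Γ : InternalGroupoid G M} (h : Γ.IsTopological) :
    C(G, M) := ⟨Γ.src, h.continuous_src⟩

/-- The target of a topological groupoid as a continuous map. -/
abbrev InternalGroupoid.IsTopological.tgtMap {Γ : InternalGroupoid G M} (h : Γ.IsTopological) :
    C(G, M) := ⟨Γ.tgt, h.continuous_tgt⟩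

/-- The arrow of the Haefliger groupoid represented by a `G`-path. -/
def gMk {x : M} {L : List (G × C(I, M))} {g₀ : G} (h : IsGPath Γ x L (Γ.tgt g₀)) :
    HaefligerArrow Γ := Quot.mk _ ⟨(x, L, g₀), h⟩

/-- The arrow of the Haefliger groupoid represented by an arrow of `G`. -/
def hArr (g : G) : HaefligerArrow Γ := Quot.mk _ (gArrow Γ g)

/-- The arrow of the Haefliger groupoid represented by a path class. -/
def hPath (γ : PathClass M) : HaefligerArrow Γ :=
  haefligerMk Γ (Γ.one ((mk'_surjective γ).choose 1)) (mk'_surjective γ).choose (Γ.src_one _)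

variable {Γ}

theorem gMk_eq_of_gEquiv {x x' : M} {L L' : List (G × C(I, M))} {g₀ g₀' : G}
    (h : IsGPath Γ x L (Γ.tgt g₀)) (h' : IsGPath Γ x' L' (Γ.tgt g₀')) (hx : x = x')
    (hg : Γ.src g₀ = Γ.src g₀') (e : GEquiv Γ (L, g₀) (L', g₀')) : gMk Γ h = gMk Γ h' :=
  Quot.sound ⟨hg, hx, Or.inl e⟩

theorem gMk_nil {x : M} {g₀ : G} (h : IsGPath Γ x [] (Γ.tgt g₀)) : gMk Γ h = hArr Γ g₀ := by
  obtain rfl : x = Γ.tgt g₀ := h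
  rfl

theorem comp_gMk {x y : M} {L K : List (G × C(I, M))} {g₀ k₀ : G} (h : IsGPath Γ x L (Γ.tgt g₀))
    (h' : IsGPath Γ y K (Γ.tgt k₀)) (e : Γ.src g₀ = y) :
    (haefliger Γ).comp (gMk Γ h) (gMk Γ h') =
      gMk Γ (x := x) (L := L ++ (g₀, .const I (Γ.src g₀)) :: K) (g₀ := k₀)
        ((isGPath_append Γ _ _ _ _).2 ⟨_, h, rfl, rfl, e ▸ h'⟩) :=
  PreCat.comp_mk _ _ e

theorem hArr_comp {g h : G} (e : Γ.src g = Γ.tgt h) :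
    hArr Γ (Γ.comp g h) = (haefliger Γ).comp (hArr Γ g) (hArr Γ h) := by
  refine Eq.trans ?_ (PreCat.comp_mk (gPathPreCat Γ) _ (a := gArrow Γ g) (b := gArrow Γ h) e).symm
  rw [comp_eq e]
  exact (Quot.sound ⟨(Γ.src_mul _ _ _).symm, (Γ.tgt_mul _ _ _).symm,
    Or.inl (GEquiv.mul_last (Γ := Γ) [] g h e)⟩).symm

theorem hArr_one (x : M) : hArr Γ (Γ.one x) = (haefliger Γ).one x :=
  gMk_nil (Γ.tgt_one x).symm ▸ rfl

/-- A unit followed by a constant path can be removed from a `G`-path. -/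
theorem gEquiv_unit {x : M} (P : List (G × C(I, M))) {L : List (G × C(I, M))} {g₀ : G}
    (h : IsGPath Γ x L (Γ.tgt g₀)) :
    GEquiv Γ (P ++ (Γ.one x, .const I x) :: L, g₀) (P ++ L, g₀) := by
  have e : ∀ y : M, Γ.src (Γ.one y) = y := Γ.src_one
  cases L with
  | nil =>
    obtain rfl : x = Γ.tgt g₀ := h
    have := GEquiv.mul_last (Γ := Γ) P (Γ.one (Γ.tgt g₀)) g₀ (Γ.src_one _)
    rw [Γ.one_mul, e] at this
    simpa using this
  | cons c R =>
    obtain ⟨k, τ⟩ := c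
    obtain rfl : Γ.tgt k = x := h.1
    have := GEquiv.mul (Γ := Γ) P R (Γ.one (Γ.tgt k)) k τ g₀ (Γ.src_one _)
    rwa [Γ.one_mul, e] at this

/-- A homotopy of paths with fixed end points is a deformation of `G`-paths. -/
theorem haefligerMk_eq_of_homotopic {g : G} {ρ ρ' : C(I, M)} (h : Γ.src g = ρ 1)
    (h' : Γ.src g = ρ' 1) (e : mk' ρ = mk' ρ') : haefligerMk Γ g ρ h = haefligerMk Γ g ρ' h' := by
  obtain ⟨F, h₀, h₁, k₀, k₁⟩ := exists_homotopy e
  have e₀ : ρ' 0 = ρ 0 := (congrArg PathClass.src e).symm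
  refine Quot.sound ⟨?_, rfl, Or.inr ⟨⟨fun t => ⟨(Γ.tgt g, [(g, F.curry t)], Γ.one (ρ 0)),
    rfl, ?_, ?_⟩, ?_⟩, ?_, ?_, ?_⟩⟩
  · change Γ.src (Γ.one (ρ 0)) = Γ.src (Γ.one (ρ' 0))
    rw [e₀]
  · exact h.trans (k₁ t).symm
  · exact (k₀ t).trans (Γ.tgt_one _).symm
  · refine Continuous.subtype_mk ?_ _
    exact continuous_const.prodMk ((List.continuous_cons.comp
      ((continuous_const.prodMk F.curry.continuous).prodMk continuous_const)).prodMk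
        continuous_const)
  · refine Subtype.ext ?_
    have : F.curry 0 = ρ := ContinuousMap.ext h₀
    change (_, [(_, F.curry 0)], _) = _
    rw [this]; rfl
  · refine Subtype.ext ?_
    have : F.curry 1 = ρ' := ContinuousMap.ext h₁
    change (_, [(_, F.curry 1)], _) = (_, [(_, _)], Γ.one (ρ' 0))
    rw [this, e₀]
  · exact fun t => ⟨rfl, rfl⟩

theorem hPath_mk' (ρ : C(I, M)) :
    hPath Γ (mk' ρ) = haefligerMk Γ (Γ.one (ρ 1)) ρ (Γ.src_one _) := by
  have e := (mk'_surjective (mk' ρ)).choose_spec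
  have key : ∀ ρ' x (h : Γ.src (Γ.one x) = ρ' 1), mk' ρ' = mk' ρ → x = ρ 1 →
      haefligerMk Γ (Γ.one x) ρ' h = haefligerMk Γ (Γ.one (ρ 1)) ρ (Γ.src_one _) := by
    rintro ρ' _ h e rfl
    exact haefligerMk_eq_of_homotopic _ _ e
  exact key _ _ _ e (congrArg PathClass.tgt e)

@[simp]
theorem src_hPath (γ : PathClass M) : (haefliger Γ).src (hPath Γ γ) = γ.src := by
  obtain ⟨ρ, rfl⟩ := mk'_surjective γ
  rw [hPath_mk']
  exact Γ.src_one _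

@[simp]
theorem tgt_hPath (γ : PathClass M) : (haefliger Γ).tgt (hPath Γ γ) = γ.tgt := by
  obtain ⟨ρ, rfl⟩ := mk'_surjective γ
  rw [hPath_mk']
  exact Γ.tgt_one _

/-- A `G`-path is the product of its arrows and paths. -/
theorem gMk_cons {x : M} {g : G} {ρ : C(I, M)} {L : List (G × C(I, M))} {g₀ : G}
    (h : IsGPath Γ x ((g, ρ) :: L) (Γ.tgt g₀)) :
    gMk Γ h = (haefliger Γ).comp (hArr Γ g) ((haefliger Γ).comp (hPath Γ (mk' ρ))
      (gMk Γ h.2.2)) := by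
  obtain rfl : Γ.tgt g = x := h.1
  have h₁ : Γ.src g = ρ 1 := h.2.1
  have h₂ : IsGPath Γ (ρ 0) L (Γ.tgt g₀) := h.2.2
  have hp : IsGPath Γ (ρ 1) [(Γ.one (ρ 1), ρ)] (Γ.tgt (Γ.one (ρ 0))) :=
    ⟨Γ.tgt_one _, Γ.src_one _, (Γ.tgt_one _).symm⟩
  have e : hPath Γ (mk' ρ) = gMk Γ hp := by
    rw [hPath_mk']
    exact congrArg (Quot.mk _) (Subtype.ext (Prod.ext (Γ.tgt_one _) rfl))
  have h₃ : IsGPath Γ (ρ 1) ((Γ.one (ρ 1), ρ) :: L) (Γ.tgt g₀) := ⟨Γ.tgt_one _, Γ.src_one _, h₂⟩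
  have e₁ : (haefliger Γ).comp (hPath Γ (mk' ρ)) (gMk Γ h₂) = gMk Γ h₃ := by
    rw [e, comp_gMk _ _ (Γ.src_one _)]
    refine gMk_eq_of_gEquiv _ _ rfl rfl ?_
    have := gEquiv_unit [(Γ.one (ρ 1), ρ)] h₂
    simp only [Γ.src_one]
    exact this
  have e₂ : IsGPath Γ (Γ.tgt g) [] (Γ.tgt g) := rfl
  refine Eq.trans ?_ (congrArg ((haefliger Γ).comp (hArr Γ g)) e₁.symm)
  rw [← gMk_nil e₂, comp_gMk e₂ h₃ h₁]
  refine (gMk_eq_of_gEquiv _ _ rfl rfl ?_).symm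
  have := GEquiv.mul (Γ := Γ) [] L g (Γ.one (ρ 1)) ρ g₀ (by rw [h₁, Γ.tgt_one])
  rwa [← comp_eq, comp_one h₁] at this

theorem haefligerMk_eq {g : G} {ρ : C(I, M)} (h : Γ.src g = ρ 1) :
    haefligerMk Γ g ρ h = (haefliger Γ).comp (hArr Γ g) (hPath Γ (mk' ρ)) := by
  have h' : IsGPath Γ (Γ.tgt g) [(g, ρ)] (Γ.tgt (Γ.one (ρ 0))) := ⟨rfl, h, (Γ.tgt_one _).symm⟩
  refine (gMk_cons h').trans ?_
  rw [gMk_nil, hArr_one, comp_one]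
  exact src_hPath _

theorem hPath_one (x : M) : hPath Γ ((Pi1 M).one x) = (haefliger Γ).one x := by
  rw [← mk'_const, hPath_mk', ← hArr_one, ← gMk_nil (Γ.tgt_one x).symm]
  have k : IsGPath Γ (Γ.tgt (Γ.one x)) [(Γ.one x, .const I x)] (Γ.tgt (Γ.one x)) :=
    ⟨rfl, Γ.src_one _, (Γ.tgt_one _).symm⟩
  refine gMk_eq_of_gEquiv (x' := x) k _ (Γ.tgt_one _) rfl ?_
  exact gEquiv_unit (Γ := Γ) [] (Γ.tgt_one x).symm

theorem hPath_comp {a b : PathClass M} (h : a.src = b.tgt) :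
    hPath Γ ((Pi1 M).comp a b) = (haefliger Γ).comp (hPath Γ a) (hPath Γ b) := by
  obtain ⟨ρ, rfl⟩ := mk'_surjective a
  obtain ⟨τ, rfl⟩ := mk'_surjective b
  have h₀ : τ 1 = ρ 0 := h.symm
  rw [comp_mk' h₀]
  have k : IsGPath Γ (ρ 1) [(Γ.one (ρ 1), ρ), (Γ.one (ρ 0), τ)] (Γ.tgt (Γ.one (τ 0))) :=
    ⟨Γ.tgt_one _, Γ.src_one _, Γ.tgt_one _, (Γ.src_one _).trans h₀.symm, (Γ.tgt_one _).symm⟩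
  have k' : IsGPath Γ (ρ 1) [(Γ.one (ρ 1), pathComp ρ τ h₀)] (Γ.tgt (Γ.one (τ 0))) :=
    ⟨Γ.tgt_one _, (Γ.src_one _).trans (pathComp_one ρ τ h₀).symm,
      (pathComp_zero ρ τ h₀).trans (Γ.tgt_one _).symm⟩
  have e := gMk_eq_of_gEquiv k k' rfl rfl
    (GEquiv.concat (Γ := Γ) [] [] (Γ.one (ρ 1)) ρ τ (Γ.one (τ 0)) h₀)
  rw [gMk_cons, gMk_cons, gMk_cons, gMk_nil, gMk_nil, hArr_one, hArr_one, hArr_one, comp_one,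
    one_comp, one_comp, comp_one, one_comp] at e
  · exact e.symm
  · rw [tgt_hPath]; exact (pathComp_one ρ τ h₀).symm
  · rw [src_hPath]; exact pathComp_zero ρ τ h₀
  · rw [tgt_hPath]; exact h₀.symm
  · rw [InternalGroupoid.tgt_comp, tgt_hPath]; rfl
  · rw [src_hPath]; rfl

/-- Sliding an arrow along a path `γ` of arrows is a deformation. -/
theorem hPath_comp_hArr (hΓ : Γ.IsTopological) (γ : PathClass G) :
    (haefliger Γ).comp (hPath Γ (map hΓ.tgtMap γ)) (hArr Γ γ.src) =
      (haefliger Γ).comp (hArr Γ γ.tgt) (hPath Γ (map hΓ.srcMap γ)) := by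
  obtain ⟨a, rfl⟩ := mk'_surjective γ
  -- at time `u`, the first part of the target path has been traded for a part of the source path
  let P : C(I × I, M) := ⟨fun z => Γ.tgt (a (unitInterval.symm
    (unitInterval.symm z.1 * unitInterval.symm z.2))), hΓ.continuous_tgt.comp (by fun_prop)⟩
  let R : C(I × I, M) := ⟨fun z => Γ.src (a (z.1 * z.2)), hΓ.continuous_src.comp (by fun_prop)⟩
  have hF : ∀ u, IsGPath Γ (Γ.tgt (a 1)) [(Γ.one (Γ.tgt (a 1)), P.curry u), (a u, R.curry u)]
      (Γ.tgt (Γ.one (Γ.src (a 0)))) := fun u => by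
    refine ⟨Γ.tgt_one _, (Γ.src_one _).trans ?_, ?_, ?_, (Eq.trans ?_ (Γ.tgt_one _).symm)⟩
    · simp [P]
    · simp [P]
    · simp [R]
    · simp [R]
  have e : gMk Γ (hF 0) = gMk Γ (hF 1) := by
    refine Quot.sound ⟨rfl, rfl, Or.inr ⟨⟨fun u => ⟨(Γ.tgt (a 1),
      [(Γ.one (Γ.tgt (a 1)), P.curry u), (a u, R.curry u)], Γ.one (Γ.src (a 0))), hF u⟩, ?_⟩, ?_, ?_, fun t => ⟨rfl, rfl⟩⟩⟩
    rotate_left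
    · rfl
    · rfl
    refine Continuous.subtype_mk ?_ _
    refine continuous_const.prodMk (Continuous.prodMk ?_ continuous_const)
    refine List.continuous_cons.comp ((continuous_const.prodMk P.curry.continuous).prodMk
      (List.continuous_cons.comp ((a.continuous.prodMk R.curry.continuous).prodMk
        continuous_const)))
  have hP0 : P.curry 0 = hΓ.tgtMap.comp a := by ext v; simp [P]
  have hP1 : P.curry 1 = .const I (Γ.tgt (a 1)) := by ext v; simp [P]
  have hR0 : R.curry 0 = .const I (Γ.src (a 0)) := by ext v; simp [R]
  have hR1 : R.curry 1 = hΓ.srcMap.comp a := by ext v; simp [R]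
  simp only [gMk_cons, gMk_nil, hArr_one, hP0, hP1, hR0, hR1, mk'_const, hPath_one] at e
  rw [comp_one (a := (haefliger Γ).one (Γ.src (a 0))), comp_one (a := hArr Γ (a 0)), one_comp,
    one_comp (x := Γ.tgt (a 1)), one_comp (x := Γ.tgt (a 1)), comp_one] at e
  · exact e
  · exact src_hPath _
  · rw [InternalGroupoid.tgt_comp]; rfl
  · rw [InternalGroupoid.tgt_comp, (haefliger Γ).tgt_one]
  · rw [InternalGroupoid.tgt_comp, tgt_hPath]; rfl
  · rfl
  · exact (haefliger Γ).src_one _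

end

/-! ### Actions of arrows and path classes -/

section

variable {G : Type u} {M : Type v} [TopologicalSpace G] [TopologicalSpace M]

/-- An action of the arrows of `Γ` and of the path classes of its base on a set `Z` over the base
that is compatible with sliding arrows along paths of arrows. Such actions are the same as
actions of the Haefliger groupoid. The operations are only meaningful on composable pairs. -/
structure LeftAction {Γ : InternalGroupoid G M} (hΓ : Γ.IsTopological) (Z : Type w) where
  anchor : Z → M
  arr : G → Z → Z
  path : PathClass M → Z → Z
  anchor_arr : ∀ {g z}, Γ.src g = anchor z → anchor (arr g z) = Γ.tgt g
  anchor_path : ∀ {γ : PathClass M} {z}, γ.src = anchor z → anchor (path γ z) = γ.tgt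
  arr_one : ∀ z, arr (Γ.one (anchor z)) z = z
  path_one : ∀ z, path ((Pi1 M).one (anchor z)) z = z
  arr_comp : ∀ {g h z}, Γ.src g = Γ.tgt h → Γ.src h = anchor z →
    arr (Γ.comp g h) z = arr g (arr h z)
  path_comp : ∀ {a b : PathClass M} {z}, a.src = b.tgt → b.src = anchor z →
    path ((Pi1 M).comp a b) z = path a (path b z)
  path_arr : ∀ {γ : PathClass G} {z}, Γ.src γ.src = anchor z →
    path (map hΓ.tgtMap γ) (arr γ.src z) = arr γ.tgt (path (map hΓ.srcMap γ) z)

theorem nhds_cons_eq_map {α : Type*} [TopologicalSpace α] (a : α) (l : List α) :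
    𝓝 (a :: l) = Filter.map (fun p : α × List α => p.1 :: p.2) (𝓝 a ×ˢ 𝓝 l) := by
  simp only [nhds_cons, Filter.prod_eq, (Filter.map_def _ _).symm,
    (Filter.seq_eq_filter_seq _ _).symm]
  simp [-Filter.map_def, Function.comp_def, functor_norm]

namespace LeftAction

variable {Γ : InternalGroupoid G M} {hΓ : Γ.IsTopological} {Z : Type w} (E : LeftAction hΓ Z)

/-- The action of a composable sequence of pairs, each consisting of an arrow and a path. -/
def evalList (L : List (G × C(I, M))) (z : Z) : Z :=
  L.foldr (fun c z => E.arr c.1 (E.path (mk' c.2) z)) z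

theorem evalList_append (L K : List (G × C(I, M))) (z : Z) :
    E.evalList (L ++ K) z = E.evalList L (E.evalList K z) := List.foldr_append

theorem evalList_cons (c : G × C(I, M)) (L : List (G × C(I, M))) (z : Z) :
    E.evalList (c :: L) z = E.arr c.1 (E.path (mk' c.2) (E.evalList L z)) := rfl

variable {E}

theorem anchor_evalList {L : List (G × C(I, M))} {z : Z} {x : M} (h : IsGPath Γ x L (E.anchor z)) :
    E.anchor (E.evalList L z) = x := by
  induction L generalizing x with
  | nil => exact Eq.symm h
  | cons c L ih =>
    have e := ih h.2.2
    rw [evalList_cons, E.anchor_arr, h.1]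
    rw [E.anchor_path e.symm]
    exact h.2.1

/-- The action of a `G`-path varies with the `G`-path only through short path classes at its end
points. The paths between corresponding points of two nearby `G`-paths cancel against each other,
since neighbourhoods in which path classes are determined by their end points are used. -/
theorem eventually_eval [LocallySimple G] [LocallySimple M] {x : M} {L : List (G × C(I, M))}
    {g₀ : G} (h : IsGPath Γ x L (Γ.tgt g₀)) {V V' : Set M} (hV : V ∈ 𝓝 x)
    (hV' : V' ∈ 𝓝 (Γ.src g₀)) : ∀ᶠ p in 𝓝 L ×ˢ 𝓝 g₀, ∀ y, IsGPath Γ y p.1 (Γ.tgt p.2) →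
      ∃ a b : PathClass M, InSet V a ∧ InSet V' b ∧ a.src = x ∧ a.tgt = y ∧ b.src = Γ.src g₀ ∧
        b.tgt = Γ.src p.2 ∧ ∀ z, Γ.src g₀ = E.anchor z →
          E.evalList p.1 (E.arr p.2 (E.path b z)) = E.path a (E.evalList L (E.arr g₀ z)) := by
  induction L generalizing x V with
  | nil =>
    obtain rfl : x = Γ.tgt g₀ := h
    rw [nhds_nil, Filter.pure_prod, Filter.eventually_map]
    obtain ⟨W, hW, hWo, hgW, -, τ, -, hτ⟩ := LocallySimple.exists_nhd g₀ _
      (Filter.inter_mem (hΓ.continuous_tgt.continuousAt hV) (hΓ.continuous_src.continuousAt hV'))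
    filter_upwards [hWo.mem_nhds hgW] with g hg y hy
    obtain rfl : y = Γ.tgt g := hy
    obtain ⟨h₀, h₁, hm⟩ := hτ ⟨g, hg⟩
    have hγ : InSet W (mk' (τ ⟨g, hg⟩)) := ⟨_, hm, rfl⟩
    refine ⟨map hΓ.tgtMap (mk' (τ ⟨g, hg⟩)), map hΓ.srcMap (mk' (τ ⟨g, hg⟩)),
      hγ.map _ fun k hk => (hW hk).1, hγ.map _ fun k hk => (hW hk).2, congrArg Γ.tgt h₀,
      congrArg Γ.tgt h₁, congrArg Γ.src h₀, congrArg Γ.src h₁, fun z hz => ?_⟩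
    have := E.path_arr (γ := mk' (τ ⟨g, hg⟩)) (z := z) ((congrArg Γ.src h₀).trans hz)
    have e₀ : (mk' (τ ⟨g, hg⟩)).src = g₀ := h₀
    have e₁ : (mk' (τ ⟨g, hg⟩)).tgt = g := h₁
    rw [e₀, e₁] at this
    exact this.symm
  | cons c L ih =>
    obtain ⟨g, ρ⟩ := c
    obtain rfl : Γ.tgt g = x := h.1
    have h₁ : Γ.src g = ρ 1 := h.2.1
    have h₂ : IsGPath Γ (ρ 0) L (Γ.tgt g₀) := h.2.2
    obtain ⟨V₁, -, hV₁o, hV₁, hV₁s, -⟩ := LocallySimple.exists_nhd (ρ 1) _ Filter.univ_mem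
    obtain ⟨V₀, -, hV₀o, hV₀, hV₀s, -⟩ := LocallySimple.exists_nhd (ρ 0) _ Filter.univ_mem
    have hV₁' : V₁ ∈ 𝓝 (Γ.src g) := h₁ ▸ hV₁o.mem_nhds hV₁
    obtain ⟨W, hW, hWo, hgW, -, τ, -, hτ⟩ := LocallySimple.exists_nhd g _
      (Filter.inter_mem (hΓ.continuous_tgt.continuousAt hV)
        (hΓ.continuous_src.continuousAt hV₁'))
    have k₁ := ih h₂ (hV₀o.mem_nhds hV₀)
    have k₂ := eventually_mk'_eq ρ (hV₁o.mem_nhds hV₁) (hV₀o.mem_nhds hV₀)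
    rw [nhds_cons_eq_map, ← Filter.map_id (f := 𝓝 g₀), Filter.prod_map_map_eq,
      Filter.eventually_map, nhds_prod_eq]
    filter_upwards [(Filter.tendsto_fst.comp (Filter.tendsto_fst.comp Filter.tendsto_fst)).eventually
        (hWo.mem_nhds hgW),
      (Filter.tendsto_snd.comp (Filter.tendsto_fst.comp Filter.tendsto_fst)).eventually k₂,
      ((Filter.tendsto_snd.comp Filter.tendsto_fst).prodMk Filter.tendsto_snd).eventually k₁]
    rintro ⟨⟨⟨g', ρ'⟩, L'⟩, g₀'⟩ hg' ⟨a, b, ha, hb, has, hat, hbs, hbt, hab⟩ hL y hy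
    change g' ∈ W at hg'
    change a.tgt = ρ' 1 at hat
    change b.tgt = ρ' 0 at hbt
    change (Pi1 M).comp (mk' ρ') b = _ at hab
    obtain rfl : Γ.tgt g' = y := hy.1
    have hs' : Γ.src g' = ρ' 1 := hy.2.1
    obtain ⟨a₁, b₁, ha₁, hb₁, ha₁s, ha₁t, hb₁s, hb₁t, hE⟩ := hL _ hy.2.2
    obtain rfl : a₁ = b := hV₀s _ _ ha₁ hb (ha₁s.trans hbs.symm) (ha₁t.trans hbt.symm)
    obtain ⟨hτ₀, hτ₁, hm⟩ := hτ ⟨g', hg'⟩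
    generalize hγ' : mk' (τ ⟨g', hg'⟩) = γ
    have hγ₀ : γ.src = g := by rw [← hγ']; exact hτ₀
    have hγ₁ : γ.tgt = g' := by rw [← hγ']; exact hτ₁
    have hγ : InSet W γ := ⟨_, hm, hγ'⟩
    obtain rfl : map hΓ.srcMap γ = a := by
      refine hV₁s _ _ (hγ.map _ fun k hk => (hW hk).2) ha ?_ ?_
      · rw [has, ← h₁, ← hγ₀]; rfl
      · rw [hat, ← hs', ← hγ₁]; rfl
    refine ⟨map hΓ.tgtMap γ, b₁, hγ.map _ fun k hk => (hW hk).1, hb₁, congrArg Γ.tgt hγ₀,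
      congrArg Γ.tgt hγ₁, hb₁s, hb₁t, fun z hz => ?_⟩
    have hz₁ : E.anchor (E.evalList L (E.arr g₀ z)) = ρ 0 := by
      refine anchor_evalList ?_
      rw [E.anchor_arr hz]
      exact h₂
    change E.arr g' (E.path (mk' ρ') (E.evalList L' (E.arr g₀' (E.path b₁ z)))) =
      E.path _ (E.arr g (E.path (mk' ρ) (E.evalList L (E.arr g₀ z))))
    have hE' : E.evalList L' (E.arr g₀' (E.path b₁ z)) = _ := hE z hz
    rw [hE', ← E.path_comp hbt.symm (hbs.trans hz₁.symm), hab,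
      E.path_comp has hz₁.symm, ← hγ₀, E.path_arr, hγ₁]
    rw [hγ₀, E.anchor_path hz₁.symm]
    exact h₁

variable (E)

/-- The action of a `G`-path. -/
def eval (c : GPath Γ) (z : Z) : Z := E.evalList c.1.2.1 (E.arr c.1.2.2 z)

variable {E}

theorem anchor_eval {c : GPath Γ} {z : Z} (h : c.src = E.anchor z) :
    E.anchor (E.eval c z) = c.tgt := by
  refine anchor_evalList ?_
  rw [E.anchor_arr h]
  exact c.2

/-- The action is locally constant along a deformation: a neighbor acts as the original up to path
classes in simple sets at both ends, and these are loops, hence trivial. -/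
theorem eval_eq_of_deformation [LocallySimple G] [LocallySimple M] (F : C(I, GPath Γ)) {z : Z}
    {x : M} (hs : ∀ t, (F t).src = E.anchor z) (ht : ∀ t, (F t).tgt = x) :
    E.eval (F 0) z = E.eval (F 1) z := by
  have hc : Continuous fun t => (F t).1 := continuous_subtype_val.comp F.continuous
  suffices h : IsLocallyConstant fun t => E.eval (F t) z from
    h.apply_eq_of_preconnectedSpace 0 1
  rw [IsLocallyConstant.iff_eventually_eq]
  intro t
  obtain ⟨V, -, hVo, hV, hVs, -⟩ := LocallySimple.exists_nhd x _ Filter.univ_mem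
  obtain ⟨V', -, hVo', hV', hVs', -⟩ := LocallySimple.exists_nhd (E.anchor z) _ Filter.univ_mem
  have hcont : Filter.Tendsto (fun t => ((F t).1.2.1, (F t).1.2.2)) (𝓝 t)
      (𝓝 (F t).1.2.1 ×ˢ 𝓝 (F t).1.2.2) := by
    rw [← nhds_prod_eq]
    exact (hc.snd.fst.prodMk hc.snd.snd).continuousAt
  have hs' : Γ.src (F t).1.2.2 = E.anchor z := hs t
  have ht' : (F t).1.1 = x := ht t
  filter_upwards [hcont.eventually (eventually_eval (E := E) (F t).2 (V := V) (V' := V')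
    (ht'.symm ▸ hVo.mem_nhds hV) (hs'.symm ▸ hVo'.mem_nhds hV'))] with t' h
  obtain ⟨a, b, ha, hb, has, hat, hbs, hbt, h⟩ := h _ (F t').2
  have ones : ∀ {V : Set M} {x : M}, x ∈ V → InSet V ((Pi1 M).one x) :=
    fun hx => ⟨.const I _, fun _ => hx, rfl⟩
  have e₁ : a = (Pi1 M).one x := hVs _ _ ha (ones hV) (has.trans ht') (hat.trans (ht t'))
  have e₂ : b = (Pi1 M).one (E.anchor z) :=
    hVs' _ _ hb (ones hV') (hbs.trans hs') (hbt.trans (hs t'))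
  have e := h z hs'
  rw [e₂, E.path_one] at e
  have hx : E.anchor (E.eval (F t) z) = x := (anchor_eval (hs t)).trans (ht t)
  refine e.trans ?_
  rw [e₁, ← hx]
  exact E.path_one _

theorem eval_eq_of_gEquiv {c c' : GPath Γ} {z : Z} (h : c.src = E.anchor z)
    (h' : c'.src = E.anchor z) (e : GEquiv Γ c.seq c'.seq) : E.eval c z = E.eval c' z := by
  obtain ⟨⟨x, K, k⟩, hc⟩ := c
  obtain ⟨⟨x', K', k'⟩, hc'⟩ := c'
  change Γ.src k = _ at h
  change Γ.src k' = _ at h'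
  change GEquiv Γ (K, k) (K', k') at e
  change E.evalList K (E.arr k z) = E.evalList K' (E.arr k' z)
  change IsGPath Γ x K (Γ.tgt k) at hc
  cases e with
  | mul L R g h₀ τ _ hgh =>
    rw [evalList_append, evalList_append]
    obtain ⟨y, -, -, -, -, hτ, hR⟩ := (isGPath_append Γ _ _ _ _).1 hc
    change Γ.src h₀ = τ 1 at hτ
    rw [← E.anchor_arr h] at hR
    have e₁ := anchor_evalList hR
    have e₂ : Γ.src h₀ = E.anchor (E.path (mk' τ) (E.evalList R (E.arr k z))) := by
      rw [E.anchor_path e₁.symm]; exact hτ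
    simp only [evalList_cons, mk'_const, ← comp_eq]
    rw [E.arr_comp hgh e₂, hgh, ← E.anchor_arr e₂, E.path_one]
  | mul_last L g _ hgh =>
    rw [evalList_append]
    simp only [evalList_cons, mk'_const, ← comp_eq]
    rw [E.arr_comp hgh h, hgh, ← E.anchor_arr h]
    exact congrArg (fun z => E.evalList _ (E.arr g z)) (E.path_one _)
  | concat L R g ρ τ _ hρτ =>
    rw [evalList_append, evalList_append]
    obtain ⟨y, -, -, -, -, -, hR⟩ := (isGPath_append Γ _ _ _ _).1 hc
    rw [← E.anchor_arr h] at hR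
    have e₁ := anchor_evalList hR
    have e₂ := E.anchor_path (γ := mk' τ) e₁.symm
    have e₃ : ρ 0 = E.anchor (E.path (mk' τ) (E.evalList R (E.arr k z))) := by
      rw [e₂]; exact hρτ.symm
    simp only [evalList_cons]
    rw [← comp_mk' hρτ, E.path_comp hρτ.symm e₁.symm, e₃, E.arr_one]

variable [LocallySimple G] [LocallySimple M]

theorem eval_eq_of_gRel {c c' : GPath Γ} (r : GRel Γ c c') {z : Z} (h : c.src = E.anchor z) :
    E.eval c z = E.eval c' z := by
  obtain ⟨hs, ht, e | ⟨F, rfl, rfl, hF⟩⟩ := r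
  · exact eval_eq_of_gEquiv h (hs.symm.trans h) e
  · exact eval_eq_of_deformation F (fun t => (hF t).1.trans h) fun t => (hF t).2

open Classical in
variable (E) in
/-- The action of the Haefliger groupoid; the value `z` is used on non-composable pairs. -/
def act (a : HaefligerArrow Γ) (z : Z) : Z :=
  Quot.lift (fun c : GPath Γ => if c.src = E.anchor z then E.eval c z else z)
    (fun c c' r => by
      by_cases h : c.src = E.anchor z
      · rw [if_pos h, if_pos (r.1.symm.trans h), eval_eq_of_gRel r h]
      · rw [if_neg h, if_neg fun h' => h (r.1.trans h')]) a

theorem act_mk {c : GPath Γ} {z : Z} (h : c.src = E.anchor z) :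
    E.act (Quot.mk _ c) z = E.eval c z := if_pos h

theorem anchor_act {a : HaefligerArrow Γ} {z : Z} (h : (haefliger Γ).src a = E.anchor z) :
    E.anchor (E.act a z) = (haefliger Γ).tgt a := by
  induction a using Quot.ind with
  | mk c =>
    rw [act_mk h]
    exact anchor_eval h

theorem act_comp {a b : HaefligerArrow Γ} {z : Z} (h : (haefliger Γ).src a = (haefliger Γ).tgt b)
    (hz : (haefliger Γ).src b = E.anchor z) :
    E.act ((haefliger Γ).comp a b) z = E.act a (E.act b z) := by
  have hb := anchor_act hz
  induction a using Quot.ind with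
  | mk c =>
    induction b using Quot.ind with
    | mk d =>
      change d.src = _ at hz
      have e : (haefliger Γ).comp (Quot.mk _ c) (Quot.mk _ d) =
        Quot.mk (GRel Γ) ((gPathPreCat Γ).mul c d h) := PreCat.comp_mk _ _ h
      rw [e]
      have e₁ : E.act (Quot.mk _ d) z = E.eval d z := act_mk hz
      rw [e₁, act_mk (c := (gPathPreCat Γ).mul c d h) hz,
        act_mk (c := c) (h.trans (anchor_eval hz).symm)]
      change E.evalList (_ ++ _ :: _) _ = _
      rw [evalList_append, evalList_cons, mk'_const]
      have h' : Γ.src c.1.2.2 = E.anchor (E.eval d z) := h.trans (anchor_eval hz).symm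
      change E.evalList _ (E.arr _ (E.path _ (E.eval d z))) = _
      dsimp only
      rw [h', E.path_one]
      rfl

theorem act_hArr {g : G} {z : Z} (h : Γ.src g = E.anchor z) : E.act (hArr Γ g) z = E.arr g z :=
  act_mk (c := gArrow Γ g) h

theorem act_one (z : Z) : E.act ((haefliger Γ).one (E.anchor z)) z = z := by
  rw [← hArr_one, act_hArr (Γ.src_one _), E.arr_one]

theorem act_hPath {γ : PathClass M} {z : Z} (h : γ.src = E.anchor z) :
    E.act (hPath Γ γ) z = E.path γ z := by
  obtain ⟨ρ, rfl⟩ := mk'_surjective γ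
  have h₁ := E.anchor_path h
  rw [hPath_mk']
  have h' : (gArrowPath Γ (Γ.one (ρ 1)) ρ (Γ.src_one _)).src = E.anchor z :=
    (Γ.src_one (ρ 0)).trans h
  refine (act_mk h').trans ?_
  change E.arr (Γ.one (ρ 1)) (E.path _ (E.arr (Γ.one (ρ 0)) z)) = _
  have e₀ : ρ 0 = E.anchor z := h
  have e₁ : ρ 1 = E.anchor (E.path (mk' ρ) z) := h₁.symm
  rw [e₀, E.arr_one, e₁, E.arr_one]

theorem act_inv {a : HaefligerArrow Γ} {z : Z} (h : (haefliger Γ).tgt a = E.anchor z) :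
    E.act a (E.act ((haefliger Γ).inv a) z) = z := by
  rw [← act_comp ((haefliger Γ).tgt_inv a).symm (((haefliger Γ).src_inv a).trans h), comp_inv, h,
    act_one]

end LeftAction

/-! ### The topology of the Haefliger groupoid -/

variable {Γ : InternalGroupoid G M}

/-- The Haefliger groupoid acts on itself. -/
def haefligerAction (hΓ : Γ.IsTopological) : LeftAction hΓ (HaefligerArrow Γ) where
  anchor := (haefliger Γ).tgt
  arr g := (haefliger Γ).comp (hArr Γ g)
  path γ := (haefliger Γ).comp (hPath Γ γ)
  anchor_arr _ := InternalGroupoid.tgt_comp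
  anchor_path _ := InternalGroupoid.tgt_comp.trans (tgt_hPath _)
  arr_one z := by rw [hArr_one, one_comp rfl]
  path_one z := by rw [hPath_one, one_comp rfl]
  arr_comp h h' := by rw [hArr_comp h]; exact comp_assoc h h'
  path_comp h h' := by
    rw [hPath_comp h, comp_assoc _ ((src_hPath _).trans h')]
    rw [src_hPath, tgt_hPath, h]
  path_arr {γ z} h := by
    rw [← comp_assoc _ h, hPath_comp_hArr hΓ, comp_assoc _ ((src_hPath _).trans h)]
    · rw [tgt_hPath]; rfl
    · rw [src_hPath]; rfl

theorem haefligerAction_eval (hΓ : Γ.IsTopological) {c : GPath Γ} {a : HaefligerArrow Γ}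
    (h : c.src = (haefliger Γ).tgt a) :
    (haefligerAction hΓ).eval c a = (haefliger Γ).comp (Quot.mk _ c) a := by
  obtain ⟨⟨x, L, g₀⟩, hc⟩ := c
  change Γ.src g₀ = _ at h
  change IsGPath Γ x L (Γ.tgt g₀) at hc
  change (haefligerAction hΓ).evalList L ((haefliger Γ).comp (hArr Γ g₀) a) =
    (haefliger Γ).comp (gMk Γ hc) a
  induction L generalizing x with
  | nil => rw [gMk_nil]; rfl
  | cons c L ih =>
    obtain ⟨g, ρ⟩ := c
    have h₁ : (haefliger Γ).src (hPath Γ (mk' ρ)) = (haefliger Γ).tgt (gMk Γ hc.2.2) :=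
      src_hPath _
    have h₂ : (haefliger Γ).src (hArr Γ g) = (haefliger Γ).tgt (hPath Γ (mk' ρ)) :=
      Eq.trans (b := (mk' ρ).tgt) hc.2.1 (tgt_hPath _).symm
    rw [gMk_cons, comp_assoc (h₂.trans InternalGroupoid.tgt_comp.symm)
      ((InternalGroupoid.src_comp h₁).trans h), comp_assoc h₁ h, ← ih _ hc.2.2]
    rfl

end

section

variable {G : Type u} {M : Type v} [TopologicalSpace G] [TopologicalSpace M]
  {Γ : InternalGroupoid G M}

theorem hPath_inv (γ : PathClass M) : hPath Γ ((Pi1 M).inv γ) = (haefliger Γ).inv (hPath Γ γ) := by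
  refine eq_inv_of_comp ((src_hPath _).trans (tgt_hPath _).symm) (x := γ.src) ?_
  rw [← hPath_comp rfl, inv_comp, hPath_one]
  rfl

theorem gMk_concat {x : M} {L : List (G × C(I, M))} {g₀ : G} (h : IsGPath Γ x L (Γ.tgt g₀))
    {q : C(I, M)} (hq : Γ.src g₀ = q 1)
    (h' : IsGPath Γ x (L ++ [(g₀, q)]) (Γ.tgt (Γ.one (q 0)))) :
    gMk Γ h' = (haefliger Γ).comp (gMk Γ h) (hPath Γ (mk' q)) := by
  have k : IsGPath Γ (q 1) [(Γ.one (q 1), q)] (Γ.tgt (Γ.one (q 0))) :=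
    ⟨Γ.tgt_one _, Γ.src_one _, (Γ.tgt_one _).symm⟩
  have e : hPath Γ (mk' q) = gMk Γ k := by
    rw [hPath_mk', haefligerMk_eq, gMk_cons, gMk_nil, hArr_one, hArr_one,
      comp_one (x := q 0) (src_hPath _)]
  rw [e, comp_gMk h k hq]
  refine (gMk_eq_of_gEquiv _ _ rfl rfl ?_).symm
  have := GEquiv.mul (Γ := Γ) L [] g₀ (Γ.one (q 1)) q (Γ.one (q 0)) (by rw [hq, Γ.tgt_one])
  rwa [← comp_eq, comp_one hq] at this

section

variable [LocallySimple G] [LocallySimple M]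

/-- Near an arrow, the arrows of the Haefliger groupoid result from it by composing it with short
paths on both sides. -/
theorem isEtaleVia_haefliger (hΓ : Γ.IsTopological) (T : ShortPaths M) :
    (haefliger Γ).IsEtaleVia fun x v => hPath Γ (T.cls x v) := by
  refine isEtaleVia_of_isQuotientMap T (haefliger Γ) (hPath Γ) src_hPath tgt_hPath hPath_one
    (fun a b h => hPath_comp h) (Quot.mk (GRel Γ)) isQuotientMap_quot_mk ?_ ?_
  · rintro ⟨⟨x, L, g₀⟩, hc⟩ V hV V' hV'
    have hcont : Filter.Tendsto (fun c : GPath Γ => (c.1.2.1, c.1.2.2)) (𝓝 ⟨(x, L, g₀), hc⟩)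
        (𝓝 L ×ˢ 𝓝 g₀) := by
      rw [← nhds_prod_eq]
      exact (continuous_subtype_val.snd.fst.prodMk continuous_subtype_val.snd.snd).continuousAt
    filter_upwards [hcont.eventually (LeftAction.eventually_eval (E := haefligerAction hΓ) hc hV hV')]
      with c' h
    obtain ⟨a, b, ha, hb, has, hat, hbs, hbt, h⟩ := h _ c'.2
    refine ⟨a, b, ha, hb, has, hat, hbs, hbt, ?_⟩
    have e := h ((haefliger Γ).one (Γ.src g₀)) ((haefliger Γ).tgt_one _).symm
    have e₁ := haefligerAction_eval hΓ (c := ⟨(x, L, g₀), hc⟩)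
      (a := (haefliger Γ).one (Γ.src g₀)) ((haefliger Γ).tgt_one _).symm
    have hb₁ : (haefliger Γ).comp (hPath Γ b) ((haefliger Γ).one (Γ.src g₀)) = hPath Γ b :=
      comp_one ((src_hPath _).trans hbs)
    have e₂ := haefligerAction_eval hΓ (c := c') (a := hPath Γ b) (hbt.symm.trans (tgt_hPath _).symm)
    have e₃ : (haefliger Γ).comp (Quot.mk _ ⟨(x, L, g₀), hc⟩) ((haefliger Γ).one (Γ.src g₀)) =
      Quot.mk (GRel Γ) ⟨(x, L, g₀), hc⟩ := comp_one rfl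
    rw [← e₃, ← e₁, ← e₂]
    refine Eq.trans ?_ e
    refine congrArg ((haefligerAction hΓ).eval c') ?_
    exact hb₁.symm
  · intro a
    induction a using Quot.ind with
    | mk c =>
    obtain ⟨⟨x, L, g₀⟩, hc⟩ := c
    change IsGPath Γ x L (Γ.tgt g₀) at hc
    let sy : C(I, M) → C(I, M) := fun p =>
      (Path.symm (⟨p, rfl, rfl⟩ : Path (p 0) (p 1))).toContinuousMap
    have sy0 : ∀ p, sy p 0 = p 1 := fun p => Path.source _
    have sy1 : ∀ p, sy p 1 = p 0 := fun p => Path.target _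
    -- the composite with two paths is represented by an explicit `G`-path
    have hL : ∀ z : C(I, M) × C(I, M), z.1 0 = x → z.2 0 = Γ.src g₀ →
        IsGPath Γ (z.1 1) ((Γ.one (z.1 1), z.1) :: (L ++ [(g₀, sy z.2)]))
          (Γ.tgt (Γ.one (z.2 1))) := fun z h h' =>
      ⟨Γ.tgt_one _, Γ.src_one _, (isGPath_append Γ _ _ _ _).2 ⟨_, h.symm ▸ hc, rfl,
        h'.symm.trans (sy1 _).symm, (sy0 _).trans (Γ.tgt_one _).symm⟩⟩
    classical
    refine continuousAt_conj T x (Γ.src g₀) _ (fun z => if h : z.1 0 = x ∧ z.2 0 = Γ.src g₀ then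
      gMk Γ (hL z h.1 h.2) else gMk Γ hc) ?_ ?_
    · rw [continuousOn_iff_continuous_domRestrict]
      have hz : Continuous fun z : {z : C(I, M) × C(I, M) | z.1 0 = x ∧ z.2 0 = Γ.src g₀} =>
          (⟨(z.1.1 1, (Γ.one (z.1.1 1), z.1.1) :: (L ++ [(g₀, sy z.1.2)]), Γ.one (z.1.2 1)),
            hL z.1 z.2.1 z.2.2⟩ : GPath Γ) := by
        have h₁ : Continuous fun p : C(I, M) => p 1 := continuous_eval_const 1
        have h₂ : Continuous fun z : {z : C(I, M) × C(I, M) | z.1 0 = x ∧ z.2 0 = Γ.src g₀} =>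
          z.1.1 := continuous_subtype_val.fst
        have h₃ : Continuous fun z : {z : C(I, M) × C(I, M) | z.1 0 = x ∧ z.2 0 = Γ.src g₀} =>
          z.1.2 := continuous_subtype_val.snd
        refine Continuous.subtype_mk ((h₁.comp h₂).prodMk (Continuous.prodMk ?_
          (hΓ.continuous_one.comp (h₁.comp h₃)))) _
        refine List.continuous_cons.comp (((hΓ.continuous_one.comp (h₁.comp h₂)).prodMk h₂).prodMk
          ((list_continuous_append_left L).comp (List.continuous_cons.comp
            ((continuous_const.prodMk (continuous_pathSymm.comp h₃)).prodMk continuous_const))))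
      refine (continuous_quot_mk.comp hz).congr fun z => ?_
      have hz : z.1.1 0 = x ∧ z.1.2 0 = Γ.src g₀ := z.2
      change gMk Γ (hL z.1 z.2.1 z.2.2) =
        if h : z.1.1 0 = x ∧ z.1.2 0 = Γ.src g₀ then gMk Γ (hL z.1 h.1 h.2) else gMk Γ hc
      rw [dif_pos hz]
    · intro v hv u hu
      have hp := T.path_zero x ⟨v, hv⟩
      have hq := T.path_zero (Γ.src g₀) ⟨u, hu⟩
      refine Eq.trans ?_ (dif_pos ⟨hp, hq⟩).symm
      change (haefliger Γ).comp ((haefliger Γ).comp (hPath Γ (T.cls x v)) (gMk Γ hc))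
        ((haefliger Γ).inv (hPath Γ (T.cls (Γ.src g₀) u))) = _
      rw [T.cls_eq hv, T.cls_eq hu, ← hPath_inv, inv_mk']
      generalize T.path x ⟨v, hv⟩ = p at *
      generalize T.path (Γ.src g₀) ⟨u, hu⟩ = q at *
      subst hp
      have h₁ : IsGPath Γ (p 1) ((Γ.one (p 1), p) :: L) (Γ.tgt g₀) :=
        ⟨Γ.tgt_one _, Γ.src_one _, hc⟩
      have e₁ : (haefliger Γ).comp (hPath Γ (mk' p)) (gMk Γ hc) = gMk Γ h₁ := by
        rw [gMk_cons, hArr_one, one_comp]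
        rw [InternalGroupoid.tgt_comp, tgt_hPath]
        rfl
      rw [e₁]
      refine (gMk_concat h₁ (q := sy q) (hq.symm.trans (sy1 q).symm) ?_).symm.trans ?_
      · exact (isGPath_append Γ _ _ _ _).2 ⟨_, h₁, rfl, hq.symm.trans (sy1 q).symm,
          (Γ.tgt_one _).symm⟩
      · refine congrArg (Quot.mk (GRel Γ)) (Subtype.ext ?_)
        change (_, _, Γ.one (sy q 0)) = (_, _, Γ.one (q 1))
        rw [sy0]
        rfl

theorem isTopological_haefliger (hΓ : Γ.IsTopological) : (haefliger Γ).IsTopological :=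
  (isEtaleVia_haefliger hΓ (nonempty_shortPaths M).some).isTopological

theorem isLocalHomeomorph_haefliger (hΓ : Γ.IsTopological) :
    IsLocalHomeomorph fun a => ((haefliger Γ).tgt a, (haefliger Γ).src a) :=
  (isEtaleVia_haefliger hΓ (nonempty_shortPaths M).some).isLocalHomeomorph

end

theorem continuous_hArr (hΓ : Γ.IsTopological) : Continuous (hArr Γ) :=
  continuous_quot_mk.comp (Continuous.subtype_mk
    (hΓ.continuous_tgt.prodMk (continuous_const.prodMk continuous_id)) _)

theorem continuous_hPath (hΓ : Γ.IsTopological) : Continuous (hPath Γ) := by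
  refine continuous_coinduced_dom.2 ?_
  have h₁ : Continuous fun p : C(I, M) => p 1 := continuous_eval_const 1
  have h₀ : Continuous fun p : C(I, M) => p 0 := continuous_eval_const 0
  have h : Continuous fun ρ : C(I, M) => gArrowPath Γ (Γ.one (ρ 1)) ρ (Γ.src_one _) := by
    refine Continuous.subtype_mk ((hΓ.continuous_tgt.comp (hΓ.continuous_one.comp h₁)).prodMk
      (Continuous.prodMk ?_ (hΓ.continuous_one.comp h₀))) _
    exact List.continuous_cons.comp
      (((hΓ.continuous_one.comp h₁).prodMk continuous_id).prodMk continuous_const)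
  exact (continuous_quot_mk.comp h).congr fun ρ => (hPath_mk' ρ).symm

end

/-! ### Low-dimensional simplices of the bar construction -/

section

variable {G : Type u} {M : Type v} [TopologicalSpace G] [TopologicalSpace M]
  {Γ : InternalGroupoid G M} (hΓ : Γ.IsTopological)

theorem Nerve.ext_zero {y z : Nerve Γ 0} (h : y.obj 0 = z.obj 0) : y = z := by
  refine ext_arr 0 fun v => ?_
  obtain rfl : v = 0 := Fin.fin_one_eq_zero v
  rw [y.arr_self, z.arr_self, h]

/-- The inverse of the identification `G^{(0)} = M`. -/
def pointC : C(M, Nerve Γ 0) :=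
  ⟨fun x => cone (fun _ => Γ.one x) x fun _ => Γ.src_one x,
    (Nerve.continuous_iff hΓ 0).2 fun v => hΓ.continuous_one.congr fun _ =>
      (cone_arr (a := fun _ => Γ.one _) (c := 0) rfl v).symm⟩

@[simp]
theorem pointC_obj (x : M) : (pointC hΓ x).obj 0 = x := Γ.tgt_one x

theorem map_vertexC_map_pointC (γ : PathClass M) :
    map (vertexC Γ) (map (pointC hΓ) γ) = γ := by
  rw [map_map]
  conv_rhs => rw [← map_id γ]
  congr 1
  ext x
  exact pointC_obj hΓ x

theorem map_pointC_map_vertexC (γ : PathClass (Nerve Γ 0)) :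
    map (pointC hΓ) (map (vertexC Γ) γ) = γ := by
  rw [map_map]
  conv_rhs => rw [← map_id γ]
  congr 1
  ext1 x
  exact ext_zero (pointC_obj hΓ _)

theorem arrowPart_eq (w : Bar (doubleNerve Γ) 1) : arrowPart Γ w = (top w).arr 0 1 := rfl

theorem pathPart_eq (w : Bar (doubleNerve Γ) 1) : pathPart Γ w = map (vertexC Γ) (edge₀ w) := rfl

theorem baseMap_eq (x : Bar (doubleNerve Γ) 0) : baseMap Γ x = (top x).obj 0 := rfl

theorem baseMap_injective : Function.Injective (baseMap Γ) := fun _ _ h =>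
  bar_zero_ext (ext_zero h)

theorem exists_baseMap_eq (x : M) : ∃ b, baseMap Γ b = x := by
  obtain ⟨b, hb, -⟩ := exists_bar_of_edges (r := 0) (Γ := Γ)
    (fun _ => cone (fun _ => Γ.one x) x fun _ => Γ.src_one x) (fun _ _ h => absurd h (by omega))
    (fun _ _ h => absurd h (by omega)) fun _ _ h => absurd h (by omega)
  refine ⟨b, ?_⟩
  have : top b = _ := congrFun hb _
  rw [baseMap_eq, this]
  exact Γ.tgt_one x

theorem baseMap_face_zero (w : Bar (doubleNerve Γ) 1) :
    baseMap Γ (Bar.face 0 0 (Nat.zero_le _) w) = (pathPart Γ w).src := by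
  rw [baseMap_eq, ← src_edge₀]
  rfl

theorem baseMap_face_one (w : Bar (doubleNerve Γ) 1) :
    baseMap Γ (Bar.face 0 1 le_rfl w) = Γ.tgt (arrowPart Γ w) := by
  rw [baseMap_eq, top_face _ one_ne_zero, arrowPart_eq, Nerve.tgt_arr]
  rfl

theorem bar_one_ext (hΓ : Γ.IsTopological) {w w' : Bar (doubleNerve Γ) 1}
    (h : arrowPart Γ w = arrowPart Γ w') (h' : pathPart Γ w = pathPart Γ w') : w = w' := by
  have e : edge₀ w = edge₀ w' := by
    rw [← map_pointC_map_vertexC hΓ (edge₀ w), ← map_pointC_map_vertexC hΓ (edge₀ w')]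
    exact congrArg _ h'
  refine bar_ext_cons (ext_one h) e (baseMap_injective ?_)
  rw [baseMap_face_zero, baseMap_face_zero, h']

theorem exists_bar_one (hΓ : Γ.IsTopological) {g : G} {η : PathClass M} (h : Γ.src g = η.tgt) :
    ∃ w, arrowPart Γ w = g ∧ pathPart Γ w = η := by
  obtain ⟨b, hb⟩ := exists_baseMap_eq (Γ := Γ) η.src
  obtain ⟨w, hw, hw', -⟩ := exists_cons (single g) (map (pointC hΓ) η) b
    (ext_zero ((pointC_obj hΓ η.tgt).trans (h.symm.trans
      (((single g : Nerve Γ 1).src_arr 0 1).symm.trans (by rw [single_arr])).symm)))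
    (ext_zero ((pointC_obj hΓ η.src).trans hb.symm))
  refine ⟨w, ?_, ?_⟩
  · rw [arrowPart_eq, hw, single_arr]
  · rw [pathPart_eq, hw', map_vertexC_map_pointC]

/-- The element `(g, η)` of `W̄_1 = G ×_{s,t} Π₁(M)`. -/
def barPair (g : G) (η : PathClass M) (h : Γ.src g = η.tgt) :
    Bar (doubleNerve Γ) 1 := (exists_bar_one hΓ h).choose

@[simp]
theorem arrowPart_barPair {g : G} {η : PathClass M} (h : Γ.src g = η.tgt) :
    arrowPart Γ (barPair hΓ g η h) = g := (exists_bar_one hΓ h).choose_spec.1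

@[simp]
theorem pathPart_barPair {g : G} {η : PathClass M} (h : Γ.src g = η.tgt) :
    pathPart Γ (barPair hΓ g η h) = η := (exists_bar_one hΓ h).choose_spec.2

theorem continuous_arrowPart : Continuous (arrowPart Γ) :=
  (continuous_apply 1).comp ((continuous_apply 0).comp ((continuous_arr 1).comp
    ((continuous_apply (0 : Fin 1)).comp ((continuous_obj (Γ := Pi1 (Nerve Γ 1)) 0).comp
      (Bar.continuous_at (X := doubleNerve Γ) 0 1 rfl)))))

theorem continuous_pathPart : Continuous (pathPart Γ) :=
  (continuous_map _).comp ((continuous_apply (1 : Fin 2)).comp ((continuous_apply 0).comp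
    ((continuous_arr (Γ := Pi1 (Nerve Γ 0)) 1).comp
      (Bar.continuous_at (X := doubleNerve Γ) 1 0 rfl))))

theorem PathClass.continuous_pi1_one {X : Type*} [TopologicalSpace X] :
    Continuous (Pi1 X).one := continuous_mk'.comp ContinuousMap.continuous_const'

theorem PathClass.continuous_src {X : Type*} [TopologicalSpace X] :
    Continuous (PathClass.src : PathClass X → X) :=
  continuous_coinduced_dom.2 (continuous_eval_const (F := C(I, X)) 0)

theorem PathClass.continuous_tgt {X : Type*} [TopologicalSpace X] :
    Continuous (PathClass.tgt : PathClass X → X) :=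
  continuous_coinduced_dom.2 (continuous_eval_const (F := C(I, X)) 1)

theorem continuous_baseMap : Continuous (baseMap Γ) :=
  (continuous_apply 0).comp ((continuous_obj 0).comp
    ((continuous_apply (0 : Fin 1)).comp ((continuous_obj (Γ := Pi1 (Nerve Γ 0)) 0).comp
      (Bar.continuous_at (X := doubleNerve Γ) 0 0 rfl))))

variable [LocallySimple (Nerve Γ 0)] [LocallySimple (Nerve Γ 1)]

theorem continuous_bar_zero (hΓ : Γ.IsTopological) {Z : Type*} [TopologicalSpace Z]
    {f : Z → Bar (doubleNerve Γ) 0} (h : Continuous fun z => baseMap Γ (f z)) : Continuous f := by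
  refine continuous_induced_rng.2 (continuous_pi ?_)
  rintro ⟨⟨p, q⟩, hpq⟩
  obtain ⟨rfl, rfl⟩ : p = 0 ∧ q = 0 := by
    change p + q = 0 at hpq
    omega
  change Continuous fun z => barAt (f z) 0 0 rfl
  refine (Nerve.continuous_iff isTopological_pi1 0).2 fun v => ?_
  obtain rfl : v = 0 := Fin.fin_one_eq_zero v
  refine ((continuous_pi1_one.comp ((pointC hΓ).continuous.comp h))).congr fun z => ?_
  refine Eq.trans ?_ ((barAt (f z) 0 0 rfl).arr_self 0).symm
  exact congrArg (Pi1 _).one (ext_zero (pointC_obj hΓ _))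

theorem continuous_bar_one (hΓ : Γ.IsTopological) {Z : Type*} [TopologicalSpace Z]
    {f : Z → Bar (doubleNerve Γ) 1} (h : Continuous fun z => arrowPart Γ (f z))
    (h' : Continuous fun z => pathPart Γ (f z)) : Continuous f := by
  refine continuous_induced_rng.2 (continuous_pi ?_)
  rintro ⟨⟨p, q⟩, hpq⟩
  have hpq' : (p = 0 ∧ q = 1) ∨ (p = 1 ∧ q = 0) := by
    change p + q = 1 at hpq
    omega
  obtain ⟨rfl, rfl⟩ | ⟨rfl, rfl⟩ := hpq'
  · change Continuous fun z => barAt (f z) 0 1 rfl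
    refine (Nerve.continuous_iff isTopological_pi1 0).2 fun v => ?_
    obtain rfl : v = 0 := Fin.fin_one_eq_zero v
    have ht : Continuous fun z => top (f z) := by
      refine (Nerve.continuous_iff hΓ 1).2 (Fin.forall_fin_two.2 ⟨h, ?_⟩)
      refine (hΓ.continuous_one.comp (hΓ.continuous_src.comp h)).congr fun z => ?_
      rw [(top (f z)).arr_self]
      exact congrArg Γ.one ((top (f z)).src_arr 0 1)
    exact (continuous_pi1_one.comp ht).congr fun z => ((barAt (f z) 0 1 rfl).arr_self 0).symm
  · have he : Continuous fun z => (barAt (f z) 1 0 rfl).arr 0 1 :=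
      ((continuous_map (pointC hΓ)).comp h').congr fun z => map_pointC_map_vertexC hΓ _
    change Continuous fun z => barAt (f z) 1 0 rfl
    refine (Nerve.continuous_iff isTopological_pi1 1).2 (Fin.forall_fin_two.2 ⟨he, ?_⟩)
    refine (continuous_pi1_one.comp (PathClass.continuous_src.comp he)).congr fun z => ?_
    refine Eq.trans ?_ ((barAt (f z) 1 0 rfl).arr_self 1).symm
    exact congrArg (Pi1 _).one ((barAt (f z) 1 0 rfl).src_arr 0 1)

/-- The identification `W̄_0 = M` as a homeomorphism. -/
def baseHomeo : Bar (doubleNerve Γ) 0 ≃ₜ M where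
  toEquiv := Equiv.ofBijective (baseMap Γ) ⟨baseMap_injective, exists_baseMap_eq (Γ := Γ)⟩
  continuous_toFun := continuous_baseMap
  continuous_invFun := continuous_bar_zero hΓ (by
    refine continuous_id.congr fun x => ?_
    exact (Equiv.apply_symm_apply (Equiv.ofBijective (baseMap Γ)
      ⟨baseMap_injective, exists_baseMap_eq⟩) x).symm)

end

section

variable {G : Type u} {M : Type v} [TopologicalSpace G] [TopologicalSpace M]
  {Γ : InternalGroupoid G M}

/-- A `2`-simplex of the bar construction consists of elements `(θ, t_* γ)` and `(γ(0), η)` of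
`W̄_1` and of a path class `γ` of arrows. -/
theorem bar_two_faces (hΓ : Γ.IsTopological) (z : Bar (doubleNerve Γ) 2) {γ : PathClass G}
    (hγ : map (arrC 0 1) (edge₀ z) = γ) : arrowPart Γ (Bar.face 1 0 (by omega) z) = γ.src ∧
    pathPart Γ (Bar.face 1 2 (by omega) z) = map hΓ.tgtMap γ ∧
    arrowPart Γ (Bar.face 1 1 (by omega) z) =
      Γ.comp (arrowPart Γ (Bar.face 1 2 (by omega) z)) γ.tgt ∧
    pathPart Γ (Bar.face 1 1 (by omega) z) =
      (Pi1 M).comp (map hΓ.srcMap γ) (pathPart Γ (Bar.face 1 0 (by omega) z)) := by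
  subst hγ
  refine ⟨?_, ?_, ?_, ?_⟩
  · rw [arrowPart_eq, ← src_edge₀]
    rfl
  · rw [pathPart_eq, edge₀_face _ le_rfl, map_map]
    refine (map_map _ _ _).trans ?_
    congr 1
    ext y
    exact (y.tgt_arr 0 1).symm
  · rw [arrowPart_eq, arrowPart_eq, top_face _ one_ne_zero, top_face _ two_ne_zero]
    have e : (map (arrC 0 1) (edge₀ z)).tgt = (top z).arr 1 2 :=
      congrArg (fun y : Nerve Γ 1 => y.arr 0 1) (tgt_edge₀ z)
    rw [e]
    exact ((top z).comp_arr 0 1 2).symm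
  · rw [pathPart_eq, pathPart_eq, edge₀_face_one, map_comp _ (src_pface_edge₀ z), map_map]
    congr 1
    refine (map_map _ _ _).trans ?_
    congr 1
    ext y
    exact (y.src_arr 0 1).symm

/-- A path class `γ` of arrows and compatible elements of `W̄_1` are part of a `2`-simplex, the cone
over `w₀` with edge `γ`. -/
theorem exists_bar_two (hΓ : Γ.IsTopological) (γ : PathClass G) {w w₀ w₁ : Bar (doubleNerve Γ) 1}
    (h₁ : pathPart Γ w₁ = map hΓ.tgtMap γ) (h₀ : arrowPart Γ w₀ = γ.src)
    (h₂ : Γ.src (arrowPart Γ w₁) = Γ.tgt γ.tgt) (h : arrowPart Γ w = Γ.comp (arrowPart Γ w₁) γ.tgt)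
    (h' : pathPart Γ w = (Pi1 M).comp (map hΓ.srcMap γ) (pathPart Γ w₀)) :
    ∃ z : Bar (doubleNerve Γ) 2, Bar.face 1 0 (by omega) z = w₀ ∧ Bar.face 1 2 (by omega) z = w₁ ∧
      Bar.face 1 1 (by omega) z = w := by
  let σ₁ : C(G, Nerve Γ 1) := ⟨single, (Nerve.continuous_iff hΓ 1).2 (Fin.forall_fin_two.2
    ⟨continuous_id.congr fun g => (single_arr g).symm,
      (hΓ.continuous_one.comp hΓ.continuous_src).congr fun g => by
        rw [Nerve.arr_self, ← Nerve.src_arr _ 0 1, single_arr]; rfl⟩)⟩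
  let a : Fin 3 → G := ![Γ.comp (arrowPart Γ w₁) γ.tgt, γ.tgt, Γ.one (Γ.src γ.tgt)]
  let y : Nerve Γ 2 := cone a (Γ.src γ.tgt) (by
    rw [Fin.forall_fin_succ, Fin.forall_fin_two]
    exact ⟨InternalGroupoid.src_comp h₂, rfl, Γ.src_one _⟩)
  have hy : ∀ v, y.arr v 2 = a v := fun v => cone_arr (a := a) (c := 2) rfl v
  obtain ⟨z, hz, hz', hz₀⟩ := exists_cons y (map σ₁ γ) w₀
    (ext_one (Eq.trans (single_arr γ.tgt) (hy 1).symm)) (ext_one ((single_arr γ.src).trans h₀.symm))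
  have hγ : map (arrC 0 1) (edge₀ z) = γ := by
    rw [hz', map_map]
    conv_rhs => rw [← map_id γ]
    congr 1
    ext g
    exact single_arr g
  obtain ⟨-, k₁, k₂, k₃⟩ := bar_two_faces hΓ z hγ
  have e : arrowPart Γ (Bar.face 1 2 (by omega) z) = arrowPart Γ w₁ := by
    rw [arrowPart_eq, top_face _ two_ne_zero, hz]
    change y.arr 0 1 = _
    have := y.comp_arr 0 1 2
    rw [hy 0, hy 1] at this
    refine comp_right_cancel (c := γ.tgt) ?_ h₂ this
    rw [y.src_arr, ← y.tgt_arr 1 2, hy 1]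
    rfl
  refine ⟨z, hz₀, bar_one_ext hΓ e (k₁.trans h₁.symm), bar_one_ext hΓ ?_ ?_⟩
  · rw [k₂, e, h]
  · rw [k₃, hz₀, h']

end

/-! ### The groupoid generated by a simplicial space -/

namespace SimplicialSpace

variable (X : SimplicialSpace.{u})

/-- The arrow of `𝔊(X)` represented by a word. -/
def wordMk {x y : X.obj 0} {l : List X.Letter} (h : X.IsWord x l y) : X.GenArrow :=
  Quot.mk _ ⟨(x, l, y), h⟩

theorem isWord_letter (a : X.Letter) : X.IsWord (X.ltgt a) [a] (X.lsrc a) := ⟨rfl, rfl⟩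

/-- The arrow of `𝔊(X)` represented by a letter. -/
def letterMk (a : X.Letter) : X.GenArrow := X.wordMk (X.isWord_letter a)

variable {X}

theorem comp_wordMk {x y y' z : X.obj 0} {l m : List X.Letter} (h : X.IsWord x l y)
    (h' : X.IsWord y' m z) (e : y = y') :
    X.gen.comp (X.wordMk h) (X.wordMk h') =
      X.wordMk (l := l ++ m) ((X.isWord_append _ _ _ _).2 ⟨y, h, e ▸ h'⟩) :=
  PreCat.comp_mk X.wordPreCat X.word_invertible (a := ⟨(x, l, y), h⟩) (b := ⟨(y', m, z), h'⟩) e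

theorem wordMk_cons {x y : X.obj 0} {a : X.Letter} {l : List X.Letter} (h : X.IsWord x (a :: l) y) :
    X.wordMk h = X.gen.comp (X.letterMk a) (X.wordMk h.2) := by
  obtain rfl : X.ltgt a = x := h.1
  exact (comp_wordMk (X.isWord_letter a) h.2 rfl).symm

theorem wordMk_eq {x y x' y' : X.obj 0} {l m : List X.Letter} (r : X.LetterRel l m)
    (h : X.IsWord x l y) (h' : X.IsWord x' m y') (hx : x = x') (hy : y = y') :
    X.wordMk h = X.wordMk h' := by
  subst hx hy
  exact X.mk_eq_of_letterRel r h h'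

theorem genMk_degen (x : X.obj 0) : X.genMk (X.degen 0 0 le_rfl x) = X.gen.one x :=
  wordMk_eq (.one x) ⟨rfl, rfl⟩ rfl (X.laws.d_s_succ 0 0 le_rfl x) (X.laws.d_s_self 0 0 le_rfl x)

theorem genMk_comp (z : X.obj 2) : X.genMk (X.face 1 1 (by omega) z) =
    X.gen.comp (X.genMk (X.face 1 2 (by omega) z)) (X.genMk (X.face 1 0 (by omega) z)) := by
  have e := X.laws.d_d 0 0 2 (by omega) le_rfl z
  refine (wordMk_eq (.simplex z) (X.isWord_letter (_, true)) ?_ ?_ ?_).trans 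
    (comp_wordMk (X.isWord_letter (_, true)) (X.isWord_letter (_, true)) e).symm
  · exact ⟨rfl, e.symm, rfl⟩
  · exact (X.laws.d_d 0 1 2 (by omega) le_rfl z).symm
  · exact X.laws.d_d 0 0 1 (by omega) (by omega) z

theorem letterMk_false (y : X.obj 1) : X.letterMk (y, false) = X.gen.inv (X.genMk y) := by
  refine eq_inv_of_comp (x := X.face 0 0 (by omega) y) rfl ?_
  refine (comp_wordMk (X.isWord_letter (y, false)) (X.isWord_letter (y, true)) rfl).trans (Eq.trans ?_ (genMk_degen _))
  exact wordMk_eq (.inv_mul y) _ ⟨rfl, rfl⟩ (X.laws.d_s_succ 0 0 le_rfl _).symm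
    (X.laws.d_s_self 0 0 le_rfl _).symm

end SimplicialSpace

open SimplicialSpace

/-! ### The homomorphism to the Haefliger groupoid -/

section

variable {G : Type u} {M : Type v} [TopologicalSpace G] [TopologicalSpace M]
  (Γ : InternalGroupoid G M)

/-- The image in the Haefliger groupoid of an element `(g, η)` of `W̄_1`. -/
def hBar (w : Bar (doubleNerve Γ) 1) : HaefligerArrow Γ :=
  (haefliger Γ).comp (hArr Γ (arrowPart Γ w)) (hPath Γ (pathPart Γ w))

/-- The image in the Haefliger groupoid of a letter. -/
def hLetter : (bar (doubleNerve Γ)).Letter → HaefligerArrow Γ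
  | (w, true) => hBar Γ w
  | (w, false) => (haefliger Γ).inv (hBar Γ w)

/-- The product in the Haefliger groupoid of the images of letters with a given arrow. -/
def hWord (l : List (bar (doubleNerve Γ)).Letter) (a : HaefligerArrow Γ) : HaefligerArrow Γ :=
  l.foldr (fun y a => (haefliger Γ).comp (hLetter Γ y) a) a

variable {Γ}

@[simp]
theorem tgt_hBar (w : Bar (doubleNerve Γ) 1) :
    (haefliger Γ).tgt (hBar Γ w) = Γ.tgt (arrowPart Γ w) := InternalGroupoid.tgt_comp

theorem src_hArr_eq (w : Bar (doubleNerve Γ) 1) :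
    (haefliger Γ).src (hArr Γ (arrowPart Γ w)) = (haefliger Γ).tgt (hPath Γ (pathPart Γ w)) :=
  (src_arrowPart Γ w).trans (tgt_hPath _).symm

@[simp]
theorem src_hBar (w : Bar (doubleNerve Γ) 1) :
    (haefliger Γ).src (hBar Γ w) = (pathPart Γ w).src :=
  (InternalGroupoid.src_comp (src_hArr_eq w)).trans (src_hPath _)

theorem tgt_hLetter (y : (bar (doubleNerve Γ)).Letter) :
    (haefliger Γ).tgt (hLetter Γ y) = baseMap Γ ((bar (doubleNerve Γ)).ltgt y) := by
  obtain ⟨w, _ | _⟩ := y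
  · exact ((haefliger Γ).tgt_inv _).trans ((src_hBar w).trans (baseMap_face_zero w).symm)
  · exact (tgt_hBar w).trans (baseMap_face_one w).symm

theorem src_hLetter (y : (bar (doubleNerve Γ)).Letter) :
    (haefliger Γ).src (hLetter Γ y) = baseMap Γ ((bar (doubleNerve Γ)).lsrc y) := by
  obtain ⟨w, _ | _⟩ := y
  · exact ((haefliger Γ).src_inv _).trans ((tgt_hBar w).trans (baseMap_face_one w).symm)
  · exact (src_hBar w).trans (baseMap_face_zero w).symm

theorem hWord_append (l m : List (bar (doubleNerve Γ)).Letter) (a : HaefligerArrow Γ) :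
    hWord Γ (l ++ m) a = hWord Γ l (hWord Γ m a) := List.foldr_append

theorem tgt_hWord {x y : (bar (doubleNerve Γ)).obj 0} {l : List (bar (doubleNerve Γ)).Letter}
    (h : (bar (doubleNerve Γ)).IsWord x l y) {a : HaefligerArrow Γ}
    (ha : (haefliger Γ).tgt a = baseMap Γ y) : (haefliger Γ).tgt (hWord Γ l a) = baseMap Γ x := by
  cases l with
  | nil =>
    obtain rfl : x = y := h
    exact ha
  | cons c l =>
    refine InternalGroupoid.tgt_comp.trans ?_
    rw [tgt_hLetter, h.1]

theorem hWord_comp {x y : (bar (doubleNerve Γ)).obj 0} {l : List (bar (doubleNerve Γ)).Letter}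
    (h : (bar (doubleNerve Γ)).IsWord x l y) {a b : HaefligerArrow Γ}
    (ha : (haefliger Γ).tgt a = baseMap Γ y) (hab : (haefliger Γ).src a = (haefliger Γ).tgt b) :
    hWord Γ l ((haefliger Γ).comp a b) = (haefliger Γ).comp (hWord Γ l a) b ∧
      (haefliger Γ).src (hWord Γ l a) = (haefliger Γ).src a := by
  induction l generalizing x with
  | nil => exact ⟨rfl, rfl⟩
  | cons c l ih =>
    obtain ⟨e, e'⟩ := ih h.2
    have e₁ : (haefliger Γ).src (hLetter Γ c) = (haefliger Γ).tgt (hWord Γ l a) :=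
      (src_hLetter c).trans (tgt_hWord h.2 ha).symm
    refine ⟨?_, (InternalGroupoid.src_comp e₁).trans e'⟩
    change (haefliger Γ).comp (hLetter Γ c) (hWord Γ l ((haefliger Γ).comp a b)) = _
    rw [e, ← comp_assoc e₁ (e'.trans hab)]
    rfl

/-- The multiplication rule `θ t_*γ · γ(0) η = θ γ(1) · s_*γ η` in the Haefliger groupoid. -/
theorem comp_hArr_hPath (hΓ : Γ.IsTopological) {θ : G} {γ : PathClass G} {η : PathClass M}
    (h₁ : Γ.src θ = Γ.tgt γ.tgt) (h₂ : Γ.src γ.src = η.tgt) :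
    (haefliger Γ).comp (hArr Γ (Γ.comp θ γ.tgt)) (hPath Γ ((Pi1 M).comp (map hΓ.srcMap γ) η)) =
      (haefliger Γ).comp ((haefliger Γ).comp (hArr Γ θ) (hPath Γ (map hΓ.tgtMap γ)))
        ((haefliger Γ).comp (hArr Γ γ.src) (hPath Γ η)) := by
  have a₁ : (haefliger Γ).src (hArr Γ θ) = (haefliger Γ).tgt (hArr Γ γ.tgt) := h₁
  have a₂ : (haefliger Γ).src (hArr Γ γ.tgt) = (haefliger Γ).tgt (hPath Γ (map hΓ.srcMap γ)) :=
    (tgt_hPath (map hΓ.srcMap γ)).symm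
  have a₃ : (haefliger Γ).src (hPath Γ (map hΓ.srcMap γ)) = (haefliger Γ).tgt (hPath Γ η) := by
    rw [src_hPath, tgt_hPath]
    exact h₂
  have a₄ : (haefliger Γ).src (hArr Γ θ) = (haefliger Γ).tgt (hPath Γ (map hΓ.tgtMap γ)) := by
    rw [tgt_hPath]
    exact h₁
  have a₅ : (haefliger Γ).src (hPath Γ (map hΓ.tgtMap γ)) = (haefliger Γ).tgt (hArr Γ γ.src) :=
    src_hPath _
  have a₆ : (haefliger Γ).src (hArr Γ γ.src) = (haefliger Γ).tgt (hPath Γ η) := by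
    rw [tgt_hPath]
    exact h₂
  rw [hArr_comp h₁, hPath_comp h₂, comp_assoc a₁ (a₂.trans InternalGroupoid.tgt_comp.symm),
    ← comp_assoc a₂ a₃, ← hPath_comp_hArr hΓ, comp_assoc a₅ a₆, comp_assoc a₄
      (a₅.trans InternalGroupoid.tgt_comp.symm)]

theorem hBar_comp (hΓ : Γ.IsTopological) (z : Bar (doubleNerve Γ) 2) :
    hBar Γ (Bar.face 1 1 (by omega) z) = (haefliger Γ).comp (hBar Γ (Bar.face 1 2 (by omega) z))
      (hBar Γ (Bar.face 1 0 (by omega) z)) := by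
  obtain ⟨h₀, h₂, h₁, h₁'⟩ := bar_two_faces hΓ z rfl
  have k₀ := src_arrowPart Γ (Bar.face 1 0 (by omega) z)
  have k₂ := src_arrowPart Γ (Bar.face 1 2 (by omega) z)
  unfold hBar
  rw [h₁, h₁', h₂, h₀]
  rw [h₂] at k₂
  rw [h₀] at k₀
  exact comp_hArr_hPath hΓ k₂ k₀

/-- The Haefliger groupoid is generated by the classes of arrows and of paths. -/
theorem haefliger_induction {p : HaefligerArrow Γ → Prop} (arr : ∀ g, p (hArr Γ g))
    (path : ∀ η, p (hPath Γ η)) (comp : ∀ a b, (haefliger Γ).src a = (haefliger Γ).tgt b → p a →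
      p b → p ((haefliger Γ).comp a b)) (a : HaefligerArrow Γ) : p a := by
  induction a using Quot.ind with
  | mk c =>
  obtain ⟨⟨x, L, g₀⟩, hc⟩ := c
  change IsGPath Γ x L (Γ.tgt g₀) at hc
  change p (gMk Γ hc)
  induction L generalizing x with
  | nil => exact (gMk_nil hc).symm ▸ arr g₀
  | cons c L ih =>
    obtain ⟨g, ρ⟩ := c
    rw [gMk_cons]
    refine comp _ _ ?_ (arr g) (comp _ _ ?_ (path _) (ih _ hc.2.2))
    · rw [InternalGroupoid.tgt_comp, tgt_hPath]
      exact hc.2.1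
    · exact src_hPath _

theorem hBar_degen (hΓ : Γ.IsTopological) (x : Bar (doubleNerve Γ) 0) :
    hBar Γ ((bar (doubleNerve Γ)).degen 0 0 le_rfl x) = (haefliger Γ).one (baseMap Γ x) := by
  have L := (bar (doubleNerve Γ)).laws
  have e := hBar_comp hΓ ((bar (doubleNerve Γ)).degen 1 0 (by omega)
    ((bar (doubleNerve Γ)).degen 0 0 le_rfl x))
  have e₀ := L.d_s_self 1 0 (by omega) ((bar (doubleNerve Γ)).degen 0 0 le_rfl x)
  have e₁ := L.d_s_succ 1 0 (by omega) ((bar (doubleNerve Γ)).degen 0 0 le_rfl x)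
  have e₂ := L.d_s_gt 0 2 0 (by omega) (by omega) ((bar (doubleNerve Γ)).degen 0 0 le_rfl x)
  have e₃ := L.d_s_succ 0 0 (by omega) x
  have e₄ := L.d_s_self 0 0 (by omega) x
  dsimp only [Nat.reduceSub, Nat.reduceAdd] at e₂
  rw [e₃] at e₂
  have ht := tgt_hLetter ((bar (doubleNerve Γ)).degen 0 0 le_rfl x, true)
  have hs := src_hLetter ((bar (doubleNerve Γ)).degen 0 0 le_rfl x, true)
  change hBar Γ ((bar (doubleNerve Γ)).face 1 1 _ _) = (haefliger Γ).comp
    (hBar Γ ((bar (doubleNerve Γ)).face 1 2 _ _)) (hBar Γ ((bar (doubleNerve Γ)).face 1 0 _ _)) at e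
  change (haefliger Γ).tgt (hBar Γ _) = baseMap Γ ((bar (doubleNerve Γ)).face 0 1 _ _) at ht
  change (haefliger Γ).src (hBar Γ _) = baseMap Γ ((bar (doubleNerve Γ)).face 0 0 _ _) at hs
  rw [e₃] at ht
  rw [e₄] at hs
  rw [e₀, e₁, e₂] at e
  refine (comp_right_cancel (hs.trans ht.symm) (((haefliger Γ).src_one _).trans ht.symm)
    (e.symm.trans ?_))
  rw [one_comp ht.symm]

/-- The relations of `𝔊(W̄ N)` hold in the Haefliger groupoid. -/
theorem hWord_letterRel (hΓ : Γ.IsTopological) {l m : List (bar (doubleNerve Γ)).Letter}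
    (r : (bar (doubleNerve Γ)).LetterRel l m) {x y : (bar (doubleNerve Γ)).obj 0}
    (h : (bar (doubleNerve Γ)).IsWord x l y) {a : HaefligerArrow Γ}
    (ha : (haefliger Γ).tgt a = baseMap Γ y) : hWord Γ l a = hWord Γ m a := by
  have hm := r.isWord _ h
  cases r with
  | simplex z =>
    refine (congrArg (fun b => (haefliger Γ).comp b a) (hBar_comp hΓ z)).trans (comp_assoc ?_ ?_)
    · have := hm.2.1
      exact (src_hLetter ((bar (doubleNerve Γ)).face 1 2 (by omega) z, true)).trans
        ((congrArg _ this.symm).trans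
          (tgt_hLetter ((bar (doubleNerve Γ)).face 1 0 (by omega) z, true)).symm)
    · exact (src_hLetter ((bar (doubleNerve Γ)).face 1 0 (by omega) z, true)).trans
        ((congrArg _ hm.2.2).trans ha.symm)
  | mul_inv w =>
    have e : (haefliger Γ).tgt (hBar Γ w) = (haefliger Γ).tgt a := by
      rw [ha, ← show _ = y from h.2.2]
      exact tgt_hLetter (w, true)
    refine (comp_inv_cancel e).trans
      ((congrArg (fun b => (haefliger Γ).comp b a) (hBar_degen hΓ _)).trans (one_comp ?_)).symm
    exact (tgt_hLetter (w, true)).symm.trans e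
  | inv_mul w =>
    have e : (haefliger Γ).src (hBar Γ w) = (haefliger Γ).tgt a := by
      rw [ha, ← show _ = y from h.2.2]
      exact src_hLetter (w, true)
    refine (inv_comp_cancel e).trans
      ((congrArg (fun b => (haefliger Γ).comp b a) (hBar_degen hΓ _)).trans (one_comp ?_)).symm
    exact (src_hLetter (w, true)).symm.trans e
  | one x' =>
    obtain rfl : x = y := hm
    have hx : (bar (doubleNerve Γ)).face 0 1 (by omega) _ = x := h.1
    rw [(bar (doubleNerve Γ)).laws.d_s_succ 0 0 le_rfl x'] at hx
    refine (congrArg (fun b => (haefliger Γ).comp b a) (hBar_degen hΓ x')).trans (one_comp ?_)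
    rw [ha, hx]

/-- The homomorphism from `𝔊(W̄ N)` to the Haefliger groupoid. -/
def genToHaefliger (hΓ : Γ.IsTopological) :
    (bar (doubleNerve Γ)).GenArrow → HaefligerArrow Γ :=
  Quot.lift (fun w => hWord Γ w.1.2.1 ((haefliger Γ).one (baseMap Γ w.1.2.2))) (by
    rintro ⟨⟨x, K, y⟩, h⟩ ⟨⟨x', K', y'⟩, h'⟩ ⟨e₁, e₂, l, p, q, m, r, e₃, e₄⟩
    dsimp only at e₁ e₂ e₃ e₄
    subst e₁ e₂ e₃ e₄
    change hWord Γ (l ++ (p ++ m)) _ = hWord Γ (l ++ (q ++ m)) _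
    change (bar (doubleNerve Γ)).IsWord x (l ++ (p ++ m)) y at h
    obtain ⟨x₁, h₁, h₂⟩ := (isWord_append _ _ _ _ _).1 h
    obtain ⟨x₂, h₂, h₃⟩ := (isWord_append _ _ _ _ _).1 h₂
    rw [hWord_append, hWord_append, hWord_append, hWord_append,
      hWord_letterRel hΓ r h₂ (tgt_hWord h₃ ((haefliger Γ).tgt_one _))])

theorem genToHaefliger_wordMk (hΓ : Γ.IsTopological) {x y : (bar (doubleNerve Γ)).obj 0}
    {l : List (bar (doubleNerve Γ)).Letter} (h : (bar (doubleNerve Γ)).IsWord x l y) :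
    genToHaefliger hΓ (wordMk _ h) = hWord Γ l ((haefliger Γ).one (baseMap Γ y)) := rfl

theorem tgt_genToHaefliger (hΓ : Γ.IsTopological) (a : (bar (doubleNerve Γ)).GenArrow) :
    (haefliger Γ).tgt (genToHaefliger hΓ a) = baseMap Γ ((bar (doubleNerve Γ)).gen.tgt a) := by
  induction a using Quot.ind with
  | mk w => exact tgt_hWord w.2 ((haefliger Γ).tgt_one _)

theorem src_genToHaefliger (hΓ : Γ.IsTopological) (a : (bar (doubleNerve Γ)).GenArrow) :
    (haefliger Γ).src (genToHaefliger hΓ a) = baseMap Γ ((bar (doubleNerve Γ)).gen.src a) := by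
  induction a using Quot.ind with
  | mk w =>
    refine (hWord_comp w.2 ((haefliger Γ).tgt_one _) (b := (haefliger Γ).one (baseMap Γ w.1.2.2))
      ?_).2.trans ((haefliger Γ).src_one _)
    rw [(haefliger Γ).src_one, (haefliger Γ).tgt_one]

theorem genToHaefliger_comp (hΓ : Γ.IsTopological) {a b : (bar (doubleNerve Γ)).GenArrow}
    (h : (bar (doubleNerve Γ)).gen.src a = (bar (doubleNerve Γ)).gen.tgt b) :
    genToHaefliger hΓ ((bar (doubleNerve Γ)).gen.comp a b) =
      (haefliger Γ).comp (genToHaefliger hΓ a) (genToHaefliger hΓ b) := by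
  have hb := tgt_genToHaefliger hΓ b
  induction a using Quot.ind with
  | mk a =>
  induction b using Quot.ind with
  | mk b =>
  obtain ⟨⟨x, l, y⟩, ha⟩ := a
  obtain ⟨⟨y', m, z⟩, hb'⟩ := b
  obtain rfl : y = y' := h
  have e := comp_wordMk (X := bar (doubleNerve Γ)) ha hb' rfl
  refine (congrArg (genToHaefliger hΓ) e).trans ?_
  rw [genToHaefliger_wordMk, hWord_append]
  change _ = (haefliger Γ).comp (hWord Γ l ((haefliger Γ).one (baseMap Γ y))) _
  have hb₁ : baseMap Γ y = (haefliger Γ).tgt (genToHaefliger hΓ (Quot.mk _ ⟨(y, m, z), hb'⟩)) :=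
    hb.symm
  rw [← (hWord_comp ha ((haefliger Γ).tgt_one _) (((haefliger Γ).src_one _).trans hb₁)).1,
    one_comp hb₁]
  rfl

theorem genToHaefliger_genMk (hΓ : Γ.IsTopological) (w : Bar (doubleNerve Γ) 1) :
    genToHaefliger hΓ ((bar (doubleNerve Γ)).genMk w) = hBar Γ w :=
  comp_one (src_hLetter (w, true))

end

/-! ### The action of the Haefliger groupoid on the generated groupoid -/

section

variable {G : Type u} {M : Type v} [TopologicalSpace G] [TopologicalSpace M]
  {Γ : InternalGroupoid G M} (hΓ : Γ.IsTopological)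

/-- The groupoid generated by the bar construction of the double nerve. -/
abbrev barGen (Γ : InternalGroupoid G M) :
    InternalGroupoid (bar (doubleNerve Γ)).GenArrow (Bar (doubleNerve Γ) 0) :=
  (bar (doubleNerve Γ)).gen

/-- The generator given by an element of `W̄_1`. -/
abbrev barGenMk (w : Bar (doubleNerve Γ) 1) : (bar (doubleNerve Γ)).GenArrow :=
  (bar (doubleNerve Γ)).genMk w

theorem baseMap_src_barGenMk (w : Bar (doubleNerve Γ) 1) :
    baseMap Γ ((barGen Γ).src (barGenMk w)) = (pathPart Γ w).src := baseMap_face_zero w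

theorem baseMap_tgt_barGenMk (w : Bar (doubleNerve Γ) 1) :
    baseMap Γ ((barGen Γ).tgt (barGenMk w)) = Γ.tgt (arrowPart Γ w) := baseMap_face_one w

/-- The relation in the generated groupoid that comes from a `2`-simplex. -/
theorem barGenMk_eq_comp (γ : PathClass G)
    {w w₀ w₁ : Bar (doubleNerve Γ) 1} (h₁ : pathPart Γ w₁ = map hΓ.tgtMap γ)
    (h₀ : arrowPart Γ w₀ = γ.src) (h : arrowPart Γ w = Γ.comp (arrowPart Γ w₁) γ.tgt)
    (h' : pathPart Γ w = (Pi1 M).comp (map hΓ.srcMap γ) (pathPart Γ w₀)) :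
    barGenMk w = (barGen Γ).comp (barGenMk w₁) (barGenMk w₀) := by
  obtain ⟨z, rfl, rfl, rfl⟩ := exists_bar_two hΓ γ h₁ h₀
    ((src_arrowPart Γ w₁).trans (congrArg PathClass.tgt h₁)) h h'
  exact genMk_comp (X := bar (doubleNerve Γ)) z

theorem barGenMk_eq_one (hΓ : Γ.IsTopological) {w : Bar (doubleNerve Γ) 1} {x : M}
    (h : arrowPart Γ w = Γ.one x) (h' : pathPart Γ w = (Pi1 M).one x)
    {b : Bar (doubleNerve Γ) 0} (hb : baseMap Γ b = x) : barGenMk w = (barGen Γ).one b := by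
  have e := barGenMk_eq_comp hΓ ((Pi1 G).one (Γ.one x)) (w := w) (w₀ := w) (w₁ := w)
    (h'.trans (congrArg (Pi1 M).one (Γ.tgt_one x).symm)) h
    (by rw [h]; exact (comp_one (Γ.src_one x)).symm)
    (by rw [h']; exact (one_comp (Γ.src_one x)).symm)
  have ht : b = (barGen Γ).tgt (barGenMk w) := baseMap_injective (by
    rw [baseMap_tgt_barGenMk, h, hb, Γ.tgt_one])
  have hs : (barGen Γ).src (barGenMk w) = b := baseMap_injective (by
    rw [baseMap_src_barGenMk, h', hb]; rfl)
  refine comp_right_cancel (hs.trans ht) (((barGen Γ).src_one _).trans ht) (e.symm.trans ?_)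
  rw [one_comp ht]

/-- The element `(g, 1)` of `W̄_1`. -/
def arrBar (g : G) : Bar (doubleNerve Γ) 1 :=
  barPair hΓ g ((Pi1 M).one (Γ.src g)) rfl

/-- The element `(1, η)` of `W̄_1`. -/
def pathBar (η : PathClass M) : Bar (doubleNerve Γ) 1 :=
  barPair hΓ (Γ.one η.tgt) η (Γ.src_one _)

theorem arrowPart_arrBar (g : G) : arrowPart Γ (arrBar hΓ g) = g :=
  arrowPart_barPair _ _

theorem pathPart_arrBar (g : G) :
    pathPart Γ (arrBar hΓ g) = (Pi1 M).one (Γ.src g) :=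
  pathPart_barPair _ _

theorem arrowPart_pathBar (η : PathClass M) :
    arrowPart Γ (pathBar hΓ η) = Γ.one η.tgt :=
  arrowPart_barPair _ _

theorem pathPart_pathBar (η : PathClass M) :
    pathPart Γ (pathBar hΓ η) = η :=
  pathPart_barPair _ _

/-- The generator given by an arrow. -/
def genArr (g : G) : (bar (doubleNerve Γ)).GenArrow :=
  barGenMk (arrBar hΓ g)

/-- The generator given by a path class. -/
def genPath (η : PathClass M) : (bar (doubleNerve Γ)).GenArrow :=
  barGenMk (pathBar hΓ η)

theorem tgt_genArr (g : G) :
    baseMap Γ ((barGen Γ).tgt (genArr hΓ g)) = Γ.tgt g := by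
  rw [genArr, baseMap_tgt_barGenMk, arrowPart_arrBar]

theorem src_genArr (g : G) :
    baseMap Γ ((barGen Γ).src (genArr hΓ g)) = Γ.src g := by
  rw [genArr, baseMap_src_barGenMk, pathPart_arrBar]
  rfl

theorem tgt_genPath (η : PathClass M) :
    baseMap Γ ((barGen Γ).tgt (genPath hΓ η)) = η.tgt := by
  rw [genPath, baseMap_tgt_barGenMk, arrowPart_pathBar, Γ.tgt_one]

theorem src_genPath (η : PathClass M) :
    baseMap Γ ((barGen Γ).src (genPath hΓ η)) = η.src := by
  rw [genPath, baseMap_src_barGenMk, pathPart_pathBar]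

theorem genArr_one (b : Bar (doubleNerve Γ) 0) :
    genArr hΓ (Γ.one (baseMap Γ b)) = (barGen Γ).one b :=
  barGenMk_eq_one hΓ (arrowPart_arrBar _ _)
    ((pathPart_arrBar _ _).trans (congrArg (Pi1 M).one (Γ.src_one _))) rfl

theorem genPath_one (b : Bar (doubleNerve Γ) 0) :
    genPath hΓ ((Pi1 M).one (baseMap Γ b)) = (barGen Γ).one b :=
  barGenMk_eq_one hΓ (arrowPart_pathBar _ _) (pathPart_pathBar _ _) rfl

theorem genArr_comp {g h : G} (e : Γ.src g = Γ.tgt h) :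
    genArr hΓ (Γ.comp g h) = (barGen Γ).comp (genArr hΓ g) (genArr hΓ h) := by
  refine barGenMk_eq_comp hΓ ((Pi1 G).one h) ?_ ?_ ?_ ?_
  · rw [pathPart_arrBar, e]; rfl
  · rw [arrowPart_arrBar]; rfl
  · rw [arrowPart_arrBar, arrowPart_arrBar]; rfl
  · rw [pathPart_arrBar, pathPart_arrBar, InternalGroupoid.src_comp e]
    exact (one_comp rfl).symm

theorem map_map_eq_self {X Y : Type*} [TopologicalSpace X] [TopologicalSpace Y] {f : C(Y, X)}
    {g : C(X, Y)} (h : ∀ x, f (g x) = x) (a : PathClass X) : map f (map g a) = a := by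
  rw [map_map]
  conv_rhs => rw [← map_id a]
  congr 1
  ext x
  exact h x

theorem genPath_comp {a b : PathClass M} (h : a.src = b.tgt) :
    genPath hΓ ((Pi1 M).comp a b) = (barGen Γ).comp (genPath hΓ a) (genPath hΓ b) := by
  -- slide along the path of units
  refine barGenMk_eq_comp hΓ (map ⟨Γ.one, hΓ.continuous_one⟩ a) ?_ ?_ ?_ ?_
  · rw [pathPart_pathBar]
    exact (map_map_eq_self (f := hΓ.tgtMap) Γ.tgt_one a).symm
  · rw [arrowPart_pathBar, ← h]; rfl
  · rw [arrowPart_pathBar, arrowPart_pathBar]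
    refine Eq.trans ?_ (one_comp (Γ := Γ) (a := Γ.one a.tgt) (Γ.tgt_one _).symm).symm
    exact congrArg Γ.one PathClass.tgt_comp
  · rw [pathPart_pathBar, pathPart_pathBar]
    exact congrArg (fun c => (Pi1 M).comp c b) 
      (map_map_eq_self (f := hΓ.srcMap) Γ.src_one a).symm

theorem genPath_comp_genArr (γ : PathClass G) :
    (barGen Γ).comp (genPath hΓ (map hΓ.tgtMap γ)) (genArr hΓ γ.src) =
      (barGen Γ).comp (genArr hΓ γ.tgt) (genPath hΓ (map hΓ.srcMap γ)) := by
  have hw : Γ.src γ.tgt = (map hΓ.srcMap γ).tgt := rfl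
  refine (barGenMk_eq_comp hΓ γ (w := barPair hΓ γ.tgt _ hw) (pathPart_pathBar _ _)
    (arrowPart_arrBar _ _) ?_ ?_).symm.trans
    (barGenMk_eq_comp hΓ ((Pi1 G).one (Γ.one (Γ.src γ.tgt))) ?_ (arrowPart_pathBar _ _) ?_ ?_)
  · rw [arrowPart_barPair, arrowPart_pathBar]
    exact (one_comp rfl).symm
  · rw [pathPart_barPair, pathPart_arrBar]
    exact (comp_one rfl).symm
  · rw [pathPart_arrBar]
    exact congrArg (Pi1 M).one (Γ.tgt_one _).symm
  · rw [arrowPart_barPair, arrowPart_arrBar]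
    exact (comp_one rfl).symm
  · rw [pathPart_barPair, pathPart_pathBar]
    exact (one_comp (Γ.src_one _)).symm

theorem barGenMk_eq (w : Bar (doubleNerve Γ) 1) :
    barGenMk w =
      (barGen Γ).comp (genArr hΓ (arrowPart Γ w)) (genPath hΓ (pathPart Γ w)) := by
  have hw := src_arrowPart Γ w
  refine barGenMk_eq_comp hΓ ((Pi1 G).one (Γ.one (Γ.src (arrowPart Γ w)))) ?_ ?_ ?_ ?_
  · rw [pathPart_arrBar]
    exact congrArg (Pi1 M).one (Γ.tgt_one _).symm
  · rw [arrowPart_pathBar]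
    exact congrArg Γ.one hw.symm
  · rw [arrowPart_arrBar]
    exact (comp_one rfl).symm
  · rw [pathPart_pathBar]
    exact (one_comp ((Γ.src_one _).trans hw)).symm

/-- The action of arrows and path classes on the generated groupoid. -/
def genAction : LeftAction hΓ (bar (doubleNerve Γ)).GenArrow where
  anchor a := baseMap Γ ((barGen Γ).tgt a)
  arr g := (barGen Γ).comp (genArr hΓ g)
  path η := (barGen Γ).comp (genPath hΓ η)
  anchor_arr _ := (congrArg _ InternalGroupoid.tgt_comp).trans (tgt_genArr hΓ _)
  anchor_path _ := (congrArg _ InternalGroupoid.tgt_comp).trans (tgt_genPath hΓ _)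
  arr_one z := by rw [genArr_one, one_comp rfl]
  path_one z := by rw [genPath_one, one_comp rfl]
  arr_comp {g h z} e e' := by
    rw [genArr_comp hΓ e]
    exact comp_assoc (baseMap_injective ((src_genArr hΓ g).trans (e.trans (tgt_genArr hΓ h).symm)))
      (baseMap_injective ((src_genArr hΓ h).trans e'))
  path_comp {a b z} e e' := by
    rw [genPath_comp hΓ e]
    exact comp_assoc (baseMap_injective ((src_genPath hΓ a).trans (e.trans (tgt_genPath hΓ b).symm)))
      (baseMap_injective ((src_genPath hΓ b).trans e'))
  path_arr {γ z} e := by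
    have e₁ : (barGen Γ).src (genArr hΓ γ.src) = (barGen Γ).tgt z :=
      baseMap_injective ((src_genArr hΓ _).trans e)
    have e₂ : (barGen Γ).src (genPath hΓ (map hΓ.srcMap γ)) = (barGen Γ).tgt z :=
      baseMap_injective ((src_genPath hΓ _).trans e)
    exact (comp_assoc (baseMap_injective ((src_genPath hΓ _).trans (tgt_genArr hΓ _).symm))
      e₁).symm.trans ((congrArg (fun c => (barGen Γ).comp c z) (genPath_comp_genArr hΓ γ)).trans
        (comp_assoc (baseMap_injective ((src_genArr hΓ _).trans
          (tgt_genPath hΓ (map hΓ.srcMap γ)).symm)) e₂))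

variable [LocallySimple G] [LocallySimple M]

theorem genAction_hBar (w : Bar (doubleNerve Γ) 1)
    {z : (bar (doubleNerve Γ)).GenArrow} (h : (barGen Γ).src (barGenMk w) = (barGen Γ).tgt z) :
    (genAction hΓ).act (hBar Γ w) z = (barGen Γ).comp (barGenMk w) z := by
  have hz : (pathPart Γ w).src = (genAction hΓ).anchor z :=
    (baseMap_src_barGenMk w).symm.trans (congrArg _ h)
  have e₁ : (barGen Γ).src (genArr hΓ (arrowPart Γ w)) =
      (barGen Γ).tgt (genPath hΓ (pathPart Γ w)) :=
    baseMap_injective ((src_genArr hΓ _).trans ((src_arrowPart Γ w).trans (tgt_genPath hΓ _).symm))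
  have e₂ : (barGen Γ).src (genPath hΓ (pathPart Γ w)) = (barGen Γ).tgt z :=
    baseMap_injective ((src_genPath hΓ _).trans hz)
  rw [hBar, LeftAction.act_comp (src_hArr_eq w) ((src_hPath _).trans hz),
    LeftAction.act_hPath hz, LeftAction.act_hArr, barGenMk_eq hΓ w, comp_assoc e₁ e₂]
  · rfl
  · rw [(genAction hΓ).anchor_path hz]
    exact src_arrowPart Γ w

theorem genAction_hLetter (y : (bar (doubleNerve Γ)).Letter)
    {z : (bar (doubleNerve Γ)).GenArrow}
    (h : (bar (doubleNerve Γ)).lsrc y = (barGen Γ).tgt z) :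
    (genAction hΓ).act (hLetter Γ y) z = (barGen Γ).comp (letterMk _ y) z := by
  obtain ⟨w, _ | _⟩ := y
  · rw [letterMk_false]
    have e₁ : (haefliger Γ).tgt (hBar Γ w) = (genAction hΓ).anchor z :=
      (tgt_hBar w).trans ((baseMap_face_one w).symm.trans (congrArg _ h))
    have e₂ := LeftAction.act_inv (E := genAction hΓ) e₁
    have e₃ : (barGen Γ).src (barGenMk w) =
        (barGen Γ).tgt ((genAction hΓ).act ((haefliger Γ).inv (hBar Γ w)) z) := by
      refine baseMap_injective ?_
      refine Eq.trans ?_ (LeftAction.anchor_act (E := genAction hΓ)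
        (((haefliger Γ).src_inv _).trans e₁)).symm
      exact (baseMap_src_barGenMk w).trans
        ((src_hBar w).symm.trans ((haefliger Γ).tgt_inv _).symm)
    have e₄ := (genAction_hBar hΓ w e₃).symm.trans e₂
    exact (inv_comp_cancel e₃).symm.trans
      (congrArg ((barGen Γ).comp ((barGen Γ).inv (barGenMk w))) e₄)
  · exact genAction_hBar hΓ w h

/-- The action lets the image of an arrow of the generated groupoid act by composition with that
arrow. -/
theorem genAction_genToHaefliger {a z : (bar (doubleNerve Γ)).GenArrow}
    (h : (barGen Γ).src a = (barGen Γ).tgt z) :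
    (genAction hΓ).act (genToHaefliger hΓ a) z = (barGen Γ).comp a z := by
  induction a using Quot.ind with
  | mk w =>
  obtain ⟨⟨x, l, y⟩, hw⟩ := w
  change (bar (doubleNerve Γ)).IsWord x l y at hw
  obtain rfl : y = (barGen Γ).tgt z := h
  change (genAction hΓ).act (genToHaefliger hΓ (wordMk _ hw)) z = (barGen Γ).comp (wordMk _ hw) z
  induction l generalizing x with
  | nil =>
    obtain rfl : x = (barGen Γ).tgt z := hw
    refine Eq.trans ?_ (one_comp (Γ := barGen Γ) (a := z) rfl).symm
    exact LeftAction.act_one (E := genAction hΓ) z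
  | cons c l ih =>
    have e₁ : (barGen Γ).src (letterMk _ c) = (barGen Γ).tgt (wordMk _ hw.2) := rfl
    have e₂ : (barGen Γ).src (wordMk _ hw.2) = (barGen Γ).tgt z := rfl
    have hc : genToHaefliger hΓ (letterMk _ c) = hLetter Γ c := comp_one (src_hLetter c)
    have hs := src_genToHaefliger hΓ (wordMk _ hw.2)
    have e₃ : (haefliger Γ).src (hLetter Γ c) =
      (haefliger Γ).tgt (genToHaefliger hΓ (wordMk _ hw.2)) :=
        (src_hLetter c).trans (tgt_genToHaefliger hΓ (wordMk _ hw.2)).symm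
    have e₄ : (barGen Γ).tgt ((barGen Γ).comp (wordMk _ hw.2) z) =
      (barGen Γ).tgt (wordMk _ hw.2) := InternalGroupoid.tgt_comp
    have e₅ : wordMk _ hw = (barGen Γ).comp (letterMk _ c) (wordMk _ hw.2) := wordMk_cons hw
    refine (congrArg (fun a => (genAction hΓ).act (genToHaefliger hΓ a) z) e₅).trans ?_
    refine Eq.trans ?_ (congrArg (fun a => (barGen Γ).comp a z) e₅).symm
    refine Eq.trans ?_ (comp_assoc e₁ e₂).symm
    refine (congrArg (fun a => (genAction hΓ).act a z)
      ((genToHaefliger_comp hΓ e₁).trans (congrArg (fun a => (haefliger Γ).comp a _) hc))).trans ?_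
    refine (LeftAction.act_comp e₃ hs).trans ?_
    refine (congrArg _ (ih _ hw.2)).trans ?_
    exact genAction_hLetter hΓ c e₄.symm

theorem genToHaefliger_injective :
    Function.Injective (genToHaefliger hΓ) := fun a b h => by
  have hs : (barGen Γ).src a = (barGen Γ).src b := baseMap_injective (by
    rw [← src_genToHaefliger hΓ a, ← src_genToHaefliger hΓ b, h])
  have e := genAction_genToHaefliger hΓ (a := a) (z := (barGen Γ).one _) ((barGen Γ).tgt_one _).symm
  have e' := genAction_genToHaefliger hΓ (a := b) (z := (barGen Γ).one ((barGen Γ).src a))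
    (hs.symm.trans ((barGen Γ).tgt_one _).symm)
  rwa [h, e', comp_one hs.symm, comp_one rfl, eq_comm] at e

end

section

variable {G : Type u} {M : Type v} [TopologicalSpace G] [TopologicalSpace M]
  {Γ : InternalGroupoid G M} (hΓ : Γ.IsTopological)

theorem genToHaefliger_genArr (g : G) :
    genToHaefliger hΓ (genArr hΓ g) = hArr Γ g := by
  refine (genToHaefliger_genMk hΓ _).trans ?_
  rw [hBar, arrowPart_arrBar, pathPart_arrBar, hPath_one]
  exact comp_one rfl

theorem genToHaefliger_genPath (η : PathClass M) :
    genToHaefliger hΓ (genPath hΓ η) = hPath Γ η := by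
  refine (genToHaefliger_genMk hΓ _).trans ?_
  rw [hBar, arrowPart_pathBar, pathPart_pathBar, hArr_one, one_comp (tgt_hPath _).symm]

theorem genToHaefliger_surjective :
    Function.Surjective (genToHaefliger hΓ) := fun a => by
  refine haefliger_induction (p := fun a => ∃ c, genToHaefliger hΓ c = a)
    (fun g => ⟨_, genToHaefliger_genArr hΓ g⟩) (fun η => ⟨_, genToHaefliger_genPath hΓ η⟩) ?_ a
  rintro _ _ h ⟨a, rfl⟩ ⟨b, rfl⟩
  rw [src_genToHaefliger, tgt_genToHaefliger] at h
  exact ⟨_, genToHaefliger_comp hΓ (baseMap_injective h)⟩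

end

/-! ### Continuity criteria for groupoids -/

section

variable {A : Type u} {O : Type v} {Γ : InternalGroupoid A O}

theorem InternalGroupoid.IsTopological.tendsto_comp [TopologicalSpace A] [TopologicalSpace O]
    (h : Γ.IsTopological) {Z : Type*} {F : Filter Z} {f g : Z → A} {a b : A}
    (hf : Filter.Tendsto f F (𝓝 a)) (hg : Filter.Tendsto g F (𝓝 b))
    (hfg : ∀ᶠ z in F, Γ.src (f z) = Γ.tgt (g z)) (hab : Γ.src a = Γ.tgt b) :
    Filter.Tendsto (fun z => Γ.comp (f z) (g z)) F (𝓝 (Γ.comp a b)) := by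
  have hc := (h.continuous_mul.tendsto ⟨(a, b), hab⟩)
  rw [nhds_subtype_eq_comap, nhds_prod_eq] at hc
  have hz := (Filter.tendsto_iff_eventually.1 hc)
  refine Filter.tendsto_iff_eventually.2 fun {p} hp => ?_
  rw [comp_eq hab] at hp
  have := Filter.eventually_comap.1 (hz hp)
  filter_upwards [(hf.prodMk hg).eventually this, hfg] with z hz hz'
  rw [comp_eq hz']
  exact hz ⟨(f z, g z), hz'⟩ rfl

/-- In an étale groupoid, a map is continuous if it is continuous along the neighborhoods given by
the local families of arrows. -/
theorem InternalGroupoid.IsEtaleVia.continuous_of_conj [TopologicalSpace A] [TopologicalSpace O]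
    {τ : O → O → A} (h : Γ.IsEtaleVia τ) {B : Type*} [TopologicalSpace B] (f : A → B)
    (hf : ∀ a, ContinuousAt (fun z : O × O => f (Γ.comp (Γ.comp (τ (Γ.tgt a) z.1) a)
      (Γ.inv (τ (Γ.src a) z.2)))) (Γ.tgt a, Γ.src a)) : Continuous f := by
  refine continuous_iff_continuousAt.2 fun a => ?_
  have e := (h.eventually_nhds a).self_of_nhds.2.2.2.2
  have := hf a
  rw [ContinuousAt, ← e] at this
  rw [ContinuousAt, h.nhds, Filter.tendsto_map'_iff]
  exact this

end

section

variable {A : Type u} {O : Type v} {B : Type w} {P : Type*} {Γ : InternalGroupoid A O}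
  {Δ : InternalGroupoid B P} {f : A → B} {o : O → P}

theorem InternalGroupoid.map_one_of_map_comp (hs : ∀ a, Δ.src (f a) = o (Γ.src a))
    (ht : ∀ a, Δ.tgt (f a) = o (Γ.tgt a))
    (hcomp : ∀ a b, Γ.src a = Γ.tgt b → f (Γ.comp a b) = Δ.comp (f a) (f b)) (x : O) :
    f (Γ.one x) = Δ.one (o x) := by
  have hs := hs (Γ.one x)
  have ht := ht (Γ.one x)
  rw [Γ.src_one] at hs
  rw [Γ.tgt_one] at ht
  refine comp_right_cancel (hs.trans ht.symm) ((Δ.src_one _).trans ht.symm) ?_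
  rw [← hcomp _ _ ((Γ.src_one x).trans (Γ.tgt_one x).symm), one_comp (Γ.tgt_one x).symm,
    one_comp ht.symm]

theorem InternalGroupoid.map_inv_of_map_comp (hs : ∀ a, Δ.src (f a) = o (Γ.src a))
    (ht : ∀ a, Δ.tgt (f a) = o (Γ.tgt a))
    (hcomp : ∀ a b, Γ.src a = Γ.tgt b → f (Γ.comp a b) = Δ.comp (f a) (f b)) (a : A) :
    f (Γ.inv a) = Δ.inv (f a) := by
  refine eq_inv_of_comp (x := o (Γ.src a)) ?_ ?_
  · rw [hs, ht, Γ.src_inv]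
  · rw [← hcomp _ _ (Γ.src_inv a), inv_comp, map_one_of_map_comp hs ht hcomp]

end

section

variable {A : Type u} {O : Type v} {B : Type w} {P : Type*} [TopologicalSpace A]
  [TopologicalSpace O] [TopologicalSpace B] [TopologicalSpace P] {Γ : InternalGroupoid A O}
  {Δ : InternalGroupoid B P}

/-- A groupoid isomorphic to a topological groupoid is a topological groupoid. -/
theorem TopGroupoidIso.isTopological (Φ : TopGroupoidIso Γ Δ) (h : Δ.IsTopological) :
    Γ.IsTopological := by
  have hcomp : ∀ {a b}, Γ.src a = Γ.tgt b →
      Φ.arr (Γ.comp a b) = Δ.comp (Φ.arr a) (Φ.arr b) := fun {a b} e => by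
    have e' : Δ.src (Φ.arr a) = Δ.tgt (Φ.arr b) := by rw [Φ.src_arr, Φ.tgt_arr, e]
    rw [comp_eq e, comp_eq e', Φ.mul_arr]
  have hone := map_one_of_map_comp Φ.src_arr Φ.tgt_arr fun _ _ => hcomp
  have hinv := map_inv_of_map_comp Φ.src_arr Φ.tgt_arr fun _ _ => hcomp
  constructor
  · refine (Φ.obj.symm.continuous.comp (h.continuous_src.comp Φ.arr.continuous)).congr fun a => ?_
    simp [Φ.src_arr]
  · refine (Φ.obj.symm.continuous.comp (h.continuous_tgt.comp Φ.arr.continuous)).congr fun a => ?_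
    simp [Φ.tgt_arr]
  · refine (Φ.arr.symm.continuous.comp (h.continuous_one.comp Φ.obj.continuous)).congr fun a => ?_
    simp [← hone]
  · refine (Φ.arr.symm.continuous.comp (h.continuous_inv.comp Φ.arr.continuous)).congr fun a => ?_
    simp [← hinv]
  · have hz : Continuous (Subtype.val : {p : A × A // Γ.src p.1 = Γ.tgt p.2} → A × A) :=
      continuous_subtype_val
    have hc := h.continuous_comp (Φ.arr.continuous.comp hz.fst) (Φ.arr.continuous.comp hz.snd)
      fun z => by simp [Φ.src_arr, Φ.tgt_arr, z.2]
    refine (Φ.arr.symm.continuous.comp hc).congr fun z => ?_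
    refine (congrArg Φ.arr.symm (hcomp z.2).symm).trans ?_
    rw [Φ.arr.symm_apply_apply, comp_eq z.2]

end

/-! ### The isomorphism of the generated groupoid and the Haefliger groupoid -/

section

variable {G : Type u} {M : Type v} [TopologicalSpace G] [TopologicalSpace M]
  {Γ : InternalGroupoid G M} (hΓ : Γ.IsTopological) [LocallySimple G] [LocallySimple M]

theorem continuous_hBar (hΓ : Γ.IsTopological) : Continuous (hBar Γ) :=
  (isTopological_haefliger hΓ).continuous_comp ((continuous_hArr hΓ).comp continuous_arrowPart)
    ((continuous_hPath hΓ).comp continuous_pathPart) src_hArr_eq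

theorem continuous_hLetter (hΓ : Γ.IsTopological) : Continuous (hLetter Γ) := by
  have h : Continuous fun p : Bool × Bar (doubleNerve Γ) 1 => hLetter Γ (p.2, p.1) := by
    rw [continuous_prod_of_discrete_left]
    rintro (_ | _)
    · exact (isTopological_haefliger hΓ).continuous_inv.comp (continuous_hBar hΓ)
    · exact continuous_hBar hΓ
  exact h.comp continuous_swap

/-- By induction on the limit word: nearby lists of letters have the same length. -/
theorem tendsto_hWord (hΓ : Γ.IsTopological) {Z : Type*} {F : Filter Z}
    {L : Z → List (bar (doubleNerve Γ)).Letter} {b : Z → (bar (doubleNerve Γ)).obj 0}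
    {x y : (bar (doubleNerve Γ)).obj 0} {l : List (bar (doubleNerve Γ)).Letter}
    (h : (bar (doubleNerve Γ)).IsWord x l y) (hL : Filter.Tendsto L F (𝓝 l))
    (hb : Filter.Tendsto b F (𝓝 y)) (hw : ∀ᶠ z in F, ∃ x, (bar (doubleNerve Γ)).IsWord x (L z) (b z)) :
    Filter.Tendsto (fun z => hWord Γ (L z) ((haefliger Γ).one (baseMap Γ (b z)))) F
      (𝓝 (hWord Γ l ((haefliger Γ).one (baseMap Γ y)))) := by
  have hH := isTopological_haefliger hΓ
  induction l generalizing x L with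
  | nil =>
    rw [nhds_nil, Filter.tendsto_pure] at hL
    refine ((hH.continuous_one.comp continuous_baseMap).tendsto y |>.comp hb).congr' ?_
    filter_upwards [hL] with z hz
    rw [hz]
    rfl
  | cons c l ih =>
    have h₁ : Filter.Tendsto (fun z => (L z).headD c) F (𝓝 c) :=
      (show Filter.Tendsto (fun m : List (bar (doubleNerve Γ)).Letter => m.headD c) _ _ from
        List.tendsto_cons_iff.2 Filter.tendsto_fst).comp hL
    have h₂ : Filter.Tendsto (fun z => (L z).tail) F (𝓝 l) :=
      (show Filter.Tendsto (fun m : List (bar (doubleNerve Γ)).Letter => m.tail) _ _ from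
        List.tendsto_cons_iff.2 Filter.tendsto_snd).comp hL
    have h₃ : ∀ᶠ z in F, L z = (L z).headD c :: (L z).tail := by
      refine hL.eventually (p := fun m => m = m.headD c :: m.tail) ?_
      rw [nhds_cons_eq_map]
      exact Filter.eventually_map.2 (Filter.Eventually.of_forall fun _ => rfl)
    have h₄ : ∀ᶠ z in F, ∃ x, (bar (doubleNerve Γ)).IsWord x (L z).tail (b z) := by
      filter_upwards [h₃, hw] with z hz hw
      obtain ⟨x, hw⟩ := hw
      rw [hz] at hw
      exact ⟨_, hw.2⟩
    refine Filter.Tendsto.congr' ?_ (hH.tendsto_comp (((continuous_hLetter hΓ).tendsto c).comp h₁)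
      (ih h.2 h₂ h₄) ?_ ((src_hLetter c).trans (tgt_hWord h.2 ((haefliger Γ).tgt_one _)).symm))
    · filter_upwards [h₃] with z hz
      conv_rhs => rw [hz]
      rfl
    · filter_upwards [h₃, hw] with z hz hw
      obtain ⟨x, hw⟩ := hw
      rw [hz] at hw
      exact (src_hLetter _).trans (tgt_hWord hw.2 ((haefliger Γ).tgt_one _)).symm

theorem continuous_genToHaefliger : Continuous (genToHaefliger hΓ) := by
  refine continuous_coinduced_dom.2 (continuous_iff_continuousAt.2 fun w => ?_)
  have hc : Continuous fun w : (bar (doubleNerve Γ)).Word => (w.1.2.1, w.1.2.2) :=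
    continuous_subtype_val.snd
  exact tendsto_hWord hΓ w.2 (hc.fst.tendsto w) (hc.snd.tendsto w)
    (Filter.Eventually.of_forall fun w => ⟨_, w.2⟩)

end

section

variable {G : Type u} {M : Type v} [TopologicalSpace G] [TopologicalSpace M]
  {Γ : InternalGroupoid G M} (hΓ : Γ.IsTopological)

theorem isWord_pathBar {x y : (bar (doubleNerve Γ)).obj 0}
    {l : List (bar (doubleNerve Γ)).Letter} (h : (bar (doubleNerve Γ)).IsWord x l y)
    {a b : PathClass M} (ha : a.src = baseMap Γ x) (hb : b.src = baseMap Γ y) :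
    (bar (doubleNerve Γ)).IsWord (Bar.face 0 1 le_rfl (pathBar hΓ a))
      ((pathBar hΓ a, true) :: (l ++ ([(pathBar hΓ b, false)] : List (bar (doubleNerve Γ)).Letter)))
      (Bar.face 0 1 le_rfl (pathBar hΓ b)) := by
  have hx : (bar (doubleNerve Γ)).lsrc (pathBar hΓ a, true) = x :=
    baseMap_injective ((src_genPath hΓ a).trans ha)
  have hy : (bar (doubleNerve Γ)).ltgt (pathBar hΓ b, false) = y :=
    baseMap_injective ((src_genPath hΓ b).trans hb)
  have k : (bar (doubleNerve Γ)).IsWord y [(pathBar hΓ b, false)]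
    (Bar.face 0 1 le_rfl (pathBar hΓ b)) := ⟨hy, rfl⟩
  exact ⟨rfl, (isWord_append _ _ _ _ _).2 ⟨y, hx.symm ▸ h, k⟩⟩

theorem wordMk_pathBar {x y : (bar (doubleNerve Γ)).obj 0}
    {l : List (bar (doubleNerve Γ)).Letter} (h : (bar (doubleNerve Γ)).IsWord x l y)
    {a b : PathClass M} (ha : a.src = baseMap Γ x) (hb : b.src = baseMap Γ y) :
    wordMk _ (isWord_pathBar hΓ h ha hb) =
      (barGen Γ).comp ((barGen Γ).comp (genPath hΓ a) (wordMk _ h))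
        ((barGen Γ).inv (genPath hΓ b)) := by
  have hx : (barGen Γ).src (genPath hΓ a) = x := baseMap_injective ((src_genPath hΓ a).trans ha)
  have hy : (barGen Γ).src (genPath hΓ b) = y := baseMap_injective ((src_genPath hΓ b).trans hb)
  have e := comp_wordMk h ((bar (doubleNerve Γ)).isWord_letter (pathBar hΓ b, false)) hy.symm
  refine (wordMk_cons (isWord_pathBar hΓ h ha hb)).trans ?_
  refine Eq.trans ?_ (comp_assoc hx (hy.symm.trans ((barGen Γ).tgt_inv _).symm)).symm
  refine congrArg ((barGen Γ).comp (genPath hΓ a)) ?_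
  refine Eq.trans ?_ (e.symm.trans (congrArg _ (letterMk_false (X := bar (doubleNerve Γ)) _)))
  subst hx
  rfl

variable [LocallySimple (Nerve Γ 0)] [LocallySimple (Nerve Γ 1)]

theorem continuous_pathBar : Continuous (pathBar hΓ) := by
  refine continuous_bar_one hΓ ?_ ?_
  · exact (hΓ.continuous_one.comp PathClass.continuous_tgt).congr
      fun η => (arrowPart_pathBar hΓ η).symm
  · exact continuous_id.congr fun η => (pathPart_pathBar hΓ η).symm

/-- Composing a word with paths at both ends yields an explicit longer word, which depends
continuously on the paths. -/
theorem continuousAt_conj_genPath (T : ShortPaths M)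
    (a : (bar (doubleNerve Γ)).GenArrow) {x y : M} (hx : baseMap Γ ((barGen Γ).tgt a) = x)
    (hy : baseMap Γ ((barGen Γ).src a) = y) :
    ContinuousAt (fun z : M × M => (barGen Γ).comp ((barGen Γ).comp (genPath hΓ (T.cls x z.1)) a)
      ((barGen Γ).inv (genPath hΓ (T.cls y z.2)))) (x, y) := by
  induction a using Quot.ind with
  | mk w =>
  obtain ⟨⟨x', l, y'⟩, h⟩ := w
  change (bar (doubleNerve Γ)).IsWord x' l y' at h
  change baseMap Γ x' = x at hx
  change baseMap Γ y' = y at hy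
  subst hx hy
  classical
  refine continuousAt_conj T _ _ _ (fun z => if k : z.1 0 = baseMap Γ x' ∧ z.2 0 = baseMap Γ y' then
    wordMk _ (isWord_pathBar hΓ h (a := mk' z.1) (b := mk' z.2) k.1 k.2) else wordMk _ h) ?_ ?_
  · rw [continuousOn_iff_continuous_domRestrict]
    have hz : Continuous fun z : {z : C(I, M) × C(I, M) |
        z.1 0 = baseMap Γ x' ∧ z.2 0 = baseMap Γ y'} =>
        (⟨(_, _, _), isWord_pathBar hΓ h (a := mk' z.1.1) (b := mk' z.1.2) z.2.1 z.2.2⟩ :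
          (bar (doubleNerve Γ)).Word) := by
      have h₁ : Continuous fun z : {z : C(I, M) × C(I, M) |
          z.1 0 = baseMap Γ x' ∧ z.2 0 = baseMap Γ y'} => pathBar hΓ (mk' z.1.1) :=
        (continuous_pathBar hΓ).comp (continuous_mk'.comp continuous_subtype_val.fst)
      have h₂ : Continuous fun z : {z : C(I, M) × C(I, M) |
          z.1 0 = baseMap Γ x' ∧ z.2 0 = baseMap Γ y'} => pathBar hΓ (mk' z.1.2) :=
        (continuous_pathBar hΓ).comp (continuous_mk'.comp continuous_subtype_val.snd)
      have hf : Continuous (Bar.face (X := doubleNerve Γ) 0 1 le_rfl) :=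
        (bar (doubleNerve Γ)).continuous_face 0 1 le_rfl
      refine Continuous.subtype_mk ((hf.comp h₁).prodMk (Continuous.prodMk ?_ (hf.comp h₂))) _
      exact List.continuous_cons.comp ((h₁.prodMk continuous_const).prodMk
        ((list_continuous_append_left l).comp (List.continuous_cons.comp
          ((h₂.prodMk continuous_const).prodMk continuous_const))))
    refine (continuous_quot_mk.comp hz).congr fun z => ?_
    have hz : z.1.1 0 = baseMap Γ x' ∧ z.1.2 0 = baseMap Γ y' := z.2
    change wordMk _ (isWord_pathBar hΓ h (a := mk' z.1.1) (b := mk' z.1.2) z.2.1 z.2.2) =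
      if k : z.1.1 0 = baseMap Γ x' ∧ z.1.2 0 = baseMap Γ y' then
        wordMk _ (isWord_pathBar hΓ h (a := mk' z.1.1) (b := mk' z.1.2) k.1 k.2) else wordMk _ h
    rw [dif_pos hz]
  · intro v hv u hu
    rw [T.cls_eq hv, T.cls_eq hu]
    refine Eq.trans ?_ (dif_pos ⟨T.path_zero _ _, T.path_zero _ _⟩).symm
    exact (wordMk_pathBar hΓ h (T.path_zero _ _) (T.path_zero _ _)).symm

variable [LocallySimple G] [LocallySimple M]

/-- The inverse of the bijection from the generated groupoid to the Haefliger groupoid is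
continuous, since the latter is étale over the pair groupoid of `M`. -/
theorem continuous_genToHaefliger_symm
    (e : (bar (doubleNerve Γ)).GenArrow ≃ HaefligerArrow Γ) (he : ∀ a, e a = genToHaefliger hΓ a) :
    Continuous e.symm := by
  obtain ⟨T⟩ := nonempty_shortPaths M
  have hE := isEtaleVia_haefliger hΓ T
  refine hE.continuous_of_conj _ fun b => ?_
  obtain ⟨a, rfl⟩ := e.surjective b
  have ht : baseMap Γ ((barGen Γ).tgt a) = (haefliger Γ).tgt (e a) := by
    rw [he]
    exact (tgt_genToHaefliger hΓ a).symm
  have hs : baseMap Γ ((barGen Γ).src a) = (haefliger Γ).src (e a) := by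
    rw [he]
    exact (src_genToHaefliger hΓ a).symm
  refine (continuousAt_conj_genPath hΓ T a ht hs).congr ?_
  filter_upwards [hE.eventually_ends (e a)] with z hz
  refine (e.symm_apply_eq.2 ?_).symm
  simp only [src_hPath, tgt_hPath] at hz
  have h₁ : (barGen Γ).src (genPath hΓ (T.cls ((haefliger Γ).tgt (e a)) z.1)) = (barGen Γ).tgt a :=
    baseMap_injective ((src_genPath hΓ _).trans (hz.1.1.trans ht.symm))
  have h₂ : (barGen Γ).src a = (barGen Γ).src (genPath hΓ (T.cls ((haefliger Γ).src (e a)) z.2)) :=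
    baseMap_injective (hs.trans ((src_genPath hΓ _).trans hz.2.1).symm)
  have hinv := map_inv_of_map_comp (Γ := barGen Γ) (src_genToHaefliger hΓ) (tgt_genToHaefliger hΓ)
    fun _ _ => genToHaefliger_comp hΓ
  refine Eq.symm ((he _).trans ((genToHaefliger_comp hΓ ((InternalGroupoid.src_comp h₁).trans
    (h₂.trans ((barGen Γ).tgt_inv _).symm))).trans ?_))
  refine congrArg₂ (haefliger Γ).comp ((genToHaefliger_comp hΓ h₁).trans ?_) ((hinv _).trans ?_)
  · rw [genToHaefliger_genPath, he]
  · rw [genToHaefliger_genPath]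

/-- The bijection from the groupoid generated by the bar construction to the Haefliger groupoid. -/
def genEquiv : (bar (doubleNerve Γ)).GenArrow ≃ HaefligerArrow Γ :=
  Equiv.ofBijective (genToHaefliger hΓ)
    ⟨genToHaefliger_injective hΓ, genToHaefliger_surjective hΓ⟩

/-- The isomorphism of the groupoid generated by the bar construction and the Haefliger
fundamental groupoid. -/
def genIso : TopGroupoidIso (barGen Γ) (haefliger Γ) where
  arr :=
    { toEquiv := genEquiv hΓ
      continuous_toFun := continuous_genToHaefliger hΓ
      continuous_invFun := continuous_genToHaefliger_symm hΓ (genEquiv hΓ) fun _ => rfl }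
  obj := baseHomeo hΓ
  src_arr := src_genToHaefliger hΓ
  tgt_arr := tgt_genToHaefliger hΓ
  mul_arr a b h h' := by
    exact (congrArg (genToHaefliger hΓ) (comp_eq h).symm).trans
      ((genToHaefliger_comp hΓ h).trans (comp_eq h'))

theorem genIso_genMk (w : Bar (doubleNerve Γ) 1) {ρ : C(I, M)}
    (hρ : pathPart Γ w = mk' ρ) (h : Γ.src (arrowPart Γ w) = ρ 1) :
    (genIso hΓ).arr (barGenMk w) = haefligerMk Γ (arrowPart Γ w) ρ h := by
  rw [haefligerMk_eq, ← hρ]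
  exact (genToHaefliger_genMk hΓ w : _)

end

/-! ### The quotient of `G ×_{s,t} Π₁(M)` -/

section

variable {G : Type u} {M : Type v} [TopologicalSpace G] [TopologicalSpace M]
  {Γ : InternalGroupoid G M} (hΓ : Γ.IsTopological)

/-- The pointwise product of paths of arrows. -/
def pathProd (p q : C(I, G)) (h : ∀ t, Γ.src (p t) = Γ.tgt (q t)) :
    C(I, G) := ⟨fun t => Γ.comp (p t) (q t), hΓ.continuous_comp p.continuous q.continuous h⟩

theorem map_tgt_pathProd {p q : C(I, G)}
    (h : ∀ t, Γ.src (p t) = Γ.tgt (q t)) :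
    map hΓ.tgtMap (mk' (pathProd hΓ p q h)) = map hΓ.tgtMap (mk' p) := by
  rw [map_mk', map_mk']
  exact congrArg mk' (ContinuousMap.ext fun t => InternalGroupoid.tgt_comp)

theorem map_src_pathProd {p q : C(I, G)}
    (h : ∀ t, Γ.src (p t) = Γ.tgt (q t)) :
    map hΓ.srcMap (mk' (pathProd hΓ p q h)) = map hΓ.srcMap (mk' q) := by
  rw [map_mk', map_mk']
  exact congrArg mk' (ContinuousMap.ext fun t => InternalGroupoid.src_comp (h t))

theorem exists_lift_src (hS : IsSerreFibration Γ.src) (ρ : C(I, M)) {g : G} (h : Γ.src g = ρ 0) :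
    ∃ p : C(I, G), p 0 = g ∧ ∀ t, Γ.src (p t) = ρ t := hS.exists_path ρ g h

/-- Since `t = s ∘ inv`, paths lift along the target map, too. -/
theorem exists_lift_tgt (hΓ : Γ.IsTopological) (hS : IsSerreFibration Γ.src) (ρ : C(I, M)) {g : G}
    (h : Γ.tgt g = ρ 0) : ∃ p : C(I, G), p 0 = g ∧ ∀ t, Γ.tgt (p t) = ρ t := by
  obtain ⟨p, hp, hp'⟩ := hS.exists_path ρ (Γ.inv g) ((Γ.src_inv g).trans h)
  refine ⟨⟨fun t => Γ.inv (p t), hΓ.continuous_inv.comp p.continuous⟩, ?_,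
    fun t => (Γ.tgt_inv _).trans (hp' t)⟩
  change Γ.inv (p 0) = g
  rw [hp, inv_inv_eq]

/-- The double source map of `Π₁(G)` is onto. -/
theorem exists_pathClass_map_src (hS : IsSerreFibration Γ.src) {g : G}
    {η : PathClass M} (h : Γ.src g = η.src) :
    ∃ α : PathClass G, α.src = g ∧ map hΓ.srcMap α = η := by
  obtain ⟨ρ, rfl⟩ := mk'_surjective η
  obtain ⟨p, hp, hp'⟩ := exists_lift_src hS ρ h
  exact ⟨mk' p, hp, (map_mk' _ _).trans (congrArg mk' (ContinuousMap.ext hp'))⟩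

theorem exists_pathClass_map_tgt (hS : IsSerreFibration Γ.src) {g : G}
    {η : PathClass M} (h : η.src = Γ.tgt g) :
    ∃ α : PathClass G, α.src = g ∧ map hΓ.tgtMap α = η := by
  obtain ⟨ρ, rfl⟩ := mk'_surjective η
  obtain ⟨p, hp, hp'⟩ := exists_lift_tgt hΓ hS ρ h.symm
  exact ⟨mk' p, hp, (map_mk' _ _).trans (congrArg mk' (ContinuousMap.ext hp'))⟩

/-- The space `(G ×_{s,t} Π₁(M))/∼`. -/
abbrev Full := FullQuot Γ hΓ.srcMap hΓ.tgtMap fun _ => rfl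

/-- The class of `(θ, η)`. -/
abbrev fMk {θ : G} {η : PathClass M} (h : Γ.src θ = η.tgt) : Full hΓ :=
  fullMk Γ hΓ.srcMap hΓ.tgtMap (fun _ => rfl) θ η h

theorem fMk_congr {θ θ' : G} {η η' : PathClass M} (h : Γ.src θ = η.tgt)
    (h' : Γ.src θ' = η'.tgt) (e : θ = θ') (e' : η = η') : fMk hΓ h = fMk hΓ h' := by
  subst e e'
  rfl

theorem exists_fMk (z : Full hΓ) :
    ∃ (θ : G) (η : PathClass M) (h : Γ.src θ = η.tgt), fMk hΓ h = z := by
  induction z using Quot.ind with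
  | mk x => exact ⟨x.1.1, x.1.2, x.2, rfl⟩

theorem src_tgt_eq (α : PathClass G) (η : PathClass M) :
    Γ.src α.tgt = ((Pi1 M).comp (map hΓ.srcMap α) η).tgt :=
  (PathClass.tgt_comp' (a := map hΓ.srcMap α)).symm

theorem src_comp_eq_tgt_comp {θ : G} {α : PathClass G} {η : PathClass M}
    (h₁ : Γ.src θ = Γ.tgt α.tgt) :
    Γ.src (Γ.comp θ α.tgt) = ((Pi1 M).comp (map hΓ.srcMap α) η).tgt :=
  (InternalGroupoid.src_comp h₁).trans (src_tgt_eq hΓ α η)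

theorem fullPair_eq {θ : G} {α : PathClass G} {η : PathClass M}
    (h₁ : Γ.src θ = Γ.tgt α.tgt) (h₂ : Γ.src α.src = η.tgt) :
    fullPair Γ hΓ.srcMap (fun _ => rfl) θ α η h₁ h₂ =
      ⟨(Γ.comp θ α.tgt, (Pi1 M).comp (map hΓ.srcMap α) η), src_comp_eq_tgt_comp hΓ h₁⟩ :=
  Subtype.ext (Prod.ext (comp_eq h₁).symm
    (comp_eq (Γ := Pi1 M) (a := map hΓ.srcMap α) (b := η) h₂).symm)

/-- The defining relation of the quotient. -/
theorem fMk_eq {θ : G} {α α' : PathClass G} {η : PathClass M}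
    (h₁ : Γ.src θ = Γ.tgt α.tgt) (h₂ : Γ.src α.src = η.tgt)
    (e : map hΓ.tgtMap α = map hΓ.tgtMap α') (e' : α.src = α'.src) :
    fMk hΓ (src_comp_eq_tgt_comp hΓ (η := η) h₁) =
      fMk hΓ (src_comp_eq_tgt_comp hΓ (θ := θ) (α := α') (η := η)
        (h₁.trans (congrArg PathClass.tgt e))) := by
  have h₁' : Γ.src θ = Γ.tgt α'.tgt := h₁.trans (congrArg PathClass.tgt e)
  have h₂' : Γ.src α'.src = η.tgt := e' ▸ h₂
  have := FullRel.intro (Γ := Γ) (s := hΓ.srcMap) (t := hΓ.tgtMap) (hs := fun _ => rfl) θ α α' η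
    h₁ h₂ h₁' h₂' e e'
  rw [fullPair_eq, fullPair_eq] at this
  exact Quot.sound this

/-- A function on pairs is well defined on the quotient if it is compatible with the relation. -/
def fullLift {Z : Type*} (f : ArrowPath Γ → Z)
    (h : ∀ (θ : G) (α α' : PathClass G) (η : PathClass M) (h₁ : Γ.src θ = Γ.tgt α.tgt)
      (h₁' : Γ.src θ = Γ.tgt α'.tgt),
      Γ.src α.src = η.tgt → map hΓ.tgtMap α = map hΓ.tgtMap α' → α.src = α'.src →
        f ⟨(Γ.comp θ α.tgt, (Pi1 M).comp (map hΓ.srcMap α) η), src_comp_eq_tgt_comp hΓ h₁⟩ =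
          f ⟨(Γ.comp θ α'.tgt, (Pi1 M).comp (map hΓ.srcMap α') η), src_comp_eq_tgt_comp hΓ h₁'⟩) :
    Full hΓ → Z := Quot.lift f (by
  rintro _ _ ⟨θ, α, α', η, h₁, h₂, h₁', h₂', e, e'⟩
  rw [fullPair_eq, fullPair_eq]
  exact h θ α α' η h₁ h₁' h₂ e e')

/-- The target of the class of a pair. -/
def fullTgt : Full hΓ → M :=
  fullLift hΓ (fun x => Γ.tgt x.1.1) fun _ _ _ _ _ _ _ _ _ =>
    InternalGroupoid.tgt_comp.trans InternalGroupoid.tgt_comp.symm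

/-- The product of an arrow and the class of a pair, where this is defined. -/
def fullArr (g : G) : Full hΓ → Full hΓ := by
  classical
  exact fullLift hΓ (fun x => if h : Γ.src g = Γ.tgt x.1.1 then
    fMk hΓ (θ := Γ.comp g x.1.1) ((InternalGroupoid.src_comp h).trans x.2) else fMk hΓ x.2)
    fun θ α α' η h₁ h₁' h₂ e e' => by
      by_cases h : Γ.src g = Γ.tgt θ
      · rw [dif_pos (h.trans InternalGroupoid.tgt_comp.symm),
          dif_pos (h.trans InternalGroupoid.tgt_comp.symm)]
        have k : ∀ {α : PathClass G}, Γ.src θ = Γ.tgt α.tgt →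
          Γ.src (Γ.comp g θ) = Γ.tgt α.tgt := fun h' => (InternalGroupoid.src_comp h).trans h'
        exact (fMk_congr hΓ _ _ (comp_assoc h h₁).symm rfl).trans ((fMk_eq hΓ (k h₁) h₂ e e').trans
          (fMk_congr hΓ _ _ (comp_assoc h h₁') rfl))
      · have k : ∀ {α : PathClass G}, ¬ Γ.src g = Γ.tgt (Γ.comp θ α.tgt) := fun h' =>
          h (h'.trans InternalGroupoid.tgt_comp)
        rw [dif_neg k, dif_neg k]
        exact fMk_eq hΓ h₁ h₂ e e'

theorem fullArr_fMk {g θ : G} {η : PathClass M} (h : Γ.src θ = η.tgt)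
    (h' : Γ.src g = Γ.tgt θ) : fullArr hΓ g (fMk hΓ h) =
      fMk hΓ (θ := Γ.comp g θ) ((InternalGroupoid.src_comp h').trans h) := dif_pos h'

/-- The defining relation for a unit `θ`: pushing `α` through does not depend on the lift `α` of its
image under the target map. -/
theorem fMk_tgt_eq {α α' : PathClass G} {η : PathClass M}
    (h : Γ.src α.src = η.tgt) (e : map hΓ.tgtMap α = map hΓ.tgtMap α') (e' : α.src = α'.src) :
    fMk hΓ (θ := α.tgt) (η := (Pi1 M).comp (map hΓ.srcMap α) η) (src_tgt_eq hΓ α η) =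
      fMk hΓ (θ := α'.tgt) (η := (Pi1 M).comp (map hΓ.srcMap α') η) (src_tgt_eq hΓ α' η) := by
  have k : Γ.tgt α.tgt = Γ.tgt α'.tgt := congrArg PathClass.tgt e
  exact (fMk_congr hΓ _ _ (one_comp rfl).symm rfl).trans
    ((fMk_eq hΓ (θ := Γ.one (Γ.tgt α.tgt)) (Γ.src_one _) h e e').trans
      (fMk_congr hΓ _ _ (one_comp k) rfl))

/-- The product of a path class and the class of a pair is formed by lifting the path class along
the target map. -/
theorem exists_fullPath (hS : IsSerreFibration Γ.src) (ρ : PathClass M) :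
    ∃ f : Full hΓ → Full hΓ, ∀ (α : PathClass G) (η : PathClass M) (h : Γ.src α.src = η.tgt),
      map hΓ.tgtMap α = ρ → f (fMk hΓ h) =
        fMk hΓ (θ := α.tgt) (η := (Pi1 M).comp (map hΓ.srcMap α) η) (src_tgt_eq hΓ α η) := by
  classical
  choose l hl hl' using fun (g : G) (h : ρ.src = Γ.tgt g) => exists_pathClass_map_tgt hΓ hS h
  let F : ArrowPath Γ → Full hΓ := fun x => if h : ρ.src = Γ.tgt x.1.1 then
    fMk hΓ (θ := (l _ h).tgt) (η := (Pi1 M).comp (map hΓ.srcMap (l _ h)) x.1.2)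
      (src_tgt_eq hΓ _ _) else fMk hΓ x.2
  have hF : ∀ (x : ArrowPath Γ) (α : PathClass G), α.src = x.1.1 → map hΓ.tgtMap α = ρ →
      F x = fMk hΓ (θ := α.tgt) (η := (Pi1 M).comp (map hΓ.srcMap α) x.1.2)
        (src_tgt_eq hΓ α _) := fun x α h e => by
    have k : ρ.src = Γ.tgt x.1.1 := by rw [← e, ← h]; rfl
    refine (dif_pos k).trans (fMk_tgt_eq hΓ ?_ ((hl' _ k).trans e.symm) ((hl _ k).trans h.symm))
    exact (congrArg Γ.src (hl _ k)).trans x.2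
  have hF' : ∀ x : ArrowPath Γ, ¬ ρ.src = Γ.tgt x.1.1 → F x = fMk hΓ x.2 := fun x h => dif_neg h
  refine ⟨fullLift hΓ F fun θ α α' η h₁ h₁' h₂ e e' => ?_, fun α η h e => hF _ α rfl e⟩
  by_cases h : ρ.src = Γ.tgt θ
  · obtain ⟨δ, hδ, hδ'⟩ := exists_pathClass_map_tgt hΓ hS h
    obtain ⟨d, rfl⟩ := mk'_surjective δ
    replace hδ : d 0 = θ := hδ
    subst hδ
    -- a lift at `θ · α(1)` is the product of a lift `d` at `θ` and a lift of `s ∘ d` at `α(1)`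
    have key : ∀ α : PathClass G, Γ.src (d 0) = Γ.tgt α.tgt → Γ.src α.src = η.tgt →
        ∃ β : PathClass G, β.src = α.src ∧
          map hΓ.tgtMap β = (Pi1 M).comp (map hΓ.srcMap (mk' d)) (map hΓ.tgtMap α) ∧
          ∀ (k : Γ.src (d 1) = Γ.tgt β.tgt) k',
            F ⟨(Γ.comp (d 0) α.tgt, (Pi1 M).comp (map hΓ.srcMap α) η), k'⟩ =
            fMk hΓ (θ := Γ.comp (d 1) β.tgt) (η := (Pi1 M).comp (map hΓ.srcMap β) η)
              (src_comp_eq_tgt_comp hΓ k) := fun α h₁ h₂ => by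
      obtain ⟨p, hp, hp'⟩ := exists_lift_tgt hΓ hS (hΓ.srcMap.comp d) (g := α.tgt) h₁.symm
      have hd : ∀ t, Γ.src (d t) = Γ.tgt (p t) := fun t => (hp' t).symm
      have hpα : (mk' p).src = α.tgt := hp
      have hpd : map hΓ.tgtMap (mk' p) = map hΓ.srcMap (mk' d) := by
        rw [map_mk', map_mk']
        exact congrArg mk' (ContinuousMap.ext hp')
      refine ⟨(Pi1 G).comp (mk' p) α, PathClass.src_comp' hpα, ?_, fun k k' => ?_⟩
      · rw [map_comp _ hpα, hpd]
      · refine (hF _ (mk' (pathProd hΓ d p hd)) ?_ ((map_tgt_pathProd hΓ hd).trans hδ')).trans ?_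
        · exact congrArg (Γ.comp (d 0)) hp
        · refine fMk_congr hΓ _ _ ?_ ?_
          · exact congrArg (Γ.comp (d 1)) (PathClass.tgt_comp' (a := mk' p) (b := α)).symm
          · rw [map_src_pathProd, map_comp _ hpα]
            exact (comp_assoc (Γ := Pi1 M) (a := map hΓ.srcMap (mk' p)) (b := map hΓ.srcMap α)
              (congrArg Γ.src hpα) h₂).symm
    obtain ⟨β, hβ, hβ', hFβ⟩ := key α h₁ h₂
    obtain ⟨γ, hγ, hγ', hFγ⟩ := key α' h₁' (e' ▸ h₂)
    have k : Γ.src (d 1) = Γ.tgt β.tgt :=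
      (PathClass.tgt_comp'.symm.trans (congrArg PathClass.tgt hβ'.symm) : (map hΓ.srcMap (mk' d)).tgt = _)
    have eβγ : map hΓ.tgtMap β = map hΓ.tgtMap γ := by rw [hβ', hγ', e]
    rw [hFβ k, hFγ (k.trans (congrArg PathClass.tgt eβγ))]
    exact fMk_eq hΓ k ((congrArg Γ.src hβ).trans h₂) eβγ (hβ.trans (e'.trans hγ.symm))
  · have k : ∀ {α : PathClass G}, ¬ ρ.src = Γ.tgt (Γ.comp θ α.tgt) := fun h' =>
      h (h'.trans InternalGroupoid.tgt_comp)
    exact (hF' _ k).trans ((fMk_eq hΓ h₁ h₂ e e').trans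
      (hF' ⟨(Γ.comp θ α'.tgt, _), src_comp_eq_tgt_comp hΓ h₁'⟩ k).symm)

/-- The product of a path class and the class of a pair, where this is defined. -/
def fullPath (hS : IsSerreFibration Γ.src) (ρ : PathClass M) :
    Full hΓ → Full hΓ := (exists_fullPath hΓ hS ρ).choose

theorem fullPath_fMk (hS : IsSerreFibration Γ.src) {α : PathClass G}
    {η : PathClass M} (h : Γ.src α.src = η.tgt) :
    fullPath hΓ hS (map hΓ.tgtMap α) (fMk hΓ h) =
      fMk hΓ (θ := α.tgt) (η := (Pi1 M).comp (map hΓ.srcMap α) η) (src_tgt_eq hΓ α η) :=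
  (exists_fullPath hΓ hS _).choose_spec α η h rfl

/-! ### The isomorphism of the quotient and the Haefliger groupoid -/

/-- The action of arrows and path classes on the quotient of `G ×_{s,t} Π₁(M)`. -/
def fullAction (hS : IsSerreFibration Γ.src) : LeftAction hΓ (Full hΓ) where
  anchor := fullTgt hΓ
  arr := fullArr hΓ
  path := fullPath hΓ hS
  anchor_arr {g z} h' := by
    obtain ⟨θ, η, h, rfl⟩ := exists_fMk hΓ z
    rw [fullArr_fMk hΓ h h']
    exact InternalGroupoid.tgt_comp
  anchor_path {ρ z} h' := by
    obtain ⟨θ, η, h, rfl⟩ := exists_fMk hΓ z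
    obtain ⟨α, rfl, rfl⟩ := exists_pathClass_map_tgt hΓ hS h'
    rw [fullPath_fMk]
    rfl
  arr_one z := by
    obtain ⟨θ, η, h, rfl⟩ := exists_fMk hΓ z
    exact (fullArr_fMk hΓ h (Γ.src_one _)).trans (fMk_congr hΓ _ _ (one_comp rfl) rfl)
  path_one z := by
    obtain ⟨θ, η, h, rfl⟩ := exists_fMk hΓ z
    exact (fullPath_fMk hΓ hS (α := (Pi1 G).one θ) h).trans
      (fMk_congr hΓ _ _ rfl (one_comp (Γ := Pi1 M) h))
  arr_comp {g k z} e e' := by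
    obtain ⟨θ, η, h, rfl⟩ := exists_fMk hΓ z
    have h₁ : Γ.src g = Γ.tgt (Γ.comp k θ) := e.trans InternalGroupoid.tgt_comp.symm
    rw [fullArr_fMk hΓ h e', fullArr_fMk hΓ _ h₁,
      fullArr_fMk hΓ h ((InternalGroupoid.src_comp e).trans e')]
    exact fMk_congr hΓ _ _ (comp_assoc e e') rfl
  path_comp {a b z} e e' := by
    obtain ⟨θ, η, h, rfl⟩ := exists_fMk hΓ z
    obtain ⟨β, rfl, rfl⟩ := exists_pathClass_map_tgt hΓ hS e'
    obtain ⟨α, hα, rfl⟩ := exists_pathClass_map_tgt hΓ hS (g := β.tgt) e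
    have h₁ : Γ.src ((Pi1 G).comp α β).src = η.tgt :=
      (congrArg Γ.src (PathClass.src_comp' hα)).trans h
    have h₂ : Γ.src α.src = ((Pi1 M).comp (map hΓ.srcMap β) η).tgt :=
      (congrArg Γ.src hα).trans (src_tgt_eq hΓ β η)
    refine (congrArg₂ (fullPath hΓ hS) (map_comp _ hα).symm
      (fMk_congr hΓ h h₁ (PathClass.src_comp' hα).symm rfl)).trans
      ((fullPath_fMk hΓ hS h₁).trans (Eq.trans ?_ ((congrArg (fullPath hΓ hS _)
        ((fullPath_fMk hΓ hS h).trans (fMk_congr hΓ _ h₂ hα.symm rfl))).trans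
          (fullPath_fMk hΓ hS h₂)).symm))
    refine fMk_congr hΓ _ _ PathClass.tgt_comp' ?_
    rw [map_comp _ hα]
    exact comp_assoc (Γ := Pi1 M) (a := map hΓ.srcMap α) (b := map hΓ.srcMap β)
      (congrArg Γ.src hα) h
  path_arr {γ z} e := by
    obtain ⟨θ, η, h, rfl⟩ := exists_fMk hΓ z
    obtain ⟨p, rfl⟩ := mk'_surjective γ
    obtain ⟨q, hq, hq'⟩ := exists_lift_tgt hΓ hS (hΓ.srcMap.comp p) (g := θ) e.symm
    subst hq
    have hp : ∀ t, Γ.src (p t) = Γ.tgt (q t) := fun t => (hq' t).symm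
    have h₁ : Γ.src (mk' (pathProd hΓ p q hp)).src = η.tgt :=
      (InternalGroupoid.src_comp (hp 0)).trans h
    have hpq : map hΓ.srcMap (mk' p) = map hΓ.tgtMap (mk' q) := by
      rw [map_mk', map_mk']
      exact congrArg mk' (ContinuousMap.ext hp)
    refine (congrArg₂ (fullPath hΓ hS) (map_tgt_pathProd hΓ hp).symm
      (fullArr_fMk hΓ h e)).trans ((fullPath_fMk hΓ hS h₁).trans (Eq.trans ?_
        (congrArg (fullArr hΓ (p 1)) ((congrArg (fun a => fullPath hΓ hS a (fMk hΓ h)) hpq).trans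
          (fullPath_fMk hΓ hS (α := mk' q) h))).symm))
    refine Eq.trans ?_ (fullArr_fMk hΓ _ (hp 1)).symm
    exact fMk_congr hΓ _ _ rfl (congrArg (fun a => (Pi1 M).comp a η) (map_src_pathProd hΓ hp))

/-- The homomorphism from the quotient of `G ×_{s,t} Π₁(M)` to the Haefliger groupoid. -/
def fullToHaefliger : Full hΓ → HaefligerArrow Γ :=
  fullLift hΓ (fun x => (haefliger Γ).comp (hArr Γ x.1.1) (hPath Γ x.1.2))
    fun θ α α' η h₁ h₁' h₂ e e' => by
      dsimp only
      rw [comp_hArr_hPath hΓ h₁ h₂, comp_hArr_hPath hΓ h₁' (e' ▸ h₂), e, e']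

theorem fullToHaefliger_fMk {θ : G} {η : PathClass M}
    (h : Γ.src θ = η.tgt) :
    fullToHaefliger hΓ (fMk hΓ h) = (haefliger Γ).comp (hArr Γ θ) (hPath Γ η) := rfl

theorem src_hArr_eq_tgt_hPath {θ : G} {η : PathClass M} (h : Γ.src θ = η.tgt) :
    (haefliger Γ).src (hArr Γ θ) = (haefliger Γ).tgt (hPath Γ η) := h.trans (tgt_hPath η).symm

theorem src_fullToHaefliger {θ : G} {η : PathClass M}
    (h : Γ.src θ = η.tgt) : (haefliger Γ).src (fullToHaefliger hΓ (fMk hΓ h)) = η.src :=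
  (InternalGroupoid.src_comp (src_hArr_eq_tgt_hPath h)).trans (src_hPath η)

theorem tgt_fullToHaefliger {θ : G} {η : PathClass M}
    (h : Γ.src θ = η.tgt) : (haefliger Γ).tgt (fullToHaefliger hΓ (fMk hΓ h)) = Γ.tgt θ :=
  InternalGroupoid.tgt_comp

theorem fullToHaefliger_mul {θ : G} {α : PathClass G} {η : PathClass M}
    (h₁ : Γ.src θ = Γ.tgt α.tgt) (h₂ : Γ.src α.src = η.tgt) :
    fullToHaefliger hΓ (fMk hΓ (src_comp_eq_tgt_comp hΓ (η := η) h₁)) = (haefliger Γ).comp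
      (fullToHaefliger hΓ (fMk hΓ (η := map hΓ.tgtMap α) h₁)) (fullToHaefliger hΓ (fMk hΓ h₂)) :=
  comp_hArr_hPath hΓ h₁ h₂

theorem fullToHaefliger_one (x : M) :
    fullToHaefliger hΓ (fMk hΓ (θ := Γ.one x) (η := (Pi1 M).one x) (Γ.src_one x)) =
      (haefliger Γ).one x := by
  refine (fullToHaefliger_fMk hΓ _).trans ?_
  rw [hArr_one, hPath_one, one_comp ((haefliger Γ).tgt_one x).symm]

theorem fullToHaefliger_surjective (hS : IsSerreFibration Γ.src) :
    Function.Surjective (fullToHaefliger hΓ) := fun a => by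
  refine haefliger_induction (p := fun a => ∃ c, fullToHaefliger hΓ c = a)
    (fun g => ⟨fMk hΓ (η := (Pi1 M).one (Γ.src g)) rfl, ?_⟩)
    (fun η => ⟨fMk hΓ (Γ.src_one η.tgt), ?_⟩) ?_ a
  · refine (fullToHaefliger_fMk hΓ _).trans ?_
    rw [hPath_one]
    exact comp_one rfl
  · rw [fullToHaefliger_fMk, hArr_one, one_comp (tgt_hPath η).symm]
  · rintro _ _ e ⟨a, rfl⟩ ⟨b, rfl⟩
    obtain ⟨θ, η, h, rfl⟩ := exists_fMk hΓ a
    obtain ⟨θ', η', h', rfl⟩ := exists_fMk hΓ b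
    rw [src_fullToHaefliger, tgt_fullToHaefliger] at e
    obtain ⟨α, rfl, rfl⟩ := exists_pathClass_map_tgt hΓ hS e
    exact ⟨_, fullToHaefliger_mul hΓ h h'⟩

variable [LocallySimple G] [LocallySimple M]

/-- The image of an arrow acts on the corresponding unit with the arrow as result. -/
theorem fullAction_fullToHaefliger (hS : IsSerreFibration Γ.src) {θ : G}
    {η : PathClass M} (h : Γ.src θ = η.tgt) :
    (fullAction hΓ hS).act (fullToHaefliger hΓ (fMk hΓ h)) (fMk hΓ (Γ.src_one η.src)
      (η := (Pi1 M).one η.src)) = fMk hΓ h := by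
  have hz : η.src = (fullAction hΓ hS).anchor (fMk hΓ (Γ.src_one η.src)
      (η := (Pi1 M).one η.src)) := (Γ.tgt_one _).symm
  -- the path of units over `η` is a lift of `η`
  have e : fullPath hΓ hS η (fMk hΓ (Γ.src_one η.src) (η := (Pi1 M).one η.src)) =
      fMk hΓ (Γ.src_one η.tgt) := by
    refine (congrArg (fun a => fullPath hΓ hS a _) (map_map_eq_self (f := hΓ.tgtMap)
      (g := ⟨Γ.one, hΓ.continuous_one⟩) Γ.tgt_one η).symm).trans
      ((fullPath_fMk hΓ hS (α := map ⟨Γ.one, hΓ.continuous_one⟩ η)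
        (η := (Pi1 M).one η.src) (Γ.src_one η.src)).trans ?_)
    refine fMk_congr hΓ _ _ rfl ?_
    rw [map_map_eq_self (f := hΓ.srcMap) (g := ⟨Γ.one, hΓ.continuous_one⟩) Γ.src_one]
    exact comp_one rfl
  rw [fullToHaefliger_fMk, LeftAction.act_comp (src_hArr_eq_tgt_hPath h) ((src_hPath _).trans hz),
    LeftAction.act_hPath hz]
  refine (congrArg _ e).trans ?_
  refine (LeftAction.act_hArr (E := fullAction hΓ hS) (h.trans (Γ.tgt_one _).symm)).trans ?_
  refine (fullArr_fMk hΓ (Γ.src_one _) (h.trans (Γ.tgt_one _).symm)).trans ?_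
  exact fMk_congr hΓ _ _ (comp_one h) rfl

theorem fullToHaefliger_injective (hS : IsSerreFibration Γ.src) :
    Function.Injective (fullToHaefliger hΓ) := fun a b e => by
  obtain ⟨θ, η, h, rfl⟩ := exists_fMk hΓ a
  obtain ⟨θ', η', h', rfl⟩ := exists_fMk hΓ b
  have hs : η.src = η'.src := by rw [← src_fullToHaefliger hΓ h, ← src_fullToHaefliger hΓ h', e]
  rw [← fullAction_fullToHaefliger hΓ hS h, ← fullAction_fullToHaefliger hΓ hS h', e]
  exact congrArg _ (fMk_congr hΓ _ _ (congrArg Γ.one hs) (congrArg (Pi1 M).one hs))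

theorem continuous_fullToHaefliger : Continuous (fullToHaefliger hΓ) := by
  have h : Continuous (Subtype.val : ArrowPath Γ → G × PathClass M) := continuous_subtype_val
  exact continuous_coinduced_dom.2 ((isTopological_haefliger hΓ).continuous_comp
    ((continuous_hArr hΓ).comp h.fst) ((continuous_hPath hΓ).comp h.snd)
    fun x => src_hArr_eq_tgt_hPath x.2)

/-- A continuous map is open if its composite with a local homeomorphism is. -/
theorem _root_.IsLocalHomeomorph.isOpenMap_of_comp {X Y Z : Type*} [TopologicalSpace X]
    [TopologicalSpace Y] [TopologicalSpace Z] {f : X → Y} {g : Y → Z} (hg : IsLocalHomeomorph g)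
    (hf : Continuous f) (h : IsOpenMap (g ∘ f)) : IsOpenMap f := by
  refine isOpenMap_iff_nhds_le.2 fun x => ?_
  obtain ⟨e, hx, rfl⟩ := hg (f x)
  have h₁ : 𝓝 (e (f x)) ≤ Filter.map (e ∘ f) (𝓝 x) := h.nhds_le x
  have h₂ := Filter.map_mono (m := e.symm) h₁
  have h₃ : e.symm ∘ e ∘ f =ᶠ[𝓝 x] f := by
    filter_upwards [hf.continuousAt.eventually (e.open_source.mem_nhds hx)] with z hz
    exact e.left_inv hz
  rwa [e.symm_map_nhds_eq (x := f x) hx, Filter.map_map, Filter.map_congr h₃] at h₂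

/-- The map is open since the Haefliger groupoid and `Π₁(M)` are étale over the pair groupoid and
the target map of `Γ` is open. -/
theorem isOpenMap_fullToHaefliger (hT : IsOpenMap Γ.tgt) :
    IsOpenMap (fullToHaefliger hΓ) := by
  have key : IsOpenMap fun x : ArrowPath Γ => (Γ.tgt x.1.1, x.1.2.src) := by
    refine isOpenMap_iff_nhds_le.2 fun x S hS => ?_
    rw [Filter.mem_map, nhds_subtype_eq_comap, Filter.mem_comap] at hS
    obtain ⟨N, hN, hNS⟩ := hS
    rw [nhds_prod_eq, Filter.mem_prod_iff] at hN
    obtain ⟨A, hA, B, hB, hAB⟩ := hN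
    have hB' := (isLocalHomeomorph_ends (X := M)).isOpenMap.image_mem_nhds hB
    rw [nhds_prod_eq, Filter.mem_prod_iff] at hB'
    obtain ⟨V, hV, U, hU, hVU⟩ := hB'
    rw [← x.2] at hV
    have hA' := hT.image_mem_nhds (Filter.inter_mem hA (hΓ.continuous_src.continuousAt hV))
    refine Filter.mem_of_superset (prod_mem_nhds hA' hU) ?_
    rintro ⟨_, u⟩ ⟨⟨θ, hθ, rfl⟩, hu⟩
    obtain ⟨η, hη, e⟩ := hVU (Set.mk_mem_prod hθ.2 hu)
    have e₁ : η.tgt = Γ.src θ := congrArg Prod.fst e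
    have e₂ : η.src = u := congrArg Prod.snd e
    have : (⟨(θ, η), e₁.symm⟩ : ArrowPath Γ) ∈ (fun x : ArrowPath Γ => (Γ.tgt x.1.1, x.1.2.src)) ⁻¹' S :=
      hNS (hAB (Set.mk_mem_prod hθ.1 hη))
    rw [← e₂]
    exact this
  have h : IsOpenMap (fullToHaefliger hΓ ∘ Quot.mk _) :=
    (isLocalHomeomorph_haefliger hΓ).isOpenMap_of_comp
      ((continuous_fullToHaefliger hΓ).comp continuous_quot_mk) (by
        convert key using 2 with x
        exact Prod.ext (tgt_fullToHaefliger hΓ x.2) (src_fullToHaefliger hΓ x.2))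
  intro U hU
  have := h _ (hU.preimage continuous_quot_mk)
  have e := Set.image_comp (fullToHaefliger hΓ) (Quot.mk _) (Quot.mk _ ⁻¹' U)
  rwa [e.trans (congrArg _ (Set.image_preimage_eq U Quot.mk_surjective))] at this

end

/-- Near each point a submersion is a linear projection in charts. -/
theorem SmoothStr.IsSubmersion.isOpenMap {X : Type u} {Y : Type v} [TopologicalSpace X]
    [TopologicalSpace Y] {A : SmoothStr X} {B : SmoothStr Y} {f : X → Y} (h : A.IsSubmersion B f) :
    IsOpenMap f := by
  refine isOpenMap_iff_nhds_le.2 fun x => ?_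
  obtain ⟨-, κ, c, e, -, -, hx, hfc, hf⟩ := h.exists_normalForm x
  have hm : Filter.map (fun y => c.symm (e (κ y)).1) (𝓝 x) = 𝓝 (f x) := by
    have h₁ : Filter.map e (𝓝 (κ x)) = 𝓝 (e (κ x)) := e.toHomeomorph.map_nhds_eq _
    have h₂ := c.symm_map_nhds_eq (hfc x hx)
    rw [hf x hx, ← map_fst_nhds, ← h₁, ← κ.map_nhds_eq hx, Filter.map_map, Filter.map_map,
      Filter.map_map] at h₂
    exact h₂
  rw [← hm]
  refine (Filter.map_congr ?_).le
  filter_upwards [κ.open_source.mem_nhds hx] with y hy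
  rw [← hf y hy, c.left_inv (hfc y hy)]

section

variable {A : Type u} {B : Type v} {O : Type w}

/-- The groupoid structure transported along a bijection of the arrows. -/
def InternalGroupoid.transport (Δ : InternalGroupoid B O) (e : A ≃ B) : InternalGroupoid A O where
  src a := Δ.src (e a)
  tgt a := Δ.tgt (e a)
  one x := e.symm (Δ.one x)
  inv a := e.symm (Δ.inv (e a))
  mul a b h := e.symm (Δ.mul (e a) (e b) h)
  src_one x := by simp [Δ.src_one]
  tgt_one x := by simp [Δ.tgt_one]
  src_inv a := by simp [Δ.src_inv]
  tgt_inv a := by simp [Δ.tgt_inv]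
  src_mul a b h := by simp [Δ.src_mul]
  tgt_mul a b h := by simp [Δ.tgt_mul]
  mul_assoc a b c h₁ h₂ h₃ h₄ := by
    simpa using Δ.mul_assoc (e a) (e b) (e c) h₁ h₂ _ _
  one_mul a h := by simp [Δ.one_mul]
  mul_one a h := by simp [Δ.mul_one]
  inv_mul a h := by simp [Δ.inv_mul]
  mul_inv a h := by simp [Δ.mul_inv]

end

section

variable {G : Type u} {M : Type v} [TopologicalSpace G] [TopologicalSpace M]
  {Γ : InternalGroupoid G M} (hΓ : Γ.IsTopological) [LocallySimple G] [LocallySimple M]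

/-- The homeomorphism from the quotient of `G ×_{s,t} Π₁(M)` to the Haefliger groupoid. -/
def fullHomeo (hS : IsSerreFibration Γ.src) (hT : IsOpenMap Γ.tgt) :
    Full hΓ ≃ₜ HaefligerArrow Γ :=
  (Equiv.ofBijective (fullToHaefliger hΓ) ⟨fullToHaefliger_injective hΓ hS,
    fullToHaefliger_surjective hΓ hS⟩).toHomeomorphOfContinuousOpen
    (continuous_fullToHaefliger hΓ) (isOpenMap_fullToHaefliger hΓ hT)

/-- The groupoid structure on the quotient of `G ×_{s,t} Π₁(M)`. -/
def fullGroupoid (hS : IsSerreFibration Γ.src) (hT : IsOpenMap Γ.tgt) :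
    InternalGroupoid (Full hΓ) M := (haefliger Γ).transport (fullHomeo hΓ hS hT).toEquiv

theorem isFullGroupoid (hS : IsSerreFibration Γ.src)
    (hT : IsOpenMap Γ.tgt) : IsFullGroupoid Γ hΓ.srcMap hΓ.tgtMap (fun _ => rfl) (fun _ => rfl)
      (fullGroupoid hΓ hS hT) where
  src_mk θ η h := src_fullToHaefliger hΓ h
  tgt_mk θ η h := tgt_fullToHaefliger hΓ h
  one_eq x := (Equiv.symm_apply_eq _).2 (fullToHaefliger_one hΓ x).symm
  mul_mk θ α η h₁ h₂ h := by
    rw [fullPair_eq]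
    exact (Equiv.symm_apply_eq _).2 ((comp_eq (Γ := haefliger Γ)
      (a := fullToHaefliger hΓ (fMk hΓ (η := map hΓ.tgtMap α) h₁))
      (b := fullToHaefliger hΓ (fMk hΓ h₂)) h).symm.trans (fullToHaefliger_mul hΓ h₁ h₂).symm)

/-- The isomorphism of the quotient of `G ×_{s,t} Π₁(M)` and the Haefliger groupoid. -/
def fullIso (hS : IsSerreFibration Γ.src) (hT : IsOpenMap Γ.tgt) :
    TopGroupoidIso (fullGroupoid hΓ hS hT) (haefliger Γ) where
  arr := fullHomeo hΓ hS hT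
  obj := Homeomorph.refl M
  src_arr _ := rfl
  tgt_arr _ := rfl
  mul_arr _ _ _ _ := (fullHomeo hΓ hS hT).apply_symm_apply _

end

end

end DoubleGpd

theorem mainTheorem6 {G M : Type*} [TopologicalSpace G] [TopologicalSpace M] {d m : ℕ}
    [ChartedSpace (EuclideanSpace ℝ (Fin d)) G] [IsManifold (𝓡 d) ∞ G]
    [ChartedSpace (EuclideanSpace ℝ (Fin m)) M] [IsManifold (𝓡 m) ∞ M]
    (Γ : DoubleGpd.InternalGroupoid G M) (hΓ : Γ.IsLie d m) :
    -- the double nerve is a bisimplicial manifold; its columns, and its bar construction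
    (∃ S : DoubleGpd.FundamentalSmoothStr Γ (DoubleGpd.SmoothStr.of G d),
      (DoubleGpd.doubleNerve Γ).IsManifold S.N ∧
      (∀ p, ((DoubleGpd.doubleNerve Γ).vertical p).IsEtaleLie (S.N p) 1) ∧
      (DoubleGpd.bar (DoubleGpd.doubleNerve Γ)).IsEtaleLie S.W 2 ∧
      (((DoubleGpd.doubleNerve Γ).vertical 1).IsLocalLie (S.N 1) 1 →
        (DoubleGpd.bar (DoubleGpd.doubleNerve Γ)).IsLocalLie S.W 2 ∧
        (DoubleGpd.IsSerreFibration Γ.src →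
          (∀ p, ((DoubleGpd.doubleNerve Γ).vertical p).IsLie (S.N p) 1) ∧
          (DoubleGpd.bar (DoubleGpd.doubleNerve Γ)).IsLie S.W 2))) ∧
    -- the groupoid generated by the bar construction is the Haefliger fundamental groupoid
    (DoubleGpd.bar (DoubleGpd.doubleNerve Γ)).gen.IsTopological ∧
    (DoubleGpd.haefliger Γ).IsTopological ∧
    (∃ Φ : DoubleGpd.TopGroupoidIso (DoubleGpd.bar (DoubleGpd.doubleNerve Γ)).gen
        (DoubleGpd.haefliger Γ),
      (∀ x, Φ.obj x = DoubleGpd.baseMap Γ x) ∧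
      ∀ (w : (DoubleGpd.bar (DoubleGpd.doubleNerve Γ)).obj 1) (ρ : C(unitInterval, M))
        (hρ : DoubleGpd.pathPart Γ w = DoubleGpd.PathClass.mk' ρ),
        Φ.arr ((DoubleGpd.bar (DoubleGpd.doubleNerve Γ)).genMk w) =
          DoubleGpd.haefligerMk Γ (DoubleGpd.arrowPart Γ w) ρ
            ((DoubleGpd.src_arrowPart Γ w).trans (congrArg DoubleGpd.PathClass.tgt hρ))) ∧
    -- the description as a quotient when the source map is a fibration
    (DoubleGpd.IsSerreFibration Γ.src →
      (∀ (g : G) (η : DoubleGpd.PathClass M), Γ.src g = η.src →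
        ∃ α : DoubleGpd.PathClass G, α.src = g ∧ DoubleGpd.PathClass.map hΓ.srcC α = η) ∧
      ∃ Q : DoubleGpd.InternalGroupoid
          (DoubleGpd.FullQuot Γ hΓ.srcC hΓ.tgtC hΓ.srcC_apply) M,
        DoubleGpd.IsFullGroupoid Γ hΓ.srcC hΓ.tgtC hΓ.srcC_apply hΓ.tgtC_apply Q ∧
        ∃ Ψ : DoubleGpd.TopGroupoidIso Q (DoubleGpd.haefliger Γ),
          (∀ x, Ψ.obj x = x) ∧
          ∀ (θ : G) (ρ : C(unitInterval, M)) (h : Γ.src θ = ρ 1),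
            Ψ.arr (DoubleGpd.fullMk Γ hΓ.srcC hΓ.tgtC hΓ.srcC_apply θ
              (DoubleGpd.PathClass.mk' ρ) h) = DoubleGpd.haefligerMk Γ θ ρ h) := by
  have h := hΓ.isSmooth
  have hT := h.isTopological
  have _ : DoubleGpd.LocallySimple G := (DoubleGpd.SmoothStr.of G d).locallySimple
  have _ : DoubleGpd.LocallySimple M := (DoubleGpd.SmoothStr.of M m).locallySimple
  obtain ⟨S⟩ := DoubleGpd.nonempty_nerveStr h
  have _ := (S.X 0).locallySimple
  have _ := (S.X 1).locallySimple
  refine ⟨DoubleGpd.exists_fundamentalSmoothStr h,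
    (DoubleGpd.genIso hT).isTopological (DoubleGpd.isTopological_haefliger hT),
    DoubleGpd.isTopological_haefliger hT,
    ⟨DoubleGpd.genIso hT, fun _ => rfl, fun w ρ hρ => DoubleGpd.genIso_genMk hT w hρ _⟩,
    fun hS => ⟨fun g η => DoubleGpd.exists_pathClass_map_src hT hS, ?_⟩⟩
  have hO := h.submersion_tgt.isOpenMap
  exact ⟨DoubleGpd.fullGroupoid hT hS hO, DoubleGpd.isFullGroupoid hT hS hO,
    DoubleGpd.fullIso hT hS hO, fun _ => rfl,
    fun θ ρ h => (DoubleGpd.haefligerMk_eq h).symm⟩
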